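/- Let $d\in\{2,3\}$, let $k\ge 0$ be an integer, and let $\Omega\subset\mathbb{R}^d$ be an open bounded connected polygonal/polyhedral domain with Lipschitz boundary. Let $\mathcal{T}_h$ be a matching simplicial mesh of $\Omega$ with set of faces $\mathcal{F}_h$ and regularity parameter $\sigma$ (each $T\in\mathcal{T}_h$ contains a ball of diameter at least $h_T/\sigma$, $h_T$ being the diameter of $T$); $\mathcal{F}_T$ is the set of faces of $T$ and $n_{TF}$ the unit normal to $F\in\mathcal{F}_T$ pointing out of $T$. Set $\mathcal{RTN}^{k+1}(T)=\mathcal{P}^k(T)^d+x\mathcal{P}^k(T)$. Let $\underline{U}_{h,0}^k$ be the space of the $\underline{v}_h=((v_T)_T,(v_F)_F)$ with $v_T\in\mathcal{RTN}^{k+1}(T)$, $v_F\in\mathcal{P}^k(F)^d$, and $v_F=0$ if $F\subset\partial\Omega$; let $\underline{P}_{h,0}^k$ be the space of the $\underline{q}_h=((q_T)_T,(q_F)_F)$ with $q_T\in\mathcal{P}^k(T)$, $q_F\in\mathcal{P}^k(F)$, and $\int_\Omega q_h=0$. Here $v_h$, $q_h$ are the piecewise polynomial functions equal to $v_T$, $q_T$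 in each $T$. The interpolate $\underline{I}_{U,h}^k v$ of $v\in H^1(\Omega)^d$ has element components the $w_T\in\mathcal{RTN}^{k+1}(T)$ such that $w_T$ and $v$ have the same $L^2$-projection on $\mathcal{P}^{k-1}(T)^d$ and $w_T\cdot n_{TF}$ is the $L^2$-projection of $v\cdot n_{TF}$ on $\mathcal{P}^k(F)$ for all $F\in\mathcal{F}_T$, and face components the $L^2$-projections of $v$ on $\mathcal{P}^k(F)^d$. The reconstruction $R_T\underline{v}_T\in\mathcal{P}^{k+1}(T)^d$ is given by $\int_T\nabla R_T\underline{v}_T:\nabla w=-\int_T v_T\cdot\Delta w+\sum_{F\in\mathcal{F}_T}\int_F v_F\cdot(\nabla w\,n_{TF})$ for all $w\in\mathcal{P}^{k+1}(T)^d$, and $\int_T R_T\underline{v}_T=\int_T v_T$ if $k\ge1$, $\int_T R_T\underline{v}_T=\sum_{F\in\mathcal{F}_T}\frac{d_{TF}}{d}\int_F v_F$ if $k=0$, with $d_{TF}$ the distance of the center of mass of $T$ from the plane of $F$. Let $(\delta_T\underline{v}_T,(\delta_{TF}\underline{v}_T)_F)$ be the local interpolate of $R_T\underline{v}_T$ minus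 $\underline{v}_T$, and $$\|\underline{v}_T\|_{1,T}^2=\|\nabla v_T\|_{L^2(T)}^2+h_T^{-1}\sum_{F\in\mathcal{F}_T}\|v_F-v_T\|_{L^2(F)}^2,\qquad \|\underline{v}_h\|_{1,h}^2=\sum_T\|\underline{v}_T\|_{1,T}^2 .$$ Set $a_h=\sum_T a_T$, $a_T(\underline{w}_T,\underline{v}_T)=\int_T\nabla R_T\underline{w}_T:\nabla R_T\underline{v}_T+s_T(\underline{w}_T,\underline{v}_T)$, where $s_T$ is, for all $T$, either $\operatorname{card}(\mathcal{F}_T)\frac{h_T^d}{|T|}h_T^{-2}\int_T\delta_T\underline{w}_T\cdot\delta_T\underline{v}_T+h_T^{-1}\sum_{F\in\mathcal{F}_T}\int_F\delta_{TF}\underline{w}_T\cdot\delta_{TF}\underline{v}_T$, or $h_T^{-1}\sum_{F\in\mathcal{F}_T}\int_F(\delta_T-\delta_{TF})\underline{w}_T\cdot(\delta_T-\delta_{TF})\underline{v}_T$, or any other bilinear form of the components of $\delta$ for which $\eta^{-1}\|\underline{v}_T\|_{1,T}^2\le a_T(\underline{v}_T,\underline{v}_T)\le\eta\|\underline{v}_T\|_{1,T}^2$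 with a given $\eta>0$. Let $G_T\underline{q}_T\in\mathcal{RTN}^{k+1}(T)$ be given by $\int_T G_T\underline{q}_T\cdot w=-\int_T q_T\nabla\cdot w+\sum_{F\in\mathcal{F}_T}\int_F q_F\,w\cdot n_{TF}$ for all $w\in\mathcal{RTN}^{k+1}(T)$, and set $b_h(\underline{v}_h,\underline{q}_h)=\sum_T\int_T v_T\cdot G_T\underline{q}_T$, $$t_h(\underline{w}_h,\underline{v}_h,\underline{z}_h)=\sum_T\Big(\int_T(w_T\cdot\nabla)v_T\cdot z_T+\tfrac12\sum_{F\in\mathcal{F}_T}\int_F(w_T\cdot n_{TF})(v_F-v_T)\cdot(z_F+z_T)\Big),$$ $$j_{\beta,h}(\underline{w}_h,\underline{v}_h)=\sum_T\beta_T\sum_{F\in\mathcal{F}_T}\int_F(w_F-w_T)\cdot(v_F-v_T),$$ $$(\underline{w}_h,\underline{v}_h)_{0,h}=\sum_T\Big(\int_T w_T\cdot v_T+h_T\sum_{F\in\mathcal{F}_T}\int_F(w_F-w_T)\cdot(v_F-v_T)\Big).$$ Let $\nu>0$, $t_F>0$, let $f\in C^0([0,t_F];L^2(\Omega)^d)$,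 let $u_0\in H^1_0(\Omega)^d$ with $\nabla\cdot u_0=0$, and let the functions $\beta_T:[0,t_F]\to(0,\infty)$, $T\in\mathcal{T}_h$, be continuous. Then there is a unique $(\underline{u}_h,\underline{p}_h)\in C^1([0,t_F];\underline{U}_{h,0}^k)\times C^0([0,t_F];\underline{P}_{h,0}^k)$ such that $\underline{u}_h(0)=\underline{I}_{U,h}^k u_0$ and, for all $t\in[0,t_F]$ and all $(\underline{v}_h,\underline{q}_h)\in\underline{U}_{h,0}^k\times\underline{P}_{h,0}^k$, $$\Big(\frac{d\underline{u}_h}{dt},\underline{v}_h\Big)_{0,h}+\nu a_h(\underline{u}_h,\underline{v}_h)+t_h(\underline{u}_h,\underline{u}_h,\underline{v}_h)+j_{\beta,h}(\underline{u}_h,\underline{v}_h)+b_h(\underline{v}_h,\underline{p}_h)=\int_\Omega f\cdot v_h,\qquad -b_h(\underline{u}_h,\underline{q}_h)=0 .$$ Moreover, with $C>0$ depending only on $d$, $k$, $\Omega$, $\sigma$ and $\eta$ (in particular, not on $h$, $\nu$, $\beta$, $t_F$, $f$, $u_0$), $$\max_{[0,t_F]}\|\underline{u}_h\|_{0,h}^2+\int_0^{t_F}\nu\|\underline{u}_h\|_{1,h}^2\,dt+\int_0^{t_F}j_{\beta,h}(\underline{u}_h,\underline{u}_h)\,dt\le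 C e^{t_F}\Big(\int_0^{t_F}\|f\|_{L^2(\Omega)^d}^2\,dt+\|u_0\|_{H^1(\Omega)^d}^2\Big),$$ where $\|\cdot\|_{0,h}$ is the norm of $(\cdot,\cdot)_{0,h}$. -/

import Mathlib

open MeasureTheory Set Filter Topology
open scoped RealInnerProductSpace ContDiff NNReal ENNReal

noncomputable section

namespace HybridNS

/-- The Euclidean space `ℝ^d`. -/
abbrev Euc (d : ℕ) := EuclideanSpace ℝ (Fin d)

/-- The `j`-th vector of the canonical basis of `ℝ^d`. -/
def basisVec {d : ℕ} (j : Fin d) : Euc d := EuclideanSpace.single j 1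

/-- The Frobenius product `A : B` of two matrices, seen as linear maps. -/
def frob {d : ℕ} (A B : Euc d →L[ℝ] Euc d) : ℝ := ∑ j, ⟪A (basisVec j), B (basisVec j)⟫

/-- The trace of a matrix, seen as a linear map. -/
def trace {d : ℕ} (A : Euc d →L[ℝ] Euc d) : ℝ := ∑ j, A (basisVec j) j

/-! ### The domain -/

/-- Near each of its boundary points, `Ω` is, in suitable Cartesian coordinates, the set of points
strictly below the graph of a Lipschitz function. -/
def HasLipschitzBoundary {d : ℕ} (Ω : Set (Euc d)) : Prop :=
  ∀ x ∈ frontier Ω, ∃ n : Euc d, ‖n‖ = 1 ∧ ∃ γ : (ℝ ∙ n)ᗮ → ℝ, (∃ L : ℝ≥0, LipschitzWith L γ) ∧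
    ∃ U : Set (Euc d), IsOpen U ∧ x ∈ U ∧
      ∀ y ∈ U, y ∈ Ω ↔ ⟪n, y⟫ < γ ((ℝ ∙ n)ᗮ.orthogonalProjectionOnto y)

/-- Open bounded connected polygonal (polyhedral) domains with Lipschitz boundary. The closure of
such a domain is a finite union of simplices. -/
structure IsPolytopalDomain {d : ℕ} (Ω : Set (Euc d)) : Prop where
  isOpen : IsOpen Ω
  bounded : Bornology.IsBounded Ω
  connected : IsConnected Ω
  polytopal : ∃ S : Set (Finset (Euc d)), S.Finite ∧
    closure Ω = ⋃ s ∈ S, convexHull ℝ (s : Set (Euc d))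
  lipschitz : HasLipschitzBoundary Ω

/-! ### Simplices and their faces. A simplex is given by the finite set of its vertices. -/

/-- The closed simplex with the given vertices. -/
def hull {d : ℕ} (S : Finset (Euc d)) : Set (Euc d) := convexHull ℝ (S : Set (Euc d))

/-- The diameter `h_Y`. -/
def diam {d : ℕ} (S : Finset (Euc d)) : ℝ := Metric.diam (hull S)

/-- The set `F_T` of the faces of the `d`-simplex `T`. -/
def facesOf {d : ℕ} (T : Finset (Euc d)) : Finset (Finset (Euc d)) := T.powersetCard d

/-- Lebesgue measure on the element `T`. -/
def cellMeas {d : ℕ} (T : Finset (Euc d)) : Measure (Euc d) := volume.restrict (hull T)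

/-- Surface measure on the face `F`: the `(d-1)`-dimensional Hausdorff measure, normalized so as to
agree with the Lebesgue measure of hyperplanes. -/
def faceMeas {d : ℕ} (F : Finset (Euc d)) : Measure (Euc d) := (μHE[d - 1]).restrict (hull F)

/-- The unit vector `n_{TF}` normal to the face `F` of `T` and pointing out of `T`. -/
def normal {d : ℕ} (T F : Finset (Euc d)) : Euc d :=
  Classical.epsilon fun n => ‖n‖ = 1 ∧ (∀ x ∈ F, ∀ y ∈ F, ⟪n, x - y⟫ = 0) ∧
    ∀ x ∈ F, ∀ a ∈ T, a ∉ F → ⟪n, a - x⟫ < 0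

/-- The distance `d_{TF}` of the center of mass of `T` from the plane containing `F`. -/
def centerDist {d : ℕ} (T F : Finset (Euc d)) : ℝ :=
  Metric.infDist (⨍ x, x ∂(cellMeas T)) (affineSpan ℝ (F : Set (Euc d)))

/-! ### Matching simplicial meshes -/

/-- A matching simplicial mesh of `Ω`: a finite simplicial complex made of `d`-simplices and of
their faces, which covers the closure of `Ω`. -/
structure SimplicialMesh {d : ℕ} (Ω : Set (Euc d)) where
  complex : Geometry.SimplicialComplex ℝ (Euc d)
  finite : complex.faces.Finite
  pure : ∀ s ∈ complex.faces, ∃ T ∈ complex.faces, s ⊆ T ∧ T.card = d + 1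
  space_eq : complex.space = closure Ω

namespace SimplicialMesh

variable {d : ℕ} {Ω : Set (Euc d)}

/-- The set `T_h` of the elements. -/
def cells (K : SimplicialMesh Ω) : Finset (Finset (Euc d)) :=
  K.finite.toFinset.filter fun s => s.card = d + 1

/-- The set `F_h` of the faces. -/
def faces (K : SimplicialMesh Ω) : Finset (Finset (Euc d)) :=
  K.finite.toFinset.filter fun s => s.card = d

/-- Regularity of the mesh with parameter `σ`: each element `T` contains a ball of
diameter at least `h_T / σ`. -/
def IsRegular (K : SimplicialMesh Ω) (σ : ℝ) : Prop :=
  ∀ T ∈ K.cells, ∃ c : Euc d, ∃ r : ℝ, 0 < r ∧ Metric.closedBall c r ⊆ hull T ∧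
    diam T ≤ σ * (2 * r)

/-- The piecewise function on `Ω` that coincides with `v T` in each element `T`. -/
def piecewise {V : Type*} [AddCommMonoid V] (K : SimplicialMesh Ω)
    (v : Finset (Euc d) → Euc d → V) (x : Euc d) : V :=
  ∑ T ∈ K.cells, (interior (hull T)).indicator (v T) x

end SimplicialMesh

/-! ### Polynomial spaces -/

/-- Polynomial functions of total degree `≤ ℓ` on `ℝ^d`; this is `{0}` if `ℓ = -1`. A polynomial
on an element, whose interior is not empty, is identified with its extension to `ℝ^d`. -/
def poly (d : ℕ) (l : ℤ) : Submodule ℝ (Euc d → ℝ) where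
  carrier := {f | ∃ p : MvPolynomial (Fin d) ℝ, (∀ m ∈ p.support, (m.degree : ℤ) ≤ l) ∧
    f = fun x => MvPolynomial.eval (fun i => x i) p}
  zero_mem' := ⟨0, by simp, by ext; simp⟩
  add_mem' := by
    classical
    rintro _ _ ⟨p, hp, rfl⟩ ⟨q, hq, rfl⟩
    refine ⟨p + q, fun m hm => ?_, by ext; simp⟩
    rcases Finset.mem_union.1 (MvPolynomial.support_add hm) with h | h
    exacts [hp m h, hq m h]
  smul_mem' := by
    rintro c _ ⟨p, hp, rfl⟩
    exact ⟨c • p, fun m hm => hp m (MvPolynomial.support_smul hm), by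
      ext; simp [MvPolynomial.smul_eval]⟩

/-- Restrictions to the face `F` of polynomial functions of total degree `≤ ℓ`,
extended by zero outside `F`. -/
def facePoly {d : ℕ} (l : ℤ) (F : Finset (Euc d)) : Submodule ℝ (Euc d → ℝ) where
  carrier := {f | ∃ p ∈ poly d l, f = (hull F).indicator p}
  zero_mem' := ⟨0, zero_mem _, by simp⟩
  add_mem' := by
    rintro _ _ ⟨p, hp, rfl⟩ ⟨q, hq, rfl⟩
    exact ⟨p + q, add_mem hp hq, (Set.indicator_add' _ _ _).symm⟩
  smul_mem' := by
    rintro c _ ⟨p, hp, rfl⟩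
    exact ⟨c • p, Submodule.smul_mem _ _ hp, by
      funext x
      by_cases hx : x ∈ hull F <;> simp [hx]⟩

/-- Vector fields whose components belong to `V`. -/
def vec {d : ℕ} (V : Submodule ℝ (Euc d → ℝ)) : Submodule ℝ (Euc d → Euc d) where
  carrier := {v | ∀ i, (fun x => v x i) ∈ V}
  zero_mem' := fun _ => V.zero_mem
  add_mem' := fun ha hb i => V.add_mem (ha i) (hb i)
  smul_mem' := fun c _ ha i => V.smul_mem c (ha i)

/-- The Raviart--Thomas--Nédélec space of degree `ℓ ≥ 1`. -/
def rtn (d : ℕ) (l : ℤ) : Submodule ℝ (Euc d → Euc d) where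
  carrier := {v | ∃ p ∈ vec (poly d (l - 1)), ∃ q ∈ poly d (l - 1), v = fun x => p x + q x • x}
  zero_mem' := ⟨0, zero_mem _, 0, zero_mem _, by ext; simp⟩
  add_mem' := by
    rintro _ _ ⟨p, hp, q, hq, rfl⟩ ⟨p', hp', q', hq', rfl⟩
    refine ⟨p + p', add_mem hp hp', q + q', add_mem hq hq', ?_⟩
    ext x i
    simp
    ring
  smul_mem' := by
    rintro c _ ⟨p, hp, q, hq, rfl⟩
    refine ⟨c • p, Submodule.smul_mem _ _ hp, c • q, Submodule.smul_mem _ _ hq, ?_⟩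
    ext x i
    simp
    ring

/-- `p` is the `L²(μ)`-orthogonal projection of `g` on the space `V`. -/
def IsL2Proj {d : ℕ} (V : Submodule ℝ (Euc d → ℝ)) (μ : Measure (Euc d)) (g p : Euc d → ℝ) :
    Prop :=
  p ∈ V ∧ ∀ r ∈ V, ∫ x, p x * r x ∂μ = ∫ x, g x * r x ∂μ

/-- `w` is the (component-wise) `L²`-orthogonal projection of `g` on `P^ℓ(F)^d`. -/
def IsFaceProj {d : ℕ} (l : ℤ) (F : Finset (Euc d)) (g w : Euc d → Euc d) : Prop :=
  ∀ i, IsL2Proj (facePoly l F) (faceMeas F) (fun x => g x i) (fun x => w x i)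

/-- The `L²`-orthogonal projection on `P^ℓ(F)^d`. -/
def faceProj {d : ℕ} (l : ℤ) (F : Finset (Euc d)) (g : Euc d → Euc d) : Euc d → Euc d :=
  Classical.epsilon (IsFaceProj l F g)

/-- `w` is the Raviart--Thomas--Nédélec interpolate of degree `ℓ` on `T` of a vector field which is
equal to `v` inside `T` and has trace `γ F` on each face `F` of `T`: the projections of `w` and `v`
on `P^{ℓ-2}(T)^d` are equal, and `w · n_{TF}` is on `F` the projection of `γ F · n_{TF}`
on `P^{ℓ-1}(F)`. -/
def IsRTNInterp {d : ℕ} (l : ℤ) (T : Finset (Euc d)) (v : Euc d → Euc d)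
    (γ : Finset (Euc d) → Euc d → Euc d) (w : Euc d → Euc d) : Prop :=
  w ∈ rtn d l ∧
  (∀ i, ∀ r ∈ poly d (l - 2), ∫ x, w x i * r x ∂(cellMeas T) = ∫ x, v x i * r x ∂(cellMeas T)) ∧
  ∀ F ∈ facesOf T, IsL2Proj (facePoly (l - 1) F) (faceMeas F) (fun x => ⟪γ F x, normal T F⟫)
    ((hull F).indicator fun x => ⟪w x, normal T F⟫)

/-- The Raviart--Thomas--Nédélec interpolator of degree `ℓ` applied to a smooth field. -/
def rtnInterp {d : ℕ} (l : ℤ) (T : Finset (Euc d)) (v : Euc d → Euc d) : Euc d → Euc d :=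
  Classical.epsilon (IsRTNInterp l T v fun _ => v)

/-! ### Discrete spaces -/

/-- Local vectors `(v_T, (v_F)_F)`; only the components with `F` a face of `T` matter. -/
abbrev LocVel (d : ℕ) := (Euc d → Euc d) × (Finset (Euc d) → Euc d → Euc d)

/-- Families `((v_T)_T, (v_F)_F)` of vector fields. -/
abbrev Vel (d : ℕ) := (Finset (Euc d) → Euc d → Euc d) × (Finset (Euc d) → Euc d → Euc d)

/-- Families `((q_T)_T, (q_F)_F)` of scalar fields. -/
abbrev Pre (d : ℕ) := (Finset (Euc d) → Euc d → ℝ) × (Finset (Euc d) → Euc d → ℝ)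

/-- The restriction of a discrete velocity to the element `T`. -/
def loc {d : ℕ} (T : Finset (Euc d)) (v : Vel d) : LocVel d := (v.1 T, v.2)

/-- The space `U_T^k` of local discrete velocities. -/
def locSpace {d : ℕ} (k : ℕ) (T : Finset (Euc d)) : Set (LocVel d) :=
  {v | v.1 ∈ rtn d (k + 1) ∧ ∀ F ∈ facesOf T, v.2 F ∈ vec (facePoly k F)}

section Spaces

variable {d : ℕ} {Ω : Set (Euc d)}

/-- The space `U_{h,0}^k`: discrete velocities which vanish on the boundary faces. The families are
indexed by all the simplices, with zero components for those which do not belong to the mesh. -/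
def velSpace (K : SimplicialMesh Ω) (k : ℕ) : Submodule ℝ (Vel d) where
  carrier := {v | (∀ T ∈ K.cells, v.1 T ∈ rtn d (k + 1)) ∧ (∀ T, T ∉ K.cells → v.1 T = 0) ∧
    (∀ F ∈ K.faces, v.2 F ∈ vec (facePoly k F)) ∧ (∀ F, F ∉ K.faces → v.2 F = 0) ∧
    ∀ F ∈ K.faces, hull F ⊆ frontier Ω → v.2 F = 0}
  zero_mem' := ⟨fun _ _ => zero_mem _, fun _ _ => rfl, fun _ _ => zero_mem _, fun _ _ => rfl,
    fun _ _ _ => rfl⟩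
  add_mem' := by
    rintro a b ⟨h1, h2, h3, h4, h5⟩ ⟨g1, g2, g3, g4, g5⟩
    refine ⟨fun T h => add_mem (h1 T h) (g1 T h), fun T h => ?_,
      fun F h => add_mem (h3 F h) (g3 F h), fun F h => ?_, fun F h hb => ?_⟩
    · simp [h2 T h, g2 T h]
    · simp [h4 F h, g4 F h]
    · simp [h5 F h hb, g5 F h hb]
  smul_mem' := by
    rintro c a ⟨h1, h2, h3, h4, h5⟩
    refine ⟨fun T h => Submodule.smul_mem _ c (h1 T h), fun T h => ?_,
      fun F h => Submodule.smul_mem _ c (h3 F h), fun F h => ?_, fun F h hb => ?_⟩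
    · simp [h2 T h]
    · simp [h4 F h]
    · simp [h5 F h hb]

/-- The space `P_h^k` of discrete pressures. -/
def preSpace (K : SimplicialMesh Ω) (k : ℕ) : Submodule ℝ (Pre d) where
  carrier := {q | (∀ T ∈ K.cells, q.1 T ∈ poly d k) ∧ (∀ T, T ∉ K.cells → q.1 T = 0) ∧
    (∀ F ∈ K.faces, q.2 F ∈ facePoly k F) ∧ (∀ F, F ∉ K.faces → q.2 F = 0)}
  zero_mem' := ⟨fun _ _ => zero_mem _, fun _ _ => rfl, fun _ _ => zero_mem _, fun _ _ => rfl⟩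
  add_mem' := by
    rintro a b ⟨h1, h2, h3, h4⟩ ⟨g1, g2, g3, g4⟩
    refine ⟨fun T h => add_mem (h1 T h) (g1 T h), fun T h => ?_,
      fun F h => add_mem (h3 F h) (g3 F h), fun F h => ?_⟩
    · simp [h2 T h, g2 T h]
    · simp [h4 F h, g4 F h]
  smul_mem' := by
    rintro c a ⟨h1, h2, h3, h4⟩
    refine ⟨fun T h => Submodule.smul_mem _ c (h1 T h), fun T h => ?_,
      fun F h => Submodule.smul_mem _ c (h3 F h), fun F h => ?_⟩
    · simp [h2 T h]
    · simp [h4 F h]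

/-- The space `P_{h,0}^k`, as a subset of `P_h^k`: discrete pressures such that
`∫_Ω q_h = 0`. -/
def preSpaceZero (K : SimplicialMesh Ω) (k : ℕ) : Set (Pre d) :=
  {q | q ∈ preSpace K k ∧ ∫ x in Ω, K.piecewise q.1 x = 0}

end Spaces

/-! ### Viscous term -/

/-- The characterization of the velocity reconstruction `r = R_T^{k+1} v`. -/
def IsReconstruction {d : ℕ} (k : ℕ) (T : Finset (Euc d)) (v : LocVel d) (r : Euc d → Euc d) :
    Prop :=
  r ∈ vec (poly d (k + 1)) ∧
  (∀ w ∈ vec (poly d (k + 1)),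
    ∫ x, frob (fderiv ℝ r x) (fderiv ℝ w x) ∂(cellMeas T) =
      -∫ x, ⟪v.1 x, Laplacian.laplacian w x⟫ ∂(cellMeas T) +
        ∑ F ∈ facesOf T, ∫ x, ⟪v.2 F x, fderiv ℝ w x (normal T F)⟫ ∂(faceMeas F)) ∧
  ∫ x, r x ∂(cellMeas T) =
    if k = 0 then ∑ F ∈ facesOf T, (centerDist T F / d) • ∫ x, v.2 F x ∂(faceMeas F)
    else ∫ x, v.1 x ∂(cellMeas T)

/-- The velocity reconstruction `R_T^{k+1}`. -/
def reconstruction {d : ℕ} (k : ℕ) (T : Finset (Euc d)) (v : LocVel d) : Euc d → Euc d :=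
  Classical.epsilon (IsReconstruction k T v)

open Classical in
/-- The family `(δ_T^k v, (δ_{TF}^k v)_F) = I_{U,T}^k R_T^{k+1} v - v`, with zero components for the
simplices `F` which are not faces of `T`. -/
def delta {d : ℕ} (k : ℕ) (T : Finset (Euc d)) (v : LocVel d) : LocVel d :=
  (rtnInterp (k + 1) T (reconstruction k T v) - v.1,
    fun F => if F ∈ facesOf T then faceProj k F (reconstruction k T v) - v.2 F else 0)

/-- The viscous stabilization form which penalizes each component of `δ`. -/
def stabDofs {d : ℕ} (k : ℕ) (T : Finset (Euc d)) (w v : LocVel d) : ℝ :=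
  ((facesOf T).card * (diam T ^ d / volume.real (hull T))) * (diam T ^ 2)⁻¹ *
      ∫ x, ⟪(delta k T w).1 x, (delta k T v).1 x⟫ ∂(cellMeas T) +
    (diam T)⁻¹ * ∑ F ∈ facesOf T, ∫ x, ⟪(delta k T w).2 F x, (delta k T v).2 F x⟫ ∂(faceMeas F)

/-- The viscous stabilization form which penalizes the differences `δ_T - δ_{TF}` on the faces. -/
def stabFaces {d : ℕ} (k : ℕ) (T : Finset (Euc d)) (w v : LocVel d) : ℝ :=
  (diam T)⁻¹ * ∑ F ∈ facesOf T, ∫ x, ⟪(delta k T w).1 x - (delta k T w).2 F x,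
    (delta k T v).1 x - (delta k T v).2 F x⟫ ∂(faceMeas F)

/-- The local viscous form `a_T` built on the stabilization form `s`. -/
def viscT {d : ℕ} (k : ℕ) (s : Finset (Euc d) → LocVel d → LocVel d → ℝ) (T : Finset (Euc d))
    (w v : LocVel d) : ℝ :=
  ∫ x, frob (fderiv ℝ (reconstruction k T w) x) (fderiv ℝ (reconstruction k T v) x) ∂(cellMeas T) +
    s T w v

/-- The square of the local discrete `H¹`-seminorm `‖v‖_{1,T}`. -/
def normOneSqT {d : ℕ} (T : Finset (Euc d)) (v : LocVel d) : ℝ :=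
  ∫ x, frob (fderiv ℝ v.1 x) (fderiv ℝ v.1 x) ∂(cellMeas T) +
    (diam T)⁻¹ * ∑ F ∈ facesOf T, ∫ x, ‖v.2 F x - v.1 x‖ ^ 2 ∂(faceMeas F)

/-- The admissible viscous stabilizations on a mesh: one of the two explicit choices above, or else
any bilinear form of the components of `δ` which makes `a_T` equivalent to the local discrete
`H¹`-seminorm, with constant `η`. -/
def IsStabilization {d : ℕ} {Ω : Set (Euc d)} (K : SimplicialMesh Ω) (k : ℕ) (η : ℝ)
    (s : Finset (Euc d) → LocVel d → LocVel d → ℝ) : Prop :=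
  s = stabDofs k ∨ s = stabFaces k ∨
  ∀ T ∈ K.cells,
    (∃ B : LocVel d →ₗ[ℝ] LocVel d →ₗ[ℝ] ℝ, ∀ w ∈ locSpace k T, ∀ v ∈ locSpace k T,
      s T w v = B (delta k T w) (delta k T v)) ∧
    ∀ v ∈ locSpace k T, η⁻¹ * normOneSqT T v ≤ viscT k s T v v ∧
      viscT k s T v v ≤ η * normOneSqT T v

/-! ### Velocity--pressure coupling -/

/-- The divergence of a smooth vector field. -/
def divergence {d : ℕ} (w : Euc d → Euc d) (x : Euc d) : ℝ := trace (fderiv ℝ w x)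

/-- The characterization of the pressure gradient `g = G_T^k q`. -/
def IsPressureGrad {d : ℕ} (k : ℕ) (T : Finset (Euc d)) (q : Pre d) (g : Euc d → Euc d) : Prop :=
  g ∈ rtn d (k + 1) ∧ ∀ w ∈ rtn d (k + 1),
    ∫ x, ⟪g x, w x⟫ ∂(cellMeas T) =
      -∫ x, q.1 T x * divergence w x ∂(cellMeas T) +
        ∑ F ∈ facesOf T, ∫ x, q.2 F x * ⟪w x, normal T F⟫ ∂(faceMeas F)

/-- The pressure gradient `G_T^k`. -/
def pressureGrad {d : ℕ} (k : ℕ) (T : Finset (Euc d)) (q : Pre d) : Euc d → Euc d :=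
  Classical.epsilon (IsPressureGrad k T q)

section Forms

variable {d : ℕ} {Ω : Set (Euc d)}

/-- The viscous form `a_h`. -/
def visc (K : SimplicialMesh Ω) (k : ℕ) (s : Finset (Euc d) → LocVel d → LocVel d → ℝ)
    (w v : Vel d) : ℝ :=
  ∑ T ∈ K.cells, viscT k s T (loc T w) (loc T v)

/-- The velocity--pressure coupling `b_h`. -/
def coupling (K : SimplicialMesh Ω) (k : ℕ) (v : Vel d) (q : Pre d) : ℝ :=
  ∑ T ∈ K.cells, ∫ x, ⟪v.1 T x, pressureGrad k T q x⟫ ∂(cellMeas T)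

/-- The convective trilinear form `t_h`. -/
def conv (K : SimplicialMesh Ω) (w v z : Vel d) : ℝ :=
  ∑ T ∈ K.cells,
    (∫ x, ⟪fderiv ℝ (v.1 T) x (w.1 T x), z.1 T x⟫ ∂(cellMeas T) +
      1 / 2 * ∑ F ∈ facesOf T,
        ∫ x, ⟪w.1 T x, normal T F⟫ * ⟪v.2 F x - v.1 T x, z.2 F x + z.1 T x⟫ ∂(faceMeas F))

/-- The convective stabilization form `j_{β,h}`. -/
def convStab (K : SimplicialMesh Ω) (β : Finset (Euc d) → ℝ) (w v : Vel d) : ℝ :=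
  ∑ T ∈ K.cells, β T * ∑ F ∈ facesOf T,
    ∫ x, ⟪w.2 F x - w.1 T x, v.2 F x - v.1 T x⟫ ∂(faceMeas F)

/-- The discrete `L²`-product `(w, v)_{0,h}`. -/
def prodZero (K : SimplicialMesh Ω) (w v : Vel d) : ℝ :=
  ∑ T ∈ K.cells, (∫ x, ⟪w.1 T x, v.1 T x⟫ ∂(cellMeas T) +
    diam T * ∑ F ∈ facesOf T, ∫ x, ⟪w.2 F x - w.1 T x, v.2 F x - v.1 T x⟫ ∂(faceMeas F))

/-- The square of the discrete `H¹`-like seminorm `‖v‖_{1,h}`. -/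
def normOneSq (K : SimplicialMesh Ω) (v : Vel d) : ℝ := ∑ T ∈ K.cells, normOneSqT T (loc T v)

/-- The square of the norm `|||v|||_h` of a continuous function of time. -/
def tripleNormSq (K : SimplicialMesh Ω) (ν tF : ℝ) (β : Finset (Euc d) → ℝ → ℝ) (v : ℝ → Vel d) :
    ℝ :=
  sSup ((fun t => prodZero K (v t) (v t)) '' Icc 0 tF) +
    (∫ t in (0 : ℝ)..tF, ν * normOneSq K (v t)) +
    ∫ t in (0 : ℝ)..tF, convStab K (fun T => β T t) (v t) (v t)

end Forms

/-! ### Sobolev spaces and interpolation -/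

section Sobolev

variable {d : ℕ}

/-- `u ∈ H¹(Ω)^d`, with weak gradient `G`. -/
structure IsH1 (Ω : Set (Euc d)) (u : Euc d → Euc d) (G : Euc d → Euc d →L[ℝ] Euc d) : Prop where
  memLp : MemLp u 2 (volume.restrict Ω)
  memLp_grad : MemLp G 2 (volume.restrict Ω)
  weak : ∀ φ : Euc d → ℝ, ContDiff ℝ ∞ φ → HasCompactSupport φ → tsupport φ ⊆ Ω → ∀ i j : Fin d,
    ∫ x in Ω, u x i * fderiv ℝ φ x (basisVec j) = -∫ x in Ω, G x (basisVec j) i * φ x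

/-- The smooth functions `φ n` converge in `H¹(Ω)^d` to the function `u` of gradient `G`. -/
def TendstoH1 (Ω : Set (Euc d)) (φ : ℕ → Euc d → Euc d) (u : Euc d → Euc d)
    (G : Euc d → Euc d →L[ℝ] Euc d) : Prop :=
  Tendsto (fun n => eLpNorm (fun x => φ n x - u x) 2 (volume.restrict Ω)) atTop (𝓝 0) ∧
  Tendsto (fun n => eLpNorm (fun x => fderiv ℝ (φ n) x - G x) 2 (volume.restrict Ω)) atTop (𝓝 0)

/-- `u = 0` on `∂Ω`, for `u ∈ H¹(Ω)^d` of gradient `G`: the function `u` is in `H¹_0(Ω)^d`, that is,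
in the closure in `H¹(Ω)^d` of the smooth functions with compact support in `Ω`. -/
def VanishesOnBoundary (Ω : Set (Euc d)) (u : Euc d → Euc d) (G : Euc d → Euc d →L[ℝ] Euc d) :
    Prop :=
  ∃ φ : ℕ → Euc d → Euc d,
    (∀ n, ContDiff ℝ ∞ (φ n) ∧ HasCompactSupport (φ n) ∧ tsupport (φ n) ⊆ Ω) ∧ TendstoH1 Ω φ u G

/-- The square of the `H¹(Ω)^d`-norm of the function `u` of gradient `G`. -/
def normH1Sq (Ω : Set (Euc d)) (u : Euc d → Euc d) (G : Euc d → Euc d →L[ℝ] Euc d) : ℝ :=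
  (∫ x in Ω, ‖u x‖ ^ 2) + ∫ x in Ω, frob (G x) (G x)

/-- `γ` is the trace on the face `F` of `u ∈ H¹(Ω)^d` of gradient `G`: the limit in `L²(F)^d` of the
restrictions to `F` of smooth functions which converge to `u` in `H¹(Ω)^d`. -/
def IsTrace (Ω : Set (Euc d)) (F : Finset (Euc d)) (u : Euc d → Euc d)
    (G : Euc d → Euc d →L[ℝ] Euc d) (γ : Euc d → Euc d) : Prop :=
  MemLp γ 2 (faceMeas F) ∧
  ∃ φ : ℕ → Euc d → Euc d, (∀ n, ContDiff ℝ ∞ (φ n)) ∧ TendstoH1 Ω φ u G ∧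
    Tendsto (fun n => eLpNorm (fun x => φ n x - γ x) 2 (faceMeas F)) atTop (𝓝 0)

/-- `w` is the interpolate `I_{U,h}^k u` of `u ∈ H¹(Ω)^d` of gradient `G`. -/
def IsVelInterp {Ω : Set (Euc d)} (K : SimplicialMesh Ω) (k : ℕ) (u : Euc d → Euc d)
    (G : Euc d → Euc d →L[ℝ] Euc d) (w : Vel d) : Prop :=
  ∃ γ : Finset (Euc d) → Euc d → Euc d, (∀ F ∈ K.faces, IsTrace Ω F u G (γ F)) ∧
    (∀ T ∈ K.cells, IsRTNInterp (k + 1) T u γ (w.1 T)) ∧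
    ∀ F ∈ K.faces, IsFaceProj k F (γ F) (w.2 F)

end Sobolev

/-! ### The scheme -/

/-- `(u, p) ∈ C¹([0,t_F]; U_{h,0}^k) × C⁰([0,t_F]; P_{h,0}^k)` solves the discrete problem with
source term `f` and initial datum `u₀` (of gradient `G₀`). The spaces are finite-dimensional, with
their unique Hausdorff vector space topology; only the values at times in `[0,t_F]` matter. -/
structure IsSolution {d : ℕ} {Ω : Set (Euc d)} (K : SimplicialMesh Ω) (k : ℕ)
    (s : Finset (Euc d) → LocVel d → LocVel d → ℝ) (ν tF : ℝ) (β : Finset (Euc d) → ℝ → ℝ)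
    (f : ℝ → Lp (Euc d) 2 (volume.restrict Ω)) (u₀ : Euc d → Euc d)
    (G₀ : Euc d → Euc d →L[ℝ] Euc d) (u : ℝ → velSpace K k) (p : ℝ → preSpace K k) : Prop where
  initial : IsVelInterp K k u₀ G₀ (u 0 : Vel d)
  momentum : ∃ u' : ℝ → velSpace K k, ContinuousOn u' (Icc 0 tF) ∧
    (∀ t ∈ Icc 0 tF, HasDerivWithinAt u (u' t) (Icc 0 tF) t) ∧
    ∀ t ∈ Icc 0 tF, ∀ v : velSpace K k,
      prodZero K (u' t : Vel d) v + ν * visc K k s (u t : Vel d) v +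
          conv K (u t : Vel d) (u t) v + convStab K (fun T => β T t) (u t : Vel d) v +
          coupling K k (v : Vel d) (p t) =
        ∫ x in Ω, ⟪f t x, K.piecewise (v : Vel d).1 x⟫
  mass : ∀ t ∈ Icc 0 tF, ∀ q ∈ preSpaceZero K k, -coupling K k (u t : Vel d) q = 0
  continuous_pressure : ContinuousOn p (Icc 0 tF)
  zero_average : ∀ t ∈ Icc 0 tF, (p t : Pre d) ∈ preSpaceZero K k

end HybridNS

end

/-!
The proof has an abstract part, which is finite-dimensional, and a part on the mesh, which
verifies its hypotheses with constants independent of the mesh size.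

*Abstract part.* The scheme has the form `M u' + a u + N(u, u) + j(t) u + b(·, p) = ℓ(t)`,
`b(u, ·) = 0`, with `M` positive definite, `a` and `j(t)` nonnegative, and `N(u, u, u) = 0` for all
`u` in the kernel `Z` of `b`. Tested with elements of `Z`, it is an ordinary differential equation
with a quadratic nonlinearity that does no work, so that the energy prevents blow-up: solutions
are global. The part of the equation that vanishes on `Z` is `b(·, p)` for a unique `p` as soon as
`b(v, q) = 0` for all `v` implies `q = 0`; see `exists_saddle_solution` and
`eqOn_of_saddle_solution`. No uniform inf-sup constant is needed, since the pressure does not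
enter the estimate.

*The forms on the mesh.* Three properties are used.
* If `b_h(·, q) = 0`, then `G_T q = 0` for all `T`, hence `q` is constant in each element and
  takes the same values on its faces. It is then a single constant, because its distributional
  gradient is zero, and this constant is zero since the average is (`eq_zero_of_coupling`).
* If `b_h(w, ·) = 0`, then each `w_T` is divergence free and the normal components of the `w_T`
  match across the interfaces, so that `t_h(w, v, v)` reduces by the divergence theorem to fluxes
  of `|v_F|²/2` which cancel out (`conv_self_eq_zero`).
* `‖·‖_{1,T}²` is bounded by the viscous form (`exists_viscT_coercive`). For the explicit
  stabilizations this rests on local inequalities on shape-regular simplices. They are obtained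
  with no reference element, by comparison, up to a homothety, with a ball contained in the
  simplex and one that contains it: on a finite-dimensional space of polynomials all norms are
  equivalent. The stability of the Raviart--Thomas--Nédélec degrees of freedom (`exists_rtn_le`)
  is shown by bounding first the divergence of the field, which controls its distance from the
  full polynomials of lower degree, then the latter, one normal component at a time; unisolvence
  follows by counting dimensions.

*Initial datum.* The traces of a function in `H¹_0(Ω)^d` on the faces are limits of traces of
smooth functions with compact support. The interpolate of a divergence-free field is in the kernel
of `b_h` (`coupling_velInterp`), and its discrete `L²`-norm is controlled by the `H¹`-norm
(`exists_prodZero_velInterp_le`).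

*Estimate.* The test function `v = u` gives `d/dt ‖u‖² + 2 (ν a(u, u) + j(u, u)) ≤ ‖f‖² + ‖u‖²`,
which is integrated after multiplication by `e^{-t}` (`energy_estimate`).
-/

namespace HybridNS

/-! ### Dissipative quadratic differential equations -/

section ODE

variable {E : Type*} [NormedAddCommGroup E] [InnerProductSpace ℝ E] [FiniteDimensional ℝ E]

omit [FiniteDimensional ℝ E] in
lemma norm_quadratic_sub_le {A : E →L[ℝ] E} {B : E →L[ℝ] E →L[ℝ] E} {g : E} {a r : ℝ}
    (hA : ‖A‖ ≤ a) {x y : E} (hx : ‖x‖ ≤ r) (hy : ‖y‖ ≤ r) :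
    ‖(g - A x - B x x) - (g - A y - B y y)‖ ≤ (a + 2 * r * ‖B‖) * ‖x - y‖ := by
  have h : (g - A x - B x x) - (g - A y - B y y) = -(A (x - y)) - B (x - y) x - B y (x - y) := by
    simp only [map_sub, sub_apply]; abel
  rw [h]
  have h1 : ‖A (x - y)‖ ≤ a * ‖x - y‖ := A.le_of_opNorm_le hA _
  have h2 : ‖B (x - y) x‖ ≤ ‖B‖ * ‖x - y‖ * r :=
    (B.le_opNorm₂ _ _).trans (by gcongr)
  have h3 : ‖B y (x - y)‖ ≤ ‖B‖ * r * ‖x - y‖ :=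
    (B.le_opNorm₂ _ _).trans (by gcongr)
  calc _ ≤ ‖A (x - y)‖ + ‖B (x - y) x‖ + ‖B y (x - y)‖ := by
        refine (norm_sub_le _ _).trans (add_le_add_left ((norm_sub_le _ _).trans ?_) _)
        rw [norm_neg]
    _ ≤ _ := by nlinarith

omit [FiniteDimensional ℝ E] in
/-- Energy inequality in differential form, integrated after multiplication by `e^{-t}`. -/
lemma norm_sq_le_of_energy {T G : ℝ} {u u' : ℝ → E}
    (hu : ∀ t ∈ Icc 0 T, HasDerivWithinAt u (u' t) (Icc 0 T) t)
    (he : ∀ t ∈ Icc 0 T, 2 * ⟪u t, u' t⟫ ≤ G ^ 2 + ‖u t‖ ^ 2) {t : ℝ} (ht : t ∈ Icc 0 T) :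
    ‖u t‖ ^ 2 ≤ Real.exp T * (‖u 0‖ ^ 2 + T * G ^ 2) := by
  have hder : ∀ s ∈ Icc 0 T, HasDerivWithinAt
      (fun s => Real.exp (-s) * ‖u s‖ ^ 2 - G ^ 2 * s)
      (-Real.exp (-s) * ‖u s‖ ^ 2 + Real.exp (-s) * (2 * ⟪u s, u' s⟫) - G ^ 2) (Icc 0 T) s := by
    intro s hs
    have h1 : HasDerivWithinAt (fun s => ‖u s‖ ^ 2) (2 * ⟪u s, u' s⟫) (Icc 0 T) s :=
      (hu s hs).norm_sq
    have h2 : HasDerivWithinAt (fun s => Real.exp (-s)) (-Real.exp (-s)) (Icc 0 T) s := by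
      simpa using (((hasDerivAt_id s).neg).exp).hasDerivWithinAt
    have h3 : HasDerivWithinAt (fun s => G ^ 2 * s) (G ^ 2) (Icc 0 T) s := by
      simpa using ((hasDerivAt_id s).const_mul (G ^ 2)).hasDerivWithinAt
    exact (h2.mul h1).sub h3
  have hanti := antitoneOn_of_hasDerivWithinAt_nonpos (convex_Icc 0 T)
    (fun s hs => (hder s hs).continuousWithinAt)
    (fun s hs => (hder s (interior_subset hs)).mono interior_subset) (fun s hs => by
      have hs' := interior_subset hs
      have h1 := he s hs'
      have h2 : Real.exp (-s) ≤ 1 := Real.exp_le_one_iff.2 (by linarith [hs'.1])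
      have h3 := Real.exp_pos (-s)
      nlinarith [sq_nonneg G])
  have h0 := hanti (left_mem_Icc.2 (ht.1.trans ht.2)) ht ht.1
  simp only [neg_zero, Real.exp_zero, one_mul, mul_zero, sub_zero] at h0
  have h1 : ‖u t‖ ^ 2 = Real.exp t * (Real.exp (-t) * ‖u t‖ ^ 2) := by
    rw [← mul_assoc, ← Real.exp_add]; simp
  rw [h1]
  have h2 : Real.exp (-t) * ‖u t‖ ^ 2 ≤ ‖u 0‖ ^ 2 + T * G ^ 2 := by
    nlinarith [sq_nonneg G, ht.2]
  have h3 : 0 ≤ Real.exp (-t) * ‖u t‖ ^ 2 := by positivity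
  calc _ ≤ Real.exp T * (Real.exp (-t) * ‖u t‖ ^ 2) := by
        gcongr; exact ht.2
    _ ≤ _ := by gcongr

/-- Global existence for `u' = g - A u - B(u, u)` with `A ≥ 0` and `⟪B(u, u), u⟫ = 0`. The field is
truncated by means of a smooth cut-off `χ`; as `χ` is scalar, the truncated equation still satisfies
the energy inequality, and its solution stays in the region where `χ = 1`. -/
theorem exists_solution_quadratic {T : ℝ} (hT : 0 < T) {A : ℝ → E →L[ℝ] E}
    (hA : ContinuousOn A (Icc 0 T)) (B : E →L[ℝ] E →L[ℝ] E) {g : ℝ → E}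
    (hg : ContinuousOn g (Icc 0 T)) (hpos : ∀ t ∈ Icc 0 T, ∀ x, 0 ≤ ⟪x, A t x⟫)
    (hskew : ∀ x, ⟪x, B x x⟫ = 0) (u₀ : E) :
    ∃ u : ℝ → E, u 0 = u₀ ∧
      ∀ t ∈ Icc 0 T, HasDerivWithinAt u (g t - A t (u t) - B (u t) (u t)) (Icc 0 T) t := by
  obtain ⟨a, ha⟩ := isCompact_Icc.exists_bound_of_continuousOn hA
  obtain ⟨G, hG⟩ := isCompact_Icc.exists_bound_of_continuousOn hg
  have h0T : (0 : ℝ) ∈ Icc 0 T := left_mem_Icc.2 hT.le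
  have ha0 : 0 ≤ a := (norm_nonneg _).trans (ha 0 h0T)
  have hG0 : 0 ≤ G := (norm_nonneg _).trans (hG 0 h0T)
  -- `R` exceeds the a priori bound of the norm of solutions.
  set R : ℝ := Real.sqrt (Real.exp T * (‖u₀‖ ^ 2 + T * G ^ 2)) + 1 with hR
  have hR0 : 0 < R := by positivity
  let χ : ContDiffBump (0 : E) := ⟨R, 2 * R, hR0, by linarith⟩
  let ρ : E → E := fun x => χ x • x
  have hρs : ContDiff ℝ 1 ρ := χ.contDiff.smul contDiff_id
  have hρc : HasCompactSupport ρ := χ.hasCompactSupport.smul_right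
  obtain ⟨κ, hκ⟩ := ContDiff.lipschitzWith_of_hasCompactSupport hρc hρs one_ne_zero
  have hρb : ∀ x, ‖ρ x‖ ≤ 2 * R := by
    intro x
    by_cases hx : ‖x‖ ≤ 2 * R
    · rw [norm_smul, Real.norm_of_nonneg χ.nonneg]
      exact (mul_le_of_le_one_left (norm_nonneg _) χ.le_one).trans hx
    · have : χ x = 0 := χ.zero_of_le_dist (by simpa using (not_le.1 hx).le)
      simp only [ρ, this, zero_smul, norm_zero]; positivity
  let F : ℝ → E → E := fun t x => g t - A t (ρ x) - B (ρ x) (ρ x)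
  let L : ℝ≥0 := ⟨G + a * (2 * R) + ‖B‖ * (2 * R) * (2 * R), by positivity⟩
  let Kc : ℝ≥0 := ⟨a + 2 * (2 * R) * ‖B‖, by positivity⟩ * κ
  let t0 : Icc 0 T := ⟨0, h0T⟩
  have hPL : IsPicardLindelof F t0 u₀ (L * ⟨T, hT.le⟩) 0 L Kc := by
    refine ⟨fun t ht => ?_, fun x _ => ?_, fun t ht x _ => ?_, ?_⟩
    · refine LipschitzOnWith.of_dist_le_mul fun x _ y _ => ?_
      have h1 := norm_quadratic_sub_le (g := g t) (B := B) (ha t ht) (hρb x) (hρb y)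
      have h2 := hκ.dist_le_mul x y
      rw [dist_eq_norm] at h2 ⊢
      refine h1.trans ?_
      change _ ≤ (a + 2 * (2 * R) * ‖B‖) * (κ : ℝ) * dist x y
      rw [mul_assoc (a + 2 * (2 * R) * ‖B‖)]
      exact mul_le_mul_of_nonneg_left h2 (by positivity)
    · exact (hg.sub (hA.clm_apply continuousOn_const)).sub continuousOn_const
    · have h1 : ‖A t (ρ x)‖ ≤ a * (2 * R) := (A t).le_of_opNorm_le_of_le (ha t ht) (hρb x)
      have h2 : ‖B (ρ x) (ρ x)‖ ≤ ‖B‖ * (2 * R) * (2 * R) :=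
        (B.le_opNorm₂ _ _).trans (by gcongr <;> exact hρb x)
      calc _ ≤ ‖g t‖ + ‖A t (ρ x)‖ + ‖B (ρ x) (ρ x)‖ :=
            (norm_sub_le _ _).trans (add_le_add_left (norm_sub_le _ _) _)
        _ ≤ _ := by
          change _ ≤ G + a * (2 * R) + ‖B‖ * (2 * R) * (2 * R)
          linarith [hG t ht]
    · change (L : ℝ) * max (T - 0) (0 - 0) ≤ L * T - 0
      simp [hT.le]
  obtain ⟨u, hu0, hu⟩ := hPL.exists_eq_forall_mem_Icc_hasDerivWithinAt₀
  refine ⟨u, hu0, fun t ht => ?_⟩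
  -- The cut-off multiplies the dissipative term by `χ ≥ 0`, and `⟪u, B(u, u)⟫ = 0` by `χ²`.
  have hb : ‖u t‖ ≤ R := by
    have henergy := norm_sq_le_of_energy (G := G) hu (fun s hs => by
      have e1 : ⟪u s, F s (u s)⟫ =
          ⟪u s, g s⟫ - χ (u s) * ⟪u s, A s (u s)⟫ - χ (u s) ^ 2 * ⟪u s, B (u s) (u s)⟫ := by
        simp only [F, ρ, map_smul, inner_sub_right, inner_smul_right, smul_apply]
        ring
      rw [e1, hskew]
      have e2 : 0 ≤ χ (u s) * ⟪u s, A s (u s)⟫ := mul_nonneg χ.nonneg (hpos s hs _)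
      have e3 : ⟪u s, g s⟫ ≤ ‖u s‖ * ‖g s‖ := real_inner_le_norm _ _
      have e4 := hG s hs
      nlinarith [sq_nonneg (‖u s‖ - G), norm_nonneg (u s)]) ht
    have h0 : u 0 = u₀ := hu0
    rw [h0] at henergy
    have := Real.abs_le_sqrt henergy
    rw [abs_norm] at this
    linarith
  have hχ : χ (u t) = 1 := χ.one_of_mem_closedBall (by simpa using hb)
  have := hu t ht
  simpa [F, ρ, hχ] using this

omit [FiniteDimensional ℝ E] in
theorem eqOn_of_solution_quadratic {T : ℝ} {A : ℝ → E →L[ℝ] E}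
    (hA : ContinuousOn A (Icc 0 T)) (B : E →L[ℝ] E →L[ℝ] E) {g : ℝ → E} {u v : ℝ → E}
    (hu : ∀ t ∈ Icc 0 T, HasDerivWithinAt u (g t - A t (u t) - B (u t) (u t)) (Icc 0 T) t)
    (hv : ∀ t ∈ Icc 0 T, HasDerivWithinAt v (g t - A t (v t) - B (v t) (v t)) (Icc 0 T) t)
    (h0 : u 0 = v 0) : EqOn u v (Icc 0 T) := by
  have huc : ContinuousOn u (Icc 0 T) := fun t ht => (hu t ht).continuousWithinAt
  have hvc : ContinuousOn v (Icc 0 T) := fun t ht => (hv t ht).continuousWithinAt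
  obtain ⟨a, ha⟩ := isCompact_Icc.exists_bound_of_continuousOn hA
  obtain ⟨r₁, hr₁⟩ := isCompact_Icc.exists_bound_of_continuousOn huc
  obtain ⟨r₂, hr₂⟩ := isCompact_Icc.exists_bound_of_continuousOn hvc
  have hder : ∀ {w w' : ℝ → E}, (∀ t ∈ Icc 0 T, HasDerivWithinAt w (w' t) (Icc 0 T) t) →
      ∀ t ∈ Ico 0 T, HasDerivWithinAt w (w' t) (Ici t) t := fun h t ht =>
    (h t (Ico_subset_Icc_self ht)).mono_of_mem_nhdsWithin
      (mem_of_superset (Icc_mem_nhdsGE ht.2) (Icc_subset_Icc_left ht.1))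
  refine ODE_solution_unique_of_mem_Icc_right
    (v := fun t x => g t - A t x - B x x) (s := fun _ => Metric.closedBall 0 (max r₁ r₂))
    (K := (a + 2 * (max r₁ r₂) * ‖B‖).toNNReal) (fun t ht => ?_) huc (hder hu)
      ?_ hvc (hder hv) ?_ h0
  · refine LipschitzOnWith.of_dist_le_mul fun x hx y hy => ?_
    rw [dist_eq_norm, dist_eq_norm]
    refine (norm_quadratic_sub_le (ha t (Ico_subset_Icc_self ht)) (mem_closedBall_zero_iff.1 hx)
      (mem_closedBall_zero_iff.1 hy)).trans ?_
    gcongr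
    exact Real.le_coe_toNNReal _
  · exact fun t ht => mem_closedBall_zero_iff.2
      ((hr₁ t (Ico_subset_Icc_self ht)).trans (le_max_left _ _))
  · exact fun t ht => mem_closedBall_zero_iff.2
      ((hr₂ t (Ico_subset_Icc_self ht)).trans (le_max_right _ _))

end ODE

/-! ### Differential-algebraic saddle point problems -/

section SaddlePoint

lemma hasDerivWithinAt_clm_comp {V W : Type*} [AddCommGroup V] [Module ℝ V] [TopologicalSpace V]
    [ContinuousSMul ℝ V] [AddCommGroup W] [Module ℝ W] [TopologicalSpace W] [ContinuousSMul ℝ W]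
    (L : V →L[ℝ] W) {f : ℝ → V} {f' : V} {s : Set ℝ} {x : ℝ} (h : HasDerivWithinAt f f' s x) :
    HasDerivWithinAt (fun t => L (f t)) (L f') s x := by
  refine ⟨?_⟩
  refine (L.isBigOTVS_comp.trans_isLittleOTVS h.isLittleOTVS).congr_left fun p => ?_
  simp

lemma continuousOn_bilin {V : Type*} [AddCommGroup V] [Module ℝ V] [FiniteDimensional ℝ V]
    [TopologicalSpace V] [IsTopologicalAddGroup V] [ContinuousSMul ℝ V] [T2Space V]
    {B : ℝ → V →ₗ[ℝ] V →ₗ[ℝ] ℝ} {S : Set ℝ} (hB : ∀ v w, ContinuousOn (fun t => B t v w) S)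
    {u w : ℝ → V} (hu : ContinuousOn u S) (hw : ContinuousOn w S) :
    ContinuousOn (fun t => B t (u t) (w t)) S := by
  let e := Module.finBasis ℝ V
  have hcoord : ∀ i, Continuous (e.coord i) := fun i => LinearMap.continuous_of_finiteDimensional _
  have h : (fun t => B t (u t) (w t)) = fun t =>
      ∑ i, ∑ j, e.coord i (u t) * (e.coord j (w t) * B t (e i) (e j)) := by
    funext t
    conv_lhs => rw [← e.sum_repr (u t), ← e.sum_repr (w t)]
    simp only [map_sum, LinearMap.sum_apply, map_smul, LinearMap.smul_apply, smul_eq_mul,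
      Module.Basis.coord_apply, Finset.mul_sum]
    rw [Finset.sum_comm]
    exact Finset.sum_congr rfl fun i _ => Finset.sum_congr rfl fun j _ => by ring
  rw [h]
  refine continuousOn_finsetSum _ fun i _ => continuousOn_finsetSum _ fun j _ => ?_
  exact ((hcoord i).comp_continuousOn hu).mul (((hcoord j).comp_continuousOn hw).mul (hB _ _))

/-- An orthonormal coordinate system for a positive definite symmetric bilinear form. -/
lemma exists_orthonormal_coordinates {V : Type*} [AddCommGroup V] [Module ℝ V]
    [FiniteDimensional ℝ V] (M : V →ₗ[ℝ] V →ₗ[ℝ] ℝ) (hs : ∀ u v, M u v = M v u)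
    (hM : ∀ u, u ≠ 0 → 0 < M u u) :
    ∃ (n : ℕ) (e : EuclideanSpace ℝ (Fin n) ≃ₗ[ℝ] V), ∀ x y, M (e x) (e y) = ⟪x, y⟫ := by
  let core : InnerProductSpace.Core ℝ V :=
    { inner := fun u v => M u v
      conj_inner_symm := fun u v => by simp [hs u v]
      re_inner_nonneg := fun u => by
        by_cases h : u = 0
        · simp [h]
        · simpa using (hM u h).le
      add_left := fun u v w => by simp
      smul_left := fun u v c => by simp
      definite := fun u h => by
        by_contra h0
        exact (hM u h0).ne' h }
  let _ : NormedAddCommGroup V := core.toNormedAddCommGroup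
  let _ : InnerProductSpace ℝ V := InnerProductSpace.ofCore core.toCore
  refine ⟨_, (stdOrthonormalBasis ℝ V).repr.symm.toLinearEquiv, fun x y => ?_⟩
  exact (stdOrthonormalBasis ℝ V).repr.symm.inner_map_map x y

variable {n : ℕ}

local notation "𝔼" => EuclideanSpace ℝ (Fin n)

/-- The vector which represents a linear form on a Euclidean space. -/
noncomputable def rieszVec (ℓ : 𝔼 →ₗ[ℝ] ℝ) : 𝔼 :=
  WithLp.toLp 2 fun i => ℓ (EuclideanSpace.single i 1)

lemma inner_rieszVec (ℓ : 𝔼 →ₗ[ℝ] ℝ) (y : 𝔼) : ⟪y, rieszVec ℓ⟫ = ℓ y := by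
  have h : y = ∑ i, y i • EuclideanSpace.single i (1 : ℝ) := by
    ext j; simp [Finset.sum_apply, Pi.single_apply]
  conv_rhs => rw [h]
  simp [rieszVec, PiLp.inner_apply, mul_comm]

/-- The operator which represents a bilinear form on a Euclidean space. -/
noncomputable def rieszOp (c : 𝔼 →ₗ[ℝ] 𝔼 →ₗ[ℝ] ℝ) : 𝔼 →L[ℝ] 𝔼 :=
  LinearMap.toContinuousLinearMap
    { toFun := fun x => rieszVec (c x)
      map_add' := fun x y => by ext i; simp [rieszVec]
      map_smul' := fun r x => by ext i; simp [rieszVec] }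

lemma inner_rieszOp (c : 𝔼 →ₗ[ℝ] 𝔼 →ₗ[ℝ] ℝ) (x y : 𝔼) : ⟪y, rieszOp c x⟫ = c x y :=
  inner_rieszVec _ _

/-- The bilinear map which represents a trilinear form on a Euclidean space. -/
noncomputable def rieszBilin (c : 𝔼 →ₗ[ℝ] 𝔼 →ₗ[ℝ] 𝔼 →ₗ[ℝ] ℝ) : 𝔼 →L[ℝ] 𝔼 →L[ℝ] 𝔼 :=
  LinearMap.toContinuousLinearMap
    { toFun := fun x => rieszOp (c x)
      map_add' := fun x y => by ext z i; simp [rieszOp, rieszVec]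
      map_smul' := fun r x => by ext z i; simp [rieszOp, rieszVec] }

lemma inner_rieszBilin (c : 𝔼 →ₗ[ℝ] 𝔼 →ₗ[ℝ] 𝔼 →ₗ[ℝ] ℝ) (x y z : 𝔼) :
    ⟪z, rieszBilin c x y⟫ = c x y z :=
  inner_rieszVec _ _

lemma continuousOn_rieszVec {ℓ : ℝ → 𝔼 →ₗ[ℝ] ℝ} {S : Set ℝ}
    (h : ∀ v, ContinuousOn (fun t => ℓ t v) S) : ContinuousOn (fun t => rieszVec (ℓ t)) S :=
  (PiLp.continuous_toLp 2 _).comp_continuousOn (continuousOn_pi.2 fun _ => h _)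

lemma continuousOn_rieszOp {c : ℝ → 𝔼 →ₗ[ℝ] 𝔼 →ₗ[ℝ] ℝ} {S : Set ℝ}
    (h : ∀ u v, ContinuousOn (fun t => c t u v) S) : ContinuousOn (fun t => rieszOp (c t)) S :=
  continuousOn_clm_apply.2 fun x => continuousOn_rieszVec (h x)

variable {U P : Type*} [AddCommGroup U] [Module ℝ U] [FiniteDimensional ℝ U]
  [TopologicalSpace U] [IsTopologicalAddGroup U] [ContinuousSMul ℝ U] [T2Space U]
  [AddCommGroup P] [Module ℝ P] [FiniteDimensional ℝ P]
  [TopologicalSpace P] [IsTopologicalAddGroup P] [ContinuousSMul ℝ P] [T2Space P]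

/-- The kernel of a bilinear form `b`, restricted to a space `P₀` of multipliers. -/
def constraintKer (b : U →ₗ[ℝ] P →ₗ[ℝ] ℝ) (P₀ : Submodule ℝ P) : Submodule ℝ U where
  carrier := {u | ∀ q ∈ P₀, b u q = 0}
  zero_mem' := by simp
  add_mem' := fun hu hv q hq => by simp [hu q hq, hv q hq]
  smul_mem' := fun c u hu q hq => by simp [hu q hq]

omit [FiniteDimensional ℝ U] [TopologicalSpace U] [IsTopologicalAddGroup U]
    [ContinuousSMul ℝ U] [T2Space U]
  [TopologicalSpace P] [IsTopologicalAddGroup P] [ContinuousSMul ℝ P] [T2Space P] in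
/-- In finite dimension, a linear form which vanishes on the kernel of `b` is `b(·, q)` for some
multiplier `q`, which depends linearly on the form. -/
lemma exists_multiplier (b : U →ₗ[ℝ] P →ₗ[ℝ] ℝ) (P₀ : Submodule ℝ P)
    (hb : ∀ q ∈ P₀, (∀ v, b v q = 0) → q = 0) :
    ∃ G : (U →ₗ[ℝ] ℝ) →ₗ[ℝ] P, (∀ r, G r ∈ P₀) ∧
      ∀ r : U →ₗ[ℝ] ℝ, (∀ v ∈ constraintKer b P₀, r v = 0) → ∀ v, b v (G r) = r v := by
  let β : P₀ →ₗ[ℝ] Module.Dual ℝ U := b.flip ∘ₗ P₀.subtype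
  have hβ : LinearMap.ker β = ⊥ := by
    refine (LinearMap.ker_eq_bot').2 fun q hq => Subtype.ext (hb q q.2 fun v => ?_)
    exact LinearMap.congr_fun hq v
  obtain ⟨G, hG⟩ := LinearMap.exists_leftInverse_of_injective β hβ
  refine ⟨P₀.subtype ∘ₗ G, fun r => (G r).2, fun r hr v => ?_⟩
  have hmem : r ∈ LinearMap.range β := by
    rw [← Subspace.dualCoannihilator_dualAnnihilator_eq (W := LinearMap.range β)]
    refine (Submodule.mem_dualAnnihilator _).2 fun w hw => hr w fun q hq => ?_
    exact (Submodule.mem_dualCoannihilator _).1 hw _ ⟨⟨q, hq⟩, rfl⟩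
  obtain ⟨q, rfl⟩ := hmem
  have : G (β q) = q := LinearMap.congr_fun hG q
  simp only [LinearMap.comp_apply, this]
  rfl

variable {M a : U →ₗ[ℝ] U →ₗ[ℝ] ℝ} {N : U →ₗ[ℝ] U →ₗ[ℝ] U →ₗ[ℝ] ℝ} {j : ℝ → U →ₗ[ℝ] U →ₗ[ℝ] ℝ}
  {ℓ : ℝ → U →ₗ[ℝ] ℝ} {b : U →ₗ[ℝ] P →ₗ[ℝ] ℝ} {P₀ : Submodule ℝ P} {T : ℝ}

/-- Well-posedness of the differential-algebraic problem. Only the injectivity part of the inf-sup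
condition on `b` is needed. The dynamics takes place in the kernel of `b`, where the problem reduces
to an ordinary differential equation; the multiplier is recovered by duality. -/
theorem exists_saddle_solution (hT : 0 < T) (hMs : ∀ u v, M u v = M v u)
    (hM : ∀ u, u ≠ 0 → 0 < M u u) (ha : ∀ u, 0 ≤ a u u) (hj : ∀ t ∈ Icc 0 T, ∀ u, 0 ≤ j t u u)
    (hjc : ∀ u v, ContinuousOn (fun t => j t u v) (Icc 0 T))
    (hℓ : ∀ v, ContinuousOn (fun t => ℓ t v) (Icc 0 T))
    (hN : ∀ u ∈ constraintKer b P₀, N u u u = 0)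
    (hb : ∀ q ∈ P₀, (∀ v, b v q = 0) → q = 0) {u₀ : U} (hu₀ : u₀ ∈ constraintKer b P₀) :
    ∃ (u u' : ℝ → U) (p : ℝ → P), u 0 = u₀ ∧ ContinuousOn u' (Icc 0 T) ∧
      (∀ t ∈ Icc 0 T, HasDerivWithinAt u (u' t) (Icc 0 T) t) ∧
      (∀ t ∈ Icc 0 T, ∀ v, M (u' t) v + a (u t) v + N (u t) (u t) v + j t (u t) v + b v (p t) =
        ℓ t v) ∧
      (∀ t ∈ Icc 0 T, u t ∈ constraintKer b P₀) ∧ ContinuousOn p (Icc 0 T) ∧ ∀ t, p t ∈ P₀ := by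
  set Z := constraintKer b P₀
  obtain ⟨n, e, he⟩ := exists_orthonormal_coordinates (M.compl₁₂ Z.subtype Z.subtype)
    (fun u v => hMs _ _) (fun u hu => hM _ fun h => hu (Subtype.ext h))
  let ι : EuclideanSpace ℝ (Fin n) →ₗ[ℝ] U := Z.subtype ∘ₗ e.toLinearMap
  have hι : ∀ x, ι x ∈ Z := fun x => (e x).2
  have hιM : ∀ x y, M (ι x) (ι y) = ⟪x, y⟫ := he
  let ιc : EuclideanSpace ℝ (Fin n) →L[ℝ] U := ⟨ι, LinearMap.continuous_of_finiteDimensional ι⟩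
  let A : ℝ → EuclideanSpace ℝ (Fin n) →L[ℝ] EuclideanSpace ℝ (Fin n) :=
    fun t => rieszOp (a.compl₁₂ ι ι + (j t).compl₁₂ ι ι)
  let B := rieszBilin (((N.compl₁₂ ι ι).compr₂ (LinearMap.lcomp ℝ ℝ ι)))
  let g : ℝ → EuclideanSpace ℝ (Fin n) := fun t => rieszVec (ℓ t ∘ₗ ι)
  have hA : ContinuousOn A (Icc 0 T) := continuousOn_rieszOp fun x y =>
    continuousOn_const.add (hjc _ _)
  have hg : ContinuousOn g (Icc 0 T) := continuousOn_rieszVec fun x => hℓ _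
  have hAe : ∀ t x y, ⟪y, A t x⟫ = a (ι x) (ι y) + j t (ι x) (ι y) := fun t x y =>
    inner_rieszOp _ _ _
  have hBe : ∀ x y z, ⟪z, B x y⟫ = N (ι x) (ι y) (ι z) := fun x y z => inner_rieszBilin _ _ _ _
  have hge : ∀ t y, ⟪y, g t⟫ = ℓ t (ι y) := fun t y => inner_rieszVec _ _
  obtain ⟨x, hx0, hx⟩ := exists_solution_quadratic hT hA B hg
    (fun t ht x => by rw [hAe]; exact add_nonneg (ha _) (hj t ht _))
    (fun x => by rw [hBe]; exact hN _ (hι x)) (e.symm ⟨u₀, hu₀⟩)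
  have hxc : ContinuousOn x (Icc 0 T) := fun t ht => (hx t ht).continuousWithinAt
  let x' : ℝ → EuclideanSpace ℝ (Fin n) := fun t => g t - A t (x t) - B (x t) (x t)
  have hx'c : ContinuousOn x' (Icc 0 T) :=
    (hg.sub (hA.clm_apply hxc)).sub ((B.continuous.comp_continuousOn hxc).clm_apply hxc)
  obtain ⟨G, hG0, hG⟩ := exists_multiplier b P₀ hb
  let r : ℝ → U →ₗ[ℝ] ℝ := fun t =>
    ℓ t - M (ι (x' t)) - a (ι (x t)) - N (ι (x t)) (ι (x t)) - j t (ι (x t))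
  have huc : ContinuousOn (fun t => ι (x t)) (Icc 0 T) := ιc.continuous.comp_continuousOn hxc
  have hu'c : ContinuousOn (fun t => ι (x' t)) (Icc 0 T) := ιc.continuous.comp_continuousOn hx'c
  have hrc : ∀ v, ContinuousOn (fun t => r t v) (Icc 0 T) := by
    intro v
    have c1 := continuousOn_bilin (B := fun _ => M) (fun _ _ => continuousOn_const) hu'c
      (continuousOn_const (c := v))
    have c2 := continuousOn_bilin (B := fun _ => a) (fun _ _ => continuousOn_const) huc
      (continuousOn_const (c := v))
    have c3 := continuousOn_bilin (B := fun _ => N.compr₂ (LinearMap.applyₗ v))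
      (fun _ _ => continuousOn_const) huc huc
    have c4 := continuousOn_bilin (B := j) hjc huc (continuousOn_const (c := v))
    exact ((((hℓ v).sub c1).sub c2).sub c3).sub c4
  have hr : ∀ t ∈ Icc 0 T, ∀ v ∈ Z, r t v = 0 := by
    intro t _ v hv
    obtain ⟨y, rfl⟩ : ∃ y, ι y = v := ⟨e.symm ⟨v, hv⟩, by simp [ι]⟩
    have h1 : ⟪y, x' t⟫ = ⟪y, g t⟫ - ⟪y, A t (x t)⟫ - ⟪y, B (x t) (x t)⟫ := by
      simp only [x', inner_sub_right]
    rw [hge, hAe, hBe, real_inner_comm, ← hιM] at h1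
    simp only [r, LinearMap.sub_apply]
    linarith
  refine ⟨fun t => ι (x t), fun t => ι (x' t), fun t => G (r t), ?_, hu'c,
    fun t ht => hasDerivWithinAt_clm_comp ιc (hx t ht), fun t ht v => ?_, fun t _ => hι _, ?_,
    fun t => hG0 _⟩
  · simp [ι, hx0]
  · rw [hG _ (hr t ht)]
    simp only [r, LinearMap.sub_apply]
    ring
  · let f := Module.finBasis ℝ U
    have hexp : (fun t => G (r t)) = fun t => ∑ i, r t (f i) • G (f.coord i) := by
      funext t
      have : r t = ∑ i, r t (f i) • f.coord i := f.ext fun k => by simp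
      exact (congrArg G this).trans (by simp only [map_sum, map_smul])
    rw [hexp]
    exact continuousOn_finsetSum _ fun i _ => (hrc _).smul continuousOn_const

/-- Uniqueness of the solution and of the multiplier. -/
theorem eqOn_of_saddle_solution (hT : 0 < T) (hMs : ∀ u v, M u v = M v u)
    (hM : ∀ u, u ≠ 0 → 0 < M u u)
    (hjc : ∀ u v, ContinuousOn (fun t => j t u v) (Icc 0 T))
    (hb : ∀ q ∈ P₀, (∀ v, b v q = 0) → q = 0)
    {u u' v v' : ℝ → U} {p q : ℝ → P} (h0 : u 0 = v 0)
    (hu : ∀ t ∈ Icc 0 T, HasDerivWithinAt u (u' t) (Icc 0 T) t)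
    (hv : ∀ t ∈ Icc 0 T, HasDerivWithinAt v (v' t) (Icc 0 T) t)
    (hu' : ∀ t ∈ Icc 0 T, ∀ w, M (u' t) w + a (u t) w + N (u t) (u t) w + j t (u t) w + b w (p t) =
        ℓ t w)
    (hv' : ∀ t ∈ Icc 0 T, ∀ w, M (v' t) w + a (v t) w + N (v t) (v t) w + j t (v t) w + b w (q t) =
        ℓ t w)
    (huZ : ∀ t ∈ Icc 0 T, u t ∈ constraintKer b P₀)
    (hvZ : ∀ t ∈ Icc 0 T, v t ∈ constraintKer b P₀)
    (hp : ∀ t ∈ Icc 0 T, p t ∈ P₀) (hq : ∀ t ∈ Icc 0 T, q t ∈ P₀) :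
    EqOn u v (Icc 0 T) ∧ EqOn p q (Icc 0 T) := by
  set Z := constraintKer b P₀
  obtain ⟨n, e, he⟩ := exists_orthonormal_coordinates (M.compl₁₂ Z.subtype Z.subtype)
    (fun u v => hMs _ _) (fun u hu => hM _ fun h => hu (Subtype.ext h))
  let ι : EuclideanSpace ℝ (Fin n) →ₗ[ℝ] U := Z.subtype ∘ₗ e.toLinearMap
  have hιM : ∀ x y, M (ι x) (ι y) = ⟪x, y⟫ := he
  obtain ⟨π₀, hπ₀⟩ := LinearMap.exists_leftInverse_of_injective ι
    (LinearMap.ker_eq_bot.2 (Z.injective_subtype.comp e.injective))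
  let π : U →L[ℝ] EuclideanSpace ℝ (Fin n) := ⟨π₀, LinearMap.continuous_of_finiteDimensional π₀⟩
  have hπ : ∀ w ∈ Z, ι (π w) = w := by
    intro w hw
    obtain ⟨y, rfl⟩ : ∃ y, ι y = w := ⟨e.symm ⟨w, hw⟩, by simp [ι]⟩
    exact congrArg ι (LinearMap.congr_fun hπ₀ y)
  let A : ℝ → EuclideanSpace ℝ (Fin n) →L[ℝ] EuclideanSpace ℝ (Fin n) :=
    fun t => rieszOp (a.compl₁₂ ι ι + (j t).compl₁₂ ι ι)
  let B := rieszBilin (((N.compl₁₂ ι ι).compr₂ (LinearMap.lcomp ℝ ℝ ι)))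
  let g : ℝ → EuclideanSpace ℝ (Fin n) := fun t => rieszVec (ℓ t ∘ₗ ι)
  have hA : ContinuousOn A (Icc 0 T) := continuousOn_rieszOp fun x y =>
    continuousOn_const.add (hjc _ _)
  have hAe : ∀ t x y, ⟪y, A t x⟫ = a (ι x) (ι y) + j t (ι x) (ι y) := fun t x y =>
    inner_rieszOp _ _ _
  have hBe : ∀ x y z, ⟪z, B x y⟫ = N (ι x) (ι y) (ι z) := fun x y z => inner_rieszBilin _ _ _ _
  have hge : ∀ t y, ⟪y, g t⟫ = ℓ t (ι y) := fun t y => inner_rieszVec _ _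
  -- The derivative of a curve with values in `Z` is in `Z`, and so the curve solves the reduced
  -- equation.
  have key : ∀ {w w' : ℝ → U} {r : ℝ → P},
      (∀ t ∈ Icc 0 T, HasDerivWithinAt w (w' t) (Icc 0 T) t) →
      (∀ t ∈ Icc 0 T, ∀ z, M (w' t) z + a (w t) z + N (w t) (w t) z + j t (w t) z + b z (r t) =
        ℓ t z) → (∀ t ∈ Icc 0 T, w t ∈ Z) → (∀ t ∈ Icc 0 T, r t ∈ P₀) → ∀ t ∈ Icc 0 T,
      w' t ∈ Z ∧ π (w' t) = g t - A t (π (w t)) - B (π (w t)) (π (w t)) := by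
    intro w w' r hw hw' hwZ hr t ht
    have hmem : w' t ∈ Z := by
      intro q hq
      let L : U →L[ℝ] ℝ := ⟨b.flip q, LinearMap.continuous_of_finiteDimensional _⟩
      have h1 : HasDerivWithinAt (fun s => L (w s)) (L (w' t)) (Icc 0 T) t :=
        hasDerivWithinAt_clm_comp L (hw t ht)
      have h2 : HasDerivWithinAt (fun s => L (w s)) 0 (Icc 0 T) t :=
        (hasDerivWithinAt_const t _ (0 : ℝ)).congr (fun s hs => hwZ s hs q hq) (hwZ t ht q hq)
      exact (uniqueDiffOn_Icc hT t ht).eq_deriv _ h1 h2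
    refine ⟨hmem, ext_inner_left ℝ fun y => ?_⟩
    have h3 := hw' t ht (ι y)
    have h4 : b (ι y) (r t) = 0 := (e y).2 _ (hr t ht)
    rw [inner_sub_right, inner_sub_right, hge, hAe, hBe, hπ _ (hwZ t ht), real_inner_comm, ← hιM,
      hπ _ hmem]
    linarith
  have hπu : ∀ {w w' : ℝ → U}, (∀ t ∈ Icc 0 T, HasDerivWithinAt w (w' t) (Icc 0 T) t) →
      ∀ t ∈ Icc 0 T, HasDerivWithinAt (fun t => π (w t)) (π (w' t)) (Icc 0 T) t :=
    fun h t ht => hasDerivWithinAt_clm_comp π (h t ht)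
  have hu1 := key hu hu' huZ hp
  have hv1 := key hv hv' hvZ hq
  have heq : EqOn (fun t => π (u t)) (fun t => π (v t)) (Icc 0 T) :=
    eqOn_of_solution_quadratic (g := g) hA B
      (fun t ht => by simpa only [(hu1 t ht).2] using hπu hu t ht)
      (fun t ht => by simpa only [(hv1 t ht).2] using hπu hv t ht) (congrArg π h0)
  have huv : EqOn u v (Icc 0 T) := fun t ht => by
    rw [← hπ _ (huZ t ht), ← hπ _ (hvZ t ht)]
    exact congrArg ι (heq ht)
  refine ⟨huv, fun t ht => sub_eq_zero.1 (hb _ (sub_mem (hp t ht) (hq t ht)) fun w => ?_)⟩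
  have huv' : u' t = v' t := by
    rw [← hπ _ (hu1 t ht).1, ← hπ _ (hv1 t ht).1, (hu1 t ht).2, (hv1 t ht).2, huv ht]
  have h1 := hu' t ht w
  have h2 := hv' t ht w
  rw [huv', huv ht] at h1
  rw [map_sub]
  linarith

end SaddlePoint


/-! ### Polynomial functions -/

section Poly

variable {d : ℕ} {l l' : ℤ} {f g : Euc d → ℝ}

/-- Evaluation of polynomials, as a linear map into functions. -/
noncomputable def evalLin (d : ℕ) : MvPolynomial (Fin d) ℝ →ₗ[ℝ] (Euc d → ℝ) where
  toFun p := fun x => MvPolynomial.eval (fun i => x i) p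
  map_add' p q := by ext; simp
  map_smul' c p := by ext; simp [MvPolynomial.smul_eval]

lemma evalLin_injective : Function.Injective (evalLin d) := fun p q h =>
  MvPolynomial.funext fun x => by simpa [evalLin] using congrFun h (WithLp.toLp 2 x)

lemma evalLin_mul (p q : MvPolynomial (Fin d) ℝ) :
    evalLin d (p * q) = evalLin d p * evalLin d q := by
  ext; simp [evalLin]

lemma mem_poly_iff : f ∈ poly d l ↔
    ∃ p : MvPolynomial (Fin d) ℝ, (∀ m ∈ p.support, (m.degree : ℤ) ≤ l) ∧ f = evalLin d p := Iff.rfl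

lemma evalLin_mem_poly {p : MvPolynomial (Fin d) ℝ} :
    evalLin d p ∈ poly d l ↔ ∀ m ∈ p.support, (m.degree : ℤ) ≤ l := by
  refine ⟨fun ⟨q, hq, h⟩ => ?_, fun h => ⟨p, h, rfl⟩⟩
  rwa [evalLin_injective (h : evalLin d p = evalLin d q)]

lemma poly_mono (h : l ≤ l') : poly d l ≤ poly d l' := fun _ ⟨p, hp, e⟩ =>
  ⟨p, fun m hm => (hp m hm).trans h, e⟩

lemma eq_zero_of_mem_poly_neg (h : l < 0) (hf : f ∈ poly d l) : f = 0 := by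
  obtain ⟨p, hp, rfl⟩ := mem_poly_iff.1 hf
  have : p = 0 := by
    rw [← MvPolynomial.support_eq_empty]
    exact Finset.eq_empty_of_forall_notMem fun m hm => by have := hp m hm; omega
  simp [this]

lemma const_mem_poly (c : ℝ) (h : 0 ≤ l) : (fun _ => c) ∈ poly d l := by
  classical
  refine ⟨MvPolynomial.C c, fun m hm => ?_, by simp⟩
  rw [MvPolynomial.C_apply] at hm
  have hm' := MvPolynomial.support_monomial_subset hm
  rw [Finset.mem_singleton] at hm'
  simpa [hm'] using h

lemma mul_mem_poly (hf : f ∈ poly d l) (hg : g ∈ poly d l') :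
    (fun x => f x * g x) ∈ poly d (l + l') := by
  classical
  obtain ⟨p, hp, rfl⟩ := mem_poly_iff.1 hf
  obtain ⟨q, hq, rfl⟩ := mem_poly_iff.1 hg
  refine ⟨p * q, fun m hm => ?_, by ext; simp [evalLin]⟩
  obtain ⟨a, ha, b, hb, rfl⟩ := Finset.mem_add.1 (MvPolynomial.support_mul p q hm)
  have h1 := hp a ha
  have h2 := hq b hb
  rw [map_add]
  push_cast
  linarith

lemma coord_mem_poly (i : Fin d) : (fun x : Euc d => x i) ∈ poly d 1 := by
  refine ⟨MvPolynomial.X i, fun m hm => ?_, by simp⟩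
  rw [MvPolynomial.X] at hm
  have hm' := MvPolynomial.support_monomial_subset hm
  rw [Finset.mem_singleton] at hm'
  rw [hm', Finsupp.degree_single]
  rfl

/-- The polynomial functions of degree `≤ n` are generated from `1` by multiplications by the
coordinates. -/
lemma poly_induction (S : ℕ → Submodule ℝ (Euc d → ℝ)) (hS : Monotone S) (h1 : (fun _ => 1) ∈ S 0)
    (hX : ∀ n f i, f ∈ S n → (fun x => f x * x i) ∈ S (n + 1)) (n : ℕ) : poly d n ≤ S n := by
  classical
  have hmon : ∀ k, ∀ m : Fin d →₀ ℕ, m.degree = k →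
    evalLin d (MvPolynomial.monomial m 1) ∈ S k := by
    intro k
    induction k with
    | zero =>
      intro m hm
      have : m = 0 := (Finsupp.degree_eq_zero_iff m).1 hm
      subst this
      convert h1 using 1
      ext; simp [evalLin]
    | succ k ih =>
      intro m hm
      have hne : m ≠ 0 := by rintro rfl; simp at hm
      obtain ⟨i, hi⟩ := Finsupp.ne_iff.1 hne
      have hm' : m = (m - Finsupp.single i 1) + Finsupp.single i 1 := by
        ext j
        by_cases hj : j = i
        · subst hj
          have : m j ≠ 0 := by simpa using hi
          simp; omega
        · simp [Ne.symm hj]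
      have hdeg : (m - Finsupp.single i 1).degree = k := by
        have := congrArg Finsupp.degree hm'
        rw [map_add, Finsupp.degree_single] at this
        omega
      convert hX k _ i (ih _ hdeg) using 1
      have hmul : MvPolynomial.monomial m (1 : ℝ) =
          MvPolynomial.monomial (m - Finsupp.single i 1) 1 * MvPolynomial.X i := by
        rw [MvPolynomial.X, MvPolynomial.monomial_mul, ← hm', one_mul]
      rw [hmul, evalLin_mul]
      ext x
      simp [evalLin]
  rintro _ ⟨p, hp, rfl⟩
  change evalLin d p ∈ S n
  rw [p.as_sum, map_sum]
  refine Submodule.sum_mem _ fun m hm => ?_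
  have hc : MvPolynomial.monomial m (MvPolynomial.coeff m p) =
      MvPolynomial.coeff m p • MvPolynomial.monomial m (1 : ℝ) := by
    rw [MvPolynomial.smul_monomial]; simp
  rw [hc, map_smul]
  exact Submodule.smul_mem _ _ (hS (by exact_mod_cast hp m hm) (hmon _ m rfl))

lemma contDiff_of_mem_poly {n : WithTop ℕ∞} (hf : f ∈ poly d l) : ContDiff ℝ n f := by
  rcases lt_or_ge l 0 with h | h
  · rw [eq_zero_of_mem_poly_neg h hf]; exact contDiff_zero_fun
  lift l to ℕ using h
  let S : Submodule ℝ (Euc d → ℝ) :=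
    { carrier := {f | ContDiff ℝ n f}
      zero_mem' := contDiff_zero_fun
      add_mem' := fun h h' => h.add h'
      smul_mem' := fun c _ h => contDiff_const.smul h }
  refine poly_induction (fun _ => S) monotone_const contDiff_const (fun _ f i h => ?_) l hf
  exact ContDiff.mul h (by fun_prop)

lemma continuous_of_mem_poly (hf : f ∈ poly d l) : Continuous f :=
  (contDiff_of_mem_poly (n := 0) hf).continuous

lemma differentiable_of_mem_poly (hf : f ∈ poly d l) : Differentiable ℝ f :=
  (contDiff_of_mem_poly (n := 1) hf).differentiable one_ne_zero

lemma fderiv_mem_poly (hf : f ∈ poly d l) (v : Euc d) :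
    (fun x => fderiv ℝ f x v) ∈ poly d (l - 1) := by
  rcases lt_or_ge l 0 with h | h
  · rw [eq_zero_of_mem_poly_neg h hf]
    convert zero_mem (poly d (l - 1)) using 1
    ext x; simp
  lift l to ℕ using h
  let S : ℕ → Submodule ℝ (Euc d → ℝ) := fun n =>
    { carrier := {f | f ∈ poly d n ∧ (fun x => fderiv ℝ f x v) ∈ poly d ((n : ℤ) - 1)}
      zero_mem' := ⟨zero_mem _, by convert zero_mem (poly d ((n : ℤ) - 1)) using 1; ext x; simp⟩
      add_mem' := fun {a b} h h' => ⟨add_mem h.1 h'.1, by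
        convert add_mem h.2 h'.2 using 1
        ext x
        simp [fderiv_add (differentiable_of_mem_poly h.1 x) (differentiable_of_mem_poly h'.1 x)]⟩
      smul_mem' := fun c a h => ⟨Submodule.smul_mem _ _ h.1, by
        convert Submodule.smul_mem _ c h.2 using 1
        ext x
        simp [fderiv_const_smul (differentiable_of_mem_poly h.1 x)]⟩ }
  refine (poly_induction S (fun a b hab f h => ⟨poly_mono (by exact_mod_cast hab) h.1,
    poly_mono (by simpa using hab) h.2⟩) ⟨const_mem_poly _ (by simp), ?_⟩ (fun n f i h => ⟨?_, ?_⟩)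
    l hf).2
  · convert zero_mem (poly d _) using 1; ext x; simp
  · exact_mod_cast mul_mem_poly h.1 (coord_mem_poly i)
  · have e : (fun x => fderiv ℝ (fun x => f x * x i) x v) =
        (fun x => v i * f x) + fun x => fderiv ℝ f x v * x i := by
      ext x
      have h1 : HasFDerivAt f (fderiv ℝ f x) x := (differentiable_of_mem_poly h.1 x).hasFDerivAt
      have h2 : HasFDerivAt (fun x : Euc d => x i) (EuclideanSpace.proj i : Euc d →L[ℝ] ℝ) x :=
        (EuclideanSpace.proj i : Euc d →L[ℝ] ℝ).hasFDerivAt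
      rw [(h1.fun_mul h2).fderiv]
      simp; ring
    rw [e]
    refine add_mem ?_ ?_
    · rw [Nat.cast_succ, add_sub_cancel_right]
      exact Submodule.smul_mem (poly d (n : ℤ)) (v i) h.1
    · have := mul_mem_poly h.2 (coord_mem_poly i)
      simpa using this

instance : FiniteDimensional ℝ (poly d l) := by
  rcases lt_or_ge l 0 with h | h
  · have : poly d l = ⊥ := (Submodule.eq_bot_iff _).2 fun f hf => eq_zero_of_mem_poly_neg h hf
    rw [this]; infer_instance
  lift l to ℕ using h
  have : poly d l = (MvPolynomial.restrictTotalDegree (Fin d) ℝ l).map (evalLin d) := by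
    ext f
    simp only [mem_poly_iff, Submodule.mem_map, MvPolynomial.mem_restrictTotalDegree]
    refine exists_congr fun p => and_congr ?_ eq_comm
    rw [MvPolynomial.totalDegree, Finset.sup_le_iff]
    refine forall₂_congr fun m _ => ?_
    rw [Nat.cast_le]; rfl
  rw [this]; infer_instance

lemma comp_mem_poly {A : Euc d → Euc d} (hA : ∀ i, (fun x => A x i) ∈ poly d 1)
    (hf : f ∈ poly d l) :
    (fun x => f (A x)) ∈ poly d l := by
  rcases lt_or_ge l 0 with h | h
  · rw [eq_zero_of_mem_poly_neg h hf]; exact zero_mem _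
  lift l to ℕ using h
  refine poly_induction (fun n => (poly d n).comap (LinearMap.funLeft ℝ ℝ A))
    (fun a b hab => Submodule.comap_mono (poly_mono (by exact_mod_cast hab)))
    (const_mem_poly _ (by simp)) (fun n f i h => ?_) l hf
  exact_mod_cast mul_mem_poly (Submodule.mem_comap.1 h) (hA i)

/-- A polynomial minus its composition with the projection `x ↦ x - λ(x) v` is a multiple
of `λ`. -/
lemma exists_factor {lam : Euc d → ℝ} (hlam : lam ∈ poly d 1) (v : Euc d) (hf : f ∈ poly d l) :
    ∃ r ∈ poly d (l - 1), ∀ x, f x - f (x - lam x • v) = lam x * r x := by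
  rcases lt_or_ge l 0 with h | h
  · exact ⟨0, zero_mem _, by simp [eq_zero_of_mem_poly_neg h hf]⟩
  lift l to ℕ using h
  have hA : ∀ i, (fun x : Euc d => (x - lam x • v) i) ∈ poly d 1 := fun i => by
    convert sub_mem (coord_mem_poly i) (Submodule.smul_mem _ (v i) hlam) using 1
    ext x; simp [mul_comm]
  let S : ℕ → Submodule ℝ (Euc d → ℝ) := fun n =>
    { carrier := {f | f ∈ poly d n ∧
        ∃ r ∈ poly d ((n : ℤ) - 1), ∀ x, f x - f (x - lam x • v) = lam x * r x}
      zero_mem' := ⟨zero_mem _, 0, zero_mem _, by simp⟩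
      add_mem' := by
        rintro a b ⟨ha, r, hr, h⟩ ⟨hb, r', hr', h'⟩
        refine ⟨add_mem ha hb, r + r', add_mem hr hr', fun x => ?_⟩
        simp only [Pi.add_apply]
        linear_combination h x + h' x
      smul_mem' := by
        rintro c a ⟨ha, r, hr, h⟩
        refine ⟨Submodule.smul_mem _ _ ha, c • r, Submodule.smul_mem _ _ hr, fun x => ?_⟩
        simp only [Pi.smul_apply, smul_eq_mul]
        linear_combination c * h x }
  refine (poly_induction S ?_ ⟨const_mem_poly _ (by simp), 0, zero_mem _, by simp⟩ ?_ l hf).2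
  · rintro a b hab f ⟨hf, r, hr, h⟩
    exact ⟨poly_mono (by exact_mod_cast hab) hf, r, poly_mono (by simpa using hab) hr, h⟩
  · rintro n f i ⟨hf, r, hr, h⟩
    refine ⟨by exact_mod_cast mul_mem_poly hf (coord_mem_poly i),
      (fun x => r x * x i) + v i • fun x => f (x - lam x • v), ?_, fun x => ?_⟩
    · refine add_mem ?_ (Submodule.smul_mem _ _ ?_)
      · have := mul_mem_poly hr (coord_mem_poly i)
        simpa using this
      · simpa using comp_mem_poly hA hf
    · simp only [Pi.add_apply, Pi.smul_apply, PiLp.sub_apply, PiLp.smul_apply, smul_eq_mul]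
      linear_combination x i * h x

lemma mul_eq_zero_of_mem_poly (hf : f ∈ poly d l) (hg : g ∈ poly d l') (hfg : ∀ x, f x * g x = 0) :
    f = 0 ∨ g = 0 := by
  obtain ⟨p, _, rfl⟩ := mem_poly_iff.1 hf
  obtain ⟨q, _, rfl⟩ := mem_poly_iff.1 hg
  have h : evalLin d (p * q) = evalLin d 0 := by
    rw [evalLin_mul, map_zero]; exact funext hfg
  rcases mul_eq_zero.1 (evalLin_injective h) with rfl | rfl
  · left; simp
  · right; simp

lemma mem_poly_of_coord_mul (i : Fin d) (hf : f ∈ poly d l) (h : (fun x => x i * f x) ∈ poly d l) :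
    f ∈ poly d (l - 1) := by
  classical
  obtain ⟨p, hp, rfl⟩ := mem_poly_iff.1 hf
  have e : (fun x : Euc d => x i * evalLin d p x) = evalLin d (MvPolynomial.X i * p) := by
    ext; simp [evalLin]
  rw [e, evalLin_mem_poly] at h
  refine evalLin_mem_poly.2 fun m hm => ?_
  have hm' : Finsupp.single i 1 + m ∈ (MvPolynomial.X i * p).support := by
    rw [MvPolynomial.mem_support_iff, MvPolynomial.coeff_X_mul]
    exact MvPolynomial.mem_support_iff.1 hm
  have := h _ hm'
  rw [map_add, Finsupp.degree_single] at this
  push_cast at this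
  linarith

lemma hasFDerivAt_evalLin (p : MvPolynomial (Fin d) ℝ) (x : Euc d) :
    HasFDerivAt (evalLin d p)
      (∑ i, evalLin d (MvPolynomial.pderiv i p) x • (EuclideanSpace.proj i : Euc d →L[ℝ] ℝ)) x := by
  induction p using MvPolynomial.induction_on with
  | C a =>
    have : evalLin d (MvPolynomial.C a) = fun _ => a := by ext; simp [evalLin]
    rw [this]
    simpa using hasFDerivAt_const a x
  | add p q hp hq =>
    simpa only [map_add, Pi.add_apply, add_smul, Finset.sum_add_distrib] using hp.add hq
  | mul_X p j hp =>
    have hX : HasFDerivAt (fun x : Euc d => x j) (EuclideanSpace.proj j : Euc d →L[ℝ] ℝ) x :=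
      (EuclideanSpace.proj j : Euc d →L[ℝ] ℝ).hasFDerivAt
    have e : evalLin d (p * MvPolynomial.X j) = fun x => evalLin d p x * x j := by
      ext; simp [evalLin]
    rw [e]
    refine (hp.fun_mul hX).congr_fderiv ?_
    ext v
    simp only [MvPolynomial.pderiv_mul, map_add, Pi.add_apply, evalLin_mul, Pi.mul_apply,
      _root_.sum_apply, smul_apply, add_apply, smul_eq_mul, add_mul,
      Finset.sum_add_distrib, MvPolynomial.pderiv_X, Finset.mul_sum, EuclideanSpace.coe_proj]
    rw [add_comm]
    congr 1
    · refine Finset.sum_congr rfl fun i _ => ?_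
      simp [evalLin]; ring
    · rw [Finset.sum_eq_single j]
      · simp [evalLin]
      · intro i _ hij
        simp [hij.symm]
      · simp

lemma fderiv_evalLin_basisVec (p : MvPolynomial (Fin d) ℝ) (x : Euc d) (i : Fin d) :
    fderiv ℝ (evalLin d p) x (basisVec i) = evalLin d (MvPolynomial.pderiv i p) x := by
  classical
  rw [(hasFDerivAt_evalLin p x).fderiv]
  simp [basisVec]

/-- The operator `q ↦ d q + x · ∇q = div (q x)` preserves degrees, by Euler's identity. -/
lemma mem_poly_of_euler (hd : 0 < d) (hf : f ∈ poly d l)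
    (h : (fun x => d * f x + ∑ i, x i * fderiv ℝ f x (basisVec i)) ∈ poly d (l - 1)) :
    f ∈ poly d (l - 1) := by
  classical
  obtain ⟨p, hp, rfl⟩ := mem_poly_iff.1 hf
  set E : MvPolynomial (Fin d) ℝ →ₗ[ℝ] MvPolynomial (Fin d) ℝ :=
    (d : ℝ) • LinearMap.id + ∑ i, (LinearMap.mulLeft ℝ (MvPolynomial.X i)) ∘ₗ
      (MvPolynomial.pderiv i : Derivation ℝ _ _).toLinearMap with hE
  have e : (fun x => d * evalLin d p x + ∑ i, x i * fderiv ℝ (evalLin d p) x (basisVec i)) =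
      evalLin d (E p) := by
    ext x
    simp only [fderiv_evalLin_basisVec]
    simp [hE, evalLin, LinearMap.sum_apply, MvPolynomial.smul_eval]
  have hmon : ∀ (m : Fin d →₀ ℕ) (c : ℝ), E (MvPolynomial.monomial m c) =
      MvPolynomial.monomial m ((d + m.degree) * c) := by
    intro m c
    simp only [hE, LinearMap.add_apply, LinearMap.smul_apply, LinearMap.id_apply,
      LinearMap.sum_apply, LinearMap.comp_apply, LinearMap.mulLeft_apply,
      Derivation.coeFn_coe, MvPolynomial.X_mul_pderiv_monomial]
    rw [← Finset.sum_smul, ← Finsupp.degree_eq_sum, ← Nat.cast_smul_eq_nsmul ℝ, ← add_smul,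
      MvPolynomial.smul_monomial, smul_eq_mul]
  have hcoeff : ∀ m, MvPolynomial.coeff m (E p) = (d + m.degree) * MvPolynomial.coeff m p := by
    intro m
    conv_lhs => rw [p.as_sum, map_sum, MvPolynomial.coeff_sum]
    simp only [hmon, MvPolynomial.coeff_monomial]
    rw [Finset.sum_ite_eq' p.support m]
    split_ifs with hm
    · rfl
    · rw [MvPolynomial.notMem_support_iff.1 hm, mul_zero]
  rw [e, evalLin_mem_poly] at h
  refine evalLin_mem_poly.2 fun m hm => h m ?_
  rw [MvPolynomial.mem_support_iff] at hm ⊢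
  rw [hcoeff]
  exact mul_ne_zero (by positivity) hm

end Poly


/-! ### Polynomial vector fields, Raviart--Thomas--Nédélec fields, polynomials on faces -/

section VecPoly

variable {d : ℕ} {l l' : ℤ}

lemma vec_mono {V W : Submodule ℝ (Euc d → ℝ)} (h : V ≤ W) : vec V ≤ vec W :=
  fun _ hw i => h (hw i)

/-- A vector field is the family of its components. -/
noncomputable def vecEquiv (V : Submodule ℝ (Euc d → ℝ)) : vec V ≃ₗ[ℝ] (Fin d → V) where
  toFun w i := ⟨fun x => w.1 x i, w.2 i⟩
  map_add' _ _ := rfl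
  map_smul' _ _ := rfl
  invFun p := ⟨fun x => WithLp.toLp 2 fun i => (p i).1 x, fun i => (p i).2⟩
  left_inv _ := rfl
  right_inv _ := rfl

instance (V : Submodule ℝ (Euc d → ℝ)) [FiniteDimensional ℝ V] : FiniteDimensional ℝ (vec V) :=
  (vecEquiv V).symm.finiteDimensional

lemma finrank_vec (V : Submodule ℝ (Euc d → ℝ)) [FiniteDimensional ℝ V] :
    Module.finrank ℝ (vec V) = d * Module.finrank ℝ V := by
  rw [(vecEquiv V).finrank_eq, Module.finrank_pi_fintype]
  simp

lemma contDiff_of_mem_vec {n : WithTop ℕ∞} {w : Euc d → Euc d} (hw : w ∈ vec (poly d l)) :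
    ContDiff ℝ n w :=
  contDiff_euclidean.2 fun i => contDiff_of_mem_poly (hw i)

lemma continuous_of_mem_vec {w : Euc d → Euc d} (hw : w ∈ vec (poly d l)) : Continuous w :=
  (contDiff_of_mem_vec (n := 0) hw).continuous

lemma differentiable_of_mem_vec {w : Euc d → Euc d} (hw : w ∈ vec (poly d l)) :
    Differentiable ℝ w :=
  (contDiff_of_mem_vec (n := 1) hw).differentiable one_ne_zero

lemma fderiv_apply_comp {w : Euc d → Euc d} {x : Euc d} (hw : DifferentiableAt ℝ w x) (v : Euc d)
    (i : Fin d) : fderiv ℝ w x v i = fderiv ℝ (fun y => w y i) x v := by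
  have h := ((EuclideanSpace.proj i : Euc d →L[ℝ] ℝ).hasFDerivAt (x := w x)).comp x hw.hasFDerivAt
  have h' : HasFDerivAt (fun y => w y i) _ x := h
  rw [h'.fderiv]
  rfl

lemma fderiv_mem_vec {w : Euc d → Euc d} (hw : w ∈ vec (poly d l)) (v : Euc d) :
    (fun x => fderiv ℝ w x v) ∈ vec (poly d (l - 1)) := fun i => by
  simpa only [fderiv_apply_comp (differentiable_of_mem_vec hw _)] using fderiv_mem_poly (hw i) v

lemma const_mem_vec (c : Euc d) (h : 0 ≤ l) : (fun _ => c) ∈ vec (poly d l) :=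
  fun _ => const_mem_poly _ h

lemma inner_mem_poly {w : Euc d → Euc d} (hw : w ∈ vec (poly d l)) (n : Euc d) :
    (fun x => ⟪w x, n⟫) ∈ poly d l := by
  have : (fun x => ⟪w x, n⟫) = ∑ i, n i • fun x => w x i := by
    ext x; simp [PiLp.inner_apply]
  rw [this]
  exact Submodule.sum_mem _ fun i _ => Submodule.smul_mem _ _ (hw i)

lemma divergence_eq {w : Euc d → Euc d} {x : Euc d} (hw : DifferentiableAt ℝ w x) :
    divergence w x = ∑ j, fderiv ℝ (fun y => w y j) x (basisVec j) := by
  rw [divergence, trace]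
  exact Finset.sum_congr rfl fun j _ => fderiv_apply_comp hw (basisVec j) j

lemma divergence_mem_poly {w : Euc d → Euc d} (hw : w ∈ vec (poly d l)) :
    divergence w ∈ poly d (l - 1) := by
  have : divergence w = ∑ j, fun x => fderiv ℝ w x (basisVec j) j := by
    ext x; simp [divergence, trace]
  rw [this]
  exact Submodule.sum_mem _ fun j _ => fderiv_mem_vec hw (basisVec j) j

lemma divergence_add {v w : Euc d → Euc d} (hv : Differentiable ℝ v) (hw : Differentiable ℝ w) :
    divergence (v + w) = divergence v + divergence w := by
  ext x
  simp [divergence, trace, fderiv_add (hv x) (hw x), Finset.sum_add_distrib]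

lemma divergence_smul {v : Euc d → Euc d} (hv : Differentiable ℝ v) (c : ℝ) :
    divergence (c • v) = c • divergence v := by
  ext x
  simp [divergence, trace, fderiv_const_smul (hv x), Finset.mul_sum]

lemma divergence_smul_id {q : Euc d → ℝ} {x : Euc d} (hq : DifferentiableAt ℝ q x) (c : Euc d) :
    divergence (fun y => q y • (y - c)) x =
      d * q x + ∑ i, (x - c) i * fderiv ℝ q x (basisVec i) := by
  have h : HasFDerivAt (fun y => q y • (y - c)) _ x :=
    hq.hasFDerivAt.smul ((hasFDerivAt_id x).sub_const c)
  rw [divergence, trace, h.fderiv]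
  simp [Finset.sum_add_distrib, basisVec, mul_comm]

/-! #### Raviart--Thomas--Nédélec fields -/

lemma rtn_le_vec : rtn d l ≤ vec (poly d l) := by
  rintro _ ⟨p, hp, q, hq, rfl⟩ i
  refine add_mem (poly_mono (by omega) (hp i)) ?_
  simpa using mul_mem_poly hq (coord_mem_poly i)

lemma vec_le_rtn : vec (poly d (l - 1)) ≤ rtn d l := fun p hp =>
  ⟨p, hp, 0, zero_mem _, by simp⟩

instance : FiniteDimensional ℝ (rtn d l) := Submodule.finiteDimensional_of_le rtn_le_vec

/-- The map `(p, q) ↦ p + q x`. -/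
noncomputable def rtnLin (d : ℕ) (l : ℤ) :
    (vec (poly d (l - 1)) × poly d (l - 1)) →ₗ[ℝ] (Euc d → Euc d) where
  toFun pq := fun x => pq.1.1 x + pq.2.1 x • x
  map_add' a b := by ext x i; simp; ring
  map_smul' c a := by ext x i; simp; ring

/-- The kernel of `(p, q) ↦ p + q x` consists of pairs with `q` of lower degree. -/
lemma finrank_rtn_ge (hd : 0 < d) :
    d * Module.finrank ℝ (poly d (l - 1)) + Module.finrank ℝ (poly d (l - 1)) ≤
      Module.finrank ℝ (rtn d l) + Module.finrank ℝ (poly d (l - 1 - 1)) := by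
  have hr : LinearMap.range (rtnLin d l) ≤ rtn d l := by
    rintro _ ⟨⟨p, q⟩, rfl⟩
    exact ⟨p, p.2, q, q.2, rfl⟩
  have h1 := Submodule.finrank_mono hr
  have h2 := (rtnLin d l).finrank_range_add_finrank_ker
  rw [Module.finrank_prod, finrank_vec] at h2
  -- On the kernel, `q x` has the degree of `p`, and therefore `q` is of lower degree.
  have hq : ∀ z ∈ LinearMap.ker (rtnLin d l), z.2.1 ∈ poly d (l - 1 - 1) := by
    rintro ⟨p, q⟩ hz
    refine mem_poly_of_coord_mul ⟨0, hd⟩ q.2 ?_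
    have : (fun x : Euc d => x ⟨0, hd⟩ * q.1 x) = -fun x => p.1 x ⟨0, hd⟩ := by
      ext x
      have := congrArg (fun v : Euc d => v ⟨0, hd⟩) (congrFun (LinearMap.mem_ker.1 hz) x)
      simp only [rtnLin, LinearMap.coe_mk, AddHom.coe_mk, PiLp.add_apply, PiLp.smul_apply,
        smul_eq_mul, Pi.zero_apply, PiLp.zero_apply] at this
      simp only [Pi.neg_apply]
      linarith
    rw [this]
    exact neg_mem (p.2 _)
  let ψ : LinearMap.ker (rtnLin d l) →ₗ[ℝ] poly d (l - 1 - 1) :=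
    { toFun := fun z => ⟨z.1.2.1, hq z z.2⟩
      map_add' := fun _ _ => rfl
      map_smul' := fun _ _ => rfl }
  have hψ : Function.Injective ψ := by
    rintro ⟨⟨p, q⟩, hz⟩ ⟨⟨p', q'⟩, hz'⟩ h
    have h0 := congrArg Subtype.val h
    have hqq : q = q' := Subtype.ext h0
    subst hqq
    have hpp : p = p' := by
      ext x : 2
      have h1 := congrFun (LinearMap.mem_ker.1 hz) x
      have h2 := congrFun (LinearMap.mem_ker.1 hz') x
      exact add_right_cancel (h1.trans h2.symm)
    subst hpp
    rfl
  have h3 := LinearMap.finrank_le_finrank_of_injective hψ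
  omega

lemma rtn_homothety {w : Euc d → Euc d} (hw : w ∈ rtn d l) (c : Euc d) (h : ℝ) :
    (fun y => w (c + h • y)) ∈ rtn d l := by
  have hA : ∀ i, (fun y : Euc d => (c + h • y) i) ∈ poly d 1 := fun i =>
    add_mem (const_mem_poly (c i) zero_le_one) (Submodule.smul_mem _ h (coord_mem_poly i))
  obtain ⟨p, hp, q, hq, rfl⟩ := hw
  refine ⟨fun y => p (c + h • y) + q (c + h • y) • c,
    fun i => add_mem (comp_mem_poly hA (hp i)) ?_, h • fun y => q (c + h • y),
    Submodule.smul_mem _ _ (comp_mem_poly hA hq), ?_⟩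
  · convert Submodule.smul_mem _ (c i) (comp_mem_poly hA hq) using 1
    ext y; simp [mul_comm]
  · ext y i; simp; ring

lemma mem_vec_of_divergence_eq_zero (hd : 0 < d) {w : Euc d → Euc d} (hw : w ∈ rtn d l)
    (h : divergence w = 0) : w ∈ vec (poly d (l - 1)) := by
  obtain ⟨p, hp, q, hq, rfl⟩ := hw
  have hqd := differentiable_of_mem_poly hq
  have h1 : (fun x => d * q x + ∑ i, x i * fderiv ℝ q x (basisVec i)) ∈ poly d (l - 1 - 1) := by
    have e : (fun x => d * q x + ∑ i, x i * fderiv ℝ q x (basisVec i)) = -divergence p := by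
      ext x
      have hqx : Differentiable ℝ fun x : Euc d => q x • x := hqd.smul differentiable_id
      have h2 := congrFun (divergence_add (differentiable_of_mem_vec hp) hqx) x
      have h3 := divergence_smul_id (hqd x) 0
      simp only [sub_zero] at h3
      have h4 : divergence (p + fun x => q x • x) x = 0 := congrFun h x
      rw [h4, Pi.add_apply, h3] at h2
      rw [Pi.neg_apply]
      linarith
    rw [e]
    exact neg_mem (divergence_mem_poly hp)
  have h5 := mem_poly_of_euler hd hq h1
  intro i
  refine add_mem (hp i) ?_
  have := mul_mem_poly h5 (coord_mem_poly i)
  rw [sub_add_cancel] at this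
  simpa using this

/-- On a hyperplane orthogonal to `n`, the normal component of an RTN field drops one degree. -/
lemma exists_normal_poly {w : Euc d → Euc d} (hw : w ∈ rtn d l) (n : Euc d) (c : ℝ) :
    ∃ g ∈ poly d (l - 1), ∀ x, ⟪x, n⟫ = c → ⟪w x, n⟫ = g x := by
  obtain ⟨p, hp, q, hq, rfl⟩ := hw
  refine ⟨(fun x => ⟪p x, n⟫) + c • q, add_mem (inner_mem_poly hp n) (Submodule.smul_mem _ _ hq),
    fun x hx => ?_⟩
  simp [inner_add_left, inner_smul_left, hx, mul_comm]

/-! #### Polynomials on faces -/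

/-- Restriction to a set, as a linear map. -/
noncomputable def indicatorLin (S : Set (Euc d)) : (Euc d → ℝ) →ₗ[ℝ] (Euc d → ℝ) where
  toFun p := S.indicator p
  map_add' p q := Set.indicator_add' _ _ _
  map_smul' c p := Set.indicator_const_smul S c p

lemma facePoly_eq_map (F : Finset (Euc d)) :
    facePoly l F = (poly d l).map (indicatorLin (hull F)) := by
  ext f
  simp only [Submodule.mem_map]
  exact exists_congr fun p => and_congr_right fun _ => eq_comm

instance (F : Finset (Euc d)) : FiniteDimensional ℝ (facePoly l F) := by
  rw [facePoly_eq_map]; infer_instance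

lemma indicator_mem_facePoly {F : Finset (Euc d)} {p : Euc d → ℝ} (hp : p ∈ poly d l) :
    (hull F).indicator p ∈ facePoly l F := ⟨p, hp, rfl⟩

lemma finrank_facePoly_le {F : Finset (Euc d)} {lam : Euc d → ℝ} (hlam : lam ∈ poly d 1)
    (h0 : lam ≠ 0) (hF : ∀ x ∈ hull F, lam x = 0) :
    Module.finrank ℝ (facePoly l F) + Module.finrank ℝ (poly d (l - 1)) ≤
      Module.finrank ℝ (poly d l) := by
  let ρ : poly d l →ₗ[ℝ] (Euc d → ℝ) := indicatorLin (hull F) ∘ₗ (poly d l).subtype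
  have hρ : LinearMap.range ρ = facePoly l F := by
    rw [facePoly_eq_map, LinearMap.range_comp, Submodule.range_subtype]
  have h1 := ρ.finrank_range_add_finrank_ker
  rw [hρ] at h1
  have hm : ∀ r ∈ poly d (l - 1), (fun x => lam x * r x) ∈ poly d l := fun r hr => by
    simpa using mul_mem_poly hlam hr
  let ψ : poly d (l - 1) →ₗ[ℝ] LinearMap.ker ρ :=
    { toFun := fun r => ⟨⟨fun x => lam x * r.1 x, hm r r.2⟩, by
        refine LinearMap.mem_ker.2 (funext fun x => ?_)
        by_cases hx : x ∈ hull F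
        · simp [ρ, indicatorLin, hx, hF x hx]
        · simp [ρ, indicatorLin, hx]⟩
      map_add' := fun a b => by ext x; simp [mul_add]
      map_smul' := fun a b => by ext x; simp; ring }
  have hψ : Function.Injective ψ := by
    refine (injective_iff_map_eq_zero ψ).2 fun r h => ?_
    have h' : ∀ x, lam x * r.1 x = 0 := fun x =>
      congrFun (congrArg (fun z => z.1.1) h) x
    exact Subtype.ext ((mul_eq_zero_of_mem_poly hlam r.2 h').resolve_left h0)
  have h3 := LinearMap.finrank_le_finrank_of_injective hψ
  omega

end VecPoly


/-! ### Fubini's theorem in oblique directions with respect to a hyperplane -/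

section Hyperplane

variable {d : ℕ} {n v x₀ : Euc d}

/-- The hyperplane through `x₀` orthogonal to `n`. -/
def plane (n x₀ : Euc d) : Set (Euc d) := {x | ⟪n, x - x₀⟫ = 0}

/-- Surface measure on a hyperplane. -/
noncomputable def planeMeas (n x₀ : Euc d) : Measure (Euc d) := (μHE[d - 1]).restrict (plane n x₀)

lemma measurableSet_plane : MeasurableSet (plane n x₀) :=
  (isClosed_eq (by fun_prop) continuous_const).measurableSet

lemma isometry_add_coe (x₀ : Euc d) (N : Submodule ℝ (Euc d)) :
    Isometry fun y : N => x₀ + (y : Euc d) :=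
  (isometry_add_left x₀).comp isometry_subtype_coe

lemma planeMeas_eq_map (hn : ‖n‖ = 1) :
    planeMeas n x₀ = (volume : Measure (ℝ ∙ n)ᗮ).map fun y : (ℝ ∙ n)ᗮ => x₀ + (y : Euc d) := by
  have hn0 : n ≠ 0 := by rintro rfl; simp at hn
  have hfr : Module.finrank ℝ (ℝ ∙ n)ᗮ = d - 1 := by
    have h := (ℝ ∙ n).finrank_add_finrank_orthogonal
    rw [finrank_span_singleton hn0, finrank_euclideanSpace_fin] at h
    omega
  have hrange : range (fun y : (ℝ ∙ n)ᗮ => x₀ + (y : Euc d)) = plane n x₀ := by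
    ext x
    constructor
    · rintro ⟨y, rfl⟩
      have := Submodule.mem_orthogonal_singleton_iff_inner_right.1 y.2
      simpa [plane] using this
    · intro hx
      exact ⟨⟨x - x₀, Submodule.mem_orthogonal_singleton_iff_inner_right.2 hx⟩, by simp⟩
  rw [planeMeas, ← hrange, ← (isometry_add_coe x₀ _).map_euclideanHausdorffMeasure, ← hfr,
    InnerProductSpace.euclideanHausdorffMeasure_eq_volume]

lemma measurableEmbedding_add_coe (x₀ : Euc d) (N : Submodule ℝ (Euc d)) :
    MeasurableEmbedding fun y : N => x₀ + (y : Euc d) :=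
  (isometry_add_coe x₀ N).isClosedEmbedding.measurableEmbedding

lemma planeMeas_isBounded_lt_top (hn : ‖n‖ = 1) {S : Set (Euc d)} (hS : Bornology.IsBounded S) :
    planeMeas n x₀ S < ⊤ := by
  rw [planeMeas_eq_map hn, (measurableEmbedding_add_coe x₀ _).map_apply]
  exact ((isometry_add_coe x₀ _).antilipschitz.isBounded_preimage hS).measure_lt_top

/-- The map `(t, y) ↦ x₀ + y + t v`, where `y ⊥ n`. -/
def oblique (n x₀ v : Euc d) (z : ℝ × (ℝ ∙ n)ᗮ) : Euc d := x₀ + (z.2 : Euc d) + z.1 • v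

lemma continuous_oblique : Continuous (oblique n x₀ v) := by
  unfold oblique; fun_prop

lemma map_oblique_normal (hn : ‖n‖ = 1) :
    (volume : Measure (ℝ × (ℝ ∙ n)ᗮ)).map (oblique n x₀ n) = volume := by
  let s : Submodule ℝ (Euc d) := ℝ ∙ n
  have h1 := (s.measurePreserving_measurableEquivProd x₀).symm
  have h2 := (LinearIsometryEquiv.toSpanUnitSingleton (𝕜 := ℝ) n hn).measurePreserving
  have h3 : MeasurePreserving
      (Prod.map (LinearIsometryEquiv.toSpanUnitSingleton (𝕜 := ℝ) n hn) (id : sᗮ → sᗮ)) :=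
    h2.prod (MeasurePreserving.id _)
  have h4 := h1.comp h3
  have hv : (μHE[Module.finrank ℝ (Euc d)] : Measure (Euc d)) = volume :=
    InnerProductSpace.euclideanHausdorffMeasure_eq_volume
  rw [hv] at h4
  have e : oblique n x₀ n = (s.measurableEquivProd x₀).symm ∘
      Prod.map (LinearIsometryEquiv.toSpanUnitSingleton (𝕜 := ℝ) n hn) (id : sᗮ → sᗮ) := by
    funext z
    rw [Function.comp_apply, Submodule.measurableEquivProd_symm_apply]
    simp only [Prod.map, oblique, id, LinearIsometryEquiv.toSpanUnitSingleton_apply, vadd_eq_add]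
    abel
  rw [e]
  exact h4.map_eq

/-- The oblique parametrization multiplies volumes by `1 / |n · v|`. -/
lemma map_oblique (hn : ‖n‖ = 1) (hv : ⟪n, v⟫ ≠ 0) :
    ENNReal.ofReal |⟪n, v⟫| • (volume : Measure (ℝ × (ℝ ∙ n)ᗮ)).map (oblique n x₀ v) = volume := by
  set α := ⟪n, v⟫ with hα
  have hw : v - α • n ∈ (ℝ ∙ n)ᗮ := by
    rw [Submodule.mem_orthogonal_singleton_iff_inner_right, inner_sub_right, inner_smul_right,
      real_inner_self_eq_norm_sq, hn, ← hα]
    ring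
  let w : (ℝ ∙ n)ᗮ := ⟨v - α • n, hw⟩
  ext A hA
  rw [Measure.smul_apply, smul_eq_mul, ← map_oblique_normal (x₀ := x₀) hn,
    Measure.map_apply continuous_oblique.measurable hA,
    Measure.map_apply continuous_oblique.measurable hA, Measure.volume_eq_prod,
    Measure.prod_apply (continuous_oblique.measurable hA),
    Measure.prod_apply (continuous_oblique.measurable hA)]
  have h1 : ∀ t : ℝ, volume (Prod.mk t ⁻¹' (oblique n x₀ v ⁻¹' A)) =
      volume (Prod.mk (α * t) ⁻¹' (oblique n x₀ n ⁻¹' A)) := by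
    intro t
    rw [← measure_preimage_add_right volume (t • w) (Prod.mk (α * t) ⁻¹' (oblique n x₀ n ⁻¹' A))]
    congr 1
    ext y
    have : oblique n x₀ v (t, y) = oblique n x₀ n (α * t, y + t • w) := by
      simp only [oblique, w, Submodule.coe_add, Submodule.coe_smul, smul_sub, smul_smul]
      rw [mul_comm t α]
      abel
    simp only [mem_preimage, this]
  simp_rw [h1]
  have hm : Measurable fun t : ℝ => volume (Prod.mk t ⁻¹' (oblique n x₀ n ⁻¹' A)) :=
    measurable_measure_prodMk_left (continuous_oblique.measurable hA)
  have h2 := Real.smul_map_volume_mul_left hv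
  conv_rhs => rw [← h2, lintegral_smul_measure, lintegral_map hm (measurable_const_mul α)]
  rw [smul_eq_mul]

lemma integral_planeMeas (hn : ‖n‖ = 1) (f : Euc d → ℝ) :
    ∫ y, f y ∂(planeMeas n x₀) = ∫ y : (ℝ ∙ n)ᗮ, f (x₀ + y) := by
  rw [planeMeas_eq_map hn, (measurableEmbedding_add_coe x₀ _).integral_map]

/-- Oblique Fubini formula. -/
lemma integral_eq_oblique (hn : ‖n‖ = 1) (hv : ⟪n, v⟫ ≠ 0) {g : Euc d → ℝ} (hg : Integrable g) :
    ∫ x, g x = |⟪n, v⟫| * ∫ y, (∫ t : ℝ, g (y + t • v)) ∂(planeMeas n x₀) := by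
  have hm := map_oblique (x₀ := x₀) hn hv
  have hc0 : ENNReal.ofReal |⟪n, v⟫| ≠ 0 := by simpa using hv
  have hint : Integrable (fun z => g (oblique n x₀ v z)) := by
    rw [← hm] at hg
    have h1 : Integrable g ((volume : Measure (ℝ × (ℝ ∙ n)ᗮ)).map (oblique n x₀ v)) :=
      (integrable_smul_measure hc0 ENNReal.ofReal_ne_top).1 hg
    exact (integrable_map_measure h1.aestronglyMeasurable
      continuous_oblique.measurable.aemeasurable).1 h1
  have hsm : AEStronglyMeasurable g ((volume : Measure (ℝ × (ℝ ∙ n)ᗮ)).map (oblique n x₀ v)) := by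
    rw [← hm] at hg
    exact ((integrable_smul_measure hc0 ENNReal.ofReal_ne_top).1 hg).aestronglyMeasurable
  conv_lhs => rw [← hm, integral_smul_measure, integral_map
    continuous_oblique.measurable.aemeasurable hsm]
  rw [ENNReal.toReal_ofReal (abs_nonneg _), smul_eq_mul]
  congr 1
  rw [integral_planeMeas hn (fun y => ∫ t : ℝ, g (y + t • v))]
  exact integral_prod_symm _ hint

end Hyperplane


/-! ### Simplices: barycentric coordinates, normals, heights -/

section Simplex

variable {d : ℕ} {T : Finset (Euc d)} {a b : Euc d}

/-- `T` is the set of vertices of a nondegenerate `d`-simplex. -/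
structure IsSimplex (T : Finset (Euc d)) : Prop where
  indep : AffineIndependent ℝ ((↑) : T → Euc d)
  card : T.card = d + 1

lemma IsSimplex.span_eq_top (hT : IsSimplex T) :
    affineSpan ℝ (range ((↑) : T → Euc d)) = ⊤ := by
  rw [hT.indep.affineSpan_eq_top_iff_card_eq_finrank_add_one]
  simp [hT.card]

/-- The vertices of a simplex as an affine basis. -/
noncomputable def IsSimplex.basis (hT : IsSimplex T) : AffineBasis T ℝ (Euc d) :=
  ⟨(↑), hT.indep, hT.span_eq_top⟩

open Classical in
/-- The barycentric coordinate of the simplex `T` associated with the vertex `a`. -/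
noncomputable def bary (T : Finset (Euc d)) (a : Euc d) : Euc d →ᵃ[ℝ] ℝ :=
  if h : IsSimplex T ∧ a ∈ T then h.1.basis.coord ⟨a, h.2⟩ else 0

lemma IsSimplex.bary_eq (hT : IsSimplex T) (ha : a ∈ T) :
    bary T a = hT.basis.coord ⟨a, ha⟩ := by
  rw [bary, dif_pos ⟨hT, ha⟩]

lemma IsSimplex.bary_self (hT : IsSimplex T) (ha : a ∈ T) : bary T a a = 1 := by
  rw [hT.bary_eq ha]
  exact hT.basis.coord_apply_eq ⟨a, ha⟩

lemma IsSimplex.bary_ne (hT : IsSimplex T) (ha : a ∈ T) (hb : b ∈ T) (hab : a ≠ b) :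
    bary T a b = 0 := by
  rw [hT.bary_eq ha]
  exact hT.basis.coord_apply_ne (i := ⟨a, ha⟩) (j := ⟨b, hb⟩) (by simpa using hab)

lemma IsSimplex.sum_bary (hT : IsSimplex T) (x : Euc d) : ∑ a ∈ T, bary T a x = 1 := by
  rw [← hT.basis.sum_coord_apply_eq_one x, ← Finset.sum_coe_sort]
  exact Finset.sum_congr rfl fun a _ => by rw [hT.bary_eq a.2]

lemma IsSimplex.sum_bary_smul (hT : IsSimplex T) (x : Euc d) : ∑ a ∈ T, bary T a x • a = x := by
  conv_rhs => rw [← hT.basis.linear_combination_coord_eq_self x]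
  rw [← Finset.sum_coe_sort]
  exact Finset.sum_congr rfl fun a _ => by rw [hT.bary_eq a.2]; rfl

lemma IsSimplex.range_basis (hT : IsSimplex T) : range hT.basis = (T : Set (Euc d)) := by
  change range ((↑) : T → Euc d) = _
  simp

lemma IsSimplex.mem_hull_iff (hT : IsSimplex T) {x : Euc d} :
    x ∈ hull T ↔ ∀ a ∈ T, 0 ≤ bary T a x := by
  have h := hT.basis.convexHull_eq_nonneg_coord
  rw [hT.range_basis] at h
  rw [hull, h]
  refine ⟨fun hx a ha => ?_, fun hx i => ?_⟩
  · rw [hT.bary_eq ha]; exact hx ⟨a, ha⟩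
  · have := hx i i.2
    rwa [hT.bary_eq i.2] at this

lemma IsSimplex.mem_interior_iff (hT : IsSimplex T) {x : Euc d} :
    x ∈ interior (hull T) ↔ ∀ a ∈ T, 0 < bary T a x := by
  have h := hT.basis.interior_convexHull
  rw [hT.range_basis] at h
  rw [hull, h]
  refine ⟨fun hx a ha => ?_, fun hx i => ?_⟩
  · rw [hT.bary_eq ha]; exact hx ⟨a, ha⟩
  · have := hx i i.2
    rwa [hT.bary_eq i.2] at this

lemma continuous_bary : Continuous (bary T a) := (bary T a).continuous_of_finiteDimensional

lemma bary_add_smul (x v : Euc d) (t : ℝ) :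
    bary T a (x + t • v) = bary T a x + t * (bary T a).linear v := by
  have := (bary T a).map_vadd x (t • v)
  rw [vadd_eq_add, vadd_eq_add, map_smul, smul_eq_mul] at this
  rw [add_comm x, this, add_comm]

lemma bary_linear_sub (x y : Euc d) : (bary T a).linear (x - y) = bary T a x - bary T a y := by
  have := (bary T a).linearMap_vsub x y
  simpa using this

lemma IsSimplex.card_pos (hT : IsSimplex T) : T.Nonempty := by
  rw [← Finset.card_pos, hT.card]; omega

lemma hull_mono {S : Finset (Euc d)} (h : S ⊆ T) : hull S ⊆ hull T :=
  convexHull_mono (by exact_mod_cast h)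

lemma isCompact_hull : IsCompact (hull T) := T.finite_toSet.isCompact_convexHull ℝ

lemma isBounded_hull : Bornology.IsBounded (hull T) := isCompact_hull.isBounded

lemma convex_hull : Convex ℝ (hull T) := convex_convexHull ℝ _

lemma mem_hull (ha : a ∈ T) : a ∈ hull T := subset_convexHull ℝ _ (by exact_mod_cast ha)

lemma IsSimplex.mem_hull_erase_iff (hT : IsSimplex T) (ha : a ∈ T) {x : Euc d} :
    x ∈ hull (T.erase a) ↔ x ∈ hull T ∧ bary T a x = 0 := by
  constructor
  · intro hx
    refine ⟨hull_mono (Finset.erase_subset _ _) hx, ?_⟩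
    have hconv : Convex ℝ {y | bary T a y = 0} := by
      have : {y | bary T a y = 0} = bary T a ⁻¹' {0} := rfl
      rw [this]
      exact (convex_singleton (𝕜 := ℝ) (0 : ℝ)).affine_preimage _
    refine convexHull_min (fun b hb => ?_) hconv hx
    have hb' := Finset.mem_erase.1 (Finset.mem_coe.1 hb)
    exact hT.bary_ne ha hb'.2 (Ne.symm hb'.1)
  · rintro ⟨hx, h0⟩
    have h1 := hT.sum_bary x
    have h2 := hT.sum_bary_smul x
    rw [← Finset.sum_erase T (a := a) (by rw [h0])] at h1
    rw [← Finset.sum_erase T (a := a) (by rw [h0, zero_smul])] at h2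
    rw [← h2]
    exact (convex_convexHull ℝ _).sum_mem
      (fun b hb => hT.mem_hull_iff.1 hx b (Finset.mem_of_mem_erase hb)) h1
      fun b hb => mem_hull hb

lemma IsSimplex.bary_le_one (hT : IsSimplex T) (ha : a ∈ T) {x : Euc d} (hx : x ∈ hull T) :
    bary T a x ≤ 1 := by
  rw [← hT.sum_bary x]
  exact Finset.single_le_sum (f := fun a => bary T a x) (hT.mem_hull_iff.1 hx) ha

lemma IsSimplex.mem_facesOf_iff (hT : IsSimplex T) {F : Finset (Euc d)} :
    F ∈ facesOf T ↔ ∃ a ∈ T, F = T.erase a := by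
  rw [facesOf, Finset.mem_powersetCard]
  constructor
  · rintro ⟨hF, hc⟩
    obtain ⟨a, ha⟩ : (T \ F).Nonempty := by
      rw [← Finset.card_pos, Finset.card_sdiff_of_subset hF, hT.card, hc]; omega
    rw [Finset.mem_sdiff] at ha
    refine ⟨a, ha.1, Finset.eq_of_subset_of_card_le (fun x hx => ?_) ?_⟩
    · exact Finset.mem_erase.2 ⟨fun h => ha.2 (h ▸ hx), hF hx⟩
    · rw [Finset.card_erase_of_mem ha.1, hT.card, hc]; omega
  · rintro ⟨a, ha, rfl⟩
    exact ⟨Finset.erase_subset _ _, by rw [Finset.card_erase_of_mem ha, hT.card]; omega⟩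

lemma IsSimplex.erase_mem_facesOf (hT : IsSimplex T) (ha : a ∈ T) : T.erase a ∈ facesOf T :=
  hT.mem_facesOf_iff.2 ⟨a, ha, rfl⟩

lemma IsSimplex.sum_facesOf {M : Type*} [AddCommMonoid M] (hT : IsSimplex T)
    (f : Finset (Euc d) → M) : ∑ F ∈ facesOf T, f F = ∑ a ∈ T, f (T.erase a) := by
  have h : facesOf T = T.image T.erase := by
    ext F; rw [hT.mem_facesOf_iff]; simp [eq_comm]
  rw [h, Finset.sum_image]
  intro x hx y hy hxy
  by_contra hne
  have : x ∈ T.erase y := Finset.mem_erase.2 ⟨hne, hx⟩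
  rw [← (hxy : T.erase x = T.erase y)] at this
  exact (Finset.notMem_erase x T) this

lemma IsSimplex.card_facesOf (hT : IsSimplex T) : (facesOf T).card = d + 1 := by
  rw [facesOf, Finset.card_powersetCard, hT.card, Nat.choose_succ_self_right]

lemma IsSimplex.exists_ne (hd : 0 < d) (hT : IsSimplex T) (a : Euc d) : ∃ b ∈ T, b ≠ a := by
  obtain ⟨b, hb⟩ : (T.erase a).Nonempty := by
    rw [← Finset.card_pos]
    have := Finset.pred_card_le_card_erase (s := T) (a := a)
    rw [hT.card] at this
    omega
  exact ⟨b, Finset.mem_of_mem_erase hb, Finset.ne_of_mem_erase hb⟩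

lemma IsSimplex.exists_normal (hd : 0 < d) (hT : IsSimplex T) (ha : a ∈ T) :
    ∃ n : Euc d, ‖n‖ = 1 ∧ (∀ x ∈ T.erase a, ∀ y ∈ T.erase a, ⟪n, x - y⟫ = 0) ∧
      ∀ x ∈ T.erase a, ∀ a' ∈ T, a' ∉ T.erase a → ⟪n, a' - x⟫ < 0 := by
  let L : Euc d →L[ℝ] ℝ := LinearMap.toContinuousLinearMap (bary T a).linear
  let g : Euc d := (InnerProductSpace.toDual ℝ (Euc d)).symm L
  have hg : ∀ x y, ⟪g, x - y⟫ = bary T a x - bary T a y := fun x y => by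
    rw [InnerProductSpace.toDual_symm_apply]
    exact bary_linear_sub x y
  have hg0 : g ≠ 0 := by
    intro h0
    obtain ⟨b, hb, hba⟩ := hT.exists_ne hd a
    have := hg a b
    rw [hT.bary_self ha, hT.bary_ne ha hb hba.symm, h0, inner_zero_left] at this
    norm_num at this
  have hpos : 0 < ‖g‖⁻¹ := inv_pos.2 (norm_pos_iff.2 hg0)
  have hz : ∀ x ∈ T.erase a, bary T a x = 0 := fun x hx =>
    hT.bary_ne ha (Finset.mem_of_mem_erase hx) (Finset.ne_of_mem_erase hx).symm
  refine ⟨(-‖g‖⁻¹) • g, ?_, fun x hx y hy => ?_, fun x hx a' ha' hn => ?_⟩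
  · rw [norm_smul, norm_neg, Real.norm_of_nonneg hpos.le, inv_mul_cancel₀ (norm_ne_zero_iff.2 hg0)]
  · rw [real_inner_smul_left, hg, hz x hx, hz y hy, sub_zero, mul_zero]
  · have : a' = a := by
      by_contra h; exact hn (Finset.mem_erase.2 ⟨h, ha'⟩)
    rw [this, real_inner_smul_left, hg, hT.bary_self ha, hz x hx]
    linarith

lemma IsSimplex.normal_spec (hd : 0 < d) (hT : IsSimplex T) (ha : a ∈ T) :
    ‖normal T (T.erase a)‖ = 1 ∧
      (∀ x ∈ T.erase a, ∀ y ∈ T.erase a, ⟪normal T (T.erase a), x - y⟫ = 0) ∧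
      ∀ x ∈ T.erase a, ∀ a' ∈ T, a' ∉ T.erase a → ⟪normal T (T.erase a), a' - x⟫ < 0 :=
  Classical.epsilon_spec (hT.exists_normal hd ha)

/-- The height of the simplex `T` over the face opposite to the vertex `a`, characterized by the
proportionality of the normal and of the gradient of the barycentric coordinate. -/
noncomputable def height (T : Finset (Euc d)) (a : Euc d) : ℝ :=
  Classical.epsilon fun H => 0 < H ∧
    ∀ x y, ⟪normal T (T.erase a), x - y⟫ = -(H * (bary T a x - bary T a y))

lemma IsSimplex.height_spec (hd : 0 < d) (hT : IsSimplex T) (ha : a ∈ T) : 0 < height T a ∧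
    ∀ x y, ⟪normal T (T.erase a), x - y⟫ = -(height T a * (bary T a x - bary T a y)) := by
  refine Classical.epsilon_spec (p := fun H => 0 < H ∧
    ∀ x y, ⟪normal T (T.erase a), x - y⟫ = -(H * (bary T a x - bary T a y))) ?_
  obtain ⟨-, h2, h3⟩ := hT.normal_spec hd ha
  obtain ⟨b, hb, hba⟩ := hT.exists_ne hd a
  have hbF : b ∈ T.erase a := Finset.mem_erase.2 ⟨hba, hb⟩
  refine ⟨-⟪normal T (T.erase a), a - b⟫, neg_pos.2 (h3 b hbF a ha (Finset.notMem_erase _ _)),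
    fun x y => ?_⟩
  have hexp : x - y = ∑ c ∈ T, (bary T c x - bary T c y) • (c - b) := by
    simp only [smul_sub, sub_smul, Finset.sum_sub_distrib, ← Finset.sum_smul, hT.sum_bary,
      hT.sum_bary_smul]
    abel
  rw [hexp, inner_sum, Finset.sum_eq_single a]
  · rw [real_inner_smul_right]; ring
  · intro c hc hca
    rw [real_inner_smul_right, h2 c (Finset.mem_erase.2 ⟨hca, hc⟩) b hbF, mul_zero]
  · exact fun h => absurd ha h

lemma IsSimplex.height_pos (hd : 0 < d) (hT : IsSimplex T) (ha : a ∈ T) : 0 < height T a :=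
  (hT.height_spec hd ha).1

lemma IsSimplex.norm_normal (hd : 0 < d) (hT : IsSimplex T) (ha : a ∈ T) :
    ‖normal T (T.erase a)‖ = 1 := (hT.normal_spec hd ha).1

lemma IsSimplex.inner_normal (hd : 0 < d) (hT : IsSimplex T) (ha : a ∈ T) (v : Euc d) :
    ⟪normal T (T.erase a), v⟫ = -(height T a * (bary T a).linear v) := by
  have := (hT.height_spec hd ha).2 v 0
  rwa [sub_zero, ← bary_linear_sub, sub_zero] at this

lemma IsSimplex.inner_normal_face (hd : 0 < d) (hT : IsSimplex T) (ha : a ∈ T) {x y : Euc d}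
    (hx : x ∈ hull (T.erase a)) (hy : y ∈ hull (T.erase a)) :
    ⟪x, normal T (T.erase a)⟫ = ⟪y, normal T (T.erase a)⟫ := by
  have := (hT.height_spec hd ha).2 x y
  rw [((hT.mem_hull_erase_iff ha).1 hx).2, ((hT.mem_hull_erase_iff ha).1 hy).2, inner_sub_right]
    at this
  rw [real_inner_comm, real_inner_comm _ y]
  linarith

lemma IsSimplex.height_le_diam (hd : 0 < d) (hT : IsSimplex T) (ha : a ∈ T) :
    height T a ≤ diam T := by
  obtain ⟨b, hb, hba⟩ := hT.exists_ne hd a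
  have h := (hT.height_spec hd ha).2 a b
  rw [hT.bary_self ha, hT.bary_ne ha hb hba.symm] at h
  have h1 := abs_real_inner_le_norm (normal T (T.erase a)) (a - b)
  rw [h, hT.norm_normal hd ha, one_mul, abs_neg, sub_zero, mul_one,
    abs_of_pos (hT.height_pos hd ha), ← dist_eq_norm] at h1
  exact h1.trans (Metric.dist_le_diam_of_mem isBounded_hull (mem_hull ha) (mem_hull hb))

lemma IsSimplex.diam_pos (hd : 0 < d) (hT : IsSimplex T) : 0 < diam T := by
  obtain ⟨a, ha⟩ := hT.card_pos
  exact (hT.height_pos hd ha).trans_le (hT.height_le_diam hd ha)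

/-- Barycentric coordinates are bounded from below at a distance from the boundary. -/
lemma IsSimplex.le_bary_of_closedBall (hd : 0 < d) (hT : IsSimplex T) (ha : a ∈ T) {x : Euc d}
    {r : ℝ} (hr : 0 ≤ r) (hx : Metric.closedBall x r ⊆ hull T) :
    r / height T a ≤ bary T a x := by
  have hH := hT.height_pos hd ha
  have hn := hT.norm_normal hd ha
  have hmem : x + r • normal T (T.erase a) ∈ hull T := hx (by
    rw [Metric.mem_closedBall, dist_eq_norm, add_sub_cancel_left, norm_smul, hn, mul_one,
      Real.norm_of_nonneg hr])
  have h1 := hT.mem_hull_iff.1 hmem a ha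
  have h2 := (hT.height_spec hd ha).2 (x + r • normal T (T.erase a)) x
  rw [add_sub_cancel_left, real_inner_smul_right, real_inner_self_eq_norm_sq, hn] at h2
  rw [div_le_iff₀ hH]
  nlinarith

lemma IsSimplex.le_height (hd : 0 < d) (hT : IsSimplex T) (ha : a ∈ T) {c : Euc d}
    {r : ℝ} (hr : 0 ≤ r) (hc : Metric.closedBall c r ⊆ hull T) : r ≤ height T a := by
  have h1 := hT.le_bary_of_closedBall hd ha hr hc
  have h2 := hT.bary_le_one ha (hc (Metric.mem_closedBall_self hr))
  have := h1.trans h2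
  rwa [div_le_one (hT.height_pos hd ha)] at this

end Simplex


/-! ### Integration on simplices and on their faces; the divergence theorem -/

section Divergence

variable {d : ℕ} {T F : Finset (Euc d)} {a b : Euc d}

lemma measurableSet_hull : MeasurableSet (hull T) := isCompact_hull.measurableSet

instance : IsFiniteMeasure (cellMeas T) := ⟨by
  rw [cellMeas, Measure.restrict_apply_univ]; exact isCompact_hull.measure_lt_top⟩

lemma IsSimplex.hull_erase_subset_plane (hd : 0 < d) (hT : IsSimplex T) (ha : a ∈ T)
    (hb : b ∈ T.erase a) : hull (T.erase a) ⊆ plane (normal T (T.erase a)) b := fun x hx => by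
  have h := (hT.height_spec hd ha).2 x b
  rw [((hT.mem_hull_erase_iff ha).1 hx).2,
    hT.bary_ne ha (Finset.mem_of_mem_erase hb) (Finset.ne_of_mem_erase hb).symm] at h
  rw [plane, mem_ofPred_eq, h]
  ring

lemma IsSimplex.bary_eq_zero_of_mem_plane (hd : 0 < d) (hT : IsSimplex T) (ha : a ∈ T)
    (hb : b ∈ T.erase a) {x : Euc d} (hx : x ∈ plane (normal T (T.erase a)) b) :
    bary T a x = 0 := by
  have h := (hT.height_spec hd ha).2 x b
  rw [hx, hT.bary_ne ha (Finset.mem_of_mem_erase hb) (Finset.ne_of_mem_erase hb).symm] at h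
  have := (hT.height_pos hd ha).ne'
  simpa [this] using h

lemma IsSimplex.faceMeas_eq (hd : 0 < d) (hT : IsSimplex T) (ha : a ∈ T) (hb : b ∈ T.erase a) :
    faceMeas (T.erase a) =
      (planeMeas (normal T (T.erase a)) b).restrict (hull (T.erase a)) := by
  rw [faceMeas, planeMeas, Measure.restrict_restrict measurableSet_hull,
    inter_eq_left.2 (hT.hull_erase_subset_plane hd ha hb)]

lemma IsSimplex.isFiniteMeasure_faceMeas (hd : 0 < d) (hT : IsSimplex T) (hF : F ∈ facesOf T) :
    IsFiniteMeasure (faceMeas F) := by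
  obtain ⟨a, ha, rfl⟩ := hT.mem_facesOf_iff.1 hF
  obtain ⟨b, hb, hba⟩ := hT.exists_ne hd a
  refine ⟨?_⟩
  rw [hT.faceMeas_eq hd ha (Finset.mem_erase.2 ⟨hba, hb⟩), Measure.restrict_apply_univ]
  exact planeMeas_isBounded_lt_top (hT.norm_normal hd ha) isBounded_hull

/-- On a finite measure carried by a compact set, continuous functions are in all `L^p` spaces. -/
lemma memLp_of_continuousOn {X V : Type*} [TopologicalSpace X] [T2Space X] [MeasurableSpace X]
    [OpensMeasurableSpace X] [NormedAddCommGroup V] [SecondCountableTopology V]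
    {μ : Measure X} {S : Set X} [IsFiniteMeasure (μ.restrict S)]
    (hS : IsCompact S) {f : X → V} (hf : ContinuousOn f S) (p : ℝ≥0∞) :
    MemLp f p (μ.restrict S) := by
  obtain ⟨C, hC⟩ := hS.exists_bound_of_continuousOn hf
  borelize V
  refine MemLp.of_bound (hf.aestronglyMeasurable hS.measurableSet) C ?_
  exact (ae_restrict_iff' hS.measurableSet).2 (Eventually.of_forall hC)

lemma memLp_cell {V : Type*} [NormedAddCommGroup V] [SecondCountableTopology V] {f : Euc d → V}
    (hf : ContinuousOn f (hull T)) (p : ℝ≥0∞) : MemLp f p (cellMeas T) :=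
  have : IsFiniteMeasure (volume.restrict (hull T)) :=
    inferInstanceAs (IsFiniteMeasure (cellMeas T))
  memLp_of_continuousOn isCompact_hull hf p

lemma integrable_cell {V : Type*} [NormedAddCommGroup V] [SecondCountableTopology V]
    {f : Euc d → V} (hf : ContinuousOn f (hull T)) : Integrable f (cellMeas T) :=
  memLp_one_iff_integrable.1 (memLp_cell hf 1)

lemma IsSimplex.memLp_face {V : Type*} [NormedAddCommGroup V] [SecondCountableTopology V]
    (hd : 0 < d) (hT : IsSimplex T) (hF : F ∈ facesOf T) {f : Euc d → V}
    (hf : ContinuousOn f (hull F)) (p : ℝ≥0∞) : MemLp f p (faceMeas F) :=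
  have : IsFiniteMeasure ((μHE[d - 1]).restrict (hull F)) := hT.isFiniteMeasure_faceMeas hd hF
  memLp_of_continuousOn isCompact_hull hf p

lemma IsSimplex.integrable_face {V : Type*} [NormedAddCommGroup V] [SecondCountableTopology V]
    (hd : 0 < d) (hT : IsSimplex T) (hF : F ∈ facesOf T) {f : Euc d → V}
    (hf : ContinuousOn f (hull F)) : Integrable f (faceMeas F) :=
  memLp_one_iff_integrable.1 (hT.memLp_face hd hF hf 1)

lemma IsSimplex.linear_bary_sub (hT : IsSimplex T) (ha : a ∈ T) (hb : b ∈ T) (hab : a ≠ b) :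
    (bary T a).linear (a - b) = 1 ∧ (bary T b).linear (a - b) = -1 ∧
      ∀ c ∈ T, c ≠ a → c ≠ b → (bary T c).linear (a - b) = 0 := by
  simp only [bary_linear_sub]
  refine ⟨?_, ?_, fun c hc hca hcb => ?_⟩
  · rw [hT.bary_self ha, hT.bary_ne ha hb hab, sub_zero]
  · rw [hT.bary_self hb, hT.bary_ne hb ha hab.symm, zero_sub]
  · rw [hT.bary_ne hc ha hca, hT.bary_ne hc hb hcb, sub_zero]

/-- The segment with direction `a - b` through a point of the face opposite to `a`. -/
lemma IsSimplex.add_smul_mem_hull_iff (hT : IsSimplex T) (ha : a ∈ T) (hb : b ∈ T)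
    (hab : a ≠ b) {y : Euc d} (hy : bary T a y = 0) (t : ℝ) :
    y + t • (a - b) ∈ hull T ↔ y ∈ hull (T.erase a) ∧ t ∈ Icc 0 (bary T b y) := by
  obtain ⟨h1, h2, h3⟩ := hT.linear_bary_sub ha hb hab
  rw [hT.mem_hull_erase_iff ha, hT.mem_hull_iff, hT.mem_hull_iff]
  have e1 : bary T a (y + t • (a - b)) = t := by rw [bary_add_smul, h1, hy]; ring
  have e2 : bary T b (y + t • (a - b)) = bary T b y - t := by rw [bary_add_smul, h2]; ring
  have e3 : ∀ c ∈ T, c ≠ a → c ≠ b → bary T c (y + t • (a - b)) = bary T c y :=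
    fun c hc hca hcb => by rw [bary_add_smul, h3 c hc hca hcb]; ring
  constructor
  · intro h
    have ht0 : 0 ≤ t := e1 ▸ h a ha
    have ht1 : t ≤ bary T b y := by have := h b hb; rw [e2] at this; linarith
    refine ⟨⟨fun c hc => ?_, hy⟩, ht0, ht1⟩
    by_cases hca : c = a
    · rw [hca, hy]
    by_cases hcb : c = b
    · rw [hcb]; linarith
    · rw [← e3 c hc hca hcb]; exact h c hc
  · rintro ⟨⟨h, -⟩, ht0, ht1⟩ c hc
    by_cases hca : c = a
    · rw [hca, e1]; exact ht0
    by_cases hcb : c = b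
    · rw [hcb, e2]; linarith
    · rw [e3 c hc hca hcb]; exact h c hc

lemma IsSimplex.abs_inner_normal_sub (hd : 0 < d) (hT : IsSimplex T) (ha : a ∈ T) (hb : b ∈ T)
    (hab : a ≠ b) : |⟪normal T (T.erase a), a - b⟫| = height T a := by
  rw [hT.inner_normal hd ha, (hT.linear_bary_sub ha hb hab).1, mul_one, abs_neg,
    abs_of_pos (hT.height_pos hd ha)]

/-- Integration over a simplex along the direction of its edge `ab`. -/
lemma IsSimplex.integral_cell_eq (hd : 0 < d) (hT : IsSimplex T) (ha : a ∈ T) (hb : b ∈ T)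
    (hab : a ≠ b) {g : Euc d → ℝ} (hg : ContinuousOn g (hull T)) :
    ∫ x, g x ∂(cellMeas T) = height T a *
      ∫ y, (∫ t in (0 : ℝ)..bary T b y, g (y + t • (a - b))) ∂(faceMeas (T.erase a)) := by
  have hbF : b ∈ T.erase a := Finset.mem_erase.2 ⟨hab.symm, hb⟩
  have hn := hT.norm_normal hd ha
  have hv : ⟪normal T (T.erase a), a - b⟫ ≠ 0 := by
    rw [← abs_pos, hT.abs_inner_normal_sub hd ha hb hab]; exact hT.height_pos hd ha
  rw [cellMeas, ← integral_indicator measurableSet_hull,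
    integral_eq_oblique (x₀ := b) hn hv
      ((integrable_indicator_iff measurableSet_hull).2 (integrable_cell hg)),
    hT.abs_inner_normal_sub hd ha hb hab, hT.faceMeas_eq hd ha hbF,
    ← integral_indicator measurableSet_hull]
  congr 1
  refine setIntegral_congr_fun measurableSet_plane fun y hy => ?_
  have hy0 := hT.bary_eq_zero_of_mem_plane hd ha hbF hy
  have hiff := hT.add_smul_mem_hull_iff ha hb hab hy0
  by_cases hyF : y ∈ hull (T.erase a)
  · have h0 : 0 ≤ bary T b y := hT.mem_hull_iff.1 ((hT.mem_hull_erase_iff ha).1 hyF).1 b hb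
    simp only [indicator_of_mem hyF]
    rw [intervalIntegral.integral_of_le h0, ← integral_Icc_eq_integral_Ioc,
      ← integral_indicator measurableSet_Icc]
    congr 1
    ext t
    by_cases ht : t ∈ Icc 0 (bary T b y)
    · rw [indicator_of_mem ((hiff t).2 ⟨hyF, ht⟩), indicator_of_mem ht]
    · rw [indicator_of_notMem (fun h => ht ((hiff t).1 h).2), indicator_of_notMem ht]
  · simp only [indicator_of_notMem hyF]
    rw [← integral_zero ℝ ℝ]
    congr 1
    ext t
    rw [indicator_of_notMem fun h => hyF ((hiff t).1 h).1]

/-- The projection along the edge `ab` identifies the faces opposite to `a` and to `b`, up to the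
ratio of the heights. -/
lemma IsSimplex.integral_face_comp (hd : 0 < d) (hT : IsSimplex T) (ha : a ∈ T) (hb : b ∈ T)
    (hab : a ≠ b) {f : Euc d → ℝ} (hf : Continuous f) :
    height T a * ∫ y, f (y + bary T b y • (a - b)) ∂(faceMeas (T.erase a)) =
      height T b * ∫ y, f y ∂(faceMeas (T.erase b)) := by
  have hbF : b ∈ T.erase a := Finset.mem_erase.2 ⟨hab.symm, hb⟩
  have haF : a ∈ T.erase b := Finset.mem_erase.2 ⟨hab, ha⟩
  obtain ⟨h1, h2, h3⟩ := hT.linear_bary_sub ha hb hab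
  let ψ : Euc d → Euc d := fun x => x + bary T b x • (a - b)
  have hψ : Continuous ψ := continuous_id.add (continuous_bary.smul continuous_const)
  let S : Set (Euc d) := {x | ψ x ∈ hull (T.erase b) ∧ bary T b x ∈ Icc (0 : ℝ) 1}
  have hSc : IsClosed S := (isCompact_hull.isClosed.preimage hψ).inter
    (isClosed_Icc.preimage continuous_bary)
  have hSb : Bornology.IsBounded S := by
    have hK : IsCompact ((fun p : Euc d × ℝ => p.1 - p.2 • (a - b)) ''
        (hull (T.erase b) ×ˢ Icc (0 : ℝ) 1)) :=
      (isCompact_hull.prod isCompact_Icc).image (by fun_prop)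
    refine hK.isBounded.subset fun x hx => ⟨(ψ x, bary T b x), ⟨hx.1, hx.2⟩, ?_⟩
    simp [ψ]
  have hS : IsCompact S := Metric.isCompact_of_isClosed_isBounded hSc hSb
  have hint : Integrable (S.indicator (f ∘ ψ)) :=
    (integrable_indicator_iff hSc.measurableSet).2
      ((hf.comp hψ).continuousOn.integrableOn_compact hS)
  have hva : ⟪normal T (T.erase a), a - b⟫ ≠ 0 := by
    rw [← abs_pos, hT.abs_inner_normal_sub hd ha hb hab]; exact hT.height_pos hd ha
  have hvb' : |⟪normal T (T.erase b), a - b⟫| = height T b := by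
    rw [← neg_sub, inner_neg_right, abs_neg, hT.abs_inner_normal_sub hd hb ha hab.symm]
  have hvb : ⟪normal T (T.erase b), a - b⟫ ≠ 0 := by
    rw [← abs_pos, hvb']; exact hT.height_pos hd hb
  -- Both sides are the integral of `f ∘ ψ` over the slab `S`.
  have hψt : ∀ (y : Euc d) (t : ℝ), ψ (y + t • (a - b)) = ψ y := fun y t => by
    simp only [ψ, bary_add_smul, h2]; module
  have hslab : ∀ (y : Euc d) (m : ℝ), (ψ y ∈ hull (T.erase b) → f (ψ y) = m) →
      (ψ y ∉ hull (T.erase b) → m = 0) →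
      ∫ t : ℝ, S.indicator (f ∘ ψ) (y + t • (a - b)) = m := by
    intro y m hm hm0
    have hmem : ∀ t : ℝ, y + t • (a - b) ∈ S ↔ ψ y ∈ hull (T.erase b) ∧
        t ∈ Icc (bary T b y - 1) (bary T b y) := fun t => by
      simp only [S, mem_ofPred_eq, hψt, bary_add_smul, h2, mem_Icc]
      exact and_congr_right fun _ => ⟨fun h => ⟨by linarith [h.2], by linarith [h.1]⟩,
        fun h => ⟨by linarith [h.2], by linarith [h.1]⟩⟩
    by_cases hy : ψ y ∈ hull (T.erase b)
    · have e : (fun t : ℝ => S.indicator (f ∘ ψ) (y + t • (a - b))) =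
          (Icc (bary T b y - 1) (bary T b y)).indicator fun _ => m := by
        ext t
        by_cases ht : t ∈ Icc (bary T b y - 1) (bary T b y)
        · rw [indicator_of_mem ((hmem t).2 ⟨hy, ht⟩), indicator_of_mem ht, Function.comp,
          hψt, hm hy]
        · rw [indicator_of_notMem (fun h => ht ((hmem t).1 h).2), indicator_of_notMem ht]
      rw [e, integral_indicator measurableSet_Icc, setIntegral_const]
      simp
    · rw [hm0 hy, ← integral_zero ℝ ℝ]
      congr 1
      ext t
      rw [indicator_of_notMem fun h => hy ((hmem t).1 h).1]
  have hA := integral_eq_oblique (x₀ := b) (hT.norm_normal hd ha) hva hint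
  have hB := integral_eq_oblique (x₀ := a) (hT.norm_normal hd hb) hvb hint
  rw [hT.abs_inner_normal_sub hd ha hb hab] at hA
  rw [hvb'] at hB
  rw [hT.faceMeas_eq hd ha hbF, hT.faceMeas_eq hd hb haF, ← integral_indicator measurableSet_hull,
    ← integral_indicator measurableSet_hull]
  refine Eq.trans ?_ (hA.symm.trans (hB.trans ?_))
  · congr 1
    refine setIntegral_congr_fun measurableSet_plane fun y hy => ?_
    have hy0 := hT.bary_eq_zero_of_mem_plane hd ha hbF hy
    have hiff : ψ y ∈ hull (T.erase b) ↔ y ∈ hull (T.erase a) := by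
      have e := hT.add_smul_mem_hull_iff ha hb hab hy0 (bary T b y)
      rw [hT.mem_hull_erase_iff hb]
      have e0 : bary T b (ψ y) = 0 := by simp only [ψ, bary_add_smul, h2]; ring
      refine ⟨fun h => (e.1 h.1).1, fun h => ⟨e.2 ⟨h, ?_, le_rfl⟩, e0⟩⟩
      exact hT.mem_hull_iff.1 ((hT.mem_hull_erase_iff ha).1 h).1 b hb
    refine (hslab y _ (fun h => ?_) fun h => ?_).symm
    · rw [indicator_of_mem (hiff.1 h)]
    · rw [indicator_of_notMem fun h' => h (hiff.2 h')]
  · congr 1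
    refine setIntegral_congr_fun measurableSet_plane fun y hy => ?_
    have hy0 := hT.bary_eq_zero_of_mem_plane hd hb haF hy
    have hψy : ψ y = y := by simp [ψ, hy0]
    refine hslab y _ (fun h => ?_) fun h => ?_
    · rw [hψy] at h ⊢; rw [indicator_of_mem h]
    · rw [hψy] at h; rw [indicator_of_notMem h]

/-- The divergence theorem on a simplex, for one direction. For the direction of an edge `ab`, this
is the fundamental theorem of calculus along that edge: only the faces opposite to `a` and `b`
contribute. The general case follows by linearity. -/
theorem IsSimplex.integral_fderiv (hd : 0 < d) (hT : IsSimplex T) {f : Euc d → ℝ}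
    (hf : ContDiff ℝ 1 f) (v : Euc d) :
    ∫ x, fderiv ℝ f x v ∂(cellMeas T) =
      ∑ F ∈ facesOf T, ⟪v, normal T F⟫ * ∫ x, f x ∂(faceMeas F) := by
  have hfc := hf.continuous_fderiv one_ne_zero
  have hfd := hf.differentiable one_ne_zero
  have edge : ∀ a ∈ T, ∀ b ∈ T, ∫ x, fderiv ℝ f x (a - b) ∂(cellMeas T) =
      ∑ F ∈ facesOf T, ⟪a - b, normal T F⟫ * ∫ x, f x ∂(faceMeas F) := by
    intro a ha b hb
    by_cases hab : a = b
    · simp [hab]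
    obtain ⟨h1, h2, h3⟩ := hT.linear_bary_sub ha hb hab
    rw [hT.sum_facesOf (fun F => ⟪a - b, normal T F⟫ * ∫ x, f x ∂(faceMeas F)),
      ← Finset.add_sum_erase T _ ha,
      ← Finset.add_sum_erase (T.erase a) _ (Finset.mem_erase.2 ⟨Ne.symm hab, hb⟩),
      Finset.sum_eq_zero (s := (T.erase a).erase b), add_zero, real_inner_comm,
        real_inner_comm _ (a - b),
      hT.inner_normal hd ha, hT.inner_normal hd hb, h1, h2,
      hT.integral_cell_eq hd ha hb hab (hfc.clm_apply continuous_const).continuousOn]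
    · have hftc : ∀ y, ∫ t in (0 : ℝ)..bary T b y, fderiv ℝ f (y + t • (a - b)) (a - b) =
          f (y + bary T b y • (a - b)) - f y := by
        intro y
        have hder : ∀ t : ℝ, HasDerivAt (fun t : ℝ => f (y + t • (a - b)))
            (fderiv ℝ f (y + t • (a - b)) (a - b)) t := fun t => by
          have hγ : HasDerivAt (fun t : ℝ => y + t • (a - b)) (a - b) t := by
            simpa using ((hasDerivAt_id t).smul_const (a - b)).const_add y
          exact (hfd _).hasFDerivAt.comp_hasDerivAt t hγ
        rw [intervalIntegral.integral_eq_sub_of_hasDerivAt (fun t _ => hder t)]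
        · simp
        · refine Continuous.intervalIntegrable ?_ _ _
          exact (hfc.comp (by fun_prop)).clm_apply continuous_const
      simp only [hftc]
      have hF := hT.erase_mem_facesOf ha
      have hψ : Continuous fun y => f (y + bary T b y • (a - b)) :=
        hf.continuous.comp (continuous_id.add (continuous_bary.smul continuous_const))
      rw [integral_sub (hT.integrable_face hd hF hψ.continuousOn)
        (hT.integrable_face hd hF hf.continuous.continuousOn), mul_sub,
        hT.integral_face_comp hd ha hb hab hf.continuous]
      ring
    · intro c hc
      rw [Finset.mem_erase, Finset.mem_erase] at hc
      rw [real_inner_comm, hT.inner_normal hd hc.2.2, h3 c hc.2.2 hc.2.1 hc.1]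
      ring
  obtain ⟨b, hb⟩ := hT.card_pos
  have hsum : ∑ a ∈ T, (bary T a).linear v = 0 := by
    have : ∀ a, (bary T a).linear v = bary T a v - bary T a 0 := fun a => by
      rw [← bary_linear_sub, sub_zero]
    simp only [this, Finset.sum_sub_distrib, hT.sum_bary, sub_self]
  have hv : v = ∑ a ∈ T, (bary T a).linear v • (a - b) := by
    have e : v = ∑ a ∈ T, (bary T a).linear v • a := by
      have : ∀ a, (bary T a).linear v = bary T a v - bary T a 0 := fun a => by
        rw [← bary_linear_sub, sub_zero]
      simp only [this, sub_smul, Finset.sum_sub_distrib, hT.sum_bary_smul, sub_zero]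
    simp only [smul_sub, Finset.sum_sub_distrib, ← Finset.sum_smul, hsum, zero_smul, sub_zero]
    exact e
  generalize hw : (fun a => (bary T a).linear v) = w at hv
  have hw' : ∀ a, (bary T a).linear v = w a := fun a => congrFun hw a
  simp only [hw'] at hv
  rw [hv]
  simp only [map_sum, map_smul, sum_inner, real_inner_smul_left, smul_eq_mul, Finset.sum_mul]
  rw [integral_finsetSum _ fun a _ => (integrable_cell
    (hfc.clm_apply continuous_const).continuousOn).const_mul _, Finset.sum_comm]
  refine Finset.sum_congr rfl fun a ha => ?_
  rw [integral_const_mul, edge a ha b hb, Finset.mul_sum]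
  exact Finset.sum_congr rfl fun F _ => by ring

end Divergence


/-! ### Scaled inequalities on finite-dimensional spaces of polynomials -/

section Const

variable {V : Type*} [AddCommGroup V] [Module ℝ V] [FiniteDimensional ℝ V]

lemma exists_bound_of_ker_le {E F : Type*} [NormedAddCommGroup E] [NormedSpace ℝ E]
    [NormedAddCommGroup F] [NormedSpace ℝ F] (A : V →ₗ[ℝ] E) (B : V →ₗ[ℝ] F)
    (h : ∀ v, B v = 0 → A v = 0) : ∃ C : ℝ, 0 < C ∧ ∀ v, ‖A v‖ ≤ C * ‖B v‖ := by
  obtain ⟨g, hg⟩ := LinearMap.exists_rightInverse_of_surjective B.rangeRestrict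
    B.range_rangeRestrict
  let G : LinearMap.range B →L[ℝ] E := LinearMap.toContinuousLinearMap (A ∘ₗ g)
  refine ⟨‖G‖ + 1, by positivity, fun v => ?_⟩
  have e : A v = G (B.rangeRestrict v) := by
    have h1 : B (v - g (B.rangeRestrict v)) = 0 := by
      have := LinearMap.congr_fun hg (B.rangeRestrict v)
      have h2 := congrArg Subtype.val this
      simp only [LinearMap.comp_apply, LinearMap.id_apply, LinearMap.codRestrict_apply,
        LinearMap.rangeRestrict] at h2
      rw [map_sub, sub_eq_zero]
      exact h2.symm
    have := h _ h1
    rw [map_sub, sub_eq_zero] at this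
    exact this
  rw [e]
  refine (G.le_opNorm _).trans ?_
  have : ‖B.rangeRestrict v‖ = ‖B v‖ := rfl
  rw [this]
  nlinarith [norm_nonneg (B v)]

lemma norm_toLp_sq {X E : Type*} [MeasurableSpace X] {μ : Measure X} [NormedAddCommGroup E]
    {f : X → E} (hf : MemLp f 2 μ) : ‖hf.toLp f‖ ^ 2 = ∫ x, ‖f x‖ ^ 2 ∂μ := by
  rw [Lp.norm_toLp, hf.eLpNorm_eq_integral_rpow_norm two_ne_zero ENNReal.ofNat_ne_top]
  have h0 : 0 ≤ ∫ x, ‖f x‖ ^ (2 : ℝ) ∂μ := integral_nonneg fun x => by positivity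
  simp only [ENNReal.toReal_ofNat]
  rw [ENNReal.toReal_ofReal (by positivity), ← Real.rpow_natCast, ← Real.rpow_mul h0]
  norm_num

/-- A family of square-integrable functions, as a linear map into `L²`. -/
noncomputable def toLpLin {X E : Type*} [MeasurableSpace X] (μ : Measure X)
    [NormedAddCommGroup E] [NormedSpace ℝ E] (A : V →ₗ[ℝ] (X → E)) (hA : ∀ v, MemLp (A v) 2 μ) :
    V →ₗ[ℝ] Lp E 2 μ where
  toFun v := (hA v).toLp (A v)
  map_add' v w := by
    rw [← MemLp.toLp_add]; congr 1; rw [map_add]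
  map_smul' c v := by
    rw [RingHom.id_apply, ← MemLp.toLp_const_smul]; congr 1; rw [map_smul]

lemma exists_integral_bound {X Y E F : Type*} [MeasurableSpace X] [MeasurableSpace Y]
    {μ : Measure X} {ν : Measure Y} [NormedAddCommGroup E] [NormedSpace ℝ E]
    [NormedAddCommGroup F] [NormedSpace ℝ F] (A : V →ₗ[ℝ] (X → E)) (B : V →ₗ[ℝ] (Y → F))
    (hA : ∀ v, MemLp (A v) 2 μ) (hB : ∀ v, MemLp (B v) 2 ν)
    (h : ∀ v, B v =ᵐ[ν] 0 → A v =ᵐ[μ] 0) :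
    ∃ C : ℝ, 0 < C ∧ ∀ v, ∫ x, ‖A v x‖ ^ 2 ∂μ ≤ C * ∫ y, ‖B v y‖ ^ 2 ∂ν := by
  obtain ⟨C, hC, hAB⟩ := exists_bound_of_ker_le (toLpLin μ A hA) (toLpLin ν B hB) fun v hv => by
    have h1 := (Lp.eq_zero_iff_ae_eq_zero).1 hv
    refine (Lp.eq_zero_iff_ae_eq_zero).2 ?_
    have h2 := h v ((hB v).coeFn_toLp.symm.trans h1)
    exact (hA v).coeFn_toLp.trans h2
  refine ⟨C ^ 2, by positivity, fun v => ?_⟩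
  rw [← norm_toLp_sq (hA v), ← norm_toLp_sq (hB v), ← mul_pow]
  exact pow_le_pow_left₀ (norm_nonneg _) (hAB v) 2

end Const

variable {d : ℕ} {E : Type*} [NormedAddCommGroup E] [NormedSpace ℝ E]

/-- The properties of spaces of polynomial functions on which scaling arguments rely. -/
structure IsScalable (V : Submodule ℝ (Euc d → E)) : Prop where
  finite : FiniteDimensional ℝ V
  contDiff : ∀ w ∈ V, ContDiff ℝ ω w
  homothety : ∀ w ∈ V, ∀ (c : Euc d) (h : ℝ), (fun y => w (c + h • y)) ∈ V

lemma homothety_mem_poly_one (c : Euc d) (h : ℝ) (i : Fin d) :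
    (fun y => (c + h • y) i) ∈ poly d 1 := by
  have h1 := add_mem (poly_mono zero_le_one (const_mem_poly (d := d) (c i) le_rfl))
    (Submodule.smul_mem _ h (coord_mem_poly (d := d) i))
  exact h1

lemma isScalable_poly (l : ℤ) : IsScalable (poly d l) where
  finite := inferInstance
  contDiff _ hw := contDiff_of_mem_poly hw
  homothety _ hw c h := comp_mem_poly (homothety_mem_poly_one c h) hw

lemma isScalable_vec (l : ℤ) : IsScalable (vec (poly d l)) where
  finite := inferInstance
  contDiff _ hw := contDiff_of_mem_vec hw
  homothety _ hw c h i := comp_mem_poly (homothety_mem_poly_one c h) (hw i)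

lemma isScalable_rtn (l : ℤ) : IsScalable (rtn d l) where
  finite := inferInstance
  contDiff _ hw := contDiff_of_mem_vec (rtn_le_vec hw)
  homothety _ hw c h := rtn_homothety hw c h

/-- Analytic functions which vanish on a ball vanish everywhere. -/
lemma IsScalable.eq_zero {V : Submodule ℝ (Euc d → E)} (hV : IsScalable V) {w : Euc d → E}
    (hw : w ∈ V) {c : Euc d} {r : ℝ} (hr : 0 < r) (h : ∀ x ∈ Metric.ball c r, w x = 0) : w = 0 := by
  have h1 : AnalyticOnNhd ℝ w univ := contDiff_omega_iff_analyticOnNhd.1 (hV.contDiff w hw)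
  refine h1.eq_of_eventuallyEq (fun _ _ => analyticAt_const) (z₀ := c) ?_
  filter_upwards [Metric.ball_mem_nhds c hr] with x hx using h x hx

open scoped Pointwise in
lemma setIntegral_closedBall_homothety (g : Euc d → ℝ) (c : Euc d) {h : ℝ} (hh : 0 < h) (s : ℝ) :
    ∫ x in Metric.closedBall c (s * h), g x =
      h ^ d * ∫ y in Metric.closedBall 0 s, g (c + h • y) := by
  have h1 := Measure.setIntegral_comp_smul_of_pos (volume : Measure (Euc d))
    (fun x => g (c + x)) (Metric.closedBall 0 s) hh
  have h2 : h • Metric.closedBall (0 : Euc d) s = Metric.closedBall 0 (s * h) := by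
    rw [smul_closedBall' hh.ne']; simp [abs_of_pos hh, mul_comm]
  rw [h1, h2, finrank_euclideanSpace_fin, smul_eq_mul, ← mul_assoc,
    mul_inv_cancel₀ (by positivity), one_mul]
  have h3 := (measurePreserving_add_left (volume : Measure (Euc d)) c).setIntegral_preimage_emb
    (MeasurableEquiv.addLeft c).measurableEmbedding g (Metric.closedBall c (s * h))
  rw [← h3]
  congr 2
  ext x; simp

lemma ae_eq_zero_closedBall {F : Type*} [NormedAddCommGroup F] {g : Euc d → F}
    (hg : Continuous g) {s : ℝ} (h : g =ᵐ[volume.restrict (Metric.closedBall 0 s)] 0) :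
    ∀ x ∈ Metric.ball (0 : Euc d) s, g x = 0 := by
  have h1 := ae_restrict_of_ae_restrict_of_subset (Metric.ball_subset_closedBall) h
  have h2 := Measure.eqOn_open_of_ae_eq (μ := (volume : Measure (Euc d))) h1 Metric.isOpen_ball
    hg.continuousOn continuousOn_const
  exact fun x hx => h2 hx

lemma memLp_closedBall {F : Type*} [NormedAddCommGroup F] [SecondCountableTopology F]
    {g : Euc d → F} (hg : Continuous g)
    (s : ℝ) : MemLp g 2 (volume.restrict (Metric.closedBall 0 s)) := by
  have : IsFiniteMeasure ((volume : Measure (Euc d)).restrict (Metric.closedBall 0 s)) :=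
    ⟨by rw [Measure.restrict_apply_univ]; exact (isCompact_closedBall _ _).measure_lt_top⟩
  exact memLp_of_continuousOn (isCompact_closedBall _ _) hg.continuousOn 2

section Scaled

variable [FiniteDimensional ℝ E] {V : Submodule ℝ (Euc d → E)}

/-- Comparison of the `L²`-norms of a polynomial on concentric balls. -/
lemma IsScalable.exists_ball_le (hV : IsScalable V) {κ : ℝ} (hκ : 0 < κ) : ∃ C : ℝ, 0 < C ∧
    ∀ w ∈ V, ∀ (c : Euc d) (h : ℝ), 0 < h → ∫ x in Metric.closedBall c h, ‖w x‖ ^ 2 ≤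
      C * ∫ x in Metric.closedBall c (κ * h), ‖w x‖ ^ 2 := by
  have := hV.finite
  obtain ⟨C, hC, hb⟩ := exists_integral_bound
    (μ := volume.restrict (Metric.closedBall (0 : Euc d) 1))
    (ν := volume.restrict (Metric.closedBall (0 : Euc d) κ)) V.subtype V.subtype
    (fun v => memLp_closedBall (hV.contDiff _ v.2).continuous 1)
    (fun v => memLp_closedBall (hV.contDiff _ v.2).continuous κ)
    (fun v hv => by
      have := hV.eq_zero v.2 hκ (ae_eq_zero_closedBall (hV.contDiff _ v.2).continuous hv)
      rw [Submodule.subtype_apply, this])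
  refine ⟨C, hC, fun w hw c h hh => ?_⟩
  have h1 := hb ⟨_, hV.homothety w hw c h⟩
  have e := setIntegral_closedBall_homothety (fun x => ‖w x‖ ^ 2) c hh 1
  rw [one_mul] at e
  rw [e, setIntegral_closedBall_homothety _ c hh κ, mul_left_comm]
  exact mul_le_mul_of_nonneg_left h1 (by positivity)

lemma fderiv_homothety {w : Euc d → E} (hw : Differentiable ℝ w) (c : Euc d) (h : ℝ) (y : Euc d) :
    fderiv ℝ (fun y => w (c + h • y)) y = h • fderiv ℝ w (c + h • y) := by
  have h1 : HasFDerivAt (fun y : Euc d => c + h • y) (h • ContinuousLinearMap.id ℝ (Euc d)) y :=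
    ((hasFDerivAt_id y).const_smul h).const_add c
  have h2 : fderiv ℝ (fun y => w (c + h • y)) y = _ := ((hw _).hasFDerivAt.comp y h1).fderiv
  rw [h2]
  ext v
  simp

/-- The derivative, as a linear map on a space of differentiable functions. -/
noncomputable def fderivLin (V : Submodule ℝ (Euc d → E)) (hV : ∀ w ∈ V, Differentiable ℝ w) :
    V →ₗ[ℝ] (Euc d → Euc d →L[ℝ] E) where
  toFun w x := fderiv ℝ w x
  map_add' v w := by
    ext1 x
    exact fderiv_add (hV v v.2 x) (hV w w.2 x)
  map_smul' c w := by
    ext1 x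
    exact fderiv_const_smul (hV w w.2 x) c

lemma IsScalable.differentiable (hV : IsScalable V) : ∀ w ∈ V, Differentiable ℝ w :=
  fun w hw => (hV.contDiff w hw).differentiable (by simp)

lemma IsScalable.continuous_fderiv (hV : IsScalable V) {w : Euc d → E} (hw : w ∈ V) :
    Continuous (fderiv ℝ w) := (hV.contDiff w hw).continuous_fderiv (by simp)

/-- The inverse inequality on balls. -/
lemma IsScalable.exists_fderiv_ball_le (hV : IsScalable V) {κ : ℝ} (hκ : 0 < κ) : ∃ C : ℝ, 0 < C ∧
    ∀ w ∈ V, ∀ (c : Euc d) (h : ℝ), 0 < h →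
      h ^ 2 * ∫ x in Metric.closedBall c h, ‖fderiv ℝ w x‖ ^ 2 ≤
        C * ∫ x in Metric.closedBall c (κ * h), ‖w x‖ ^ 2 := by
  have := hV.finite
  obtain ⟨C, hC, hb⟩ := exists_integral_bound
    (μ := volume.restrict (Metric.closedBall (0 : Euc d) 1))
    (ν := volume.restrict (Metric.closedBall (0 : Euc d) κ)) (fderivLin V hV.differentiable)
    V.subtype (fun v => memLp_closedBall (hV.continuous_fderiv v.2) 1)
    (fun v => memLp_closedBall (hV.contDiff _ v.2).continuous κ)
    (fun v hv => by
      have := hV.eq_zero v.2 hκ (ae_eq_zero_closedBall (hV.contDiff _ v.2).continuous hv)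
      have h0 : v = 0 := Subtype.ext this
      rw [h0, map_zero])
  refine ⟨C, hC, fun w hw c h hh => ?_⟩
  have h1 := hb ⟨_, hV.homothety w hw c h⟩
  have e := setIntegral_closedBall_homothety (fun x => ‖fderiv ℝ w x‖ ^ 2) c hh 1
  rw [one_mul] at e
  rw [e, setIntegral_closedBall_homothety _ c hh κ, mul_left_comm, mul_left_comm C]
  refine mul_le_mul_of_nonneg_left (le_of_eq_of_le ?_ h1) (by positivity)
  rw [← integral_const_mul]
  refine integral_congr_ae (.of_forall fun y => ?_)
  change h ^ 2 * ‖fderiv ℝ w (c + h • y)‖ ^ 2 = ‖fderiv ℝ (fun y => w (c + h • y)) y‖ ^ 2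
  rw [fderiv_homothety (hV.differentiable w hw), norm_smul, mul_pow, Real.norm_eq_abs, sq_abs]

/-- The Poincaré inequality on balls. -/
lemma IsScalable.exists_sub_ball_le (hV : IsScalable V) (hconst : ∀ e : E, (fun _ => e) ∈ V)
    {κ : ℝ} (hκ : 0 < κ) : ∃ C : ℝ, 0 < C ∧
    ∀ w ∈ V, ∀ (c : Euc d) (h : ℝ), 0 < h → ∫ x in Metric.closedBall c h, ‖w x - w c‖ ^ 2 ≤
      C * (h ^ 2 * ∫ x in Metric.closedBall c (κ * h), ‖fderiv ℝ w x‖ ^ 2) := by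
  have := hV.finite
  let A : V →ₗ[ℝ] (Euc d → E) :=
    { toFun := fun w x => w.1 x - w.1 0
      map_add' := fun v w => by ext x; simp; abel
      map_smul' := fun a w => by ext x; simp [smul_sub] }
  obtain ⟨C, hC, hb⟩ := exists_integral_bound
    (μ := volume.restrict (Metric.closedBall (0 : Euc d) 1))
    (ν := volume.restrict (Metric.closedBall (0 : Euc d) κ)) A (fderivLin V hV.differentiable)
    (fun v => memLp_closedBall ((hV.contDiff _ v.2).continuous.sub continuous_const) 1)
    (fun v => memLp_closedBall (hV.continuous_fderiv v.2) κ)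
    (fun v hv => by
      have h1 := ae_eq_zero_closedBall (hV.continuous_fderiv v.2) hv
      have h2 : ∀ x ∈ Metric.ball (0 : Euc d) κ, v.1 x - v.1 0 = 0 := fun x hx => by
        rw [sub_eq_zero]
        exact Metric.isOpen_ball.is_const_of_fderiv_eq_zero
          (convex_ball (0 : Euc d) κ).isPreconnected
          (hV.differentiable _ v.2).differentiableOn h1 hx (Metric.mem_ball_self hκ)
      have h3 := hV.eq_zero (V.sub_mem v.2 (hconst (v.1 0))) hκ h2
      exact .of_forall fun x => congrFun h3 x)
  refine ⟨C, hC, fun w hw c h hh => ?_⟩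
  have h1 := hb ⟨_, hV.homothety w hw c h⟩
  have e := setIntegral_closedBall_homothety (fun x => ‖w x - w c‖ ^ 2) c hh 1
  rw [one_mul] at e
  rw [e, setIntegral_closedBall_homothety _ c hh κ, mul_left_comm (h ^ 2), mul_left_comm C]
  refine mul_le_mul_of_nonneg_left ?_ (by positivity)
  have e1 : ∀ y : Euc d, A ⟨_, hV.homothety w hw c h⟩ y = w (c + h • y) - w c := fun y => by
    simp [A]
  simp only [e1] at h1
  refine h1.trans_eq ?_
  congr 1
  rw [← integral_const_mul]
  refine integral_congr_ae (.of_forall fun y => ?_)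
  change ‖fderiv ℝ (fun y => w (c + h • y)) y‖ ^ 2 = h ^ 2 * ‖fderiv ℝ w (c + h • y)‖ ^ 2
  rw [fderiv_homothety (hV.differentiable w hw), norm_smul, mul_pow, Real.norm_eq_abs, sq_abs]

end Scaled

lemma continuous_divergence {w : Euc d → Euc d} {l : ℤ} (hw : w ∈ rtn d l) :
    Continuous (divergence w) := continuous_of_mem_poly (divergence_mem_poly (rtn_le_vec hw))

lemma divergence_homothety {w : Euc d → Euc d} (hw : Differentiable ℝ w) (c : Euc d) (h : ℝ)
    (y : Euc d) : divergence (fun y => w (c + h • y)) y = h * divergence w (c + h • y) := by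
  simp only [divergence, trace, fderiv_homothety hw, Finset.mul_sum]
  rfl

/-- Up to a field controlled by its divergence, a field in `RTN^ℓ` has polynomial components of
degree `ℓ - 1`. -/
lemma exists_sub_vec_ball_le (hd : 0 < d) (l : ℤ) {κ : ℝ} (hκ : 0 < κ) : ∃ C : ℝ, 0 < C ∧
    ∀ w ∈ rtn d l, ∀ (c : Euc d) (h : ℝ), 0 < h → ∃ p ∈ vec (poly d (l - 1)),
      ∫ x in Metric.closedBall c h, ‖w x - p x‖ ^ 2 ≤
        C * (h ^ 2 * ∫ x in Metric.closedBall c (κ * h), divergence w x ^ 2) := by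
  have hV := isScalable_rtn (d := d) l
  let D : rtn d l →ₗ[ℝ] (Euc d → ℝ) :=
    { toFun := fun w => divergence w.1
      map_add' := fun v w => divergence_add (hV.differentiable _ v.2) (hV.differentiable _ w.2)
      map_smul' := fun a w => divergence_smul (hV.differentiable _ w.2) a }
  obtain ⟨N, hN⟩ := Submodule.exists_isCompl (LinearMap.ker D)
  let P : rtn d l →ₗ[ℝ] rtn d l := N.subtype ∘ₗ N.projectionOnto _ hN.symm
  have hP : ∀ w, D w = 0 → P w = 0 := fun w hw => by
    simp only [P, LinearMap.comp_apply, Submodule.subtype_apply, ZeroMemClass.coe_eq_zero]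
    exact (Submodule.projectionOnto_apply_eq_zero_iff hN.symm).2 hw
  have hPD : ∀ w, D (w - P w) = 0 := fun w => by
    have : P (w - P w) = 0 := by
      simp only [P, map_sub, LinearMap.comp_apply, Submodule.subtype_apply]
      rw [Submodule.projectionOnto_apply_left, sub_self]
    simp only [P, LinearMap.comp_apply, Submodule.subtype_apply, ZeroMemClass.coe_eq_zero] at this
    exact (Submodule.projectionOnto_apply_eq_zero_iff hN.symm).1 this
  obtain ⟨C, hC, hb⟩ := exists_integral_bound
    (μ := volume.restrict (Metric.closedBall (0 : Euc d) 1))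
    (ν := volume.restrict (Metric.closedBall (0 : Euc d) κ)) ((rtn d l).subtype ∘ₗ P) D
    (fun v => memLp_closedBall (hV.contDiff _ (P v).2).continuous 1)
    (fun v => memLp_closedBall (continuous_divergence v.2) κ)
    (fun v hv => by
      have h1 := ae_eq_zero_closedBall (continuous_divergence v.2) hv
      have h2 := (isScalable_poly (l - 1)).eq_zero (divergence_mem_poly (rtn_le_vec v.2)) hκ h1
      rw [LinearMap.comp_apply, hP v h2, map_zero])
  refine ⟨C, hC, fun w hw c h hh => ?_⟩
  set w' : rtn d l := ⟨_, hV.homothety w hw c h⟩ with hw'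
  have hq : (w' - P w').1 ∈ vec (poly d (l - 1)) :=
    mem_vec_of_divergence_eq_zero hd (w' - P w').2 (hPD w')
  set q := (w' - P w').1 with hqdef
  have hcomp : ∀ y, c + h • (-(h⁻¹ • c) + h⁻¹ • y) = y := fun y => by
    rw [smul_add, smul_neg, smul_smul, smul_smul, mul_inv_cancel₀ hh.ne']; simp
  have hcomp' : ∀ y, -(h⁻¹ • c) + h⁻¹ • (c + h • y) = y := fun y => by
    rw [smul_add, smul_smul, inv_mul_cancel₀ hh.ne']; simp
  refine ⟨_, (isScalable_vec (l - 1)).homothety q hq (-(h⁻¹ • c)) h⁻¹, ?_⟩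
  have h1 := hb w'
  have e := setIntegral_closedBall_homothety
    (fun x => ‖w x - q (-(h⁻¹ • c) + h⁻¹ • x)‖ ^ 2) c hh 1
  rw [one_mul] at e
  rw [e, setIntegral_closedBall_homothety _ c hh κ, mul_left_comm (h ^ 2), mul_left_comm C]
  refine mul_le_mul_of_nonneg_left ?_ (by positivity)
  have e1 : ∀ y : Euc d, w (c + h • y) - q (-(h⁻¹ • c) + h⁻¹ • (c + h • y)) =
      ((rtn d l).subtype ∘ₗ P) w' y := fun y => by
    rw [hcomp', hqdef]
    simp [hw']
  simp only [e1]
  refine h1.trans_eq ?_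
  congr 1
  rw [← integral_const_mul]
  refine integral_congr_ae (.of_forall fun y => ?_)
  change ‖divergence (fun y => w (c + h • y)) y‖ ^ 2 = h ^ 2 * divergence w (c + h • y) ^ 2
  rw [divergence_homothety (hV.differentiable w hw), Real.norm_eq_abs, sq_abs, mul_pow]


/-! ### Local inequalities on shape-regular simplices -/

section L2

variable {X H : Type*} [MeasurableSpace X] {μ : Measure X} [NormedAddCommGroup H]
  [InnerProductSpace ℝ H] {f g : X → H}

lemma integrable_norm_sq (hf : MemLp f 2 μ) : Integrable (fun x => ‖f x‖ ^ 2) μ :=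
  hf.integrable_norm_pow two_ne_zero

lemma integral_norm_sq_nonneg : 0 ≤ ∫ x, ‖f x‖ ^ 2 ∂μ := integral_nonneg fun _ => by positivity

lemma integrable_inner (hf : MemLp f 2 μ) (hg : MemLp g 2 μ) :
    Integrable (fun x => ⟪f x, g x⟫) μ := by
  have h := L2.integrable_inner (𝕜 := ℝ) (hf.toLp f) (hg.toLp g)
  refine h.congr ?_
  filter_upwards [hf.coeFn_toLp, hg.coeFn_toLp] with x h1 h2
  rw [h1, h2]

/-- The Cauchy–Schwarz inequality for square-integrable functions. -/
lemma sq_integral_inner_le (hf : MemLp f 2 μ) (hg : MemLp g 2 μ) :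
    (∫ x, ⟪f x, g x⟫ ∂μ) ^ 2 ≤ (∫ x, ‖f x‖ ^ 2 ∂μ) * ∫ x, ‖g x‖ ^ 2 ∂μ := by
  rw [← norm_toLp_sq hf, ← norm_toLp_sq hg, ← mul_pow, sq_le_sq,
    abs_of_nonneg (mul_nonneg (norm_nonneg (hf.toLp f)) (norm_nonneg (hg.toLp g)))]
  refine le_trans (le_of_eq ?_) (abs_real_inner_le_norm (hf.toLp f) (hg.toLp g))
  rw [L2.inner_def]
  congr 1
  refine integral_congr_ae ?_
  filter_upwards [hf.coeFn_toLp, hg.coeFn_toLp] with x h1 h2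
  rw [h1, h2]

lemma sq_integral_mul_le {f g : X → ℝ} (hf : MemLp f 2 μ) (hg : MemLp g 2 μ) :
    (∫ x, f x * g x ∂μ) ^ 2 ≤ (∫ x, f x ^ 2 ∂μ) * ∫ x, g x ^ 2 ∂μ := by
  have h := sq_integral_inner_le hg hf
  simp only [Real.norm_eq_abs, sq_abs, real_inner_eq_re_inner] at h
  rw [mul_comm (∫ x, f x ^ 2 ∂μ)]
  exact h

lemma integral_norm_add_sq_le (hf : MemLp f 2 μ) (hg : MemLp g 2 μ) :
    ∫ x, ‖f x + g x‖ ^ 2 ∂μ ≤ 2 * ∫ x, ‖f x‖ ^ 2 ∂μ + 2 * ∫ x, ‖g x‖ ^ 2 ∂μ := by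
  rw [← integral_const_mul, ← integral_const_mul,
    ← integral_add ((integrable_norm_sq hf).const_mul 2) ((integrable_norm_sq hg).const_mul 2)]
  refine integral_mono (integrable_norm_sq (hf.add hg))
    (((integrable_norm_sq hf).const_mul 2).add ((integrable_norm_sq hg).const_mul 2)) fun x => ?_
  have h1 := parallelogram_law_with_norm ℝ (f x) (g x)
  change ‖f x + g x‖ ^ 2 ≤ 2 * ‖f x‖ ^ 2 + 2 * ‖g x‖ ^ 2
  nlinarith [sq_nonneg ‖f x - g x‖]

lemma integral_norm_sub_sq_le (hf : MemLp f 2 μ) (hg : MemLp g 2 μ) :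
    ∫ x, ‖f x - g x‖ ^ 2 ∂μ ≤ 2 * ∫ x, ‖f x‖ ^ 2 ∂μ + 2 * ∫ x, ‖g x‖ ^ 2 ∂μ := by
  have h := integral_norm_add_sq_le hf hg.neg
  simpa [← sub_eq_add_neg] using h

end L2

/-- From `X² a ≤ B X` one deduces `X a ≤ B`. -/
lemma mul_le_of_sq_mul_le {X a B : ℝ} (hX : 0 ≤ X) (hB : 0 ≤ B) (h : X ^ 2 * a ≤ B * X) :
    X * a ≤ B := by
  rcases hX.eq_or_lt with rfl | hX
  · simpa using hB
  · exact le_of_mul_le_mul_right (by linarith) hX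

variable {d : ℕ} {T F : Finset (Euc d)} {a b : Euc d}

lemma setIntegral_le_of_subset {g : Euc d → ℝ} (hg : Continuous g) (h0 : ∀ x, 0 ≤ g x)
    {S S' : Set (Euc d)} (hS' : IsCompact S') (h : S ⊆ S') : ∫ x in S, g x ≤ ∫ x in S', g x :=
  setIntegral_mono_set (hg.continuousOn.integrableOn_compact hS') (.of_forall h0)
    (LE.le.eventuallyLE h)

lemma hull_subset_closedBall {c : Euc d} (hc : c ∈ hull T) :
    hull T ⊆ Metric.closedBall c (diam T) :=
  fun _ hx => Metric.dist_le_diam_of_mem isBounded_hull hx hc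

/-- `T` is a simplex of diameter `h_T` which contains a ball of radius `κ h_T`. -/
def IsShapeRegular (κ : ℝ) (T : Finset (Euc d)) : Prop :=
  IsSimplex T ∧ ∃ c, Metric.closedBall c (κ * diam T) ⊆ hull T

lemma diam_nonneg : 0 ≤ diam T := Metric.diam_nonneg

/-- The trace inequality. It comes from the divergence theorem for the field `‖φ‖² (x - a)`, where
`a` is the vertex opposite to the face. -/
lemma IsSimplex.trace_le {H : Type*} [NormedAddCommGroup H] [InnerProductSpace ℝ H]
    [FiniteDimensional ℝ H] (hd : 0 < d) (hT : IsSimplex T)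
    (ha : a ∈ T) {φ : Euc d → H} (hφ : ContDiff ℝ 1 φ) :
    height T a * ∫ x, ‖φ x‖ ^ 2 ∂(faceMeas (T.erase a)) ≤
      (d + 1) * ∫ x, ‖φ x‖ ^ 2 ∂(cellMeas T) +
        diam T ^ 2 * ∫ x, ‖fderiv ℝ φ x‖ ^ 2 ∂(cellMeas T) := by
  have hφd := hφ.differentiable one_ne_zero
  have hφc := hφ.continuous
  have hφf := hφ.continuous_fderiv one_ne_zero
  have hsq : ContDiff ℝ 1 fun x => ‖φ x‖ ^ 2 := hφ.norm_sq ℝ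
  have hcoord : ∀ i, ContDiff ℝ 1 fun x : Euc d => (x - a) i := fun i =>
    (EuclideanSpace.proj i : Euc d →L[ℝ] ℝ).contDiff.comp (contDiff_id.sub contDiff_const)
  have hdiv := fun i => hT.integral_fderiv hd (hsq.mul (hcoord i)) (basisVec i)
  have hsum := Finset.sum_congr rfl fun i (_ : i ∈ Finset.univ) => hdiv i
  have hR : ∑ i, ∑ F ∈ facesOf T, ⟪basisVec i, normal T F⟫ *
      ∫ x, ‖φ x‖ ^ 2 * (x - a) i ∂(faceMeas F) =
        height T a * ∫ x, ‖φ x‖ ^ 2 ∂(faceMeas (T.erase a)) := by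
    rw [Finset.sum_comm]
    have e : ∀ F ∈ facesOf T, ∑ i, ⟪basisVec i, normal T F⟫ *
        ∫ x, ‖φ x‖ ^ 2 * (x - a) i ∂(faceMeas F) =
          ∫ x, ‖φ x‖ ^ 2 * ⟪normal T F, x - a⟫ ∂(faceMeas F) := fun F hF => by
      simp only [← integral_const_mul]
      rw [← integral_finsetSum]
      · refine integral_congr_ae (.of_forall fun x => ?_)
        simp only [PiLp.inner_apply, basisVec]
        rw [Finset.mul_sum]
        refine Finset.sum_congr rfl fun i _ => ?_
        simp [PiLp.single_apply]
        ring
      · exact fun i _ => hT.integrable_face hd hF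
          (continuous_const.mul (hsq.mul (hcoord i)).continuous).continuousOn
    rw [Finset.sum_congr rfl e, hT.sum_facesOf (fun F =>
      ∫ x, ‖φ x‖ ^ 2 * ⟪normal T F, x - a⟫ ∂(faceMeas F)), Finset.sum_eq_single a]
    · rw [← integral_const_mul]
      refine setIntegral_congr_fun measurableSet_hull fun x hx => ?_
      rw [(hT.height_spec hd ha).2, ((hT.mem_hull_erase_iff ha).1 hx).2, hT.bary_self ha]
      ring
    · intro b hb hba
      refine setIntegral_eq_zero_of_forall_eq_zero fun x hx => ?_
      rw [(hT.height_spec hd hb).2, ((hT.mem_hull_erase_iff hb).1 hx).2, hT.bary_ne hb ha hba]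
      ring
    · exact fun h => absurd ha h
  have hL : ∑ i, ∫ x, fderiv ℝ (fun x => ‖φ x‖ ^ 2 * (x - a) i) x (basisVec i) ∂(cellMeas T) =
      ∫ x, (d * ‖φ x‖ ^ 2 + 2 * ⟪φ x, fderiv ℝ φ x (x - a)⟫) ∂(cellMeas T) := by
    rw [← integral_finsetSum]
    · refine integral_congr_ae (.of_forall fun x => ?_)
      have h1 : ∀ i, fderiv ℝ (fun x => ‖φ x‖ ^ 2 * (x - a) i) x (basisVec i) =
          ‖φ x‖ ^ 2 + 2 * ((x - a) i * ⟪φ x, fderiv ℝ φ x (basisVec i)⟫) := fun i => by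
        have e1 : HasFDerivAt (fun x : Euc d => (x - a) i)
            (EuclideanSpace.proj i : Euc d →L[ℝ] ℝ) x :=
          (EuclideanSpace.proj i : Euc d →L[ℝ] ℝ).hasFDerivAt.comp x
            ((hasFDerivAt_id x).sub_const a)
        have e2 := ((hφd x).hasFDerivAt.norm_sq).mul e1
        have e3 : fderiv ℝ (fun x => ‖φ x‖ ^ 2 * (x - a) i) x = _ := e2.fderiv
        rw [e3]
        simp [basisVec]
        ring
      simp only [h1, Finset.sum_add_distrib, ← Finset.mul_sum]
      have h2 : x - a = ∑ i, (x - a) i • (basisVec i : Euc d) := by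
        ext j; simp [basisVec, Pi.single_apply, Finset.sum_apply]
      conv_rhs => rw [h2]
      simp [inner_sum, real_inner_smul_right]
    · exact fun i _ => integrable_cell
        (((hsq.mul (hcoord i)).continuous_fderiv one_ne_zero).clm_apply 
            continuous_const).continuousOn
  rw [hL, hR] at hsum
  rw [← hsum, ← integral_const_mul, ← integral_const_mul, ← integral_add
    (integrable_cell (Continuous.continuousOn (by fun_prop)))
      (integrable_cell (Continuous.continuousOn (by fun_prop)))]
  refine setIntegral_mono_on ?_ ?_ measurableSet_hull fun x hx => ?_
  · exact integrable_cell (Continuous.continuousOn (by fun_prop))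
  · exact integrable_cell (Continuous.continuousOn (by fun_prop))
  · have h1 : ‖x - a‖ ≤ diam T := by
      rw [← dist_eq_norm]; exact Metric.dist_le_diam_of_mem isBounded_hull hx (mem_hull ha)
    have h2 : ⟪φ x, fderiv ℝ φ x (x - a)⟫ ≤ ‖φ x‖ * (diam T * ‖fderiv ℝ φ x‖) := by
      refine (real_inner_le_norm _ _).trans (mul_le_mul_of_nonneg_left ?_ (norm_nonneg _))
      rw [mul_comm]
      exact ((fderiv ℝ φ x).le_opNorm _).trans (mul_le_mul_of_nonneg_left h1 (norm_nonneg _))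
    nlinarith [sq_nonneg (‖φ x‖ - diam T * ‖fderiv ℝ φ x‖)]

lemma IsShapeRegular.trace_le {H : Type*} [NormedAddCommGroup H] [InnerProductSpace ℝ H]
    [FiniteDimensional ℝ H] (hd : 0 < d) {κ : ℝ} (hκ : 0 ≤ κ) (hT : IsShapeRegular κ T)
    (hF : F ∈ facesOf T) {φ : Euc d → H} (hφ : ContDiff ℝ 1 φ) :
    κ * diam T * ∫ x, ‖φ x‖ ^ 2 ∂(faceMeas F) ≤
      (d + 1) * ∫ x, ‖φ x‖ ^ 2 ∂(cellMeas T) +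
        diam T ^ 2 * ∫ x, ‖fderiv ℝ φ x‖ ^ 2 ∂(cellMeas T) := by
  obtain ⟨hT, c, hc⟩ := hT
  obtain ⟨a, ha, rfl⟩ := hT.mem_facesOf_iff.1 hF
  refine le_trans (mul_le_mul_of_nonneg_right ?_ integral_norm_sq_nonneg) (hT.trace_le hd ha hφ)
  exact hT.le_height hd ha (mul_nonneg hκ diam_nonneg) hc

section Scaled

variable {H : Type*} [NormedAddCommGroup H] [InnerProductSpace ℝ H] [FiniteDimensional ℝ H]
  {V : Submodule ℝ (Euc d → H)} {κ : ℝ}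

lemma IsScalable.exists_cell_le_ball (hV : IsScalable V) (hd : 0 < d) (hκ : 0 < κ) :
    ∃ C : ℝ, 0 < C ∧ ∀ (T : Finset (Euc d)) (c : Euc d), IsSimplex T → c ∈ hull T → ∀ w ∈ V,
      ∫ x, ‖w x‖ ^ 2 ∂(cellMeas T) ≤
        C * ∫ x in Metric.closedBall c (κ * diam T), ‖w x‖ ^ 2 := by
  obtain ⟨C, hC, h⟩ := hV.exists_ball_le hκ
  refine ⟨C, hC, fun T c hT hc w hw => le_trans ?_ (h w hw c _ (hT.diam_pos hd))⟩
  exact setIntegral_le_of_subset ((hV.contDiff w hw).continuous.norm.pow 2)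
    (fun _ => sq_nonneg _) (isCompact_closedBall _ _) (hull_subset_closedBall hc)

/-- The inverse inequality. -/
lemma IsScalable.exists_fderiv_le (hV : IsScalable V) (hd : 0 < d) (hκ : 0 < κ) :
    ∃ C : ℝ, 0 < C ∧ ∀ T : Finset (Euc d), IsShapeRegular κ T → ∀ w ∈ V,
      diam T ^ 2 * ∫ x, ‖fderiv ℝ w x‖ ^ 2 ∂(cellMeas T) ≤ C * ∫ x, ‖w x‖ ^ 2 ∂(cellMeas T) := by
  obtain ⟨C, hC, h⟩ := hV.exists_fderiv_ball_le hκ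
  refine ⟨C, hC, fun T hT w hw => ?_⟩
  obtain ⟨hT, c, hc⟩ := hT
  have hcT : c ∈ hull T := hc (Metric.mem_closedBall_self (mul_nonneg hκ.le diam_nonneg))
  refine le_trans (mul_le_mul_of_nonneg_left ?_ (by positivity))
    ((h w hw c _ (hT.diam_pos hd)).trans
    (mul_le_mul_of_nonneg_left ?_ hC.le))
  · exact setIntegral_le_of_subset ((hV.continuous_fderiv hw).norm.pow 2)
      (fun _ => sq_nonneg _) (isCompact_closedBall _ _) (hull_subset_closedBall hcT)
  · exact setIntegral_le_of_subset ((hV.contDiff w hw).continuous.norm.pow 2)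
      (fun _ => sq_nonneg _) isCompact_hull hc

/-- The Poincaré inequality for polynomials. -/
lemma IsScalable.exists_sub_const_le (hV : IsScalable V) (hconst : ∀ e : H, (fun _ => e) ∈ V)
    (hd : 0 < d) (hκ : 0 < κ) :
    ∃ C : ℝ, 0 < C ∧ ∀ T : Finset (Euc d), IsShapeRegular κ T → ∀ w ∈ V, ∃ e : H,
      ∫ x, ‖w x - e‖ ^ 2 ∂(cellMeas T) ≤
        C * (diam T ^ 2 * ∫ x, ‖fderiv ℝ w x‖ ^ 2 ∂(cellMeas T)) := by
  obtain ⟨C, hC, h⟩ := hV.exists_sub_ball_le hconst hκ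
  refine ⟨C, hC, fun T hT w hw => ?_⟩
  obtain ⟨hT, c, hc⟩ := hT
  have hcT : c ∈ hull T := hc (Metric.mem_closedBall_self (mul_nonneg hκ.le diam_nonneg))
  refine ⟨w c, le_trans ?_ ((h w hw c _ (hT.diam_pos hd)).trans
    (mul_le_mul_of_nonneg_left (mul_le_mul_of_nonneg_left ?_ (by positivity)) hC.le))⟩
  · exact setIntegral_le_of_subset
      (((hV.contDiff w hw).continuous.sub continuous_const).norm.pow 2)
      (fun _ => sq_nonneg _) (isCompact_closedBall _ _) (hull_subset_closedBall hcT)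
  · exact setIntegral_le_of_subset ((hV.continuous_fderiv hw).norm.pow 2)
      (fun _ => sq_nonneg _) isCompact_hull hc

/-- The discrete trace inequality. -/
lemma IsScalable.exists_trace_le (hV : IsScalable V) (hd : 0 < d) (hκ : 0 < κ) :
    ∃ C : ℝ, 0 < C ∧ ∀ T : Finset (Euc d), IsShapeRegular κ T → ∀ F ∈ facesOf T, ∀ w ∈ V,
      diam T * ∫ x, ‖w x‖ ^ 2 ∂(faceMeas F) ≤ C * ∫ x, ‖w x‖ ^ 2 ∂(cellMeas T) := by
  obtain ⟨C, hC, h⟩ := hV.exists_fderiv_le hd hκ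
  refine ⟨(d + 1 + C) / κ, by positivity, fun T hT F hF w hw => ?_⟩
  have h1 := hT.trace_le hd hκ.le hF ((hV.contDiff w hw).of_le (by simp) : ContDiff ℝ 1 w)
  have h2 := h T hT w hw
  rw [div_mul_eq_mul_div, le_div_iff₀ hκ]
  linarith

end Scaled

lemma exists_sub_vec_le (hd : 0 < d) (l : ℤ) {κ : ℝ} (hκ : 0 < κ) : ∃ C : ℝ, 0 < C ∧
    ∀ T : Finset (Euc d), IsShapeRegular κ T → ∀ w ∈ rtn d l, ∃ p ∈ vec (poly d (l - 1)),
      ∫ x, ‖w x - p x‖ ^ 2 ∂(cellMeas T) ≤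
        C * (diam T ^ 2 * ∫ x, divergence w x ^ 2 ∂(cellMeas T)) := by
  obtain ⟨C, hC, h⟩ := exists_sub_vec_ball_le hd l hκ
  refine ⟨C, hC, fun T hT w hw => ?_⟩
  obtain ⟨hT, c, hc⟩ := hT
  have hcT : c ∈ hull T := hc (Metric.mem_closedBall_self (mul_nonneg hκ.le diam_nonneg))
  obtain ⟨p, hp, h1⟩ := h w hw c _ (hT.diam_pos hd)
  refine ⟨p, hp, le_trans ?_ (h1.trans
    (mul_le_mul_of_nonneg_left (mul_le_mul_of_nonneg_left ?_ (by positivity)) hC.le))⟩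
  · exact setIntegral_le_of_subset
      (((continuous_of_mem_vec (rtn_le_vec hw)).sub (continuous_of_mem_vec hp)).norm.pow 2)
      (fun _ => sq_nonneg _) (isCompact_closedBall _ _) (hull_subset_closedBall hcT)
  · exact setIntegral_le_of_subset ((continuous_divergence hw).pow 2)
      (fun _ => sq_nonneg _) isCompact_hull hc

/-- The divergence theorem for the product of a scalar and a vector field. -/
lemma IsSimplex.integral_divergence_mul (hd : 0 < d) (hT : IsSimplex T) {w : Euc d → Euc d}
    {r : Euc d → ℝ} (hw : ContDiff ℝ 1 w) (hr : ContDiff ℝ 1 r) :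
    ∫ x, divergence w x * r x ∂(cellMeas T) =
      -∑ i, ∫ x, w x i * fderiv ℝ r x (basisVec i) ∂(cellMeas T) +
        ∑ F ∈ facesOf T, ∫ x, ⟪w x, normal T F⟫ * r x ∂(faceMeas F) := by
  have hwi : ∀ i, ContDiff ℝ 1 fun x => w x i := fun i =>
    (EuclideanSpace.proj i : Euc d →L[ℝ] ℝ).contDiff.comp hw
  have hwc := hw.continuous
  have hrc := hr.continuous
  have hwf := fun i => (hwi i).continuous_fderiv one_ne_zero
  have hwic := fun i => (hwi i).continuous
  have hrf := hr.continuous_fderiv one_ne_zero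
  have hsum := Finset.sum_congr rfl fun i (_ : i ∈ Finset.univ) =>
    hT.integral_fderiv hd ((hwi i).mul hr) (basisVec i)
  have hR : ∑ i, ∑ F ∈ facesOf T, ⟪basisVec i, normal T F⟫ * ∫ x, w x i * r x ∂(faceMeas F) =
      ∑ F ∈ facesOf T, ∫ x, ⟪w x, normal T F⟫ * r x ∂(faceMeas F) := by
    rw [Finset.sum_comm]
    refine Finset.sum_congr rfl fun F hF => ?_
    simp only [← integral_const_mul]
    rw [← integral_finsetSum]
    · refine integral_congr_ae (.of_forall fun x => ?_)
      simp only [PiLp.inner_apply, basisVec]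
      rw [Finset.sum_mul]
      refine Finset.sum_congr rfl fun i _ => ?_
      simp [PiLp.single_apply]
      ring
    · exact fun i _ => hT.integrable_face hd hF
        (continuous_const.mul ((hwi i).mul hr).continuous).continuousOn
  have hL : ∑ i, ∫ x, fderiv ℝ (fun x => w x i * r x) x (basisVec i) ∂(cellMeas T) =
      ∫ x, divergence w x * r x ∂(cellMeas T) +
        ∑ i, ∫ x, w x i * fderiv ℝ r x (basisVec i) ∂(cellMeas T) := by
    have h1 : ∀ i x, fderiv ℝ (fun x => w x i * r x) x (basisVec i) =
        w x i * fderiv ℝ r x (basisVec i) + r x * fderiv ℝ (fun x => w x i) x (basisVec i) :=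
      fun i x => by
        have e : fderiv ℝ (fun x => w x i * r x) x = _ :=
          (((hwi i).differentiable one_ne_zero x).hasFDerivAt.mul
            (hr.differentiable one_ne_zero x).hasFDerivAt).fderiv
        rw [e]; simp
    simp only [h1]
    have h2 : ∀ i, ∫ x, (w x i * fderiv ℝ r x (basisVec i) +
        r x * fderiv ℝ (fun x => w x i) x (basisVec i)) ∂(cellMeas T) = _ := fun i =>
      integral_add (integrable_cell (by fun_prop)) (integrable_cell (by fun_prop))
    simp only [h2, Finset.sum_add_distrib]
    rw [add_comm, ← integral_finsetSum _ fun i _ => integrable_cell (by fun_prop)]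
    congr 1
    refine integral_congr_ae (.of_forall fun x => ?_)
    change _ = divergence w x * r x
    rw [divergence_eq (hw.differentiable one_ne_zero x), Finset.sum_mul]
    exact Finset.sum_congr rfl fun i _ => mul_comm _ _
  rw [hL, hR] at hsum
  linarith


/-! ### Stability and unisolvence of the Raviart--Thomas--Nédélec degrees of freedom -/

variable {d : ℕ} {l : ℤ} {T F : Finset (Euc d)} {a b : Euc d}

lemma sum_smul_basisVec (x : Euc d) : ∑ i, x i • (basisVec i : Euc d) = x := by
  ext j; simp [basisVec, Pi.single_apply, Finset.sum_apply]

lemma inner_basisVec (x : Euc d) (i : Fin d) : ⟪x, basisVec i⟫ = x i := by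
  simp [basisVec, EuclideanSpace.inner_single_right]

lemma norm_basisVec (i : Fin d) : ‖(basisVec i : Euc d)‖ = 1 := by
  simp [basisVec]

lemma bary_mem_poly : (bary T a : Euc d → ℝ) ∈ poly d 1 := by
  have e : (bary T a : Euc d → ℝ) = (fun _ => bary T a 0) +
      ∑ i, (bary T a).linear (basisVec i) • fun x : Euc d => x i := by
    ext x
    have h := bary_linear_sub (T := T) (a := a) x 0
    rw [sub_zero] at h
    have h2 : (bary T a).linear x = ∑ i, (bary T a).linear (basisVec i) * x i := by
      conv_lhs => rw [← sum_smul_basisVec x]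
      simp [mul_comm]
    simp only [Pi.add_apply, Finset.sum_apply, Pi.smul_apply, smul_eq_mul, ← h2, h]
    ring
  rw [e]
  exact add_mem (poly_mono zero_le_one (const_mem_poly _ le_rfl))
    (sum_mem fun i _ => Submodule.smul_mem _ _ (coord_mem_poly i))

lemma proj_mem_poly (v : Euc d) {g : Euc d → ℝ} (hg : g ∈ poly d l) :
    (fun x => g (x - bary T a x • v)) ∈ poly d l := by
  refine comp_mem_poly (fun i => ?_) hg
  have h := sub_mem (coord_mem_poly (d := d) i)
    (Submodule.smul_mem _ (v i) (bary_mem_poly (T := T) (a := a)))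
  convert h using 1
  ext x
  simp [mul_comm]

/-- The `L²(T)`-norm of a function which is constant in the direction of the edge `ab` is controlled
by its norm on the face opposite to `a`. -/
lemma IsSimplex.integral_proj_le (hd : 0 < d) (hT : IsSimplex T) (ha : a ∈ T) (hb : b ∈ T)
    (hab : a ≠ b) {g : Euc d → ℝ} (hg : Continuous g) :
    ∫ x, g (x - bary T a x • (a - b)) ^ 2 ∂(cellMeas T) ≤
      height T a * ∫ x, g x ^ 2 ∂(faceMeas (T.erase a)) := by
  obtain ⟨h1, -, -⟩ := hT.linear_bary_sub ha hb hab
  have hc : Continuous fun x => g (x - bary T a x • (a - b)) ^ 2 :=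
    (hg.comp (continuous_id.sub (continuous_bary.smul continuous_const))).pow 2
  rw [hT.integral_cell_eq hd ha hb hab hc.continuousOn]
  refine mul_le_mul_of_nonneg_left ?_ (hT.height_pos hd ha).le
  have e : ∀ y ∈ hull (T.erase a), ∫ t in (0 : ℝ)..bary T b y,
      g (y + t • (a - b) - bary T a (y + t • (a - b)) • (a - b)) ^ 2 = bary T b y * g y ^ 2 := by
    intro y hy
    have : ∀ t : ℝ, y + t • (a - b) - bary T a (y + t • (a - b)) • (a - b) = y := fun t => by
      rw [bary_add_smul, h1, ((hT.mem_hull_erase_iff ha).1 hy).2]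
      simp
    simp [this]
  have hF := hT.erase_mem_facesOf ha
  have e2 : ∫ y, (∫ t in (0 : ℝ)..bary T b y,
      g (y + t • (a - b) - bary T a (y + t • (a - b)) • (a - b)) ^ 2) ∂(faceMeas (T.erase a)) =
      ∫ y, bary T b y * g y ^ 2 ∂(faceMeas (T.erase a)) :=
    setIntegral_congr_fun measurableSet_hull e
  rw [e2]
  refine setIntegral_mono_on ?_ ?_ measurableSet_hull fun y hy => ?_
  · exact hT.integrable_face hd hF (continuous_bary.mul (hg.pow 2)).continuousOn
  · exact hT.integrable_face hd hF (hg.pow 2).continuousOn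
  · have h2 : bary T b y ≤ 1 := hT.bary_le_one hb ((hT.mem_hull_erase_iff ha).1 hy).1
    nlinarith [sq_nonneg (g y)]

lemma IsSimplex.exists_closedBall (hd : 0 < d) (hT : IsSimplex T) :
    ∃ κ : ℝ, 0 < κ ∧ IsShapeRegular κ T := by
  have hne : (interior (hull T)).Nonempty := by
    refine ⟨∑ b ∈ T, ((d + 1 : ℝ)⁻¹) • b, hT.mem_interior_iff.2 fun a ha => ?_⟩
    have e : bary T a (∑ b ∈ T, ((d + 1 : ℝ)⁻¹) • b) = (d + 1 : ℝ)⁻¹ := by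
      have hsum : ∑ _b ∈ T, ((d + 1 : ℝ)⁻¹) = 1 := by
        rw [Finset.sum_const, hT.card, nsmul_eq_mul]; push_cast; field_simp
      have h := Finset.map_affineCombination T id (fun _ => ((d + 1 : ℝ)⁻¹)) hsum (bary T a)
      rw [Finset.affineCombination_eq_linear_combination _ _ _ hsum,
        Finset.affineCombination_eq_linear_combination _ _ _ hsum] at h
      simp only [id, Function.comp] at h
      rw [h, Finset.sum_eq_single a]
      · simp [hT.bary_self ha]
      · intro c hc hca; simp [hT.bary_ne ha hc hca.symm]
      · exact fun h => absurd ha h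
    rw [e]; positivity
  obtain ⟨c, hc⟩ := hne
  obtain ⟨r, hr, hball⟩ := Metric.nhds_basis_closedBall.mem_iff.1 (mem_interior_iff_mem_nhds.1 hc)
  refine ⟨r / diam T, div_pos hr (hT.diam_pos hd), hT, c, ?_⟩
  rwa [div_mul_cancel₀ _ (hT.diam_pos hd).ne']

/-- A continuous function whose square has a zero integral over a simplex vanishes in an open
ball. -/
lemma IsSimplex.exists_ball_eq_zero {H : Type*} [NormedAddCommGroup H] (hd : 0 < d)
    (hT : IsSimplex T) {g : Euc d → H} (hg : Continuous g)
    (h : ∫ x, ‖g x‖ ^ 2 ∂(cellMeas T) ≤ 0) :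
    ∃ (c : Euc d) (r : ℝ), 0 < r ∧ ∀ x ∈ Metric.ball c r, g x = 0 := by
  obtain ⟨κ, hκ, -, c, hc⟩ := hT.exists_closedBall hd
  have hi : Integrable (fun x => ‖g x‖ ^ 2) (cellMeas T) :=
    integrable_cell (hg.norm.pow 2).continuousOn
  have h0 : ∫ x, ‖g x‖ ^ 2 ∂(cellMeas T) = 0 := le_antisymm h (integral_nonneg fun _ => sq_nonneg _)
  rw [integral_eq_zero_iff_of_nonneg (fun _ => sq_nonneg _) hi] at h0
  refine ⟨c, κ * diam T, mul_pos hκ (hT.diam_pos hd), fun x hx => ?_⟩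
  have h1 := ae_restrict_of_ae_restrict_of_subset (Metric.ball_subset_closedBall.trans hc) h0
  have h2 := Measure.eqOn_open_of_ae_eq (μ := (volume : Measure (Euc d))) h1 Metric.isOpen_ball
    (hg.norm.pow 2).continuousOn continuousOn_const
  simpa using h2 hx

lemma IsScalable.eq_zero_of_integral {E : Type*} [NormedAddCommGroup E] [NormedSpace ℝ E]
    {V : Submodule ℝ (Euc d → E)} (hV : IsScalable V) (hd : 0 < d) (hT : IsSimplex T)
    {w : Euc d → E} (hw : w ∈ V) (h : ∫ x, ‖w x‖ ^ 2 ∂(cellMeas T) ≤ 0) : w = 0 := by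
  obtain ⟨c, r, hr, hz⟩ := hT.exists_ball_eq_zero hd (hV.contDiff w hw).continuous h
  exact hV.eq_zero hw hr hz

/-- A polynomial whose square has a zero integral over a face vanishes on this face. -/
lemma IsSimplex.eq_zero_of_integral_face (hd : 0 < d) (hT : IsSimplex T) (hF : F ∈ facesOf T)
    {g : Euc d → ℝ} (hg : g ∈ poly d l) (h : ∫ x, g x ^ 2 ∂(faceMeas F) ≤ 0) :
    ∀ x ∈ hull F, g x = 0 := by
  obtain ⟨a, ha, rfl⟩ := hT.mem_facesOf_iff.1 hF
  obtain ⟨b, hb, hba⟩ := hT.exists_ne hd a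
  have h1 := hT.integral_proj_le hd ha hb hba.symm (continuous_of_mem_poly hg)
  have h2 := (isScalable_poly l).eq_zero_of_integral hd hT
    (proj_mem_poly (T := T) (a := a) (a - b) hg) (by
      simp only [Real.norm_eq_abs, sq_abs]
      exact h1.trans (mul_nonpos_of_nonneg_of_nonpos (hT.height_pos hd ha).le h))
  intro x hx
  have := congrFun h2 x
  simpa [((hT.mem_hull_erase_iff ha).1 hx).2] using this

lemma norm_fderiv_apply_basisVec_sq_le {H : Type*} [NormedAddCommGroup H] [NormedSpace ℝ H]
    (A : Euc d →L[ℝ] H) (i : Fin d) : ‖A (basisVec i)‖ ^ 2 ≤ ‖A‖ ^ 2 := by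
  refine pow_le_pow_left₀ (norm_nonneg _) ((A.le_opNorm _).trans_eq ?_) 2
  rw [norm_basisVec, mul_one]

lemma inner_eq_sum (x y : Euc d) : ⟪x, y⟫ = ∑ i, x i * y i := by
  simp [PiLp.inner_apply, mul_comm]

lemma abs_coord_le (x : Euc d) (i : Fin d) : |x i| ≤ ‖x‖ := by
  rw [← inner_basisVec x i]
  exact (abs_real_inner_le_norm _ _).trans_eq (by rw [norm_basisVec, mul_one])

/-- A vector is controlled by its components normal to the faces of a simplex. -/
lemma IsShapeRegular.norm_le (hd : 0 < d) {κ : ℝ} (hκ : 0 < κ) (hT : IsShapeRegular κ T)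
    (v : Euc d) : κ * ‖v‖ ≤ ∑ F ∈ facesOf T, |⟪v, normal T F⟫| := by
  obtain ⟨hT, c, hc⟩ := hT
  obtain ⟨b, hb⟩ := hT.card_pos
  have hh := hT.diam_pos hd
  have hlin : ∀ a, (bary T a).linear v = bary T a v - bary T a 0 := fun a => by
    rw [← bary_linear_sub, sub_zero]
  have hv : v = ∑ a ∈ T, (bary T a).linear v • (a - b) := by
    simp only [smul_sub, Finset.sum_sub_distrib, ← Finset.sum_smul, hlin, hT.sum_bary, sub_smul,
      hT.sum_bary_smul]
    simp
  rw [hT.sum_facesOf fun F => |⟪v, normal T F⟫|]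
  calc κ * ‖v‖ ≤ κ * ∑ a ∈ T, ‖(bary T a).linear v • (a - b)‖ := by
        refine mul_le_mul_of_nonneg_left ?_ hκ.le
        conv_lhs => rw [hv]
        exact norm_sum_le _ _
    _ ≤ ∑ a ∈ T, |⟪v, normal T (T.erase a)⟫| := by
        rw [Finset.mul_sum]
        refine Finset.sum_le_sum fun a ha => ?_
        have h1 := hT.le_height hd ha (mul_nonneg hκ.le hh.le) hc
        rw [real_inner_comm, hT.inner_normal hd ha, abs_neg, abs_mul,
          abs_of_pos (hT.height_pos hd ha), norm_smul, Real.norm_eq_abs]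
        have h2 : ‖a - b‖ ≤ diam T := by
          rw [← dist_eq_norm]
          exact Metric.dist_le_diam_of_mem isBounded_hull (mem_hull ha) (mem_hull hb)
        calc κ * (|(bary T a).linear v| * ‖a - b‖)
            ≤ κ * (|(bary T a).linear v| * diam T) := by gcongr
          _ = (κ * diam T) * |(bary T a).linear v| := by ring
          _ ≤ _ := by gcongr


variable {d : ℕ} {l : ℤ} {T F : Finset (Euc d)} {a b : Euc d} {κ : ℝ}

/-- A bound `D` on the squares of the dual norms of the Raviart--Thomas--Nédélec degrees of freedom
of a field `w`. -/
def DofBound (l : ℤ) (T : Finset (Euc d)) (D : ℝ) (w : Euc d → Euc d) : Prop :=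
  (∀ i, ∀ r ∈ poly d (l - 2), (∫ x, w x i * r x ∂(cellMeas T)) ^ 2 ≤
    D * ∫ x, r x ^ 2 ∂(cellMeas T)) ∧
  ∀ F ∈ facesOf T, ∀ r ∈ poly d (l - 1),
    diam T * (∫ x, ⟪w x, normal T F⟫ * r x ∂(faceMeas F)) ^ 2 ≤ D * ∫ x, r x ^ 2 ∂(faceMeas F)

/-- The divergence of a Raviart--Thomas--Nédélec field is controlled by the degrees of freedom. It
is a polynomial of degree `l - 1`, so that after integration by parts `∫_T (div w)²` involves only
the moments in `DofBound`; inverse inequalities conclude. -/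
lemma exists_divergence_le (hd : 0 < d) (l : ℤ) (hκ : 0 < κ) : ∃ C : ℝ, 0 < C ∧
    ∀ T : Finset (Euc d), IsShapeRegular κ T → ∀ w ∈ rtn d l, ∀ D, 0 ≤ D → DofBound l T D w →
      diam T ^ 2 * ∫ x, divergence w x ^ 2 ∂(cellMeas T) ≤ C * D := by
  obtain ⟨C₁, hC₁, h₁⟩ := (isScalable_poly (d := d) (l - 1)).exists_fderiv_le hd hκ
  obtain ⟨C₂, hC₂, h₂⟩ := (isScalable_poly (d := d) (l - 1)).exists_trace_le hd hκ
  refine ⟨2 * (d * (d * C₁)) + 2 * ((d + 1) * ((d + 1) * C₂)), by positivity,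
    fun T hT w hw D hD hb => ?_⟩
  have hr := divergence_mem_poly (rtn_le_vec hw)
  have hw1 : ContDiff ℝ 1 w := contDiff_of_mem_vec (rtn_le_vec hw)
  have hibp := hT.1.integral_divergence_mul hd hw1 (contDiff_of_mem_poly hr)
  have h₁' := h₁ T hT _ hr
  have h₂' := fun F hF => h₂ T hT F hF _ hr
  simp only [Real.norm_eq_abs, sq_abs] at h₁' h₂'
  set r := divergence w with hrdef
  set X := ∫ x, r x ^ 2 ∂(cellMeas T) with hX
  have hX0 : 0 ≤ X := integral_nonneg fun _ => sq_nonneg _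
  have hXeq : X = ∫ x, r x * r x ∂(cellMeas T) := by simp only [hX, sq]
  rw [← hXeq] at hibp
  have hsum1 := sq_sum_le_card_mul_sum_sq (s := Finset.univ)
    (f := fun i => ∫ x, w x i * fderiv ℝ r x (basisVec i) ∂(cellMeas T))
  have hsum2 := sq_sum_le_card_mul_sum_sq (s := facesOf T)
    (f := fun F => ∫ x, ⟪w x, normal T F⟫ * r x ∂(faceMeas F))
  have hb1 : diam T ^ 2 * ∑ i, (∫ x, w x i * fderiv ℝ r x (basisVec i) ∂(cellMeas T)) ^ 2 ≤
      d * (C₁ * D * X) := by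
    rw [Finset.mul_sum]
    refine (Finset.sum_le_card_nsmul _ _ (C₁ * D * X) fun i _ => ?_).trans_eq (by simp)
    have h3 := hb.1 i (fun x => fderiv ℝ r x (basisVec i)) (by
      have := fderiv_mem_poly hr (basisVec i)
      rwa [sub_sub, one_add_one_eq_two] at this)
    have hcf : Continuous (fderiv ℝ r) := (isScalable_poly (l - 1)).continuous_fderiv hr
    have h4 : ∫ x, (fderiv ℝ r x (basisVec i)) ^ 2 ∂(cellMeas T) ≤
        ∫ x, ‖fderiv ℝ r x‖ ^ 2 ∂(cellMeas T) :=
      integral_mono (integrable_cell (Continuous.continuousOn (by fun_prop)))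
        (integrable_cell (Continuous.continuousOn (by fun_prop))) fun x => by
          have := norm_fderiv_apply_basisVec_sq_le (fderiv ℝ r x) i
          rwa [Real.norm_eq_abs, sq_abs] at this
    calc _ ≤ diam T ^ 2 * (D * ∫ x, ‖fderiv ℝ r x‖ ^ 2 ∂(cellMeas T)) := by
          gcongr; exact h3.trans (by gcongr)
      _ = D * (diam T ^ 2 * ∫ x, ‖fderiv ℝ r x‖ ^ 2 ∂(cellMeas T)) := by ring
      _ ≤ D * (C₁ * X) := by gcongr
      _ = _ := by ring
  have hb2 : diam T ^ 2 * ∑ F ∈ facesOf T, (∫ x, ⟪w x, normal T F⟫ * r x ∂(faceMeas F)) ^ 2 ≤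
      (d + 1) * (C₂ * D * X) := by
    rw [Finset.mul_sum]
    refine (Finset.sum_le_card_nsmul _ _ (C₂ * D * X) fun F hF => ?_).trans_eq
      (by simp [hT.1.card_facesOf])
    calc _ = diam T * (diam T * (∫ x, ⟪w x, normal T F⟫ * r x ∂(faceMeas F)) ^ 2) := by ring
      _ ≤ diam T * (D * ∫ x, r x ^ 2 ∂(faceMeas F)) :=
        mul_le_mul_of_nonneg_left (hb.2 F hF r hr) diam_nonneg
      _ = D * (diam T * ∫ x, r x ^ 2 ∂(faceMeas F)) := by ring
      _ ≤ D * (C₂ * X) := mul_le_mul_of_nonneg_left (h₂' F hF) hD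
      _ = _ := by ring
  rw [mul_comm]
  refine mul_le_of_sq_mul_le hX0 (by positivity) ?_
  rw [Finset.card_univ, Fintype.card_fin] at hsum1
  rw [hT.1.card_facesOf] at hsum2
  push_cast at hsum2
  set A := ∑ i, ∫ x, w x i * fderiv ℝ r x (basisVec i) ∂(cellMeas T)
  set B := ∑ F ∈ facesOf T, ∫ x, ⟪w x, normal T F⟫ * r x ∂(faceMeas F)
  have hAB : X ^ 2 ≤ 2 * A ^ 2 + 2 * B ^ 2 := by rw [hibp]; nlinarith [sq_nonneg (A + B)]
  have hh : 0 ≤ diam T ^ 2 := sq_nonneg _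
  calc X ^ 2 * diam T ^ 2 ≤ (2 * A ^ 2 + 2 * B ^ 2) * diam T ^ 2 := by gcongr
    _ ≤ (2 * (d * ∑ i, (∫ x, w x i * fderiv ℝ r x (basisVec i) ∂(cellMeas T)) ^ 2) +
        2 * ((d + 1) * ∑ F ∈ facesOf T, (∫ x, ⟪w x, normal T F⟫ * r x ∂(faceMeas F)) ^ 2)) *
          diam T ^ 2 := by gcongr
    _ = 2 * (d * (diam T ^ 2 * ∑ i, (∫ x, w x i * fderiv ℝ r x (basisVec i) ∂(cellMeas T)) ^ 2)) +
        2 * ((d + 1) * (diam T ^ 2 *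
          ∑ F ∈ facesOf T, (∫ x, ⟪w x, normal T F⟫ * r x ∂(faceMeas F)) ^ 2)) := by ring
    _ ≤ 2 * (d * (d * (C₁ * D * X))) + 2 * ((d + 1) * ((d + 1) * (C₂ * D * X))) := by gcongr
    _ = _ := by ring

/-- A polynomial is controlled by its moments against polynomials of lower degree and by its values
on one face: it is the sum of a function constant along an edge which leaves this face and of a
multiple `λ r` of the barycentric coordinate `λ` which vanishes there, and `∫ λ r²` controls
`∫ r²`. -/
lemma exists_poly_le (hd : 0 < d) (l : ℤ) (hκ : 0 < κ) : ∃ C : ℝ, 0 < C ∧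
    ∀ T : Finset (Euc d), IsShapeRegular κ T → ∀ F ∈ facesOf T, ∀ g ∈ poly d l, ∀ D, 0 ≤ D →
      (∀ r ∈ poly d (l - 1), (∫ x, g x * r x ∂(cellMeas T)) ^ 2 ≤ D * ∫ x, r x ^ 2 ∂(cellMeas T)) →
      diam T * ∫ x, g x ^ 2 ∂(faceMeas F) ≤ D → ∫ x, g x ^ 2 ∂(cellMeas T) ≤ C * D := by
  obtain ⟨C₁, hC₁, h₁⟩ := (isScalable_poly (d := d) (l - 1)).exists_cell_le_ball hd
    (half_pos hκ)
  refine ⟨2 + 2 * ((C₁ * (2 / κ)) ^ 2 * 4), by positivity, fun T hT F hF g hg D hD hmom hface => ?_⟩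
  obtain ⟨hT, c, hc⟩ := hT
  have hh := hT.diam_pos hd
  obtain ⟨a, ha, rfl⟩ := hT.mem_facesOf_iff.1 hF
  obtain ⟨b, hb, hba⟩ := hT.exists_ne hd a
  obtain ⟨r, hr, hfac⟩ := exists_factor (bary_mem_poly (T := T) (a := a)) (a - b) hg
  have hgπ := proj_mem_poly (T := T) (a := a) (a - b) hg
  have hproj : ∫ x, g (x - bary T a x • (a - b)) ^ 2 ∂(cellMeas T) ≤ D :=
    (hT.integral_proj_le hd ha hb hba.symm (continuous_of_mem_poly hg)).trans
      ((mul_le_mul_of_nonneg_right (hT.height_le_diam hd ha)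
        (integral_nonneg fun _ => sq_nonneg _)).trans hface)
  have hcg := continuous_of_mem_poly hg
  have hcr := continuous_of_mem_poly hr
  have hcp := continuous_of_mem_poly hgπ
  set p := fun x => g (x - bary T a x • (a - b)) with hp
  have hcb : Continuous (bary T a) := continuous_bary
  set Y := ∫ x, r x ^ 2 ∂(cellMeas T) with hY
  have hY0 : 0 ≤ Y := integral_nonneg fun _ => sq_nonneg _
  have hcT : c ∈ hull T := hc (Metric.mem_closedBall_self (by positivity))
  have hsub : Metric.closedBall c (κ / 2 * diam T) ⊆ hull T := fun x hx =>
    hc (Metric.closedBall_subset_closedBall (by nlinarith) hx)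
  -- On the ball of half the radius, the coordinate `λ` is bounded from below.
  have hlow : ∀ x ∈ Metric.closedBall c (κ / 2 * diam T), κ / 2 ≤ bary T a x := fun x hx => by
    have h2 : Metric.closedBall x (κ / 2 * diam T) ⊆ hull T := by
      refine (Metric.closedBall_subset_closedBall' ?_).trans hc
      rw [Metric.mem_closedBall] at hx
      linarith
    refine le_trans ?_ (hT.le_bary_of_closedBall hd ha (by positivity) h2)
    rw [le_div_iff₀ (hT.height_pos hd ha)]
    exact mul_le_mul_of_nonneg_left (hT.height_le_diam hd ha) (by positivity)
  set Z := ∫ x, bary T a x * r x ^ 2 ∂(cellMeas T) with hZ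
  have hYZ : Y ≤ C₁ * (2 / κ) * Z := by
    have e1 := h₁ T c hT hcT r hr
    simp only [Real.norm_eq_abs, sq_abs] at e1
    have e2 : ∫ x in Metric.closedBall c (κ / 2 * diam T), r x ^ 2 ≤
        ∫ x in Metric.closedBall c (κ / 2 * diam T), 2 / κ * (bary T a x * r x ^ 2) := by
      refine setIntegral_mono_on ?_ ?_ Metric.isClosed_closedBall.measurableSet fun x hx => ?_
      · exact (hcr.pow 2).continuousOn.integrableOn_compact (isCompact_closedBall _ _)
      · exact (continuous_const.mul (hcb.mul (hcr.pow 2))).continuousOn.integrableOn_compact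
          (isCompact_closedBall _ _)
      · have := hlow x hx
        have h3 : 1 ≤ 2 / κ * bary T a x := by
          rw [div_mul_eq_mul_div, le_div_iff₀ hκ]; linarith
        nlinarith [sq_nonneg (r x)]
    have e3 : ∫ x in Metric.closedBall c (κ / 2 * diam T), bary T a x * r x ^ 2 ≤ Z := by
      refine setIntegral_mono_set (integrable_cell (hcb.mul (hcr.pow 2)).continuousOn) ?_
        (LE.le.eventuallyLE hsub)
      filter_upwards [ae_restrict_mem measurableSet_hull] with x hx
      exact mul_nonneg (hT.mem_hull_iff.1 hx a ha) (sq_nonneg _)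
    rw [integral_const_mul] at e2
    calc Y ≤ _ := e1
      _ ≤ C₁ * (2 / κ * Z) := by
        refine mul_le_mul_of_nonneg_left (e2.trans ?_) hC₁.le
        exact mul_le_mul_of_nonneg_left e3 (by positivity)
      _ = _ := by ring
  -- `∫ λ r² = ∫ g r - ∫ p r`, where `p` is `g` composed with the projection on the face along an
  -- edge.
  have hZeq : Z = ∫ x, g x * r x ∂(cellMeas T) - ∫ x, p x * r x ∂(cellMeas T) := by
    rw [← integral_sub (integrable_cell (Continuous.continuousOn (by fun_prop)))
      (integrable_cell (Continuous.continuousOn (by fun_prop)))]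
    refine integral_congr_ae (.of_forall fun x => ?_)
    change bary T a x * r x ^ 2 = g x * r x - p x * r x
    rw [← sub_mul, hp, hfac x]
    ring
  have hZ2 : Z ^ 2 ≤ 4 * (D * Y) := by
    have e1 := hmom r hr
    have e2 := sq_integral_mul_le (memLp_cell (T := T) hcp.continuousOn 2)
      (memLp_cell (T := T) hcr.continuousOn 2)
    have e3 : (∫ x, p x * r x ∂(cellMeas T)) ^ 2 ≤ D * Y :=
      e2.trans (mul_le_mul_of_nonneg_right hproj hY0)
    rw [hZeq]
    nlinarith [sq_nonneg (∫ x, g x * r x ∂(cellMeas T) + ∫ x, p x * r x ∂(cellMeas T))]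
  have hYD : Y ≤ (C₁ * (2 / κ)) ^ 2 * 4 * D := by
    have := mul_le_of_sq_mul_le (a := 1) (B := (C₁ * (2 / κ)) ^ 2 * 4 * D) hY0 (by positivity) (by
      calc Y ^ 2 * 1 ≤ (C₁ * (2 / κ) * Z) ^ 2 := by
            rw [mul_one]; exact pow_le_pow_left₀ hY0 hYZ 2
        _ = (C₁ * (2 / κ)) ^ 2 * Z ^ 2 := by ring
        _ ≤ (C₁ * (2 / κ)) ^ 2 * (4 * (D * Y)) := by gcongr
        _ = _ := by ring)
    linarith
  calc ∫ x, g x ^ 2 ∂(cellMeas T)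
      ≤ ∫ x, (2 * p x ^ 2 + 2 * r x ^ 2) ∂(cellMeas T) := by
        refine setIntegral_mono_on ?_ ?_ measurableSet_hull fun x hx => ?_
        · exact integrable_cell (hcg.pow 2).continuousOn
        · exact integrable_cell (Continuous.continuousOn (by fun_prop))
        · have e : g x = p x + bary T a x * r x := by
            have := hfac x
            simp only [hp]; linarith
          have h0 := hT.mem_hull_iff.1 hx a ha
          have h1 := hT.bary_le_one ha hx
          have h2 : (bary T a x * r x) ^ 2 ≤ r x ^ 2 := by
            rw [mul_pow]
            exact mul_le_of_le_one_left (sq_nonneg _) (pow_le_one₀ h0 h1)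
          rw [e]
          nlinarith [sq_nonneg (p x - bary T a x * r x)]
    _ = 2 * ∫ x, p x ^ 2 ∂(cellMeas T) + 2 * Y := by
        rw [integral_add (integrable_cell (Continuous.continuousOn (by fun_prop)))
          (integrable_cell (Continuous.continuousOn (by fun_prop))), integral_const_mul,
          integral_const_mul]
    _ ≤ 2 * D + 2 * ((C₁ * (2 / κ)) ^ 2 * 4 * D) := by gcongr
    _ = _ := by ring

/-- Stability of the degrees of freedom for full polynomials of degree `l - 1`, one normal component
at a time. -/
lemma exists_vec_le (hd : 0 < d) (l : ℤ) (hκ : 0 < κ) : ∃ C : ℝ, 0 < C ∧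
    ∀ T : Finset (Euc d), IsShapeRegular κ T → ∀ w ∈ vec (poly d (l - 1)), ∀ D, 0 ≤ D →
      DofBound l T D w → ∫ x, ‖w x‖ ^ 2 ∂(cellMeas T) ≤ C * D := by
  obtain ⟨C₁, hC₁, h₁⟩ := exists_poly_le hd (l - 1) hκ
  refine ⟨(κ ^ 2)⁻¹ * ((d + 1) * ((d + 1) * (C₁ * (d * d + 1)))), by positivity,
    fun T hT w hw D hD hb => ?_⟩
  have hcw := continuous_of_mem_vec hw
  have hcn : ∀ n, Continuous fun x => ⟪w x, n⟫ := fun n => hcw.inner continuous_const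
  have hF : ∀ F ∈ facesOf T, ∫ x, ⟪w x, normal T F⟫ ^ 2 ∂(cellMeas T) ≤ C₁ * ((d * d + 1) * D) := by
    intro F hF
    have hn : ‖normal T F‖ = 1 := by
      obtain ⟨a, ha, rfl⟩ := hT.1.mem_facesOf_iff.1 hF
      exact hT.1.norm_normal hd ha
    have hg := inner_mem_poly hw (normal T F)
    refine h₁ T hT F hF _ hg _ (by positivity) (fun r hr => ?_) ?_
    · rw [sub_sub, one_add_one_eq_two] at hr
      have hcr := continuous_of_mem_poly hr
      have e : ∫ x, ⟪w x, normal T F⟫ * r x ∂(cellMeas T) =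
          ∑ i, normal T F i * ∫ x, w x i * r x ∂(cellMeas T) := by
        simp only [← integral_const_mul]
        rw [← integral_finsetSum _ fun i _ =>
          integrable_cell (Continuous.continuousOn (by fun_prop))]
        refine integral_congr_ae (.of_forall fun x => ?_)
        simp only [inner_eq_sum, Finset.sum_mul]
        exact Finset.sum_congr rfl fun i _ => by ring
      rw [e]
      have h2 := sq_sum_le_card_mul_sum_sq (s := Finset.univ)
        (f := fun i => normal T F i * ∫ x, w x i * r x ∂(cellMeas T))
      have hY0 : 0 ≤ ∫ x, r x ^ 2 ∂(cellMeas T) := integral_nonneg fun _ => sq_nonneg _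
      refine h2.trans ?_
      have h3 : ∑ i, (normal T F i * ∫ x, w x i * r x ∂(cellMeas T)) ^ 2 ≤
          d * (D * ∫ x, r x ^ 2 ∂(cellMeas T)) := by
        refine (Finset.sum_le_card_nsmul _ _ (D * ∫ x, r x ^ 2 ∂(cellMeas T))
          fun i _ => ?_).trans_eq (by simp)
        have h4 := abs_coord_le (normal T F) i
        rw [hn] at h4
        have h5 : (normal T F i) ^ 2 ≤ 1 := by rw [← sq_abs]; nlinarith [abs_nonneg (normal T F i)]
        rw [mul_pow]
        have h6 := hb.1 i r hr
        nlinarith [sq_nonneg (∫ x, w x i * r x ∂(cellMeas T))]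
      rw [Finset.card_univ, Fintype.card_fin]
      calc (d : ℝ) * _ ≤ d * (d * (D * ∫ x, r x ^ 2 ∂(cellMeas T))) := by gcongr
        _ ≤ _ := by nlinarith [mul_nonneg hD hY0]
    · have h2 := hb.2 F hF _ hg
      have h3 : diam T * ∫ x, ⟪w x, normal T F⟫ ^ 2 ∂(faceMeas F) ≤ D := by
        rw [mul_comm]
        refine mul_le_of_sq_mul_le (integral_nonneg fun _ => sq_nonneg _) hD ?_
        rw [mul_comm]
        simpa only [← sq] using h2
      nlinarith [mul_nonneg (mul_self_nonneg (d : ℝ)) hD]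
  have hpt : ∀ x, ‖w x‖ ^ 2 ≤ (κ ^ 2)⁻¹ * ((d + 1) * ∑ F ∈ facesOf T, ⟪w x, normal T F⟫ ^ 2) := by
    intro x
    have h2 := hT.norm_le hd hκ (w x)
    have h3 := sq_sum_le_card_mul_sum_sq (s := facesOf T) (f := fun F => |⟪w x, normal T F⟫|)
    simp only [sq_abs, hT.1.card_facesOf] at h3
    push_cast at h3
    have h4 := (pow_le_pow_left₀ (by positivity) h2 2).trans h3
    rw [mul_pow] at h4
    rw [← div_eq_inv_mul, le_div_iff₀ (by positivity)]
    linarith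
  calc ∫ x, ‖w x‖ ^ 2 ∂(cellMeas T)
      ≤ ∫ x, (κ ^ 2)⁻¹ * ((d + 1) * ∑ F ∈ facesOf T, ⟪w x, normal T F⟫ ^ 2) ∂(cellMeas T) :=
        integral_mono (integrable_cell (hcw.norm.pow 2).continuousOn)
          (integrable_cell (Continuous.continuousOn (by fun_prop))) hpt
    _ = (κ ^ 2)⁻¹ * ((d + 1) * ∑ F ∈ facesOf T, ∫ x, ⟪w x, normal T F⟫ ^ 2 ∂(cellMeas T)) := by
        rw [integral_const_mul, integral_const_mul, integral_finsetSum _ fun F _ =>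
          integrable_cell (Continuous.continuousOn (by fun_prop))]
    _ ≤ (κ ^ 2)⁻¹ * ((d + 1) * ((d + 1) * (C₁ * ((d * d + 1) * D)))) := by
        gcongr
        refine (Finset.sum_le_card_nsmul _ _ _ hF).trans_eq ?_
        rw [hT.1.card_facesOf, nsmul_eq_mul]
        push_cast; ring
    _ = _ := by ring

/-- Stability of the Raviart--Thomas--Nédélec degrees of freedom. Up to an error controlled by its
divergence, the field is a full polynomial of degree `l - 1`. -/
theorem exists_rtn_le (hd : 0 < d) (l : ℤ) (hκ : 0 < κ) : ∃ C : ℝ, 0 < C ∧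
    ∀ T : Finset (Euc d), IsShapeRegular κ T → ∀ w ∈ rtn d l, ∀ D, 0 ≤ D →
      DofBound l T D w → ∫ x, ‖w x‖ ^ 2 ∂(cellMeas T) ≤ C * D := by
  obtain ⟨C₁, hC₁, h₁⟩ := exists_divergence_le hd l hκ
  obtain ⟨C₂, hC₂, h₂⟩ := exists_sub_vec_le hd l hκ
  obtain ⟨C₃, hC₃, h₃⟩ := exists_vec_le hd l hκ
  obtain ⟨C₄, hC₄, h₄⟩ := (isScalable_vec (d := d) l).exists_trace_le hd hκ
  refine ⟨2 * (C₂ * C₁) + 2 * (C₃ * (2 + 2 * (C₂ * C₁) + 2 * (C₄ * (C₂ * C₁)))), by positivity,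
    fun T hT w hw D hD hb => ?_⟩
  obtain ⟨p, hp, hwp⟩ := h₂ T hT w hw
  have hwv := rtn_le_vec hw
  have hpv : p ∈ vec (poly d l) := vec_mono (poly_mono (by omega)) hp
  have hcw := continuous_of_mem_vec hwv
  have hcp := continuous_of_mem_vec hp
  have he : ∫ x, ‖w x - p x‖ ^ 2 ∂(cellMeas T) ≤ C₂ * C₁ * D := by
    refine hwp.trans ?_
    rw [mul_assoc]
    exact mul_le_mul_of_nonneg_left (h₁ T hT w hw D hD hb) hC₂.le
  have hdp : DofBound l T ((2 + 2 * (C₂ * C₁) + 2 * (C₄ * (C₂ * C₁))) * D) p := by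
    refine ⟨fun i r hr => ?_, fun F hF r hr => ?_⟩
    · have hcr := continuous_of_mem_poly hr
      have hcwi : Continuous fun x => w x i := by fun_prop
      have hcei : Continuous fun x => (w x - p x) i := by fun_prop
      have hY0 : 0 ≤ ∫ x, r x ^ 2 ∂(cellMeas T) := integral_nonneg fun _ => sq_nonneg _
      have e : ∫ x, p x i * r x ∂(cellMeas T) =
          ∫ x, w x i * r x ∂(cellMeas T) - ∫ x, (w x - p x) i * r x ∂(cellMeas T) := by
        rw [← integral_sub (integrable_cell (Continuous.continuousOn (by fun_prop)))
          (integrable_cell (Continuous.continuousOn (by fun_prop)))]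
        refine integral_congr_ae (.of_forall fun x => ?_)
        simp; ring
      have e1 := hb.1 i r hr
      have e2 := sq_integral_mul_le (memLp_cell (T := T) hcei.continuousOn 2)
        (memLp_cell (T := T) hcr.continuousOn 2)
      have e3 : ∫ x, (w x - p x) i ^ 2 ∂(cellMeas T) ≤ C₂ * C₁ * D := by
        refine le_trans (integral_mono (integrable_cell (hcei.pow 2).continuousOn)
          (integrable_cell ((hcw.sub hcp).norm.pow 2).continuousOn) fun x => ?_) he
        have := abs_coord_le (w x - p x) i
        change (w x - p x) i ^ 2 ≤ ‖w x - p x‖ ^ 2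
        rw [← sq_abs ((w x - p x) i)]
        exact pow_le_pow_left₀ (abs_nonneg _) this 2
      have e4 := e2.trans (mul_le_mul_of_nonneg_right e3 hY0)
      rw [e]
      have h0 : 0 ≤ C₄ * (C₂ * C₁) * D * ∫ x, r x ^ 2 ∂(cellMeas T) := by positivity
      nlinarith [sq_nonneg
        (∫ x, w x i * r x ∂(cellMeas T) + ∫ x, (w x - p x) i * r x ∂(cellMeas T))]
    · have hcr := continuous_of_mem_poly hr
      have hn : ‖normal T F‖ = 1 := by
        obtain ⟨a, ha, rfl⟩ := hT.1.mem_facesOf_iff.1 hF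
        exact hT.1.norm_normal hd ha
      have hcwi : Continuous fun x => ⟪w x, normal T F⟫ := by fun_prop
      have hcei : Continuous fun x => ⟪w x - p x, normal T F⟫ := by fun_prop
      have hY0 : 0 ≤ ∫ x, r x ^ 2 ∂(faceMeas F) := integral_nonneg fun _ => sq_nonneg _
      have e : ∫ x, ⟪p x, normal T F⟫ * r x ∂(faceMeas F) =
          ∫ x, ⟪w x, normal T F⟫ * r x ∂(faceMeas F) -
            ∫ x, ⟪w x - p x, normal T F⟫ * r x ∂(faceMeas F) := by
        rw [← integral_sub (hT.1.integrable_face hd hF (Continuous.continuousOn (by fun_prop)))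
          (hT.1.integrable_face hd hF (Continuous.continuousOn (by fun_prop)))]
        refine integral_congr_ae (.of_forall fun x => ?_)
        simp [inner_sub_left]; ring
      have e1 := hb.2 F hF r hr
      have e2 := sq_integral_mul_le (hT.1.memLp_face hd hF hcei.continuousOn 2)
        (hT.1.memLp_face hd hF hcr.continuousOn 2)
      have e3 : diam T * ∫ x, ⟪w x - p x, normal T F⟫ ^ 2 ∂(faceMeas F) ≤ C₄ * (C₂ * C₁ * D) := by
        refine le_trans (mul_le_mul_of_nonneg_left (integral_mono
          (hT.1.integrable_face hd hF (hcei.pow 2).continuousOn)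
          (hT.1.integrable_face hd hF ((hcw.sub hcp).norm.pow 2).continuousOn) fun x => ?_)
          diam_nonneg) ((h₄ T hT F hF (w - p) (sub_mem hwv hpv)).trans
            (mul_le_mul_of_nonneg_left he hC₄.le))
        have := abs_real_inner_le_norm (w x - p x) (normal T F)
        rw [hn, mul_one] at this
        change ⟪w x - p x, normal T F⟫ ^ 2 ≤ ‖w x - p x‖ ^ 2
        rw [← sq_abs ⟪w x - p x, normal T F⟫]
        exact pow_le_pow_left₀ (abs_nonneg _) this 2
      have e4 : diam T * (∫ x, ⟪w x - p x, normal T F⟫ * r x ∂(faceMeas F)) ^ 2 ≤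
          C₄ * (C₂ * C₁ * D) * ∫ x, r x ^ 2 ∂(faceMeas F) := by
        refine le_trans (mul_le_mul_of_nonneg_left e2 diam_nonneg) ?_
        rw [← mul_assoc]
        exact mul_le_mul_of_nonneg_right e3 hY0
      rw [e]
      have h0 : 0 ≤ C₂ * C₁ * D * ∫ x, r x ^ 2 ∂(faceMeas F) := by positivity
      have hh : 0 ≤ diam T := diam_nonneg
      set α := ∫ x, ⟪w x, normal T F⟫ * r x ∂(faceMeas F)
      set β := ∫ x, ⟪w x - p x, normal T F⟫ * r x ∂(faceMeas F)
      have h5 : diam T * (α - β) ^ 2 ≤ 2 * (diam T * α ^ 2) + 2 * (diam T * β ^ 2) := by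
        nlinarith [mul_nonneg hh (sq_nonneg (α + β))]
      nlinarith
  have hpD := h₃ T hT p hp _ (by positivity) hdp
  have hfin := integral_norm_add_sq_le (memLp_cell (T := T) (hcw.sub hcp).continuousOn 2)
    (memLp_cell (T := T) hcp.continuousOn 2)
  simp only [Pi.sub_apply, sub_add_cancel] at hfin
  refine hfin.trans ?_
  nlinarith


/-! ### Projections and interpolates -/

section Pairing

variable {X H U V : Type*} [MeasurableSpace X] {μ : Measure X} [NormedAddCommGroup H]
  [InnerProductSpace ℝ H] [AddCommGroup U] [Module ℝ U] [AddCommGroup V] [Module ℝ V]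

/-- The bilinear form `∫ ⟪A u, B v⟫ dμ`. -/
noncomputable def pairing (μ : Measure X) (A : U →ₗ[ℝ] (X → H)) (B : V →ₗ[ℝ] (X → H))
    (hA : ∀ u, MemLp (A u) 2 μ) (hB : ∀ v, MemLp (B v) 2 μ) : U →ₗ[ℝ] V →ₗ[ℝ] ℝ :=
  LinearMap.mk₂ ℝ (fun u v => ∫ x, ⟪A u x, B v x⟫ ∂μ)
    (fun u u' v => by
      rw [← integral_add (integrable_inner (hA u) (hB v)) (integrable_inner (hA u') (hB v))]
      simp [inner_add_left])
    (fun c u v => by rw [smul_eq_mul, ← integral_const_mul]; simp [real_inner_smul_left])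
    (fun u v v' => by
      rw [← integral_add (integrable_inner (hA u) (hB v)) (integrable_inner (hA u) (hB v'))]
      simp [inner_add_right])
    (fun c u v => by rw [smul_eq_mul, ← integral_const_mul]; simp [real_inner_smul_right])

lemma pairing_apply (A : U →ₗ[ℝ] (X → H)) (B : V →ₗ[ℝ] (X → H))
    (hA : ∀ u, MemLp (A u) 2 μ) (hB : ∀ v, MemLp (B v) 2 μ) (u : U) (v : V) :
    pairing μ A B hA hB u v = ∫ x, ⟪A u x, B v x⟫ ∂μ := rfl

end Pairing

/-- Positive definite forms represent all the linear forms, in finite dimension. -/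
lemma exists_representation {V : Type*} [AddCommGroup V] [Module ℝ V] [FiniteDimensional ℝ V]
    (B : V →ₗ[ℝ] V →ₗ[ℝ] ℝ) (hB : ∀ v, B v v ≤ 0 → v = 0) (ℓ : V →ₗ[ℝ] ℝ) :
    ∃ u, ∀ v, B u v = ℓ v := by
  have hinj : Function.Injective B := (injective_iff_map_eq_zero B).2 fun v hv =>
    hB v (by rw [hv]; simp)
  have hsurj := (LinearMap.injective_iff_surjective_of_finrank_eq_finrank
    (Subspace.dual_finrank_eq (K := ℝ) (V := V)).symm).1 hinj
  obtain ⟨u, hu⟩ := hsurj ℓ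
  exact ⟨u, fun v => by rw [hu]⟩

variable {d : ℕ} {l : ℤ} {T F : Finset (Euc d)} {a b : Euc d} {κ : ℝ}

lemma inner_mul (x y : ℝ) : ⟪x, y⟫ = x * y := by simp [mul_comm]

lemma memLp_coord {μ : Measure (Euc d)} {f : Euc d → Euc d} (hf : MemLp f 2 μ) (i : Fin d) :
    MemLp (fun x => f x i) 2 μ :=
  (EuclideanSpace.proj i : Euc d →L[ℝ] ℝ).comp_memLp' hf

lemma memLp_inner_const {μ : Measure (Euc d)} {f : Euc d → Euc d} (hf : MemLp f 2 μ) (n : Euc d) :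
    MemLp (fun x => ⟪f x, n⟫) 2 μ := by
  have := (innerSL ℝ n : Euc d →L[ℝ] ℝ).comp_memLp' hf
  refine this.congr_norm ?_ (.of_forall fun x => ?_)
  · exact (hf.aestronglyMeasurable.inner aestronglyMeasurable_const)
  · simp [real_inner_comm]

lemma integrable_mul_memLp {μ : Measure (Euc d)} {f g : Euc d → ℝ} (hf : MemLp f 2 μ)
    (hg : MemLp g 2 μ) : Integrable (fun x => f x * g x) μ := by
  simpa only [inner_mul] using integrable_inner hf hg

lemma IsSimplex.memLp_facePoly (hd : 0 < d) (hT : IsSimplex T) (hF : F ∈ facesOf T)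
    {p : Euc d → ℝ} (hp : p ∈ facePoly l F) : MemLp p 2 (faceMeas F) := by
  obtain ⟨q, hq, rfl⟩ := hp
  refine hT.memLp_face hd hF ?_ 2
  exact (continuous_of_mem_poly hq).continuousOn.congr fun x hx => indicator_of_mem hx _

lemma IsSimplex.eq_zero_of_mem_facePoly (hd : 0 < d) (hT : IsSimplex T) (hF : F ∈ facesOf T)
    {p : Euc d → ℝ} (hp : p ∈ facePoly l F) (h : ∫ x, p x ^ 2 ∂(faceMeas F) ≤ 0) : p = 0 := by
  obtain ⟨q, hq, rfl⟩ := hp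
  have e : ∫ x, (hull F).indicator q x ^ 2 ∂(faceMeas F) = ∫ x, q x ^ 2 ∂(faceMeas F) :=
    setIntegral_congr_fun measurableSet_hull fun x hx => by simp [hx]
  rw [e] at h
  ext x
  by_cases hx : x ∈ hull F
  · rw [indicator_of_mem hx]; exact hT.eq_zero_of_integral_face hd hF hq h x hx
  · rw [indicator_of_notMem hx]; rfl

lemma IsSimplex.exists_isL2Proj_face (hd : 0 < d) (hT : IsSimplex T) (hF : F ∈ facesOf T)
    (l : ℤ) {g : Euc d → ℝ} (hg : MemLp g 2 (faceMeas F)) :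
    ∃ p, IsL2Proj (facePoly l F) (faceMeas F) g p := by
  have hm : ∀ v : facePoly l F, MemLp ((facePoly l F).subtype v) 2 (faceMeas F) :=
    fun v => hT.memLp_facePoly hd hF v.2
  let G : ℝ →ₗ[ℝ] (Euc d → ℝ) := LinearMap.toSpanSingleton ℝ _ g
  have hG : ∀ c, MemLp (G c) 2 (faceMeas F) := fun c => hg.const_smul c
  obtain ⟨u, hu⟩ := exists_representation (pairing (faceMeas F) (facePoly l F).subtype
    (facePoly l F).subtype hm hm) (fun v hv => by
      rw [pairing_apply] at hv
      refine Subtype.ext (hT.eq_zero_of_mem_facePoly hd hF v.2 ?_)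
      simpa [sq] using hv) (pairing (faceMeas F) G (facePoly l F).subtype hG hm 1)
  refine ⟨u, u.2, fun r hr => ?_⟩
  have := hu ⟨r, hr⟩
  simpa [pairing_apply, G, mul_comm] using this

lemma IsSimplex.isL2Proj_face_unique (hd : 0 < d) (hT : IsSimplex T) (hF : F ∈ facesOf T)
    {g p p' : Euc d → ℝ} (hp : IsL2Proj (facePoly l F) (faceMeas F) g p)
    (hp' : IsL2Proj (facePoly l F) (faceMeas F) g p') : p = p' := by
  have hs : p - p' ∈ facePoly l F := sub_mem hp.1 hp'.1
  have hm := hT.memLp_facePoly hd hF hs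
  rw [← sub_eq_zero]
  refine hT.eq_zero_of_mem_facePoly hd hF hs (le_of_eq ?_)
  have e : ∫ x, (p - p') x ^ 2 ∂(faceMeas F) =
      ∫ x, p x * (p - p') x ∂(faceMeas F) - ∫ x, p' x * (p - p') x ∂(faceMeas F) := by
    rw [← integral_sub (integrable_mul_memLp (hT.memLp_facePoly hd hF hp.1) hm)
      (integrable_mul_memLp (hT.memLp_facePoly hd hF hp'.1) hm)]
    refine integral_congr_ae (.of_forall fun x => ?_)
    simp; ring
  rw [e, hp.2 _ hs, hp'.2 _ hs, sub_self]

lemma IsSimplex.exists_isFaceProj (hd : 0 < d) (hT : IsSimplex T) (hF : F ∈ facesOf T)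
    (l : ℤ) {g : Euc d → Euc d} (hg : MemLp g 2 (faceMeas F)) : ∃ w, IsFaceProj l F g w := by
  choose p hp using fun i => hT.exists_isL2Proj_face hd hF l (memLp_coord hg i)
  exact ⟨fun x => WithLp.toLp 2 fun i => p i x, hp⟩

lemma IsSimplex.isFaceProj_unique (hd : 0 < d) (hT : IsSimplex T) (hF : F ∈ facesOf T)
    {g w w' : Euc d → Euc d} (hw : IsFaceProj l F g w) (hw' : IsFaceProj l F g w') : w = w' := by
  ext x i
  exact congrFun (hT.isL2Proj_face_unique hd hF (hw i) (hw' i)) x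

lemma IsSimplex.faceProj_spec (hd : 0 < d) (hT : IsSimplex T) (hF : F ∈ facesOf T)
    (l : ℤ) {g : Euc d → Euc d} (hg : MemLp g 2 (faceMeas F)) :
    IsFaceProj l F g (faceProj l F g) :=
  Classical.epsilon_spec (hT.exists_isFaceProj hd hF l hg)

lemma IsSimplex.integral_facePoly_sq_le (hd : 0 < d) (hT : IsSimplex T) (hF : F ∈ facesOf T)
    {g p : Euc d → ℝ} (hg : MemLp g 2 (faceMeas F))
    (hp : IsL2Proj (facePoly l F) (faceMeas F) g p) :
    ∫ x, p x ^ 2 ∂(faceMeas F) ≤ ∫ x, g x ^ 2 ∂(faceMeas F) := by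
  have hm := hT.memLp_facePoly hd hF hp.1
  have h1 := hp.2 p hp.1
  have h2 := sq_integral_mul_le hg hm
  rw [← h1] at h2
  simp only [← sq] at h2
  have h3 := mul_le_of_sq_mul_le (a := 1) (integral_nonneg fun x => sq_nonneg (p x))
    (integral_nonneg fun x => sq_nonneg (g x)) (by rw [mul_one]; exact h2)
  linarith

lemma norm_sq_eq_sum (x : Euc d) : ‖x‖ ^ 2 = ∑ i, x i ^ 2 := by
  rw [EuclideanSpace.norm_sq_eq]; simp

lemma integral_norm_sq_eq_sum {μ : Measure (Euc d)} {f : Euc d → Euc d} (hf : MemLp f 2 μ) :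
    ∫ x, ‖f x‖ ^ 2 ∂μ = ∑ i, ∫ x, f x i ^ 2 ∂μ := by
  simp only [norm_sq_eq_sum]
  exact integral_finsetSum _ fun i _ => by
    have := integrable_norm_sq (memLp_coord hf i)
    simpa using this

lemma IsSimplex.memLp_of_isFaceProj (hd : 0 < d) (hT : IsSimplex T) (hF : F ∈ facesOf T)
    {w : Euc d → Euc d} (hw : w ∈ vec (facePoly l F)) : MemLp w 2 (faceMeas F) := by
  choose q hq using hw
  have e : w =ᵐ[faceMeas F] fun x => WithLp.toLp 2 fun i => q i x := by
    filter_upwards [ae_restrict_mem measurableSet_hull] with x hx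
    ext i
    have := congrFun (hq i).2 x
    simpa [hx] using this
  refine (memLp_congr_ae e).2 (hT.memLp_face hd hF (Continuous.continuousOn ?_) 2)
  exact (PiLp.continuous_toLp 2 _).comp
    (continuous_pi fun i => continuous_of_mem_poly (hq i).1)

/-- Orthogonal projections do not increase the norm. -/
lemma IsSimplex.integral_faceProj_le (hd : 0 < d) (hT : IsSimplex T) (hF : F ∈ facesOf T)
    {g w : Euc d → Euc d} (hg : MemLp g 2 (faceMeas F)) (hw : IsFaceProj l F g w) :
    ∫ x, ‖w x‖ ^ 2 ∂(faceMeas F) ≤ ∫ x, ‖g x‖ ^ 2 ∂(faceMeas F) := by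
  rw [integral_norm_sq_eq_sum hg,
    integral_norm_sq_eq_sum (hT.memLp_of_isFaceProj hd hF fun i => (hw i).1)]
  exact Finset.sum_le_sum fun i _ =>
    hT.integral_facePoly_sq_le hd hF (memLp_coord hg i) (hw i)

/-- The normal component on a face of a field in `RTN^ℓ` is a polynomial of degree `ℓ - 1`. -/
lemma IsSimplex.normal_mem_facePoly (hd : 0 < d) (hT : IsSimplex T) (hF : F ∈ facesOf T)
    {w : Euc d → Euc d} (hw : w ∈ rtn d l) :
    ((hull F).indicator fun x => ⟪w x, normal T F⟫) ∈ facePoly (l - 1) F := by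
  obtain ⟨a, ha, rfl⟩ := hT.mem_facesOf_iff.1 hF
  obtain ⟨b, hb, hba⟩ := hT.exists_ne hd a
  have hbF : b ∈ hull (T.erase a) := mem_hull (Finset.mem_erase.2 ⟨hba, hb⟩)
  obtain ⟨g, hg, h⟩ := exists_normal_poly hw (normal T (T.erase a)) ⟪b, normal T (T.erase a)⟫
  refine ⟨g, hg, ?_⟩
  ext x
  by_cases hx : x ∈ hull (T.erase a)
  · rw [indicator_of_mem hx, indicator_of_mem hx]
    exact h x (hT.inner_normal_face hd ha hx hbF)
  · rw [indicator_of_notMem hx, indicator_of_notMem hx]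

lemma integral_indicator_mul {f r : Euc d → ℝ} :
    ∫ x, (hull F).indicator f x * r x ∂(faceMeas F) = ∫ x, f x * r x ∂(faceMeas F) :=
  setIntegral_congr_fun measurableSet_hull fun x hx => by simp [hx]

lemma integral_mul_indicator {f r : Euc d → ℝ} :
    ∫ x, f x * (hull F).indicator r x ∂(faceMeas F) = ∫ x, f x * r x ∂(faceMeas F) :=
  setIntegral_congr_fun measurableSet_hull fun x hx => by simp [hx]

lemma eq_zero_of_dofBound (hd : 0 < d) (hT : IsSimplex T) {w : Euc d → Euc d} (hw : w ∈ rtn d l)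
    (h : DofBound l T 0 w) : w = 0 := by
  obtain ⟨κ, hκ, hκT⟩ := hT.exists_closedBall hd
  obtain ⟨C, hC, h1⟩ := exists_rtn_le hd l hκ
  exact (isScalable_rtn l).eq_zero_of_integral hd hT hw
    ((h1 T hκT w hw 0 le_rfl h).trans_eq (mul_zero C))

lemma IsSimplex.memLp_normal (hd : 0 < d) (hT : IsSimplex T) (hF : F ∈ facesOf T)
    {w : Euc d → Euc d} (hw : w ∈ rtn d l) :
    MemLp ((hull F).indicator fun x => ⟪w x, normal T F⟫) 2 (faceMeas F) :=
  hT.memLp_facePoly hd hF (hT.normal_mem_facePoly hd hF hw)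

/-- Unisolvence: the degrees of freedom are as many as the dimension of `RTN^ℓ`, and their stability
implies that they are independent. -/
theorem IsSimplex.exists_rtn (hd : 0 < d) (hT : IsSimplex T) (l : ℤ)
    (α : Fin d → poly d (l - 2) →ₗ[ℝ] ℝ)
    (β : (F : facesOf T) → facePoly (l - 1) F.1 →ₗ[ℝ] ℝ) :
    ∃ w ∈ rtn d l, (∀ i r, ∫ x, w x i * r.1 x ∂(cellMeas T) = α i r) ∧
      ∀ F r, ∫ x, (hull F.1).indicator (fun x => ⟪w x, normal T F.1⟫) x * r.1 x ∂(faceMeas F.1) =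
        β F r := by
  have hmT : ∀ v : poly d (l - 2), MemLp ((poly d (l - 2)).subtype v) 2 (cellMeas T) :=
    fun v => memLp_cell (continuous_of_mem_poly v.2).continuousOn 2
  have hmF : ∀ (F : facesOf T) (v : facePoly (l - 1) F.1),
      MemLp ((facePoly (l - 1) F.1).subtype v) 2 (faceMeas F.1) :=
    fun F v => hT.memLp_facePoly hd F.2 v.2
  let A : Fin d → rtn d l →ₗ[ℝ] (Euc d → ℝ) := fun i =>
    { toFun := fun w x => w.1 x i
      map_add' := fun _ _ => rfl
      map_smul' := fun _ _ => rfl }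
  have hA : ∀ i w, MemLp (A i w) 2 (cellMeas T) := fun i w =>
    memLp_cell (continuous_of_mem_poly (rtn_le_vec w.2 i)).continuousOn 2
  let N : facesOf T → rtn d l →ₗ[ℝ] (Euc d → ℝ) := fun F =>
    { toFun := fun w => (hull F.1).indicator fun x => ⟪w.1 x, normal T F.1⟫
      map_add' := fun v w => by
        ext x; by_cases hx : x ∈ hull F.1 <;> simp [hx, inner_add_left]
      map_smul' := fun c w => by
        ext x; by_cases hx : x ∈ hull F.1 <;> simp [hx, real_inner_smul_left] }
  have hN : ∀ F w, MemLp (N F w) 2 (faceMeas F.1) := fun F w => hT.memLp_normal hd F.2 w.2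
  let Φ : rtn d l →ₗ[ℝ] (Fin d → Module.Dual ℝ (poly d (l - 2))) ×
      ((F : facesOf T) → Module.Dual ℝ (facePoly (l - 1) F.1)) :=
    LinearMap.prod
      (LinearMap.pi fun i => pairing (cellMeas T) (A i) (poly d (l - 2)).subtype (hA i) hmT)
      (LinearMap.pi fun F => pairing (faceMeas F.1) (N F) (facePoly (l - 1) F.1).subtype (hN F)
        (hmF F))
  have hinj : Function.Injective Φ := (injective_iff_map_eq_zero Φ).2 fun w hw => by
    have h1 := congrArg Prod.fst hw
    have h2 := congrArg Prod.snd hw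
    refine Subtype.ext (eq_zero_of_dofBound hd hT w.2 ⟨fun i r hr => ?_, fun F hF r hr => ?_⟩)
    · have := LinearMap.congr_fun (congrFun h1 i) ⟨r, hr⟩
      have e : ∫ x, w.1 x i * r x ∂(cellMeas T) = 0 :=
        (integral_congr_ae (.of_forall fun x => (inner_mul _ _).symm)).trans this
      rw [e]; simp
    · have := LinearMap.congr_fun (congrFun h2 ⟨F, hF⟩) ⟨_, indicator_mem_facePoly hr⟩
      have e : ∫ x, ⟪w.1 x, normal T F⟫ * r x ∂(faceMeas F) = 0 := by
        rw [← integral_mul_indicator, ← integral_indicator_mul]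
        simpa [Φ, pairing_apply, N, mul_comm] using this
      rw [e]; simp
  have hface : ∀ F : facesOf T, Module.finrank ℝ (facePoly (l - 1) F.1) +
      Module.finrank ℝ (poly d (l - 2)) ≤ Module.finrank ℝ (poly d (l - 1)) := fun F => by
    obtain ⟨a, ha, he⟩ := hT.mem_facesOf_iff.1 F.2
    have := finrank_facePoly_le (F := F.1) (l := l - 1) (bary_mem_poly (T := T) (a := a))
      (fun h => by
        have := congrFun h a
        rw [hT.bary_self ha] at this
        exact one_ne_zero this) fun x hx => by
        rw [he] at hx
        exact ((hT.mem_hull_erase_iff ha).1 hx).2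
    rwa [sub_sub, one_add_one_eq_two] at this
  have hdim := finrank_rtn_ge (l := l) hd
  rw [sub_sub, one_add_one_eq_two] at hdim
  have hcod : Module.finrank ℝ ((Fin d → Module.Dual ℝ (poly d (l - 2))) ×
      ((F : facesOf T) → Module.Dual ℝ (facePoly (l - 1) F.1))) ≤ Module.finrank ℝ (rtn d l) := by
    have e1 : ∑ F : facesOf T, (Module.finrank ℝ (facePoly (l - 1) F.1) +
        Module.finrank ℝ (poly d (l - 2))) ≤ (d + 1) * Module.finrank ℝ (poly d (l - 1)) := by
      refine (Finset.sum_le_card_nsmul _ _ _ fun F _ => hface F).trans_eq ?_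
      rw [Finset.card_univ, Fintype.card_coe, hT.card_facesOf, smul_eq_mul]
    rw [Finset.sum_add_distrib, Finset.sum_const, Finset.card_univ, Fintype.card_coe,
      hT.card_facesOf, smul_eq_mul] at e1
    rw [Module.finrank_prod, Module.finrank_pi_fintype, Module.finrank_pi_fintype]
    simp only [Subspace.dual_finrank_eq, Finset.sum_const, Finset.card_univ, Fintype.card_fin,
      smul_eq_mul]
    nlinarith
  have heq := le_antisymm (LinearMap.finrank_le_finrank_of_injective hinj) hcod
  obtain ⟨w, hw⟩ := (LinearMap.injective_iff_surjective_of_finrank_eq_finrank heq).1 hinj (α, β)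
  have h1 := congrArg Prod.fst hw
  have h2 := congrArg Prod.snd hw
  refine ⟨w, w.2, fun i r => ?_, fun F r => ?_⟩
  · exact (integral_congr_ae (.of_forall fun x => (inner_mul _ _).symm)).trans
      (LinearMap.congr_fun (congrFun h1 i) r)
  · have := LinearMap.congr_fun (congrFun h2 F) r
    simpa [Φ, pairing_apply, N, mul_comm] using this

lemma IsSimplex.exists_isRTNInterp (hd : 0 < d) (hT : IsSimplex T) (l : ℤ) {v : Euc d → Euc d}
    {γ : Finset (Euc d) → Euc d → Euc d} (hv : MemLp v 2 (cellMeas T))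
    (hγ : ∀ F ∈ facesOf T, MemLp (γ F) 2 (faceMeas F)) : ∃ w, IsRTNInterp l T v γ w := by
  have hmT : ∀ v : poly d (l - 2), MemLp ((poly d (l - 2)).subtype v) 2 (cellMeas T) :=
    fun v => memLp_cell (continuous_of_mem_poly v.2).continuousOn 2
  have hmF : ∀ (F : facesOf T) (v : facePoly (l - 1) F.1),
      MemLp ((facePoly (l - 1) F.1).subtype v) 2 (faceMeas F.1) :=
    fun F v => hT.memLp_facePoly hd F.2 v.2
  obtain ⟨w, hw, h1, h2⟩ := hT.exists_rtn hd l
    (fun i => pairing (cellMeas T) (LinearMap.toSpanSingleton ℝ _ fun x => v x i)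
      (poly d (l - 2)).subtype (fun c => (memLp_coord hv i).const_smul c) hmT 1)
    (fun F => pairing (faceMeas F.1) (LinearMap.toSpanSingleton ℝ _ fun x => ⟪γ F x, normal T F.1⟫)
      (facePoly (l - 1) F.1).subtype (fun c => (memLp_inner_const (hγ F F.2) _).const_smul c)
      (hmF F) 1)
  refine ⟨w, hw, fun i r hr => ?_, fun F hF => ⟨hT.normal_mem_facePoly hd hF hw, fun r hr => ?_⟩⟩
  · refine (h1 i ⟨r, hr⟩).trans ?_
    change ∫ x, ⟪(LinearMap.toSpanSingleton ℝ (Euc d → ℝ) fun x => v x i) 1 x, r x⟫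
      ∂(cellMeas T) = _
    simp [mul_comm]
  · refine (h2 ⟨F, hF⟩ ⟨r, hr⟩).trans ?_
    change ∫ x, ⟪(LinearMap.toSpanSingleton ℝ (Euc d → ℝ) fun x => ⟪γ F x, normal T F⟫) 1 x,
      r x⟫ ∂(faceMeas F) = _
    simp [mul_comm]

/-- The degrees of freedom of an interpolate are bounded by the norms of the interpolated field and
of its traces. -/
lemma IsRTNInterp.dofBound (hd : 0 < d) (hT : IsSimplex T) {v : Euc d → Euc d}
    {γ : Finset (Euc d) → Euc d → Euc d} {w : Euc d → Euc d} (hv : MemLp v 2 (cellMeas T))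
    (hγ : ∀ F ∈ facesOf T, MemLp (γ F) 2 (faceMeas F)) (h : IsRTNInterp l T v γ w) :
    DofBound l T (∫ x, ‖v x‖ ^ 2 ∂(cellMeas T) +
      diam T * ∑ F ∈ facesOf T, ∫ x, ‖γ F x‖ ^ 2 ∂(faceMeas F)) w := by
  have h0 : 0 ≤ ∫ x, ‖v x‖ ^ 2 ∂(cellMeas T) := integral_norm_sq_nonneg
  have h0' : ∀ F ∈ facesOf T, 0 ≤ ∫ x, ‖γ F x‖ ^ 2 ∂(faceMeas F) := fun F _ =>
    integral_norm_sq_nonneg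
  have hh : 0 ≤ diam T := diam_nonneg
  refine ⟨fun i r hr => ?_, fun F hF r hr => ?_⟩
  · have hmr : MemLp r 2 (cellMeas T) := memLp_cell (continuous_of_mem_poly hr).continuousOn 2
    rw [h.2.1 i r hr]
    refine (sq_integral_mul_le (memLp_coord hv i) hmr).trans
      (mul_le_mul_of_nonneg_right ?_ (integral_nonneg fun _ => sq_nonneg _))
    have e : ∫ x, v x i ^ 2 ∂(cellMeas T) ≤ ∫ x, ‖v x‖ ^ 2 ∂(cellMeas T) := by
      rw [integral_norm_sq_eq_sum hv]
      exact Finset.single_le_sum (f := fun i => ∫ x, v x i ^ 2 ∂(cellMeas T))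
        (fun j _ => integral_nonneg fun _ => sq_nonneg _) (Finset.mem_univ i)
    linarith [mul_nonneg hh (Finset.sum_nonneg h0')]
  · have hmr : MemLp r 2 (faceMeas F) :=
      hT.memLp_face hd hF (continuous_of_mem_poly hr).continuousOn 2
    have hn : ‖normal T F‖ = 1 := by
      obtain ⟨a, ha, rfl⟩ := hT.mem_facesOf_iff.1 hF
      exact hT.norm_normal hd ha
    have e1 := (h.2.2 F hF).2 _ (indicator_mem_facePoly hr)
    rw [integral_indicator_mul, integral_mul_indicator, integral_mul_indicator] at e1
    rw [e1]
    have e2 := sq_integral_mul_le (memLp_inner_const (hγ F hF) (normal T F)) hmr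
    have e3 : ∫ x, ⟪γ F x, normal T F⟫ ^ 2 ∂(faceMeas F) ≤ ∫ x, ‖γ F x‖ ^ 2 ∂(faceMeas F) := by
      refine integral_mono ?_ (integrable_norm_sq (hγ F hF)) fun x => ?_
      · simpa using integrable_norm_sq (memLp_inner_const (hγ F hF) (normal T F))
      · have := abs_real_inner_le_norm (γ F x) (normal T F)
        rw [hn, mul_one] at this
        change ⟪γ F x, normal T F⟫ ^ 2 ≤ ‖γ F x‖ ^ 2
        rw [← sq_abs ⟪γ F x, normal T F⟫]
        exact pow_le_pow_left₀ (abs_nonneg _) this 2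
    have e4 := e3.trans (Finset.single_le_sum h0' hF)
    calc _ ≤ diam T * ((∑ F ∈ facesOf T, ∫ x, ‖γ F x‖ ^ 2 ∂(faceMeas F)) *
          ∫ x, r x ^ 2 ∂(faceMeas F)) := mul_le_mul_of_nonneg_left
            (e2.trans (mul_le_mul_of_nonneg_right e4 (integral_nonneg fun _ => sq_nonneg _))) hh
      _ = (diam T * ∑ F ∈ facesOf T, ∫ x, ‖γ F x‖ ^ 2 ∂(faceMeas F)) *
          ∫ x, r x ^ 2 ∂(faceMeas F) := by ring
      _ ≤ _ := mul_le_mul_of_nonneg_right (by linarith) (integral_nonneg fun _ => sq_nonneg _)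

lemma IsRTNInterp.unique (hd : 0 < d) (hT : IsSimplex T) {v : Euc d → Euc d}
    {γ : Finset (Euc d) → Euc d → Euc d} {w w' : Euc d → Euc d} (h : IsRTNInterp l T v γ w)
    (h' : IsRTNInterp l T v γ w') : w = w' := by
  rw [← sub_eq_zero]
  have hs : w - w' ∈ rtn d l := sub_mem h.1 h'.1
  have hcw := continuous_of_mem_vec (rtn_le_vec h.1)
  have hcw' := continuous_of_mem_vec (rtn_le_vec h'.1)
  refine eq_zero_of_dofBound hd hT hs ⟨fun i r hr => ?_, fun F hF r hr => ?_⟩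
  · have hcr := continuous_of_mem_poly hr
    have e : ∫ x, (w - w') x i * r x ∂(cellMeas T) = 0 := by
      rw [← sub_eq_zero.2 ((h.2.1 i r hr).trans (h'.2.1 i r hr).symm),
        ← integral_sub (integrable_cell (Continuous.continuousOn (by fun_prop)))
          (integrable_cell (Continuous.continuousOn (by fun_prop)))]
      refine integral_congr_ae (.of_forall fun x => ?_)
      simp; ring
    rw [e]; simp
  · have hcr := continuous_of_mem_poly hr
    have e1 := (h.2.2 F hF).2 _ (indicator_mem_facePoly hr)
    have e2 := (h'.2.2 F hF).2 _ (indicator_mem_facePoly hr)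
    rw [integral_indicator_mul, integral_mul_indicator] at e1 e2
    have e : ∫ x, ⟪(w - w') x, normal T F⟫ * r x ∂(faceMeas F) = 0 := by
      rw [← sub_eq_zero.2 (e1.trans e2.symm),
        ← integral_sub (hT.integrable_face hd hF (Continuous.continuousOn (by fun_prop)))
          (hT.integrable_face hd hF (Continuous.continuousOn (by fun_prop)))]
      refine integral_congr_ae (.of_forall fun x => ?_)
      simp [inner_sub_left]; ring
    rw [e]; simp

lemma IsSimplex.rtnInterp_spec (hd : 0 < d) (hT : IsSimplex T) (l : ℤ) {v : Euc d → Euc d}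
    (hv : Continuous v) : IsRTNInterp l T v (fun _ => v) (rtnInterp l T v) :=
  Classical.epsilon_spec (hT.exists_isRTNInterp hd l (memLp_cell hv.continuousOn 2)
    fun _ hF => hT.memLp_face hd hF hv.continuousOn 2)


/-! ### Velocity reconstruction and pressure gradient -/

/-- The linear form `∫ ⟪f, B v⟫ dμ`. -/
noncomputable def pairWith {X H V : Type*} [MeasurableSpace X] [NormedAddCommGroup H]
    [InnerProductSpace ℝ H] [AddCommGroup V] [Module ℝ V] (μ : Measure X) (f : X → H)
    (B : V →ₗ[ℝ] (X → H)) (hf : MemLp f 2 μ) (hB : ∀ v, MemLp (B v) 2 μ) : V →ₗ[ℝ] ℝ where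
  toFun v := ∫ x, ⟪f x, B v x⟫ ∂μ
  map_add' v w := by
    rw [← integral_add (integrable_inner hf (hB v)) (integrable_inner hf (hB w))]
    simp [inner_add_right]
  map_smul' c v := by
    rw [RingHom.id_apply, smul_eq_mul, ← integral_const_mul]; simp [real_inner_smul_right]

variable {d : ℕ} {l : ℤ} {T F : Finset (Euc d)} {k : ℕ}

lemma laplacian_eq_sum {w : Euc d → Euc d} (hw : ContDiff ℝ 2 w) (x : Euc d) :
    Laplacian.laplacian w x =
      ∑ j, fderiv ℝ (fun y => fderiv ℝ w y (basisVec j)) x (basisVec j) := by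
  rw [InnerProductSpace.laplacian_eq_iteratedFDeriv_orthonormalBasis w
    (EuclideanSpace.basisFun (Fin d) ℝ)]
  refine Finset.sum_congr rfl fun j _ => ?_
  rw [iteratedFDeriv_two_apply]
  have h1 : DifferentiableAt ℝ (fderiv ℝ w) x :=
    (hw.fderiv_right (m := 1) (by norm_num)).differentiable one_ne_zero x
  have h2 := (h1.hasFDerivAt.clm_apply (hasFDerivAt_const (basisVec j : Euc d) x)).fderiv
  have h3 : fderiv ℝ (fun y => fderiv ℝ w y (basisVec j)) x = _ := h2
  rw [h3]
  simp [basisVec]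

lemma laplacian_mem_vec {w : Euc d → Euc d} (hw : w ∈ vec (poly d l)) :
    Laplacian.laplacian w ∈ vec (poly d (l - 1 - 1)) := by
  have e : Laplacian.laplacian w =
      ∑ j, fun x => fderiv ℝ (fun y => fderiv ℝ w y (basisVec j)) x (basisVec j) := by
    ext1 x; rw [laplacian_eq_sum (contDiff_of_mem_vec hw), Finset.sum_apply]
  rw [e]
  exact sum_mem fun j _ => fderiv_mem_vec (fderiv_mem_vec hw _) _

/-- Green's formula on a simplex. -/
lemma IsSimplex.integral_frob (hd : 0 < d) (hT : IsSimplex T) {v w : Euc d → Euc d}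
    (hv : ContDiff ℝ 1 v) (hw : ContDiff ℝ 2 w) :
    ∫ x, frob (fderiv ℝ v x) (fderiv ℝ w x) ∂(cellMeas T) =
      -∫ x, ⟪v x, Laplacian.laplacian w x⟫ ∂(cellMeas T) +
        ∑ F ∈ facesOf T, ∫ x, ⟪v x, fderiv ℝ w x (normal T F)⟫ ∂(faceMeas F) := by
  have hwj : ∀ j, ContDiff ℝ 1 fun y => fderiv ℝ w y (basisVec j) := fun j =>
    (hw.fderiv_right (m := 1) (by norm_num)).clm_apply contDiff_const
  have hvc := hv.continuous
  have hvf := hv.continuous_fderiv one_ne_zero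
  have hwf := hw.continuous_fderiv two_ne_zero
  have hwc := fun j => (hwj j).continuous
  have hwff := fun j => (hwj j).continuous_fderiv one_ne_zero
  have hsum := Finset.sum_congr rfl fun j (_ : j ∈ Finset.univ) =>
    hT.integral_fderiv hd (hv.inner ℝ (hwj j)) (basisVec j)
  have hR : ∑ j, ∑ F ∈ facesOf T, ⟪basisVec j, normal T F⟫ *
      ∫ x, ⟪v x, fderiv ℝ w x (basisVec j)⟫ ∂(faceMeas F) =
        ∑ F ∈ facesOf T, ∫ x, ⟪v x, fderiv ℝ w x (normal T F)⟫ ∂(faceMeas F) := by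
    rw [Finset.sum_comm]
    refine Finset.sum_congr rfl fun F hF => ?_
    simp only [← integral_const_mul]
    rw [← integral_finsetSum _ fun i _ => hT.integrable_face hd hF
      (Continuous.continuousOn (by fun_prop))]
    refine integral_congr_ae (.of_forall fun x => ?_)
    change ∑ j, ⟪basisVec j, normal T F⟫ * ⟪v x, fderiv ℝ w x (basisVec j)⟫ = _
    conv_rhs => rw [← sum_smul_basisVec (normal T F)]
    simp only [map_sum, map_smul, inner_sum, real_inner_smul_right]
    refine Finset.sum_congr rfl fun j _ => ?_
    rw [real_inner_comm, inner_basisVec]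
  have hder : ∀ j x, fderiv ℝ (fun x => ⟪v x, fderiv ℝ w x (basisVec j)⟫) x (basisVec j) =
      ⟪v x, fderiv ℝ (fun y => fderiv ℝ w y (basisVec j)) x (basisVec j)⟫ +
        ⟪fderiv ℝ v x (basisVec j), fderiv ℝ w x (basisVec j)⟫ := fun j x =>
    fderiv_inner_apply ℝ (hv.differentiable one_ne_zero x)
      ((hwj j).differentiable one_ne_zero x) _
  rw [hR] at hsum
  rw [← hsum, neg_add_eq_sub, eq_sub_iff_add_eq, ← integral_finsetSum]
  · simp only [hder]
    rw [← integral_add]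
    · refine integral_congr_ae (.of_forall fun x => ?_)
      change frob _ _ + ⟪v x, Laplacian.laplacian w x⟫ = _
      simp only [laplacian_eq_sum hw, inner_sum, frob, Finset.sum_add_distrib]
      exact add_comm _ _
    · refine integrable_cell (Continuous.continuousOn ?_)
      unfold frob
      fun_prop
    · have : ∀ x, ⟪v x, Laplacian.laplacian w x⟫ =
        ∑ j, ⟪v x, fderiv ℝ (fun y => fderiv ℝ w y (basisVec j)) x (basisVec j)⟫ := fun x => by
          rw [laplacian_eq_sum hw, inner_sum]
      simp only [this]
      exact integrable_cell (Continuous.continuousOn (by fun_prop))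
  · intro j _
    simp only [hder]
    exact integrable_cell (Continuous.continuousOn (by fun_prop))

lemma IsSimplex.volume_pos (hd : 0 < d) (hT : IsSimplex T) : 0 < volume.real (hull T) := by
  obtain ⟨κ, hκ, -, c, hc⟩ := hT.exists_closedBall hd
  have h1 : 0 < volume.real (Metric.closedBall c (κ * diam T)) := by
    refine ENNReal.toReal_pos (Metric.measure_closedBall_pos _ _
      (mul_pos hκ (hT.diam_pos hd))).ne' (isCompact_closedBall _ _).measure_lt_top.ne
  exact h1.trans_le (measureReal_mono hc isCompact_hull.measure_lt_top.ne)

lemma frob_self_eq (A : Euc d →L[ℝ] Euc d) : frob A A = ∑ j, ‖A (basisVec j)‖ ^ 2 := by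
  simp [frob]

/-- A polynomial field with a zero gradient and a zero mean vanishes. -/
lemma IsSimplex.eq_zero_of_grad (hd : 0 < d) (hT : IsSimplex T) {r : Euc d → Euc d}
    (hr : r ∈ vec (poly d l)) (h : ∫ x, frob (fderiv ℝ r x) (fderiv ℝ r x) ∂(cellMeas T) ≤ 0)
    (h' : ∫ x, r x ∂(cellMeas T) = 0) : r = 0 := by
  have hc : ∀ j, Continuous fun x => fderiv ℝ r x (basisVec j) := fun j =>
    continuous_of_mem_vec (fderiv_mem_vec hr (basisVec j))
  have hz : ∀ j, (fun x => fderiv ℝ r x (basisVec j)) = 0 := fun j => by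
    refine (isScalable_vec (l - 1)).eq_zero_of_integral hd hT (fderiv_mem_vec hr (basisVec j))
      (le_trans ?_ h)
    refine integral_mono (integrable_cell (Continuous.continuousOn (by fun_prop)))
      (integrable_cell (Continuous.continuousOn ?_)) fun x => ?_
    · simp only [frob_self_eq]; fun_prop
    · simp only [frob_self_eq]
      exact Finset.single_le_sum (f := fun j => ‖fderiv ℝ r x (basisVec j)‖ ^ 2)
        (fun _ _ => sq_nonneg _) (Finset.mem_univ j)
  have hf : ∀ x, fderiv ℝ r x = 0 := fun x => by
    ext1 v
    rw [← sum_smul_basisVec v]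
    simp only [map_sum, map_smul, zero_apply]
    refine Finset.sum_congr rfl fun j _ => ?_
    rw [show fderiv ℝ r x (basisVec j) = 0 from congrFun (hz j) x]
  have hconst : ∀ x, r x = r 0 := fun x =>
    is_const_of_fderiv_eq_zero (differentiable_of_mem_vec hr) hf x 0
  have hvol := hT.volume_pos hd
  have : ∫ x, r x ∂(cellMeas T) = volume.real (hull T) • r 0 := by
    rw [integral_congr_ae (.of_forall hconst), cellMeas, setIntegral_const]
  rw [this, smul_eq_zero] at h'
  ext1 x
  rw [hconst x]
  exact h'.resolve_left hvol.ne'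

/-- The `j`-th partial derivative, as a linear map. -/
noncomputable def partialLin (l : ℤ) (j : Fin d) : vec (poly d l) →ₗ[ℝ] (Euc d → Euc d) where
  toFun w x := fderiv ℝ w.1 x (basisVec j)
  map_add' v w := by
    ext1 x
    have := fderiv_add (differentiable_of_mem_vec v.2 x) (differentiable_of_mem_vec w.2 x)
    exact congrArg (fun A : Euc d →L[ℝ] Euc d => A (basisVec j)) this
  map_smul' c w := by
    ext1 x
    have := fderiv_const_smul (differentiable_of_mem_vec w.2 x) c
    exact congrArg (fun A : Euc d →L[ℝ] Euc d => A (basisVec j)) this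

lemma memLp_partialLin (l : ℤ) (j : Fin d) (w : vec (poly d l)) :
    MemLp (partialLin l j w) 2 (cellMeas T) :=
  memLp_cell (continuous_of_mem_vec (fderiv_mem_vec w.2 _)).continuousOn 2

/-- The bilinear form `∫_T ∇v : ∇w`. -/
noncomputable def gradForm (T : Finset (Euc d)) (l : ℤ) :
    vec (poly d l) →ₗ[ℝ] vec (poly d l) →ₗ[ℝ] ℝ :=
  ∑ j, pairing (cellMeas T) (partialLin l j) (partialLin l j) (memLp_partialLin l j)
    (memLp_partialLin l j)

lemma gradForm_apply (v w : vec (poly d l)) :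
    gradForm T l v w = ∫ x, frob (fderiv ℝ v.1 x) (fderiv ℝ w.1 x) ∂(cellMeas T) := by
  simp only [gradForm, LinearMap.sum_apply, pairing_apply, frob]
  exact (integral_finsetSum _ fun j _ =>
    integrable_inner (memLp_partialLin l j v) (memLp_partialLin l j w)).symm

lemma gradForm_nonneg (v : vec (poly d l)) : 0 ≤ gradForm T l v v := by
  rw [gradForm_apply]
  exact integral_nonneg fun x => by
    simp only [frob_self_eq]; positivity

/-- The integral over `T`, as a linear map. -/
noncomputable def integralLin (T : Finset (Euc d)) (l : ℤ) : vec (poly d l) →ₗ[ℝ] Euc d where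
  toFun w := ∫ x, w.1 x ∂(cellMeas T)
  map_add' v w := integral_add (integrable_cell (continuous_of_mem_vec v.2).continuousOn)
    (integrable_cell (continuous_of_mem_vec w.2).continuousOn)
  map_smul' c w := integral_smul c _

lemma fderiv_apply_mem_memLp_face (hd : 0 < d) (hT : IsSimplex T) (hF : F ∈ facesOf T)
    {w : Euc d → Euc d} (hw : w ∈ vec (poly d l)) (n : Euc d) :
    MemLp (fun x => fderiv ℝ w x n) 2 (faceMeas F) :=
  hT.memLp_face hd hF (continuous_of_mem_vec (fderiv_mem_vec hw n)).continuousOn 2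

lemma memLp_laplacian {w : Euc d → Euc d} (hw : w ∈ vec (poly d l)) :
    MemLp (Laplacian.laplacian w) 2 (cellMeas T) :=
  memLp_cell (continuous_of_mem_vec (laplacian_mem_vec hw)).continuousOn 2

lemma memLp_of_mem_rtn {w : Euc d → Euc d} (hw : w ∈ rtn d l) : MemLp w 2 (cellMeas T) :=
  memLp_cell (continuous_of_mem_vec (rtn_le_vec hw)).continuousOn 2

/-- The linear form which defines the gradient of the velocity reconstruction. -/
noncomputable def reconForm (hd : 0 < d) (hT : IsSimplex T) (l : ℤ) {v : LocVel d}
    (hv : v ∈ locSpace k T) : vec (poly d l) →ₗ[ℝ] ℝ :=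
  -pairWith (cellMeas T) v.1
      { toFun := fun w => Laplacian.laplacian w.1
        map_add' := fun w w' => by
          ext1 x
          exact (contDiff_of_mem_vec w.2).contDiffAt.laplacian_add
            (contDiff_of_mem_vec w'.2).contDiffAt
        map_smul' := fun c w => by
          ext1 x
          exact InnerProductSpace.laplacian_smul c (contDiff_of_mem_vec w.2).contDiffAt }
      (memLp_of_mem_rtn hv.1) (fun w => memLp_laplacian w.2) +
    ∑ F : facesOf T, pairWith (faceMeas F.1) (v.2 F.1)
      { toFun := fun (w : vec (poly d l)) x => fderiv ℝ w.1 x (normal T F.1)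
        map_add' := fun v w => by
          ext1 x
          have := fderiv_add (differentiable_of_mem_vec v.2 x) (differentiable_of_mem_vec w.2 x)
          exact congrArg (fun A : Euc d →L[ℝ] Euc d => A (normal T F.1)) this
        map_smul' := fun c w => by
          ext1 x
          have := fderiv_const_smul (differentiable_of_mem_vec w.2 x) c
          exact congrArg (fun A : Euc d →L[ℝ] Euc d => A (normal T F.1)) this }
      (hT.memLp_of_isFaceProj hd F.2 (hv.2 F.1 F.2))
      (fun w => fderiv_apply_mem_memLp_face hd hT F.2 w.2 _)

lemma reconForm_apply (hd : 0 < d) (hT : IsSimplex T) (l : ℤ) {v : LocVel d}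
    (hv : v ∈ locSpace k T) (w : vec (poly d l)) :
    reconForm hd hT l hv w = -∫ x, ⟪v.1 x, Laplacian.laplacian w.1 x⟫ ∂(cellMeas T) +
      ∑ F ∈ facesOf T, ∫ x, ⟪v.2 F x, fderiv ℝ w.1 x (normal T F)⟫ ∂(faceMeas F) := by
  rw [← Finset.sum_coe_sort (facesOf T)]
  simp only [reconForm, LinearMap.add_apply, LinearMap.neg_apply, LinearMap.sum_apply]
  rfl

/-- The mean value being added to the gradient, the left-hand side is a positive definite form. -/
lemma IsSimplex.exists_isReconstruction (hd : 0 < d) (hT : IsSimplex T) {v : LocVel d}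
    (hv : v ∈ locSpace k T) : ∃ r, IsReconstruction k T v r := by
  let m : Euc d := if k = 0 then ∑ F ∈ facesOf T, (centerDist T F / d) • ∫ x, v.2 F x ∂(faceMeas F)
    else ∫ x, v.1 x ∂(cellMeas T)
  let I := integralLin T ((k : ℤ) + 1)
  obtain ⟨r, hr⟩ := exists_representation
    (gradForm T (k + 1) + (innerₗ (Euc d)).compl₁₂ I I) (fun r hr => by
      simp only [LinearMap.add_apply, LinearMap.compl₁₂_apply, innerₗ_apply_apply] at hr
      have h0 := gradForm_nonneg (T := T) r
      have h1 : 0 ≤ ⟪I r, I r⟫ := real_inner_self_nonneg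
      refine Subtype.ext (hT.eq_zero_of_grad hd r.2 ?_ ?_)
      · rw [← gradForm_apply]; linarith
      · have h2 : I r = 0 := inner_self_eq_zero.1 (le_antisymm (by linarith : ⟪I r, I r⟫ ≤ 0) h1)
        exact h2)
    (reconForm hd hT (k + 1) hv + innerₗ (Euc d) m ∘ₗ I)
  simp only [LinearMap.add_apply, LinearMap.compl₁₂_apply, innerₗ_apply_apply,
    LinearMap.comp_apply, gradForm_apply, reconForm_apply] at hr
  -- Constant test functions give the mean value of `r`.
  have hI : I r = m := by
    have hvol := hT.volume_pos hd
    have h2 : ∀ c : Euc d, volume.real (hull T) * ⟪I r, c⟫ = volume.real (hull T) * ⟪m, c⟫ := by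
      intro c
      have h := hr ⟨fun _ => c, const_mem_vec c (by positivity)⟩
      have hIc : I ⟨fun _ => c, const_mem_vec c (by positivity)⟩ = volume.real (hull T) • c :=
        setIntegral_const c
      have hL : Laplacian.laplacian (fun _ : Euc d => c) = 0 :=
        InnerProductSpace.laplacian_const
      rw [hIc] at h
      simpa [frob, real_inner_smul_right, hL] using h
    exact ext_inner_right ℝ fun c => mul_left_cancel₀ hvol.ne' (h2 c)
  refine ⟨r, r.2, fun w hw => ?_, hI⟩
  have h := hr ⟨w, hw⟩
  rw [hI] at h
  exact add_right_cancel h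

lemma IsSimplex.isReconstruction_unique (hd : 0 < d) (hT : IsSimplex T) {v : LocVel d}
    {r r' : Euc d → Euc d} (h : IsReconstruction k T v r) (h' : IsReconstruction k T v r') :
    r = r' := by
  rw [← sub_eq_zero]
  let R : vec (poly d ((k : ℤ) + 1)) := ⟨r, h.1⟩
  let R' : vec (poly d ((k : ℤ) + 1)) := ⟨r', h'.1⟩
  have hg : gradForm T (k + 1) (R - R') (R - R') = 0 := by
    have e1 := h.2.1 (R - R').1 (R - R').2
    have e2 := h'.2.1 (R - R').1 (R - R').2
    rw [← gradForm_apply R (R - R')] at e1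
    rw [← gradForm_apply R' (R - R')] at e2
    rw [map_sub (gradForm T (k + 1)), LinearMap.sub_apply, e1, e2, sub_self]
  refine hT.eq_zero_of_grad hd (R - R').2 (r := (R - R').1)
    (by rw [← gradForm_apply (R - R') (R - R'), hg]) ?_
  have : integralLin T (k + 1) (R - R') = 0 := by
    rw [map_sub, sub_eq_zero]; exact h.2.2.trans h'.2.2.symm
  exact this

lemma IsSimplex.reconstruction_spec (hd : 0 < d) (hT : IsSimplex T) {v : LocVel d}
    (hv : v ∈ locSpace k T) : IsReconstruction k T v (reconstruction k T v) :=
  Classical.epsilon_spec (hT.exists_isReconstruction hd hv)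

/-- The space of local discrete velocities, as a vector space. -/
def locSub (k : ℕ) (T : Finset (Euc d)) : Submodule ℝ (LocVel d) where
  carrier := locSpace k T
  zero_mem' := ⟨zero_mem _, fun _ _ => zero_mem _⟩
  add_mem' := fun ha hb => ⟨add_mem ha.1 hb.1, fun F hF => add_mem (ha.2 F hF) (hb.2 F hF)⟩
  smul_mem' := fun c _ ha => ⟨Submodule.smul_mem _ c ha.1,
    fun F hF => Submodule.smul_mem _ c (ha.2 F hF)⟩

/-- The velocity reconstruction, as a linear map. -/
noncomputable def reconLin (hd : 0 < d) (hT : IsSimplex T) (k : ℕ) :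
    locSub k T →ₗ[ℝ] vec (poly d ((k : ℤ) + 1)) where
  toFun v := ⟨reconstruction k T v, (hT.reconstruction_spec hd v.2).1⟩
  map_add' v w := by
    have hv := hT.reconstruction_spec hd v.2
    have hw := hT.reconstruction_spec hd w.2
    refine Subtype.ext (hT.isReconstruction_unique hd (hT.reconstruction_spec hd (v + w).2)
      ⟨add_mem hv.1 hw.1, fun z hz => ?_, ?_⟩)
    · have e := reconForm_apply hd hT (k + 1) (v + w).2 ⟨z, hz⟩
      rw [← e]
      have e1 := hv.2.1 z hz
      have e2 := hw.2.1 z hz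
      have hsum : gradForm T (k + 1) (⟨_, hv.1⟩ + ⟨_, hw.1⟩) ⟨z, hz⟩ =
        gradForm T (k + 1) ⟨_, hv.1⟩ ⟨z, hz⟩ + gradForm T (k + 1) ⟨_, hw.1⟩ ⟨z, hz⟩ := by
          rw [map_add, LinearMap.add_apply]
      rw [gradForm_apply, gradForm_apply, gradForm_apply, e1, e2] at hsum
      refine hsum.trans ?_
      rw [e]
      have h1 : ∫ x, ⟪(v + w).1.1 x, Laplacian.laplacian z x⟫ ∂(cellMeas T) =
          ∫ x, ⟪v.1.1 x, Laplacian.laplacian z x⟫ ∂(cellMeas T) +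
            ∫ x, ⟪w.1.1 x, Laplacian.laplacian z x⟫ ∂(cellMeas T) := by
        rw [← integral_add (integrable_inner (memLp_of_mem_rtn v.2.1) (memLp_laplacian hz))
          (integrable_inner (memLp_of_mem_rtn w.2.1) (memLp_laplacian hz))]
        simp [inner_add_left]
      have h2 : ∀ F ∈ facesOf T,
          ∫ x, ⟪(v + w).1.2 F x, fderiv ℝ z x (normal T F)⟫ ∂(faceMeas F) =
          ∫ x, ⟪v.1.2 F x, fderiv ℝ z x (normal T F)⟫ ∂(faceMeas F) +
            ∫ x, ⟪w.1.2 F x, fderiv ℝ z x (normal T F)⟫ ∂(faceMeas F) := fun F hF => by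
        rw [← integral_add
          (integrable_inner (hT.memLp_of_isFaceProj hd hF (v.2.2 F hF))
            (fderiv_apply_mem_memLp_face hd hT hF hz _))
          (integrable_inner (hT.memLp_of_isFaceProj hd hF (w.2.2 F hF))
            (fderiv_apply_mem_memLp_face hd hT hF hz _))]
        simp [inner_add_left]
      rw [Finset.sum_congr rfl h2, Finset.sum_add_distrib]
      linarith
    · refine (integral_add (integrable_cell (continuous_of_mem_vec hv.1).continuousOn)
        (integrable_cell (continuous_of_mem_vec hw.1).continuousOn)).trans ?_
      rw [hv.2.2, hw.2.2]
      split_ifs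
      · rw [← Finset.sum_add_distrib]
        refine Finset.sum_congr rfl fun F hF => ?_
        have hfin := hT.isFiniteMeasure_faceMeas hd hF
        rw [← smul_add, ← integral_add
          ((hT.memLp_of_isFaceProj hd hF (v.2.2 F hF)).integrable one_le_two)
          ((hT.memLp_of_isFaceProj hd hF (w.2.2 F hF)).integrable one_le_two)]
        rfl
      · exact (integral_add ((memLp_of_mem_rtn v.2.1).integrable one_le_two)
          ((memLp_of_mem_rtn w.2.1).integrable one_le_two)).symm
  map_smul' c v := by
    have hv := hT.reconstruction_spec hd v.2
    refine Subtype.ext (hT.isReconstruction_unique hd (hT.reconstruction_spec hd (c • v).2)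
      ⟨Submodule.smul_mem _ c hv.1, fun z hz => ?_, ?_⟩)
    · have hsmul : gradForm T (k + 1) (c • ⟨_, hv.1⟩) ⟨z, hz⟩ =
        c * gradForm T (k + 1) ⟨_, hv.1⟩ ⟨z, hz⟩ := by
          rw [map_smul, LinearMap.smul_apply, smul_eq_mul]
      rw [gradForm_apply, gradForm_apply, hv.2.1 z hz] at hsmul
      refine hsmul.trans ?_
      rw [mul_add, mul_neg, Finset.mul_sum]
      simp only [← integral_const_mul]
      simp [real_inner_smul_left]
    · refine (integral_smul c _).trans ?_
      rw [hv.2.2]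
      split_ifs
      · rw [Finset.smul_sum]
        refine Finset.sum_congr rfl fun F hF => ?_
        rw [smul_comm, ← integral_smul]
        rfl
      · exact (integral_smul c _).symm


/-! ### The local viscous form: bilinearity and coercivity -/

variable {d : ℕ} {l : ℤ} {T F : Finset (Euc d)} {k : ℕ} {κ : ℝ}

lemma IsL2Proj.add {V : Submodule ℝ (Euc d → ℝ)} {μ : Measure (Euc d)} {g g' p p' : Euc d → ℝ}
    (hV : ∀ r ∈ V, MemLp r 2 μ) (hg : MemLp g 2 μ) (hg' : MemLp g' 2 μ) (h : IsL2Proj V μ g p)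
    (h' : IsL2Proj V μ g' p') : IsL2Proj V μ (fun x => g x + g' x) (fun x => p x + p' x) := by
  refine ⟨add_mem h.1 h'.1, fun r hr => ?_⟩
  simp only [add_mul]
  rw [integral_add (integrable_mul_memLp (hV p h.1) (hV r hr))
      (integrable_mul_memLp (hV p' h'.1) (hV r hr)),
    integral_add (integrable_mul_memLp hg (hV r hr)) (integrable_mul_memLp hg' (hV r hr)),
    h.2 r hr, h'.2 r hr]

lemma IsL2Proj.smul {V : Submodule ℝ (Euc d → ℝ)} {μ : Measure (Euc d)} {g p : Euc d → ℝ}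
    (c : ℝ) (h : IsL2Proj V μ g p) : IsL2Proj V μ (fun x => c * g x) (fun x => c * p x) := by
  refine ⟨V.smul_mem c h.1, fun r hr => ?_⟩
  simp only [mul_assoc]
  rw [integral_const_mul, integral_const_mul, h.2 r hr]

lemma IsSimplex.isFaceProj_add (hd : 0 < d) (hT : IsSimplex T) (hF : F ∈ facesOf T)
    {g g' w w' : Euc d → Euc d} (hg : MemLp g 2 (faceMeas F)) (hg' : MemLp g' 2 (faceMeas F))
    (h : IsFaceProj l F g w) (h' : IsFaceProj l F g' w') : IsFaceProj l F (g + g') (w + w') :=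
  fun i => (h i).add (fun _ hr => hT.memLp_facePoly hd hF hr) (memLp_coord hg i)
    (memLp_coord hg' i) (h' i)

lemma IsFaceProj.smul {g w : Euc d → Euc d} (c : ℝ) (h : IsFaceProj l F g w) :
    IsFaceProj l F (c • g) (c • w) := fun i => (h i).smul c

lemma isL2Proj_indicator {p : Euc d → ℝ} (hp : p ∈ poly d l) :
    IsL2Proj (facePoly l F) (faceMeas F) p ((hull F).indicator p) :=
  ⟨indicator_mem_facePoly hp, fun _ _ => integral_indicator_mul⟩

lemma IsRTNInterp.add (hd : 0 < d) (hT : IsSimplex T) {v v' w w' : Euc d → Euc d}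
    (hv : Continuous v) (hv' : Continuous v') (h : IsRTNInterp l T v (fun _ => v) w)
    (h' : IsRTNInterp l T v' (fun _ => v') w') :
    IsRTNInterp l T (v + v') (fun _ => v + v') (w + w') := by
  have hcw := continuous_of_mem_vec (rtn_le_vec h.1)
  have hcw' := continuous_of_mem_vec (rtn_le_vec h'.1)
  refine ⟨add_mem h.1 h'.1, fun i r hr => ?_, fun F hF => ?_⟩
  · have hcr := continuous_of_mem_poly hr
    simp only [Pi.add_apply, PiLp.add_apply, add_mul]
    rw [integral_add (integrable_cell (Continuous.continuousOn (by fun_prop)))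
        (integrable_cell (Continuous.continuousOn (by fun_prop))),
      integral_add (integrable_cell (Continuous.continuousOn (by fun_prop)))
        (integrable_cell (Continuous.continuousOn (by fun_prop))), h.2.1 i r hr, h'.2.1 i r hr]
  · have e := (h.2.2 F hF).add (fun _ hr => hT.memLp_facePoly hd hF hr)
      (hT.memLp_face hd hF (Continuous.continuousOn (by fun_prop)) 2)
      (hT.memLp_face hd hF (Continuous.continuousOn (by fun_prop)) 2) (h'.2.2 F hF)
    convert e using 1
    · ext x; simp [inner_add_left]
    · ext x; by_cases hx : x ∈ hull F <;> simp [hx, inner_add_left]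

lemma IsRTNInterp.smul {v w : Euc d → Euc d} (c : ℝ) (h : IsRTNInterp l T v (fun _ => v) w) :
    IsRTNInterp l T (c • v) (fun _ => c • v) (c • w) := by
  refine ⟨Submodule.smul_mem _ c h.1, fun i r hr => ?_, fun F hF => ?_⟩
  · simp only [Pi.smul_apply, PiLp.smul_apply, smul_eq_mul, mul_assoc]
    rw [integral_const_mul, integral_const_mul, h.2.1 i r hr]
  · have e := (h.2.2 F hF).smul c
    convert e using 1
    · ext x; simp [real_inner_smul_left]
    · ext x; by_cases hx : x ∈ hull F <;> simp [hx, real_inner_smul_left]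

lemma IsSimplex.isRTNInterp_self (hd : 0 < d) (hT : IsSimplex T) {w : Euc d → Euc d}
    (hw : w ∈ rtn d l) : IsRTNInterp l T w (fun _ => w) w :=
  ⟨hw, fun _ _ _ => rfl, fun _ hF => ⟨hT.normal_mem_facePoly hd hF hw,
    fun _ _ => integral_indicator_mul⟩⟩

lemma continuous_recon (hd : 0 < d) (hT : IsSimplex T) (v : locSub k T) :
    Continuous (reconstruction k T v) :=
  continuous_of_mem_vec (hT.reconstruction_spec hd v.2).1

/-- The element component of `δ`, as a linear map. -/
noncomputable def deltaCell (hd : 0 < d) (hT : IsSimplex T) (k : ℕ) :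
    locSub k T →ₗ[ℝ] (Euc d → Euc d) where
  toFun v := rtnInterp (k + 1) T (reconstruction k T v) - v.1.1
  map_add' v w := by
    have e : reconstruction k T (v + w : locSub k T).1 = reconstruction k T v.1 +
      reconstruction k T w.1 := congrArg Subtype.val (map_add (reconLin hd hT k) v w)
    have hv := continuous_recon hd hT v
    have hw := continuous_recon hd hT w
    have e2 := IsRTNInterp.unique hd hT (hT.rtnInterp_spec hd (k + 1) (hv.add hw))
      ((hT.rtnInterp_spec hd (k + 1) hv).add hd hT hv hw (hT.rtnInterp_spec hd (k + 1) hw))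
    rw [e, e2]
    simp only [Submodule.coe_add, Prod.fst_add]
    abel
  map_smul' c v := by
    have e : reconstruction k T (c • v : locSub k T).1 = c • reconstruction k T v.1 :=
      congrArg Subtype.val (map_smul (reconLin hd hT k) c v)
    have hv := continuous_recon hd hT v
    have e2 := IsRTNInterp.unique hd hT (hT.rtnInterp_spec hd (k + 1) (hv.const_smul c))
      ((hT.rtnInterp_spec hd (k + 1) hv).smul c)
    change rtnInterp (k + 1) T (reconstruction k T (c • v : locSub k T).1) - c • v.1.1 = _
    rw [e]
    refine (congrArg (· - c • v.1.1) e2).trans ?_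
    rw [RingHom.id_apply, smul_sub]

/-- The face components of `δ`, as linear maps. -/
noncomputable def deltaFace (hd : 0 < d) (hT : IsSimplex T) (k : ℕ) (hF : F ∈ facesOf T) :
    locSub k T →ₗ[ℝ] (Euc d → Euc d) where
  toFun v := faceProj k F (reconstruction k T v) - v.1.2 F
  map_add' v w := by
    have e : reconstruction k T (v + w : locSub k T).1 = reconstruction k T v.1 +
      reconstruction k T w.1 := congrArg Subtype.val (map_add (reconLin hd hT k) v w)
    have hv := hT.memLp_face hd hF (continuous_recon hd hT v).continuousOn 2
    have hw := hT.memLp_face hd hF (continuous_recon hd hT w).continuousOn 2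
    have e2 := hT.isFaceProj_unique hd hF (hT.faceProj_spec hd hF k (hv.add hw))
      (hT.isFaceProj_add hd hF hv hw (hT.faceProj_spec hd hF k hv) (hT.faceProj_spec hd hF k hw))
    rw [e, e2]
    simp only [Submodule.coe_add, Prod.snd_add, Pi.add_apply]
    abel
  map_smul' c v := by
    have e : reconstruction k T (c • v : locSub k T).1 = c • reconstruction k T v.1 :=
      congrArg Subtype.val (map_smul (reconLin hd hT k) c v)
    have hv := hT.memLp_face hd hF (continuous_recon hd hT v).continuousOn 2
    have e2 := hT.isFaceProj_unique hd hF (hT.faceProj_spec hd hF k (hv.const_smul c))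
      ((hT.faceProj_spec hd hF k hv).smul c)
    change faceProj k F (reconstruction k T (c • v : locSub k T).1) - c • v.1.2 F = _
    rw [e]
    refine (congrArg (· - c • v.1.2 F) e2).trans ?_
    rw [RingHom.id_apply, smul_sub]

lemma deltaCell_mem (hd : 0 < d) (hT : IsSimplex T) (v : locSub k T) :
    deltaCell hd hT k v ∈ rtn d (k + 1) :=
  sub_mem (hT.rtnInterp_spec hd (k + 1) (continuous_recon hd hT v)).1 v.2.1

lemma deltaFace_mem (hd : 0 < d) (hT : IsSimplex T) (hF : F ∈ facesOf T) (v : locSub k T) :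
    deltaFace hd hT k hF v ∈ vec (facePoly k F) := by
  refine sub_mem (fun i => ?_) (v.2.2 F hF)
  exact (hT.faceProj_spec hd hF k
    (hT.memLp_face hd hF (continuous_recon hd hT v).continuousOn 2) i).1

open Classical in
/-- The operator `δ`, as a linear map. -/
noncomputable def deltaLin (hd : 0 < d) (hT : IsSimplex T) (k : ℕ) :
    locSub k T →ₗ[ℝ] LocVel d :=
  (deltaCell hd hT k).prod (LinearMap.pi fun F =>
    if hF : F ∈ facesOf T then deltaFace hd hT k hF else 0)

lemma deltaLin_apply (hd : 0 < d) (hT : IsSimplex T) (v : locSub k T) :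
    deltaLin hd hT k v = delta k T v := by
  refine Prod.ext rfl ?_
  funext F
  change (if hF : F ∈ facesOf T then deltaFace hd hT k hF else 0 :
    locSub k T →ₗ[ℝ] (Euc d → Euc d)) v = (delta k T v).2 F
  simp only [delta]
  split_ifs <;> rfl

lemma delta_fst (hd : 0 < d) (hT : IsSimplex T) (v : locSub k T) :
    (delta k T v).1 = deltaCell hd hT k v := rfl

lemma delta_snd (hd : 0 < d) (hT : IsSimplex T) (hF : F ∈ facesOf T) (v : locSub k T) :
    (delta k T v).2 F = deltaFace hd hT k hF v := by
  simp only [delta, if_pos hF]; rfl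

lemma memLp_deltaCell (hd : 0 < d) (hT : IsSimplex T) (v : locSub k T) :
    MemLp (deltaCell hd hT k v) 2 (cellMeas T) := memLp_of_mem_rtn (deltaCell_mem hd hT v)

lemma memLp_deltaCell_face (hd : 0 < d) (hT : IsSimplex T) (hF : F ∈ facesOf T) (v : locSub k T) :
    MemLp (deltaCell hd hT k v) 2 (faceMeas F) :=
  hT.memLp_face hd hF (continuous_of_mem_vec (rtn_le_vec (deltaCell_mem hd hT v))).continuousOn 2

lemma memLp_deltaFace (hd : 0 < d) (hT : IsSimplex T) (hF : F ∈ facesOf T) (v : locSub k T) :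
    MemLp (deltaFace hd hT k hF v) 2 (faceMeas F) :=
  hT.memLp_of_isFaceProj hd hF (deltaFace_mem hd hT hF v)

/-- The local viscous forms are bilinear. -/
lemma exists_viscT_bilin (hd : 0 < d) (hT : IsSimplex T) {η : ℝ} {Ω : Set (Euc d)}
    {K : SimplicialMesh Ω} {s : Finset (Euc d) → LocVel d → LocVel d → ℝ}
    (hs : IsStabilization K k η s) (hTK : T ∈ K.cells) :
    ∃ A : locSub k T →ₗ[ℝ] locSub k T →ₗ[ℝ] ℝ, ∀ w v, A w v = viscT k s T w v := by
  suffices h : ∃ S : locSub k T →ₗ[ℝ] locSub k T →ₗ[ℝ] ℝ, ∀ w v, S w v = s T w v by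
    obtain ⟨S, hS⟩ := h
    refine ⟨(gradForm T (k + 1)).compl₁₂ (reconLin hd hT k) (reconLin hd hT k) + S, fun w v => ?_⟩
    rw [LinearMap.add_apply, LinearMap.add_apply, hS, LinearMap.compl₁₂_apply, gradForm_apply]
    rfl
  rcases hs with rfl | rfl | hs
  · refine ⟨(((facesOf T).card * (diam T ^ d / volume.real (hull T))) * (diam T ^ 2)⁻¹) •
        pairing (cellMeas T) (deltaCell hd hT k) (deltaCell hd hT k) (memLp_deltaCell hd hT)
          (memLp_deltaCell hd hT) + (diam T)⁻¹ • ∑ F : facesOf T,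
        pairing (faceMeas F.1) (deltaFace hd hT k F.2) (deltaFace hd hT k F.2)
          (memLp_deltaFace hd hT F.2) (memLp_deltaFace hd hT F.2), fun w v => ?_⟩
    simp only [LinearMap.add_apply, LinearMap.smul_apply, LinearMap.sum_apply, pairing_apply,
      smul_eq_mul, stabDofs, delta_fst hd hT]
    rw [← Finset.sum_coe_sort (facesOf T)]
    simp only [delta_snd hd hT (Subtype.prop _)]
  · refine ⟨(diam T)⁻¹ • ∑ F : facesOf T,
        pairing (faceMeas F.1) (deltaCell hd hT k - deltaFace hd hT k F.2)
          (deltaCell hd hT k - deltaFace hd hT k F.2)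
          (fun v => (memLp_deltaCell_face hd hT F.2 v).sub (memLp_deltaFace hd hT F.2 v))
          (fun v => (memLp_deltaCell_face hd hT F.2 v).sub (memLp_deltaFace hd hT F.2 v)),
        fun w v => ?_⟩
    simp only [LinearMap.smul_apply, LinearMap.sum_apply, pairing_apply,
      smul_eq_mul, stabFaces, delta_fst hd hT]
    rw [← Finset.sum_coe_sort (facesOf T)]
    simp only [delta_snd hd hT (Subtype.prop _)]
    rfl
  · obtain ⟨⟨B, hB⟩, -⟩ := hs T hTK
    refine ⟨B.compl₁₂ (deltaLin hd hT k) (deltaLin hd hT k), fun w v => ?_⟩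
    rw [LinearMap.compl₁₂_apply, deltaLin_apply, deltaLin_apply, hB w w.2 v v.2]

lemma norm_sq_le_frob (A : Euc d →L[ℝ] Euc d) : ‖A‖ ^ 2 ≤ frob A A := by
  rw [frob_self_eq]
  have h0 : 0 ≤ ∑ j, ‖A (basisVec j)‖ ^ 2 := Finset.sum_nonneg fun _ _ => sq_nonneg _
  rw [← Real.le_sqrt (norm_nonneg _) h0]
  refine A.opNorm_le_bound (Real.sqrt_nonneg _) fun x => ?_
  conv_lhs => rw [← sum_smul_basisVec x]
  rw [← Real.sqrt_sq (norm_nonneg x), ← Real.sqrt_mul h0]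
  refine Real.le_sqrt_of_sq_le ?_
  simp only [map_sum, map_smul]
  calc ‖∑ i, x i • A (basisVec i)‖ ^ 2 ≤ (∑ i, |x i| * ‖A (basisVec i)‖) ^ 2 := by
        refine pow_le_pow_left₀ (norm_nonneg _) ((norm_sum_le _ _).trans_eq ?_) 2
        simp [norm_smul]
    _ ≤ (∑ i, |x i| ^ 2) * ∑ i, ‖A (basisVec i)‖ ^ 2 := Finset.sum_mul_sq_le_sq_mul_sq _ _ _
    _ = _ := by simp only [sq_abs]; rw [← norm_sq_eq_sum, mul_comm]

lemma continuous_frob {v w : Euc d → Euc d} (hv : Continuous (fderiv ℝ v))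
    (hw : Continuous (fderiv ℝ w)) : Continuous fun x => frob (fderiv ℝ v x) (fderiv ℝ w x) := by
  unfold frob; fun_prop

lemma IsSimplex.norm_normal' (hd : 0 < d) (hT : IsSimplex T) (hF : F ∈ facesOf T) :
    ‖normal T F‖ = 1 := by
  obtain ⟨a, ha, rfl⟩ := hT.mem_facesOf_iff.1 hF
  exact hT.norm_normal hd ha

lemma le_of_le_add_abs {X G S p q : ℝ} (hX : 0 ≤ X) (hG : 0 ≤ G) (hp : 0 ≤ p) (hq : 0 ≤ q)
    (hY : X ≤ G + 2 * |S|) (hS : S ^ 2 ≤ p * q * X) : X ≤ (2 + 16 * p) * (G + q) := by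
  have hpq := mul_nonneg hp hq
  have hpG := mul_nonneg hp hG
  rcases le_total X (2 * G) with h | h
  · linarith
  · have h3 : X ≤ 4 * |S| := by linarith
    have h4 := mul_le_of_sq_mul_le (a := 1) (B := 16 * (p * q)) hX (by positivity) (by
      have := pow_le_pow_left₀ hX h3 2
      rw [mul_pow, sq_abs] at this
      linarith)
    linarith

/-- The gradient of the element component is controlled by the gradient of the reconstruction and by
the jumps between the face and element components. -/
lemma exists_grad_le (hd : 0 < d) (k : ℕ) (hκ : 0 < κ) : ∃ C : ℝ, 0 < C ∧
    ∀ T : Finset (Euc d), IsShapeRegular κ T → ∀ v ∈ locSpace k T,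
      ∫ x, frob (fderiv ℝ v.1 x) (fderiv ℝ v.1 x) ∂(cellMeas T) ≤
        C * (∫ x, frob (fderiv ℝ (reconstruction k T v) x)
          (fderiv ℝ (reconstruction k T v) x) ∂(cellMeas T) +
          (diam T)⁻¹ * ∑ F ∈ facesOf T, ∫ x, ‖v.2 F x - v.1 x‖ ^ 2 ∂(faceMeas F)) := by
  obtain ⟨C₁, hC₁, h₁⟩ := (isScalable_vec (d := d) ((k : ℤ) + 1 - 1)).exists_trace_le hd hκ
  refine ⟨2 + 16 * ((d + 1) * C₁), by positivity, fun T hT v hv => ?_⟩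
  have hh := hT.1.diam_pos hd
  have hvv : v.1 ∈ vec (poly d ((k : ℤ) + 1)) := rtn_le_vec hv.1
  have hr := hT.1.reconstruction_spec hd hv
  let R : vec (poly d ((k : ℤ) + 1)) := ⟨_, hr.1⟩
  let V : vec (poly d ((k : ℤ) + 1)) := ⟨_, hvv⟩
  have hcv := continuous_of_mem_vec hvv
  have hcf : Continuous (fderiv ℝ v.1) := (isScalable_vec _).continuous_fderiv hvv
  -- Testing the definition of the reconstruction with `w = v_T` gives
  -- `∫ ∇R : ∇v_T = ‖∇v_T‖² + ∑_F ∫_F (v_F - v_T) · ∇v_T n`.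
  have e1 := hr.2.1 v.1 hvv
  have e2 := hT.1.integral_frob hd (v := v.1) (w := v.1) (contDiff_of_mem_vec hvv)
    (contDiff_of_mem_vec hvv)
  have hvF := fun F hF => hT.1.memLp_of_isFaceProj hd hF (hv.2 F hF)
  have hvTF := fun F (hF : F ∈ facesOf T) => hT.1.memLp_face hd hF hcv.continuousOn 2
  have hgF := fun F (hF : F ∈ facesOf T) =>
    fderiv_apply_mem_memLp_face hd hT.1 hF hvv (normal T F)
  have hS : ∑ F ∈ facesOf T, ∫ x, ⟪v.2 F x, fderiv ℝ v.1 x (normal T F)⟫ ∂(faceMeas F) =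
      ∑ F ∈ facesOf T, ∫ x, ⟪v.2 F x - v.1 x, fderiv ℝ v.1 x (normal T F)⟫ ∂(faceMeas F) +
      ∑ F ∈ facesOf T, ∫ x, ⟪v.1 x, fderiv ℝ v.1 x (normal T F)⟫ ∂(faceMeas F) := by
    rw [← Finset.sum_add_distrib]
    refine Finset.sum_congr rfl fun F hF => ?_
    refine Eq.trans ?_ (integral_add (integrable_inner ((hvF F hF).sub (hvTF F hF)) (hgF F hF))
      (integrable_inner (hvTF F hF) (hgF F hF)))
    simp [inner_sub_left]
  set X := ∫ x, frob (fderiv ℝ v.1 x) (fderiv ℝ v.1 x) ∂(cellMeas T) with hX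
  set G := ∫ x, frob (fderiv ℝ (reconstruction k T v) x)
    (fderiv ℝ (reconstruction k T v) x) ∂(cellMeas T) with hG
  set S := ∑ F ∈ facesOf T, ∫ x, ⟪v.2 F x - v.1 x, fderiv ℝ v.1 x (normal T F)⟫ ∂(faceMeas F)
  set J := ∑ F ∈ facesOf T, ∫ x, ‖v.2 F x - v.1 x‖ ^ 2 ∂(faceMeas F) with hJ
  have hJ0 : 0 ≤ J := Finset.sum_nonneg fun _ _ => integral_norm_sq_nonneg
  have hXV : gradForm T (k + 1) V V = X := gradForm_apply V V
  have hGR : gradForm T (k + 1) R R = G := gradForm_apply R R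
  have hX0 : 0 ≤ X := hXV ▸ gradForm_nonneg V
  have hG0 : 0 ≤ G := hGR ▸ gradForm_nonneg R
  have hRV : gradForm T (k + 1) R V = X + S := by
    rw [gradForm_apply]
    change ∫ x, frob (fderiv ℝ (reconstruction k T v) x) (fderiv ℝ v.1 x) ∂(cellMeas T) = _
    rw [e1, e2, hS]; ring
  have hVR : gradForm T (k + 1) V R = X + S := by
    rw [← hRV, gradForm_apply, gradForm_apply]
    simp only [frob, real_inner_comm]
  have hY : X ≤ G + 2 * |S| := by
    have h := gradForm_nonneg (T := T) (R - V)
    simp only [map_sub, LinearMap.sub_apply] at h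
    rw [hXV, hGR, hRV, hVR] at h
    linarith [neg_abs_le S]
  have hS2 : S ^ 2 ≤ (d + 1) * C₁ * ((diam T)⁻¹ * J) * X := by
    have h := sq_sum_le_card_mul_sum_sq (s := facesOf T)
      (f := fun F => ∫ x, ⟪v.2 F x - v.1 x, fderiv ℝ v.1 x (normal T F)⟫ ∂(faceMeas F))
    rw [hT.1.card_facesOf] at h
    push_cast at h
    refine h.trans ?_
    have h2 : ∀ F ∈ facesOf T,
        (∫ x, ⟪v.2 F x - v.1 x, fderiv ℝ v.1 x (normal T F)⟫ ∂(faceMeas F)) ^ 2 ≤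
          (∫ x, ‖v.2 F x - v.1 x‖ ^ 2 ∂(faceMeas F)) * (C₁ * ((diam T)⁻¹ * X)) := fun F hF => by
      refine (sq_integral_inner_le ((hvF F hF).sub (hvTF F hF)) (hgF F hF)).trans ?_
      refine mul_le_mul_of_nonneg_left ?_ integral_norm_sq_nonneg
      have h3 := h₁ T hT F hF _ (fderiv_mem_vec hvv (normal T F))
      have h4 : ∫ x, ‖fderiv ℝ v.1 x (normal T F)‖ ^ 2 ∂(cellMeas T) ≤ X := by
        refine integral_mono (integrable_cell (Continuous.continuousOn (by fun_prop)))
          (integrable_cell (continuous_frob hcf hcf).continuousOn) fun x => ?_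
        refine le_trans (pow_le_pow_left₀ (norm_nonneg _) ((fderiv ℝ v.1 x).le_opNorm _) 2) ?_
        rw [hT.1.norm_normal' hd hF, mul_one]
        exact norm_sq_le_frob _
      have h5 := h3.trans (mul_le_mul_of_nonneg_left h4 hC₁.le)
      rw [mul_left_comm, ← div_eq_inv_mul, le_div_iff₀ hh, mul_comm]
      exact h5
    calc _ ≤ (d + 1 : ℝ) * ∑ F ∈ facesOf T,
          (∫ x, ‖v.2 F x - v.1 x‖ ^ 2 ∂(faceMeas F)) * (C₁ * ((diam T)⁻¹ * X)) :=
          mul_le_mul_of_nonneg_left (Finset.sum_le_sum h2) (by positivity)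
      _ = _ := by rw [← Finset.sum_mul]; ring
  clear_value X G S J
  have hp : 0 ≤ (d + 1) * C₁ := by positivity
  have hq : 0 ≤ (diam T)⁻¹ * J := mul_nonneg (inv_nonneg.2 hh.le) hJ0
  exact le_of_le_add_abs hX0 hG0 hp hq hY hS2

/-- Coercivity of the viscous form stabilized with differences on the faces. -/
lemma exists_normOneSqT_le (hd : 0 < d) (k : ℕ) (hκ : 0 < κ) : ∃ C : ℝ, 0 < C ∧
    ∀ T : Finset (Euc d), IsShapeRegular κ T → ∀ v ∈ locSpace k T,
      normOneSqT T v ≤ C * (∫ x, frob (fderiv ℝ (reconstruction k T v) x)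
          (fderiv ℝ (reconstruction k T v) x) ∂(cellMeas T) + stabFaces k T v v) := by
  obtain ⟨C₀, hC₀, h₀⟩ := exists_grad_le hd k hκ
  obtain ⟨C₁, hC₁, h₁⟩ := (isScalable_vec (d := d) ((k : ℤ) + 1)).exists_sub_const_le
    (fun e => const_mem_vec e (by positivity)) hd hκ
  obtain ⟨C₂, hC₂, h₂⟩ := exists_rtn_le hd ((k : ℤ) + 1) hκ
  obtain ⟨C₃, hC₃, h₃⟩ := (isScalable_vec (d := d) ((k : ℤ) + 1)).exists_trace_le hd hκ
  set A := 4 * C₃ * C₁ + 4 * C₃ * (C₂ * ((1 + (d + 1) * C₃) * C₁)) with hA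
  have hA0 : 0 < A := by positivity
  refine ⟨C₀ + (C₀ + 1) * ((d + 1) * A + 2), by positivity, fun T hT v hv => ?_⟩
  have hh := hT.1.diam_pos hd
  have hr := hT.1.reconstruction_spec hd hv
  obtain ⟨e, he⟩ := h₁ T hT _ hr.1
  have h0' := h₀ T hT v hv
  set r := reconstruction k T v with hrdef
  set G := ∫ x, frob (fderiv ℝ r x) (fderiv ℝ r x) ∂(cellMeas T) with hG
  have hcr := continuous_of_mem_vec hr.1
  have hcf : Continuous (fderiv ℝ r) := (isScalable_vec _).continuous_fderiv hr.1
  have hce : (fun _ : Euc d => e) ∈ vec (poly d (k : ℤ)) := const_mem_vec e (by positivity)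
  have hce' : (fun _ : Euc d => e) ∈ rtn d ((k : ℤ) + 1) := vec_le_rtn (by simpa using hce)
  set z : Euc d → Euc d := r + (-1 : ℝ) • fun _ => e with hz
  have hzx : ∀ x, z x = r x - e := fun x => by simp [hz, sub_eq_add_neg]
  have hcz : Continuous z := hcr.add (continuous_const.const_smul _)
  have hzv : z ∈ vec (poly d ((k : ℤ) + 1)) :=
    add_mem hr.1 (Submodule.smul_mem _ _ (const_mem_vec e (by positivity)))
  have hZG : ∫ x, ‖z x‖ ^ 2 ∂(cellMeas T) ≤ C₁ * (diam T ^ 2 * G) := by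
    simp only [hzx]
    refine he.trans (mul_le_mul_of_nonneg_left (mul_le_mul_of_nonneg_left ?_ (sq_nonneg _)) hC₁.le)
    exact integral_mono (integrable_cell (Continuous.continuousOn (by fun_prop)))
      (integrable_cell (continuous_frob hcf hcf).continuousOn) fun x => norm_sq_le_frob _
  set Z := ∫ x, ‖z x‖ ^ 2 ∂(cellMeas T) with hZdef
  have hzF := fun F hF => h₃ T hT F hF z hzv
  -- Interpolation of `r - e` on the element.
  have hI := hT.1.rtnInterp_spec hd (k + 1) hcr
  set w := rtnInterp (k + 1) T r + (-1 : ℝ) • fun _ : Euc d => e with hw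
  have hIw : IsRTNInterp (k + 1) T z (fun _ => z) w :=
    hI.add hd hT.1 hcr (continuous_const.const_smul _) ((hT.1.isRTNInterp_self hd hce').smul (-1))
  have hcw := continuous_of_mem_vec (rtn_le_vec hIw.1)
  have hW : ∫ x, ‖w x‖ ^ 2 ∂(cellMeas T) ≤ C₂ * ((1 + (d + 1) * C₃) * Z) := by
    have hb := hIw.dofBound hd hT.1 (memLp_cell hcz.continuousOn 2)
      (fun F hF => hT.1.memLp_face hd hF hcz.continuousOn 2)
    refine (h₂ T hT w hIw.1 _ ?_ hb).trans (mul_le_mul_of_nonneg_left ?_ hC₂.le)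
    · exact add_nonneg integral_norm_sq_nonneg
        (mul_nonneg hh.le (Finset.sum_nonneg fun _ _ => integral_norm_sq_nonneg))
    · rw [Finset.mul_sum, add_mul, one_mul]
      refine add_le_add le_rfl ((Finset.sum_le_card_nsmul _ _ _ hzF).trans_eq ?_)
      rw [hT.1.card_facesOf, nsmul_eq_mul]; push_cast; ring
  have hwF := fun F hF => (h₃ T hT F hF w (rtn_le_vec hIw.1)).trans
    (mul_le_mul_of_nonneg_left hW hC₃.le)
  -- The jump on each face.
  have hjump : ∀ F ∈ facesOf T, (diam T)⁻¹ * ∫ x, ‖v.2 F x - v.1 x‖ ^ 2 ∂(faceMeas F) ≤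
      2 * ((diam T)⁻¹ * ∫ x, ‖(delta k T v).1 x - (delta k T v).2 F x‖ ^ 2 ∂(faceMeas F)) +
        A * G := by
    intro F hF
    have hmr := hT.1.memLp_face hd hF hcr.continuousOn 2
    have hP := hT.1.faceProj_spec hd hF k hmr
    have hPe : IsFaceProj k F (fun _ => e) ((hull F).indicator fun _ => e) := fun i => by
      have h := isL2Proj_indicator (F := F) (hce i)
      convert h using 1
      ext x; by_cases hx : x ∈ hull F <;> simp [hx]
    have hme := hT.1.memLp_face hd hF (continuous_const (y := e)).continuousOn 2
    have hPz := hT.1.isFaceProj_add hd hF hmr (hme.const_smul (-1 : ℝ)) hP (hPe.smul (-1))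
    have hmz := hT.1.memLp_face hd hF hcz.continuousOn 2
    have hPle := hT.1.integral_faceProj_le hd hF hmz hPz
    set P := faceProj k F r + (-1 : ℝ) • (hull F).indicator fun _ => e with hPdef
    have hmP := hT.1.memLp_of_isFaceProj hd hF fun i => (hPz i).1
    have hmw := hT.1.memLp_face hd hF hcw.continuousOn 2
    have hδT := memLp_deltaCell_face hd hT.1 hF ⟨v, hv⟩
    have hδF := memLp_deltaFace hd hT.1 hF ⟨v, hv⟩
    have e1 : ∫ x, ‖v.2 F x - v.1 x‖ ^ 2 ∂(faceMeas F) =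
        ∫ x, ‖((delta k T v).1 x - (delta k T v).2 F x) + (P x - w x)‖ ^ 2 ∂(faceMeas F) := by
      refine setIntegral_congr_fun measurableSet_hull fun x hx => ?_
      simp only [delta, if_pos hF, ← hrdef, hPdef, hw, Pi.add_apply, Pi.sub_apply, Pi.smul_apply,
        indicator_of_mem hx]
      congr 2
      abel
    have hδ : MemLp (fun x => (delta k T v).1 x - (delta k T v).2 F x) 2 (faceMeas F) := by
      have := hδT.sub hδF
      rwa [← delta_fst hd hT.1 ⟨v, hv⟩, ← delta_snd hd hT.1 hF ⟨v, hv⟩] at this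
    have e2 := integral_norm_add_sq_le hδ (hmP.sub hmw)
    have e3 := integral_norm_sub_sq_le hmP hmw
    simp only [Pi.sub_apply] at e2
    rw [← e1] at e2
    have e4 := hzF F hF
    have e5 := hwF F hF
    set a₁ := ∫ x, ‖v.2 F x - v.1 x‖ ^ 2 ∂(faceMeas F)
    set a₂ := ∫ x, ‖(delta k T v).1 x - (delta k T v).2 F x‖ ^ 2 ∂(faceMeas F)
    set a₃ := ∫ x, ‖P x‖ ^ 2 ∂(faceMeas F)
    set a₄ := ∫ x, ‖w x‖ ^ 2 ∂(faceMeas F)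
    set a₅ := ∫ x, ‖z x‖ ^ 2 ∂(faceMeas F)
    have e6 : a₁ ≤ 2 * a₂ + 4 * a₅ + 4 * a₄ := by linarith
    have e7 : diam T * a₁ ≤ 2 * (diam T * a₂) + A * (diam T ^ 2 * G) := by
      calc diam T * a₁ ≤ diam T * (2 * a₂ + 4 * a₅ + 4 * a₄) := by gcongr
        _ = 2 * (diam T * a₂) + 4 * (diam T * a₅) + 4 * (diam T * a₄) := by ring
        _ ≤ 2 * (diam T * a₂) + 4 * (C₃ * (C₁ * (diam T ^ 2 * G))) +
            4 * (C₃ * (C₂ * ((1 + (d + 1) * C₃) * (C₁ * (diam T ^ 2 * G))))) := by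
          have i1 : diam T * a₅ ≤ C₃ * (C₁ * (diam T ^ 2 * G)) :=
            e4.trans (mul_le_mul_of_nonneg_left hZG hC₃.le)
          have i2 : diam T * a₄ ≤ C₃ * (C₂ * ((1 + (d + 1) * C₃) * (C₁ * (diam T ^ 2 * G)))) :=
            e5.trans (by gcongr)
          linarith
        _ = _ := by rw [hA]; ring
    have e8 : (diam T ^ 2)⁻¹ * (diam T * a₁) ≤
        (diam T ^ 2)⁻¹ * (2 * (diam T * a₂) + A * (diam T ^ 2 * G)) :=
      mul_le_mul_of_nonneg_left e7 (by positivity)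
    have e9 : (diam T ^ 2)⁻¹ * (diam T * a₁) = (diam T)⁻¹ * a₁ := by field_simp
    have e10 : (diam T ^ 2)⁻¹ * (2 * (diam T * a₂) + A * (diam T ^ 2 * G)) =
        2 * ((diam T)⁻¹ * a₂) + A * G := by field_simp
    rw [e9, e10] at e8
    exact e8
  have hJ : (diam T)⁻¹ * ∑ F ∈ facesOf T, ∫ x, ‖v.2 F x - v.1 x‖ ^ 2 ∂(faceMeas F) ≤
      2 * stabFaces k T v v + (d + 1) * A * G := by
    rw [Finset.mul_sum]
    refine (Finset.sum_le_sum hjump).trans_eq ?_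
    rw [Finset.sum_add_distrib, Finset.sum_const, hT.1.card_facesOf, ← Finset.mul_sum,
      ← Finset.mul_sum, nsmul_eq_mul]
    simp only [stabFaces, real_inner_self_eq_norm_sq]
    push_cast; ring
  have hG0 : 0 ≤ G := integral_nonneg fun x => by simp only [frob_self_eq]; positivity
  have hs0 : 0 ≤ stabFaces k T v v := by
    simp only [stabFaces, real_inner_self_eq_norm_sq]
    exact mul_nonneg (inv_nonneg.2 hh.le) (Finset.sum_nonneg fun _ _ => integral_norm_sq_nonneg)
  unfold normOneSqT
  set J := (diam T)⁻¹ * ∑ F ∈ facesOf T, ∫ x, ‖v.2 F x - v.1 x‖ ^ 2 ∂(faceMeas F)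
  set s := stabFaces k T v v
  calc _ ≤ C₀ * (G + J) + J := by linarith
    _ = C₀ * G + (C₀ + 1) * J := by ring
    _ ≤ C₀ * G + (C₀ + 1) * (2 * s + (d + 1) * A * G) := by gcongr
    _ ≤ _ := by
      have h1 : 0 ≤ (C₀ + 1) * ((d + 1) * A * s) := by positivity
      have h2 : 0 ≤ (C₀ + 1) * (2 * G) := by positivity
      have h3 : 0 ≤ C₀ * s := by positivity
      nlinarith


variable {d : ℕ} {l : ℤ} {T F : Finset (Euc d)} {k : ℕ} {κ : ℝ}

lemma IsSimplex.volume_le (hd : 0 < d) (hT : IsSimplex T) :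
    volume.real (hull T) ≤ diam T ^ d * volume.real (Metric.closedBall (0 : Euc d) 1) := by
  obtain ⟨a, ha⟩ := hT.card_pos
  have h := setIntegral_closedBall_homothety (fun _ : Euc d => (1 : ℝ)) a (hT.diam_pos hd) 1
  simp only [setIntegral_const, smul_eq_mul, mul_one, one_mul] at h
  rw [← h]
  exact measureReal_mono (hull_subset_closedBall (mem_hull ha))
    (isCompact_closedBall _ _).measure_lt_top.ne

/-- The stabilization with differences on the faces is controlled by the one with all the components
of `δ`, by a discrete trace inequality. -/
lemma exists_stabFaces_le (hd : 0 < d) (k : ℕ) (hκ : 0 < κ) : ∃ C : ℝ, 0 < C ∧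
    ∀ T : Finset (Euc d), IsShapeRegular κ T → ∀ v ∈ locSpace k T,
      stabFaces k T v v ≤ C * stabDofs k T v v := by
  obtain ⟨C₁, hC₁, h₁⟩ := (isScalable_rtn (d := d) ((k : ℤ) + 1)).exists_trace_le hd hκ
  set ϖ := volume.real (Metric.closedBall (0 : Euc d) 1) with hϖ
  have hϖ0 : 0 ≤ ϖ := measureReal_nonneg
  refine ⟨2 * C₁ * ϖ + 2, by positivity, fun T hT v hv => ?_⟩
  have hh := hT.1.diam_pos hd
  have hvol := hT.1.volume_pos hd
  have hδ := deltaCell_mem hd hT.1 ⟨v, hv⟩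
  rw [← delta_fst hd hT.1 ⟨v, hv⟩] at hδ
  simp only [stabFaces, stabDofs, real_inner_self_eq_norm_sq, hT.1.card_facesOf]
  set a := ∫ x, ‖(delta k T v).1 x‖ ^ 2 ∂(cellMeas T) with ha
  have ha0 : 0 ≤ a := integral_norm_sq_nonneg
  have hF : ∀ F ∈ facesOf T, ∫ x, ‖(delta k T v).1 x - (delta k T v).2 F x‖ ^ 2 ∂(faceMeas F) ≤
      2 * (C₁ * ((diam T)⁻¹ * a)) + 2 * ∫ x, ‖(delta k T v).2 F x‖ ^ 2 ∂(faceMeas F) :=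
        fun F hF => by
    have h1 := memLp_deltaCell_face hd hT.1 hF ⟨v, hv⟩
    have h2 := memLp_deltaFace hd hT.1 hF ⟨v, hv⟩
    rw [← delta_fst hd hT.1 ⟨v, hv⟩] at h1
    rw [← delta_snd hd hT.1 hF ⟨v, hv⟩] at h2
    refine (integral_norm_sub_sq_le h1 h2).trans (add_le_add (mul_le_mul_of_nonneg_left ?_
      zero_le_two) le_rfl)
    rw [mul_left_comm, ← div_eq_inv_mul, le_div_iff₀ hh, mul_comm]
    exact h₁ T hT F hF _ hδ
  have hsum := Finset.sum_le_sum hF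
  rw [Finset.sum_add_distrib, Finset.sum_const, hT.1.card_facesOf, nsmul_eq_mul,
    ← Finset.mul_sum] at hsum
  set b := ∑ F ∈ facesOf T, ∫ x, ‖(delta k T v).2 F x‖ ^ 2 ∂(faceMeas F) with hb
  have hb0 : 0 ≤ b := Finset.sum_nonneg fun _ _ => integral_norm_sq_nonneg
  have hϖ1 : 1 ≤ ϖ * (diam T ^ d / volume.real (hull T)) := by
    rw [mul_div_assoc', le_div_iff₀ hvol, one_mul, mul_comm ϖ]
    exact hT.1.volume_le hd
  set c := diam T ^ d / volume.real (hull T) with hc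
  have hc0 : 0 ≤ c := by positivity
  push_cast at hsum ⊢
  have e1 := mul_le_mul_of_nonneg_left hsum (inv_nonneg.2 hh.le)
  have ht : (diam T)⁻¹ * (diam T)⁻¹ = (diam T ^ 2)⁻¹ := by rw [← mul_inv, sq]
  have ht0 : 0 ≤ (diam T)⁻¹ := inv_nonneg.2 hh.le
  have ht2 : 0 ≤ (diam T ^ 2)⁻¹ := by positivity
  refine e1.trans ?_
  have e2 : (diam T)⁻¹ * ((d + 1) * (2 * (C₁ * ((diam T)⁻¹ * a))) + 2 * b) =
      2 * C₁ * ((d + 1) * ((diam T ^ 2)⁻¹ * a)) + 2 * ((diam T)⁻¹ * b) := by rw [← ht]; ring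
  rw [e2]
  clear_value a b c ϖ
  have e3 : (d + 1) * ((diam T ^ 2)⁻¹ * a) ≤ ϖ * ((d + 1) * c * (diam T ^ 2)⁻¹ * a) := by
    have h0 : 0 ≤ (d + 1) * ((diam T ^ 2)⁻¹ * a) := by positivity
    calc _ ≤ (ϖ * c) * ((d + 1) * ((diam T ^ 2)⁻¹ * a)) := le_mul_of_one_le_left h0 hϖ1
      _ = _ := by ring
  have e4 : 2 * C₁ * ((d + 1) * ((diam T ^ 2)⁻¹ * a)) ≤
      2 * C₁ * (ϖ * ((d + 1) * c * (diam T ^ 2)⁻¹ * a)) :=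
    mul_le_mul_of_nonneg_left e3 (by positivity)
  have h1 : 0 ≤ (d + 1) * c * (diam T ^ 2)⁻¹ * a := by positivity
  have h2 : 0 ≤ 2 * C₁ * ϖ * ((diam T)⁻¹ * b) := by positivity
  calc _ ≤ 2 * C₁ * (ϖ * ((d + 1) * c * (diam T ^ 2)⁻¹ * a)) + 2 * ((diam T)⁻¹ * b) := by linarith
    _ ≤ 2 * C₁ * (ϖ * ((d + 1) * c * (diam T ^ 2)⁻¹ * a)) + 2 * ((diam T)⁻¹ * b) +
        (2 * ((d + 1) * c * (diam T ^ 2)⁻¹ * a) + 2 * C₁ * ϖ * ((diam T)⁻¹ * b)) := by linarith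
    _ = _ := by ring

lemma normOneSqT_nonneg (v : LocVel d) : 0 ≤ normOneSqT T v := by
  refine add_nonneg (integral_nonneg fun x => ?_) (mul_nonneg (inv_nonneg.2 diam_nonneg)
    (Finset.sum_nonneg fun _ _ => integral_norm_sq_nonneg))
  simp only [frob_self_eq]; positivity

/-- All the admissible viscous forms are coercive, uniformly with respect to the mesh. -/
theorem exists_viscT_coercive (hd : 0 < d) (k : ℕ) (hκ : 0 < κ) {η : ℝ} (hη : 0 < η) :
    ∃ C : ℝ, 0 < C ∧ ∀ {Ω : Set (Euc d)} (K : SimplicialMesh Ω)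
      (s : Finset (Euc d) → LocVel d → LocVel d → ℝ), IsStabilization K k η s →
      ∀ T ∈ K.cells, IsShapeRegular κ T → ∀ v ∈ locSpace k T,
        normOneSqT T v ≤ C * viscT k s T v v ∧ 0 ≤ viscT k s T v v := by
  obtain ⟨C₁, hC₁, h₁⟩ := exists_normOneSqT_le hd k hκ
  obtain ⟨C₂, hC₂, h₂⟩ := exists_stabFaces_le hd k hκ
  refine ⟨C₁ * (1 + C₂) + η, by positivity, fun K s hs T hTK hT v hv => ?_⟩
  have hh := hT.1.diam_pos hd
  have hvol := hT.1.volume_pos hd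
  have hG0 : 0 ≤ ∫ x, frob (fderiv ℝ (reconstruction k T v) x)
      (fderiv ℝ (reconstruction k T v) x) ∂(cellMeas T) :=
    integral_nonneg fun x => by simp only [frob_self_eq]; positivity
  have h1 := h₁ T hT v hv
  have h2 := h₂ T hT v hv
  have hF0 : 0 ≤ stabFaces k T v v := by
    simp only [stabFaces, real_inner_self_eq_norm_sq]
    exact mul_nonneg (inv_nonneg.2 hh.le) (Finset.sum_nonneg fun _ _ => integral_norm_sq_nonneg)
  have hD0 : 0 ≤ stabDofs k T v v := by
    simp only [stabDofs, real_inner_self_eq_norm_sq]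
    exact add_nonneg (mul_nonneg (by positivity) integral_norm_sq_nonneg)
      (mul_nonneg (inv_nonneg.2 hh.le) (Finset.sum_nonneg fun _ _ => integral_norm_sq_nonneg))
  rcases hs with rfl | rfl | hs
  · unfold viscT
    refine ⟨h1.trans ?_, by linarith⟩
    have h3 := mul_le_mul_of_nonneg_left h2 hC₁.le
    have := mul_nonneg hC₁.le hD0
    have := mul_nonneg (mul_nonneg hC₁.le hC₂.le) hG0
    have := mul_nonneg hη.le hG0
    have := mul_nonneg hη.le hD0
    linarith
  · unfold viscT
    refine ⟨h1.trans ?_, by linarith⟩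
    have := mul_nonneg (mul_nonneg hC₁.le hC₂.le) hF0
    have := mul_nonneg (mul_nonneg hC₁.le hC₂.le) hG0
    have := mul_nonneg hη.le hG0
    have := mul_nonneg hη.le hF0
    linarith
  · have h3 := ((hs T hTK).2 v hv).1
    have h4 := normOneSqT_nonneg (T := T) v
    have h5 : 0 ≤ viscT k s T v v := le_trans (by positivity) h3
    rw [inv_mul_le_iff₀ hη] at h3
    refine ⟨?_, h5⟩
    have : 0 ≤ C₁ * (1 + C₂) * viscT k s T v v := by positivity
    linarith

/-! ### The discrete pressure gradient -/

/-- Discrete pressures which are polynomial on `T` and on its faces. -/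
def locPreSub (k : ℕ) (T : Finset (Euc d)) : Submodule ℝ (Pre d) where
  carrier := {q | q.1 T ∈ poly d k ∧ ∀ F ∈ facesOf T, q.2 F ∈ facePoly k F}
  zero_mem' := ⟨zero_mem _, fun _ _ => zero_mem _⟩
  add_mem' := fun ha hb => ⟨add_mem ha.1 hb.1, fun F hF => add_mem (ha.2 F hF) (hb.2 F hF)⟩
  smul_mem' := fun c _ ha => ⟨Submodule.smul_mem _ c ha.1,
    fun F hF => Submodule.smul_mem _ c (ha.2 F hF)⟩

/-- The divergence, as a linear map. -/
noncomputable def divLin (d : ℕ) (l : ℤ) : rtn d l →ₗ[ℝ] (Euc d → ℝ) where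
  toFun w := divergence w.1
  map_add' v w := divergence_add (differentiable_of_mem_vec (rtn_le_vec v.2))
    (differentiable_of_mem_vec (rtn_le_vec w.2))
  map_smul' a w := divergence_smul (differentiable_of_mem_vec (rtn_le_vec w.2)) a

/-- The normal component, as a linear map. -/
noncomputable def normalLin (l : ℤ) (n : Euc d) : rtn d l →ₗ[ℝ] (Euc d → ℝ) where
  toFun w x := ⟪w.1 x, n⟫
  map_add' v w := by ext x; simp [inner_add_left]
  map_smul' a w := by ext x; simp [real_inner_smul_left]

lemma memLp_divLin (w : rtn d l) : MemLp (divLin d l w) 2 (cellMeas T) :=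
  memLp_cell (continuous_divergence w.2).continuousOn 2

lemma memLp_normalLin (hd : 0 < d) (hT : IsSimplex T) (hF : F ∈ facesOf T) (n : Euc d)
    (w : rtn d l) : MemLp (normalLin l n w) 2 (faceMeas F) :=
  hT.memLp_face hd hF
    ((continuous_of_mem_vec (rtn_le_vec w.2)).inner continuous_const).continuousOn 2

/-- The element component of a discrete pressure, as a linear map. -/
def preCell (k : ℕ) (T : Finset (Euc d)) : locPreSub k T →ₗ[ℝ] (Euc d → ℝ) where
  toFun q := q.1.1 T
  map_add' _ _ := rfl
  map_smul' _ _ := rfl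

/-- The face components of a discrete pressure, as linear maps. -/
def preFace (k : ℕ) (T F : Finset (Euc d)) : locPreSub k T →ₗ[ℝ] (Euc d → ℝ) where
  toFun q := q.1.2 F
  map_add' _ _ := rfl
  map_smul' _ _ := rfl

/-- The bilinear form which defines the discrete pressure gradient. -/
noncomputable def gradPreForm (hd : 0 < d) (hT : IsSimplex T) (k : ℕ) :
    locPreSub k T →ₗ[ℝ] rtn d ((k : ℤ) + 1) →ₗ[ℝ] ℝ :=
  -pairing (cellMeas T) (preCell k T) (divLin d (k + 1))
      (fun q => memLp_cell (continuous_of_mem_poly q.2.1).continuousOn 2) memLp_divLin +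
    ∑ F : facesOf T, pairing (faceMeas F.1) (preFace k T F.1) (normalLin (k + 1) (normal T F.1))
      (fun q => hT.memLp_facePoly hd F.2 (q.2.2 F.1 F.2)) (memLp_normalLin hd hT F.2 _)

lemma gradPreForm_apply (hd : 0 < d) (hT : IsSimplex T) (k : ℕ) (q : locPreSub k T)
    (w : rtn d ((k : ℤ) + 1)) : gradPreForm hd hT k q w =
      -∫ x, q.1.1 T x * divergence w.1 x ∂(cellMeas T) +
        ∑ F ∈ facesOf T, ∫ x, q.1.2 F x * ⟪w.1 x, normal T F⟫ ∂(faceMeas F) := by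
  rw [← Finset.sum_coe_sort (facesOf T)]
  simp only [gradPreForm, LinearMap.add_apply, LinearMap.neg_apply, LinearMap.sum_apply]
  refine congrArg₂ (· + ·) (congrArg Neg.neg ?_) (Finset.sum_congr rfl fun F _ => ?_)
  · exact integral_congr_ae (.of_forall fun x => inner_mul _ _)
  · exact integral_congr_ae (.of_forall fun x => inner_mul _ _)

/-- The `L²(T)`-product on `RTN^ℓ`. -/
noncomputable def rtnForm (T : Finset (Euc d)) (l : ℤ) : rtn d l →ₗ[ℝ] rtn d l →ₗ[ℝ] ℝ :=
  pairing (cellMeas T) (rtn d l).subtype (rtn d l).subtype (fun w => memLp_of_mem_rtn w.2)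
    (fun w => memLp_of_mem_rtn w.2)

lemma rtnForm_apply (v w : rtn d l) : rtnForm T l v w = ∫ x, ⟪v.1 x, w.1 x⟫ ∂(cellMeas T) := rfl

lemma IsSimplex.rtnForm_pos (hd : 0 < d) (hT : IsSimplex T) (w : rtn d l)
    (h : rtnForm T l w w ≤ 0) : w = 0 := by
  rw [rtnForm_apply] at h
  simp only [real_inner_self_eq_norm_sq] at h
  exact Subtype.ext ((isScalable_rtn l).eq_zero_of_integral hd hT w.2 h)

lemma isPressureGrad_iff (hd : 0 < d) (hT : IsSimplex T) (q : locPreSub k T)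
    (g : rtn d ((k : ℤ) + 1)) :
    IsPressureGrad k T q g ↔ ∀ w, rtnForm T (k + 1) g w = gradPreForm hd hT k q w := by
  simp only [gradPreForm_apply, rtnForm_apply]
  exact ⟨fun h w => h.2 w w.2, fun h => ⟨g.2, fun w hw => h ⟨w, hw⟩⟩⟩

lemma IsSimplex.isPressureGrad_unique (hd : 0 < d) (hT : IsSimplex T) (q : locPreSub k T)
    {g g' : Euc d → Euc d} (h : IsPressureGrad k T q g) (h' : IsPressureGrad k T q g') :
      g = g' := by
  have e := (isPressureGrad_iff hd hT q ⟨g, h.1⟩).1 h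
  have e' := (isPressureGrad_iff hd hT q ⟨g', h'.1⟩).1 h'
  have h0 := hT.rtnForm_pos hd (⟨g, h.1⟩ - ⟨g', h'.1⟩ : rtn d ((k : ℤ) + 1)) (by
    rw [map_sub (rtnForm T (k + 1)), LinearMap.sub_apply, e, e', sub_self])
  exact congrArg Subtype.val (sub_eq_zero.1 h0)

lemma IsSimplex.pressureGrad_spec (hd : 0 < d) (hT : IsSimplex T) (q : locPreSub k T) :
    IsPressureGrad k T q (pressureGrad k T q) := by
  obtain ⟨g, hg⟩ := exists_representation (rtnForm T (k + 1)) (hT.rtnForm_pos hd)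
    (gradPreForm hd hT k q)
  exact Classical.epsilon_spec (⟨g.1, (isPressureGrad_iff hd hT q g).2 hg⟩ :
    ∃ g, IsPressureGrad k T q g)

/-- The discrete pressure gradient, as a linear map. -/
noncomputable def gradPreLin (hd : 0 < d) (hT : IsSimplex T) (k : ℕ) :
    locPreSub k T →ₗ[ℝ] rtn d ((k : ℤ) + 1) where
  toFun q := ⟨pressureGrad k T q, (hT.pressureGrad_spec hd q).1⟩
  map_add' p q := by
    have hp := (isPressureGrad_iff hd hT p ⟨_, (hT.pressureGrad_spec hd p).1⟩).1
      (hT.pressureGrad_spec hd p)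
    have hq := (isPressureGrad_iff hd hT q ⟨_, (hT.pressureGrad_spec hd q).1⟩).1
      (hT.pressureGrad_spec hd q)
    refine Subtype.ext (hT.isPressureGrad_unique hd (p + q) (hT.pressureGrad_spec hd (p + q))
      ((isPressureGrad_iff hd hT (p + q) _).2 fun w => ?_))
    rw [map_add, map_add, LinearMap.add_apply, LinearMap.add_apply, hp, hq]
  map_smul' c q := by
    have hq := (isPressureGrad_iff hd hT q ⟨_, (hT.pressureGrad_spec hd q).1⟩).1
      (hT.pressureGrad_spec hd q)
    refine Subtype.ext (hT.isPressureGrad_unique hd (c • q) (hT.pressureGrad_spec hd (c • q))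
      ((isPressureGrad_iff hd hT (c • q) _).2 fun w => ?_))
    rw [map_smul, map_smul, LinearMap.smul_apply, LinearMap.smul_apply, hq]
    rfl

/-- The product with a discrete pressure gradient, in terms of the pressure itself. -/
lemma IsSimplex.integral_inner_pressureGrad (hd : 0 < d) (hT : IsSimplex T) (q : locPreSub k T)
    {w : Euc d → Euc d} (hw : w ∈ rtn d ((k : ℤ) + 1)) :
    ∫ x, ⟪w x, pressureGrad k T q x⟫ ∂(cellMeas T) =
      -∫ x, q.1.1 T x * divergence w x ∂(cellMeas T) +
        ∑ F ∈ facesOf T, ∫ x, q.1.2 F x * ⟪w x, normal T F⟫ ∂(faceMeas F) := by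
  rw [← (hT.pressureGrad_spec hd q).2 w hw]
  simp only [real_inner_comm]

/-- A pressure whose discrete gradient vanishes on `T` is constant on `T`, with the same value on
its faces. Indeed, a field in `RTN^{k+1}` may have the gradient of `q_T` as moments against the
polynomials of degree `k - 1` and the jumps `q_F - q_T` as normal components. -/
lemma IsSimplex.eq_const_of_pressureGrad (hd : 0 < d) (hT : IsSimplex T) (q : locPreSub k T)
    (h : pressureGrad k T q = 0) : ∃ c : ℝ, (∀ x, q.1.1 T x = c) ∧
      ∀ F ∈ facesOf T, ∀ x ∈ hull F, q.1.2 F x = c := by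
  set p := q.1.1 T with hp
  have hpp : p ∈ poly d (k : ℤ) := q.2.1
  have hcp := continuous_of_mem_poly hpp
  have hcf : Continuous (fderiv ℝ p) := (isScalable_poly _).continuous_fderiv hpp
  have hpj : ∀ j, (fun x => fderiv ℝ p x (basisVec j)) ∈ poly d ((k : ℤ) + 1 - 2) := fun j => by
    have := fderiv_mem_poly hpp (basisVec j)
    convert this using 2
    ring
  have hjump : ∀ F ∈ facesOf T, q.1.2 F - (hull F).indicator p ∈ facePoly ((k : ℤ) + 1 - 1) F :=
    fun F hF => by
      rw [add_sub_cancel_right]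
      exact sub_mem (q.2.2 F hF) (indicator_mem_facePoly hpp)
  -- The moments of `w` in the element are those of `∇q_T`, its normal components the jumps.
  obtain ⟨w, hw, h1, h2⟩ := hT.exists_rtn hd ((k : ℤ) + 1)
    (fun i => pairWith (cellMeas T) (fun x => fderiv ℝ p x (basisVec i)) (poly d _).subtype
      (memLp_cell (Continuous.continuousOn (by fun_prop)) 2)
      (fun r => memLp_cell (continuous_of_mem_poly r.2).continuousOn 2))
    (fun F => pairWith (faceMeas F.1) (q.1.2 F.1 - (hull F.1).indicator p)
      (facePoly _ F.1).subtype (hT.memLp_facePoly hd F.2 (hjump F.1 F.2))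
      (fun r => hT.memLp_facePoly hd F.2 r.2))
  have hcw := continuous_of_mem_vec (rtn_le_vec hw)
  have e0 := hT.integral_inner_pressureGrad hd q hw
  rw [h] at e0
  simp only [Pi.zero_apply, inner_zero_right, integral_zero] at e0
  have e1 := hT.integral_divergence_mul hd (contDiff_of_mem_vec (n := 1) (rtn_le_vec hw))
    (contDiff_of_mem_poly hpp)
  have e2 : ∫ x, q.1.1 T x * divergence w x ∂(cellMeas T) =
      ∫ x, divergence w x * p x ∂(cellMeas T) := by simp only [mul_comm, ← hp]
  rw [e2, e1] at e0
  have e3 : ∀ i, ∫ x, w x i * fderiv ℝ p x (basisVec i) ∂(cellMeas T) =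
      ∫ x, fderiv ℝ p x (basisVec i) ^ 2 ∂(cellMeas T) := fun i => by
    refine (h1 i ⟨_, hpj i⟩).trans ?_
    change ∫ x, ⟪fderiv ℝ p x (basisVec i), fderiv ℝ p x (basisVec i)⟫ ∂(cellMeas T) = _
    simp only [inner_mul, sq]
  have e4 : ∀ F ∈ facesOf T, ∫ x, q.1.2 F x * ⟪w x, normal T F⟫ ∂(faceMeas F) -
      ∫ x, ⟪w x, normal T F⟫ * p x ∂(faceMeas F) =
        ∫ x, (q.1.2 F - (hull F).indicator p) x ^ 2 ∂(faceMeas F) := fun F hF => by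
    have e5 := h2 ⟨F, hF⟩ ⟨_, hjump F hF⟩
    have e6 : ∫ x, ⟪w x, normal T F⟫ * (q.1.2 F - (hull F).indicator p) x ∂(faceMeas F) =
        ∫ x, (q.1.2 F - (hull F).indicator p) x ^ 2 ∂(faceMeas F) := by
      rw [← integral_indicator_mul]
      refine e5.trans ?_
      change ∫ x, ⟪(q.1.2 F - (hull F).indicator p) x,
        (q.1.2 F - (hull F).indicator p) x⟫ ∂(faceMeas F) = _
      simp only [inner_mul, sq]
    have hmw : MemLp (fun x => ⟪w x, normal T F⟫) 2 (faceMeas F) :=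
      hT.memLp_face hd hF (Continuous.continuousOn (by fun_prop)) 2
    rw [← e6, ← integral_mul_indicator (f := fun x => ⟪w x, normal T F⟫) (r := p),
      ← integral_sub (integrable_mul_memLp (hT.memLp_facePoly hd hF (q.2.2 F hF)) hmw)
        (integrable_mul_memLp hmw (hT.memLp_facePoly hd hF (indicator_mem_facePoly hpp)))]
    refine integral_congr_ae (.of_forall fun x => ?_)
    simp only [Pi.sub_apply]; ring
  simp only [e3] at e0
  -- Testing the definition of `G_T q = 0` with `w` gives `‖∇q_T‖² + ∑_F ‖q_F - q_T‖² = 0`.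
  have e5 : ∑ i, ∫ x, fderiv ℝ p x (basisVec i) ^ 2 ∂(cellMeas T) +
      ∑ F ∈ facesOf T, ∫ x, (q.1.2 F - (hull F).indicator p) x ^ 2 ∂(faceMeas F) = 0 := by
    rw [← Finset.sum_congr rfl e4, Finset.sum_sub_distrib]
    linarith
  have p1 : ∀ i ∈ Finset.univ, 0 ≤ ∫ x, fderiv ℝ p x (basisVec i) ^ 2 ∂(cellMeas T) :=
    fun i _ => integral_nonneg fun _ => sq_nonneg _
  have p2 : ∀ F ∈ facesOf T,
      0 ≤ ∫ x, (q.1.2 F - (hull F).indicator p) x ^ 2 ∂(faceMeas F) :=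
    fun F _ => integral_nonneg fun _ => sq_nonneg _
  have z := (add_eq_zero_iff_of_nonneg (Finset.sum_nonneg p1) (Finset.sum_nonneg p2)).1 e5
  have z1 := (Finset.sum_eq_zero_iff_of_nonneg p1).1 z.1
  have z2 := (Finset.sum_eq_zero_iff_of_nonneg p2).1 z.2
  have hz : ∀ j, (fun x => fderiv ℝ p x (basisVec j)) = 0 := fun j => by
    refine (isScalable_poly _).eq_zero_of_integral hd hT (hpj j) ?_
    simp only [Real.norm_eq_abs, sq_abs]
    exact (z1 j (Finset.mem_univ j)).le
  have hf : ∀ x, fderiv ℝ p x = 0 := fun x => by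
    ext1 v
    rw [← sum_smul_basisVec v]
    simp only [map_sum, map_smul, zero_apply]
    refine Finset.sum_congr rfl fun j _ => ?_
    rw [show fderiv ℝ p x (basisVec j) = 0 from congrFun (hz j) x]
  have hconst : ∀ x, p x = p 0 := fun x =>
    is_const_of_fderiv_eq_zero (differentiable_of_mem_poly hpp) hf x 0
  refine ⟨p 0, hconst, fun F hF x hx => ?_⟩
  have := congrFun (hT.eq_zero_of_mem_facePoly hd hF (hjump F hF) (z2 F hF).le) x
  simp only [Pi.sub_apply, indicator_of_mem hx, Pi.zero_apply, sub_eq_zero] at this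
  rw [this, hconst x]


/-! ### Geometry of a simplicial mesh -/

/-- A Lipschitz domain lies on one side of its boundary. -/
lemma IsPolytopalDomain.interior_closure {d : ℕ} {Ω : Set (Euc d)} (hΩ : IsPolytopalDomain Ω) :
    interior (closure Ω) = Ω := by
  refine Subset.antisymm (fun x hx => ?_) (interior_maximal subset_closure hΩ.isOpen)
  by_contra hxΩ
  have hxf : x ∈ frontier Ω := by
    rw [frontier, hΩ.isOpen.interior_eq]
    exact ⟨interior_subset hx, hxΩ⟩
  obtain ⟨n, hn, γ, ⟨L, hL⟩, U, hU, hxU, hUΩ⟩ := hΩ.lipschitz x hxf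
  have hγ : ¬ ⟪n, x⟫ < γ ((ℝ ∙ n)ᗮ.orthogonalProjectionOnto x) := fun h => hxΩ ((hUΩ x hxU).2 h)
  -- The points `x + t n` with small `t > 0` lie strictly above the graph, hence outside
  -- `closure Ω`.
  have hopen : IsOpen (U ∩ interior (closure Ω)) := hU.inter isOpen_interior
  have hcont : Continuous fun t : ℝ => x + t • n := by fun_prop
  have hev : ∀ᶠ t in 𝓝[>] (0 : ℝ), x + t • n ∈ U ∩ interior (closure Ω) :=
    (hcont.tendsto' 0 x (by simp)).mono_left nhdsWithin_le_nhds
      |>.eventually_mem (hopen.mem_nhds ⟨hxU, hx⟩)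
  obtain ⟨t, ⟨htU, htc⟩, ht⟩ := (hev.and self_mem_nhdsWithin).exists
  have ht : 0 < t := ht
  have hproj : (ℝ ∙ n)ᗮ.orthogonalProjectionOnto (x + t • n) =
      (ℝ ∙ n)ᗮ.orthogonalProjectionOnto x := by
    rw [map_add, map_smul, Submodule.orthogonalProjectionOnto_orthogonal_apply_eq_zero
      (Submodule.mem_span_singleton_self n), smul_zero, add_zero]
  have hV : IsOpen (U ∩ {z | γ ((ℝ ∙ n)ᗮ.orthogonalProjectionOnto z) < ⟪n, z⟫}) :=
    hU.inter (isOpen_lt (hL.continuous.comp (ContinuousLinearMap.continuous _)) (by fun_prop))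
  obtain ⟨z, ⟨hzU, hz⟩, hzΩ⟩ := mem_closure_iff.1 (interior_subset htc) _ hV ⟨htU, by
    rw [mem_ofPred_eq, hproj, inner_add_right, inner_smul_right, real_inner_self_eq_norm_sq, hn]
    push Not at hγ
    linarith⟩
  exact absurd ((hUΩ z hzU).1 hzΩ) (not_lt.2 hz.le)

namespace SimplicialMesh

variable {d : ℕ} {Ω : Set (Euc d)} {K : SimplicialMesh Ω} {S T F : Finset (Euc d)}

lemma mem_cells : T ∈ K.cells ↔ T ∈ K.complex.faces ∧ T.card = d + 1 := by simp [cells]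

lemma mem_faces : F ∈ K.faces ↔ F ∈ K.complex.faces ∧ F.card = d := by simp [faces]

lemma isSimplex (hT : T ∈ K.cells) : IsSimplex T :=
  ⟨K.complex.indep (mem_cells.1 hT).1, (mem_cells.1 hT).2⟩

lemma mem_faces_of_mem_facesOf (hd : 0 < d) (hT : T ∈ K.cells) (hF : F ∈ facesOf T) :
    F ∈ K.faces := by
  obtain ⟨hFT, hc⟩ := Finset.mem_powersetCard.1 hF
  exact mem_faces.2 ⟨K.complex.down_closed (mem_cells.1 hT).1 hFT
    (Finset.card_pos.1 (by omega)), hc⟩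

lemma exists_cell (hF : F ∈ K.faces) : ∃ T ∈ K.cells, F ∈ facesOf T := by
  obtain ⟨T, hT, hFT, hc⟩ := K.pure F (mem_faces.1 hF).1
  exact ⟨T, mem_cells.2 ⟨hT, hc⟩, Finset.mem_powersetCard.2 ⟨hFT, (mem_faces.1 hF).2⟩⟩

open Classical in
lemma hull_inter_subset (hS : S ∈ K.complex.faces) (hT : T ∈ K.complex.faces) :
    hull S ∩ hull T ⊆ hull (S ∩ T) := by
  have := K.complex.inter_subset_convexHull hS hT
  rwa [← Finset.coe_inter] at this

lemma closure_eq (K : SimplicialMesh Ω) : closure Ω = ⋃ T ∈ K.cells, hull T := by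
  rw [← K.space_eq]
  refine Subset.antisymm (fun x hx => ?_) (iUnion₂_subset fun T hT =>
    K.complex.convexHull_subset_space (mem_cells.1 hT).1)
  obtain ⟨s, hs, hxs⟩ := K.complex.mem_space_iff.1 hx
  obtain ⟨T, hT, hsT, hc⟩ := K.pure s hs
  exact mem_iUnion₂.2 ⟨T, mem_cells.2 ⟨hT, hc⟩, hull_mono hsT hxs⟩

lemma hull_subset_closure (hT : T ∈ K.cells) : hull T ⊆ closure Ω := by
  rw [K.closure_eq]
  exact subset_biUnion_of_mem (u := fun T => hull T) hT

open Classical in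
lemma disjoint_interior_hull (hT : T ∈ K.cells) (hS : S ∈ K.cells) (hne : T ≠ S) :
    Disjoint (interior (hull T)) (hull S) := by
  rw [Set.disjoint_left]
  intro x hxT hxS
  have hx := hull_inter_subset (mem_cells.1 hT).1 (mem_cells.1 hS).1 ⟨interior_subset hxT, hxS⟩
  have hsub : ¬ T ⊆ S := fun h => hne (Finset.eq_of_subset_of_card_le h
    (by rw [(mem_cells.1 hT).2, (mem_cells.1 hS).2]))
  obtain ⟨a, haT, haS⟩ := Finset.not_subset.1 hsub
  have hT' := isSimplex hT
  have := (hT'.mem_hull_erase_iff haT).1 (hull_mono (fun b hb => Finset.mem_erase.2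
    ⟨by rintro rfl; exact haS (Finset.mem_inter.1 hb).2, (Finset.mem_inter.1 hb).1⟩) hx)
  exact ((hT'.mem_interior_iff.1 hxT) a haT).ne' this.2

lemma interior_hull_subset (hΩ : IsPolytopalDomain Ω) (hT : T ∈ K.cells) :
    interior (hull T) ⊆ Ω := by
  conv_rhs => rw [← hΩ.interior_closure]
  exact interior_mono (hull_subset_closure hT)

lemma cells_nonempty (hΩ : IsPolytopalDomain Ω) (K : SimplicialMesh Ω) : K.cells.Nonempty := by
  obtain ⟨x, hx⟩ := hΩ.connected.nonempty
  have := subset_closure hx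
  rw [K.closure_eq] at this
  obtain ⟨T, hT, -⟩ := mem_iUnion₂.1 this
  exact ⟨T, hT⟩

lemma diam_le (hΩ : IsPolytopalDomain Ω) (hT : T ∈ K.cells) : diam T ≤ Metric.diam Ω := by
  rw [← Metric.diam_closure]
  exact Metric.diam_mono (hull_subset_closure hT) hΩ.bounded.closure

lemma IsRegular.isShapeRegular {σ : ℝ} (hσ : K.IsRegular σ) (hT : T ∈ K.cells) :
    IsShapeRegular (2 * max σ 1)⁻¹ T := by
  obtain ⟨c, r, hr, hc, hle⟩ := hσ T hT
  refine ⟨isSimplex hT, c, (Metric.closedBall_subset_closedBall ?_).trans hc⟩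
  have hm : 0 < max σ 1 := by positivity
  rw [inv_mul_le_iff₀ (by positivity)]
  nlinarith [le_max_left σ 1]

end SimplicialMesh

lemma interior_hull_ae_eq {d : ℕ} (T : Finset (Euc d)) :
    (interior (hull T) : Set (Euc d)) =ᵐ[volume] hull T :=
  interior_ae_eq_of_null_frontier (convex_hull.addHaar_frontier volume)

lemma cellMeas_eq {d : ℕ} (T : Finset (Euc d)) :
    cellMeas T = volume.restrict (interior (hull T)) :=
  (Measure.restrict_congr_set (interior_hull_ae_eq T)).symm

/-! ### Integration over the domain, element by element -/

namespace SimplicialMesh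

variable {d : ℕ} {Ω : Set (Euc d)} {K : SimplicialMesh Ω} {S T F : Finset (Euc d)}

lemma restrict_eq_sum (hΩ : IsPolytopalDomain Ω) (K : SimplicialMesh Ω) :
    (volume.restrict Ω : Measure (Euc d)) = ∑ T ∈ K.cells, cellMeas T := by
  have h1 : (⋃ T ∈ K.cells, interior (hull T) : Set (Euc d)) =ᵐ[volume] Ω := by
    refine (LE.le.eventuallyLE
      (iUnion₂_subset fun T hT => interior_hull_subset hΩ hT)).antisymm ?_
    have h2 : (⋃ T ∈ K.cells, interior (hull T) : Set (Euc d)) =ᵐ[volume]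
        (⋃ T ∈ K.cells, hull T : Set (Euc d)) :=
      Filter.EventuallyEq.countable_bUnion K.cells.countable_toSet fun T _ => interior_hull_ae_eq T
    refine EventuallyLE.trans ?_ h2.symm.le
    rw [← K.closure_eq]
    exact subset_closure.eventuallyLE
  rw [← Measure.restrict_congr_set h1, Measure.restrict_biUnion_finset]
  · rw [Measure.sum_fintype, Finset.sum_coe_sort K.cells fun T => volume.restrict
      (interior (hull T))]
    exact Finset.sum_congr rfl fun T _ => (cellMeas_eq T).symm
  · intro T hT S hS hne
    exact (disjoint_interior_hull hT hS hne).mono_right interior_subset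
  · exact fun T => isOpen_interior.measurableSet

lemma cellMeas_le (hΩ : IsPolytopalDomain Ω) (hT : T ∈ K.cells) :
    cellMeas T ≤ volume.restrict Ω := by
  rw [cellMeas_eq]
  exact Measure.restrict_mono (interior_hull_subset hΩ hT) le_rfl

lemma integral_eq_sum {V : Type*} [NormedAddCommGroup V] [NormedSpace ℝ V]
    (hΩ : IsPolytopalDomain Ω) (K : SimplicialMesh Ω) {g : Euc d → V}
    (hg : ∀ T ∈ K.cells, Integrable g (cellMeas T)) :
    ∫ x in Ω, g x = ∑ T ∈ K.cells, ∫ x, g x ∂(cellMeas T) := by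
  rw [restrict_eq_sum hΩ K, integral_finsetSum_measure hg]

lemma piecewise_ae_eq {V : Type*} [AddCommMonoid V] (hT : T ∈ K.cells)
    (v : Finset (Euc d) → Euc d → V) : ∀ᵐ x ∂(cellMeas T), K.piecewise v x = v T x := by
  rw [cellMeas_eq]
  refine (ae_restrict_iff' isOpen_interior.measurableSet).2 (.of_forall fun x hx => ?_)
  rw [piecewise, Finset.sum_eq_single T, indicator_of_mem hx]
  · intro S hS hne
    exact indicator_of_notMem (fun h => (disjoint_interior_hull hT hS hne.symm).le_bot
      ⟨hx, interior_subset h⟩) _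
  · exact fun h => absurd hT h

lemma memLp_piecewise {V : Type*} [NormedAddCommGroup V] {v : Finset (Euc d) → Euc d → V}
    (hv : ∀ T ∈ K.cells, MemLp (v T) 2 (cellMeas T)) :
    MemLp (K.piecewise v) 2 (volume.restrict Ω) := by
  refine memLp_finsetSum (f := fun T x => (interior (hull T)).indicator (v T) x) K.cells
    fun T hT => MemLp.restrict _ ?_
  refine (memLp_indicator_iff_restrict isOpen_interior.measurableSet).2 ?_
  rw [← cellMeas_eq]
  exact hv T hT

lemma integral_piecewise {V W : Type*} [NormedAddCommGroup V] [NormedAddCommGroup W]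
    [NormedSpace ℝ W] (hΩ : IsPolytopalDomain Ω) (K : SimplicialMesh Ω)
    {v : Finset (Euc d) → Euc d → V} (g : Euc d → V → W)
    (hv : ∀ T ∈ K.cells, Integrable (fun x => g x (v T x)) (cellMeas T)) :
    ∫ x in Ω, g x (K.piecewise v x) = ∑ T ∈ K.cells, ∫ x, g x (v T x) ∂(cellMeas T) := by
  have h : ∀ T ∈ K.cells, (fun x => g x (K.piecewise v x)) =ᵐ[cellMeas T] fun x => g x (v T x) :=
    fun T hT => (piecewise_ae_eq hT v).mono fun x hx => by simp only [hx]
  rw [integral_eq_sum hΩ K fun T hT => (hv T hT).congr (h T hT).symm]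
  exact Finset.sum_congr rfl fun T hT => integral_congr_ae (h T hT)

lemma piecewise_add {V : Type*} [AddCommMonoid V] (v w : Finset (Euc d) → Euc d → V) (x : Euc d) :
    K.piecewise (v + w) x = K.piecewise v x + K.piecewise w x := by
  simp [piecewise, Set.indicator_add', Finset.sum_add_distrib]

lemma piecewise_smul {V : Type*} [AddCommGroup V] [Module ℝ V] (c : ℝ)
    (v : Finset (Euc d) → Euc d → V) (x : Euc d) :
    K.piecewise (c • v) x = c • K.piecewise v x := by
  simp only [piecewise, Finset.smul_sum, Pi.smul_apply]
  exact Finset.sum_congr rfl fun T _ => Set.indicator_const_smul_apply _ c (v T) x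

end SimplicialMesh

/-! ### Jumps of normals across the faces of a mesh -/

variable {d : ℕ} {Ω : Set (Euc d)} {K : SimplicialMesh Ω} {S T F : Finset (Euc d)}

lemma integral_fderiv_eq_zero {ψ : Euc d → ℝ} (hψ : ContDiff ℝ 1 ψ) (hc : HasCompactSupport ψ)
    (hs : tsupport ψ ⊆ Ω) (v : Euc d) : ∫ x in Ω, fderiv ℝ ψ x v = 0 := by
  have hd : Continuous fun x => fderiv ℝ ψ x v := (hψ.continuous_fderiv one_ne_zero).clm_apply
    continuous_const
  have hdc : HasCompactSupport fun x => fderiv ℝ ψ x v := hc.fderiv_apply (𝕜 := ℝ) v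
  rw [setIntegral_eq_integral_of_forall_compl_eq_zero]
  · have := integral_mul_fderiv_eq_neg_fderiv_mul_of_integrable (μ := volume)
      (f := fun _ : Euc d => (1 : ℝ)) (g := ψ) (v := v) (by simp)
      (by simpa using hd.integrable_of_hasCompactSupport hdc)
      (by simpa using hψ.continuous.integrable_of_hasCompactSupport hc)
      (fun x _ => differentiableAt_const _) (fun x _ => (hψ.differentiable one_ne_zero) x)
    simpa using this
  · intro x hx
    rw [fderiv_of_notMem_tsupport (𝕜 := ℝ) fun h => hx (hs h)]
    rfl

lemma IsSimplex.hull_subset_closure_interior (hd : 0 < d) (hT : IsSimplex T) :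
    hull T ⊆ closure (interior (hull T)) := by
  obtain ⟨κ, hκ, -, c, hc⟩ := hT.exists_closedBall hd
  rw [convex_hull.closure_interior_eq_closure_of_nonempty_interior]
  · exact subset_closure
  · exact ⟨c, mem_interior.2 ⟨_, Metric.ball_subset_closedBall.trans hc, Metric.isOpen_ball,
      Metric.mem_ball_self (mul_pos hκ (hT.diam_pos hd))⟩⟩

lemma IsSimplex.eqOn_zero_of_integral_face (hd : 0 < d) (hT : IsSimplex T) (hF : F ∈ facesOf T)
    {g : Euc d → ℝ} (hg : Continuous g) (h : ∫ x, g x ^ 2 ∂(faceMeas F) ≤ 0) :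
    ∀ x ∈ hull F, g x = 0 := by
  obtain ⟨a, ha, rfl⟩ := hT.mem_facesOf_iff.1 hF
  obtain ⟨b, hb, hba⟩ := hT.exists_ne hd a
  have h1 := hT.integral_proj_le hd ha hb hba.symm hg
  set G : Euc d → ℝ := fun x => g (x - bary T a x • (a - b)) with hG
  have hGc : Continuous G :=
    hg.comp (continuous_id.sub (continuous_bary.smul continuous_const))
  have h2 : ∫ x, G x ^ 2 ∂(cellMeas T) = 0 := le_antisymm
    (h1.trans (mul_nonpos_of_nonneg_of_nonpos (hT.height_pos hd ha).le h))
    (integral_nonneg fun x => sq_nonneg _)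
  rw [integral_eq_zero_iff_of_nonneg (fun x => sq_nonneg _)
    (integrable_cell (hGc.pow 2).continuousOn), cellMeas_eq] at h2
  have h3 := Measure.eqOn_open_of_ae_eq h2 isOpen_interior (hGc.pow 2).continuousOn
    continuousOn_const
  have h4 : EqOn (fun x => G x ^ 2) 0 (closure (interior (hull T))) :=
    h3.closure (hGc.pow 2) continuous_zero
  intro x hx
  have h5 := (hT.mem_hull_erase_iff ha).1 hx
  have h6 : G x ^ 2 = 0 := h4 (hT.hull_subset_closure_interior hd h5.1)
  simpa [hG, h5.2] using h6

namespace SimplicialMesh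

open Classical in
lemma sum_facesOf_comm {M : Type*} [AddCommMonoid M] (hd : 0 < d)
    (g : Finset (Euc d) → Finset (Euc d) → M) :
    ∑ T ∈ K.cells, ∑ F ∈ facesOf T, g T F =
      ∑ F ∈ K.faces, ∑ T ∈ K.cells with F ∈ facesOf T, g T F := by
  refine Finset.sum_comm' fun T F => ?_
  simp only [Finset.mem_filter]
  exact ⟨fun h => ⟨⟨h.1, h.2⟩, mem_faces_of_mem_facesOf hd h.1 h.2⟩, fun h => h.1⟩

open Classical in
/-- A face which is not contained in `∂Ω` has a point of `Ω` that belongs to no other face. -/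
lemma exists_mem_face (hd : 0 < d) (hΩ : IsPolytopalDomain Ω) (hF : F ∈ K.faces)
    (hb : ¬ hull F ⊆ frontier Ω) :
    ∃ x ∈ Ω, x ∈ hull F ∧ ∀ F' ∈ K.faces, F' ≠ F → x ∉ hull F' := by
  obtain ⟨T, hTK, hFT⟩ := exists_cell hF
  have hT := isSimplex hTK
  obtain ⟨a, ha, rfl⟩ := hT.mem_facesOf_iff.1 hFT
  obtain ⟨e, he, hea⟩ := hT.exists_ne hd a
  obtain ⟨x, hx, hxf⟩ := not_subset.1 hb
  have hxT := (hT.mem_hull_erase_iff ha).1 hx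
  have hxΩ : x ∈ Ω := by
    by_contra h
    rw [frontier, hΩ.isOpen.interior_eq] at hxf
    exact hxf ⟨hull_subset_closure hTK hxT.1, h⟩
  obtain ⟨κ, hκ, -, c, hc⟩ := hT.exists_closedBall hd
  have hcI : c ∈ interior (hull T) := mem_interior.2 ⟨_, Metric.ball_subset_closedBall.trans hc,
    Metric.isOpen_ball, Metric.mem_ball_self (mul_pos hκ (hT.diam_pos hd))⟩
  have hcpos := hT.mem_interior_iff.1 hcI
  -- `y` is the projection along an edge of an interior point of `T` on the face.
  set y := c - bary T a c • (a - e) with hy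
  obtain ⟨l1, l2, l3⟩ := hT.linear_bary_sub ha he hea.symm
  have hbary : ∀ z, bary T z y = bary T z c - bary T a c * (bary T z).linear (a - e) := fun z => by
    rw [hy, sub_eq_add_neg, ← neg_smul, bary_add_smul]; ring
  have hya : bary T a y = 0 := by rw [hbary, l1]; ring
  have hypos : ∀ z ∈ T.erase a, 0 < bary T z y := by
    intro z hz
    obtain ⟨hza, hzT⟩ := Finset.mem_erase.1 hz
    rw [hbary]
    rcases eq_or_ne z e with rfl | hze
    · rw [l2]; linarith [hcpos z hzT, hcpos a ha]
    · rw [l3 z hzT hza hze]; linarith [hcpos z hzT]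
  have hyT : y ∈ hull (T.erase a) := (hT.mem_hull_erase_iff ha).2 ⟨hT.mem_hull_iff.2 fun z hz => by
    rcases eq_or_ne z a with rfl | hza
    · exact hya.ge
    · exact (hypos z (Finset.mem_erase.2 ⟨hza, hz⟩)).le, hya⟩
  -- Near `x`, the segment from `x` to `y` is in `Ω` and in the relative interior of the face.
  have hcont : Continuous fun t : ℝ => x + t • (y - x) := by fun_prop
  have hev : ∀ᶠ t in 𝓝[>] (0 : ℝ), x + t • (y - x) ∈ Ω :=
    (hcont.tendsto' 0 x (by simp)).mono_left nhdsWithin_le_nhds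
      |>.eventually_mem (hΩ.isOpen.mem_nhds hxΩ)
  obtain ⟨t, ⟨htΩ, ht1⟩, ht0⟩ := ((hev.and (nhdsWithin_le_nhds (Iio_mem_nhds one_pos))).and
    self_mem_nhdsWithin).exists
  have ht0 : 0 < t := ht0
  have ht1 : t < 1 := ht1
  have hz : x + t • (y - x) = (1 - t) • x + t • y := by module
  refine ⟨x + t • (y - x), htΩ, ?_, fun F' hF' hne h => ?_⟩
  · rw [hz]
    exact convex_hull hx hyT (by linarith) ht0.le (by ring)
  have hmem : x + t • (y - x) ∈ hull (T.erase a) := by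
    rw [hz]; exact convex_hull hx hyT (by linarith) ht0.le (by ring)
  have hsub : ¬ T.erase a ⊆ F' := fun h => hne (Finset.eq_of_subset_of_card_le h
    (by rw [(mem_faces.1 hF).2, (mem_faces.1 hF').2])).symm
  obtain ⟨z, hzT, hzF⟩ := Finset.not_subset.1 hsub
  have hzT' := (Finset.mem_erase.1 hzT).2
  have h1 := hull_inter_subset (mem_faces.1 hF).1 (mem_faces.1 hF').1 ⟨hmem, h⟩
  have h2 := ((hT.mem_hull_erase_iff hzT').1 (hull_mono (fun b hb => Finset.mem_erase.2
    ⟨by rintro rfl; exact hzF (Finset.mem_inter.1 hb).2,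
      (Finset.mem_erase.1 (Finset.mem_inter.1 hb).1).2⟩) h1)).2
  rw [bary_add_smul, bary_linear_sub] at h2
  have h3 := hT.mem_hull_iff.1 hxT.1 z hzT'
  have h4 := mul_pos ht0 (hypos z hzT)
  nlinarith

open Classical in
/-- The normals to an interface which point out of the elements it belongs to cancel out. Localizing
`∫_Ω ∂_v ψ = 0` near a point of the interface avoids counting these elements. -/
lemma sum_normal_eq_zero (hd : 0 < d) (hΩ : IsPolytopalDomain Ω) (hF : F ∈ K.faces)
    (hb : ¬ hull F ⊆ frontier Ω) : ∑ T ∈ K.cells with F ∈ facesOf T, normal T F = 0 := by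
  obtain ⟨x, hxΩ, hxF, hx⟩ := exists_mem_face hd hΩ hF hb
  have hopen : IsOpen (Ω ∩ ⋂ F' ∈ K.faces.erase F, (hull F')ᶜ) := hΩ.isOpen.inter
    (isOpen_biInter_finset fun F' _ => isCompact_hull.isClosed.isOpen_compl)
  obtain ⟨r, hr, hball⟩ := Metric.isOpen_iff.1 hopen x ⟨hxΩ, mem_iInter₂.2 fun F' hF' =>
    hx F' (Finset.mem_of_mem_erase hF') (Finset.ne_of_mem_erase hF')⟩
  let φ : ContDiffBump x := ⟨r / 3, r / 2, by positivity, by linarith⟩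
  have hφc : ContDiff ℝ 1 φ := φ.contDiff
  have hsupp : tsupport (fun y => φ y ^ 2) ⊆ Metric.closedBall x (r / 2) := by
    refine (closure_mono fun y hy => ?_).trans φ.tsupport_eq.subset
    exact fun h => hy (by simp [h])
  have hsub : Metric.closedBall x (r / 2) ⊆ Metric.ball x r :=
    Metric.closedBall_subset_ball (by linarith)
  have hψc : ContDiff ℝ 1 fun y => φ y ^ 2 := hφc.pow 2
  refine ext_inner_left ℝ fun v => ?_
  have h0 := integral_fderiv_eq_zero hψc
    ((isCompact_closedBall x (r / 2)).of_isClosed_subset (isClosed_tsupport _) hsupp)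
    ((hsupp.trans hsub).trans (hball.trans inter_subset_left)) v
  have hd' : Continuous fun y => fderiv ℝ (fun y => φ y ^ 2) y v :=
    (hψc.continuous_fderiv one_ne_zero).clm_apply continuous_const
  rw [integral_eq_sum hΩ K fun T _ => integrable_cell hd'.continuousOn,
    Finset.sum_congr rfl fun T hT => (isSimplex hT).integral_fderiv hd hψc v,
    sum_facesOf_comm hd, Finset.sum_eq_single F, ← Finset.sum_mul, ← inner_sum] at h0
  · rw [inner_zero_right]
    refine (mul_eq_zero.1 h0).resolve_right fun h => ?_
    obtain ⟨T, hTK, hFT⟩ := exists_cell hF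
    have := (isSimplex hTK).eqOn_zero_of_integral_face hd hFT hφc.continuous h.le x hxF
    simp [φ.one_of_mem_closedBall (Metric.mem_closedBall_self φ.rIn_pos.le)] at this
  · intro F' hF' hne
    refine Finset.sum_eq_zero fun T _ => ?_
    rw [show ∫ y, φ y ^ 2 ∂(faceMeas F') = 0 from ?_, mul_zero]
    refine setIntegral_eq_zero_of_forall_eq_zero fun y hy => ?_
    by_contra h
    have := (hball (hsub (hsupp (subset_tsupport _ h)))).2
    exact mem_iInter₂.1 this F' (Finset.mem_erase.2 ⟨hne, hF'⟩) hy
  · exact fun h => absurd hF h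

/-- Fluxes through the faces which are single-valued and vanish on `∂Ω` sum up to zero. -/
lemma sum_inner_normal_eq_zero (hd : 0 < d) (hΩ : IsPolytopalDomain Ω)
    (a : Finset (Euc d) → Euc d) (ha : ∀ F ∈ K.faces, hull F ⊆ frontier Ω → a F = 0) :
    ∑ T ∈ K.cells, ∑ F ∈ facesOf T, ⟪a F, normal T F⟫ = 0 := by
  classical
  rw [sum_facesOf_comm hd]
  refine Finset.sum_eq_zero fun F hF => ?_
  rw [← inner_sum]
  by_cases hb : hull F ⊆ frontier Ω
  · rw [ha F hF hb, inner_zero_left]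
  · rw [sum_normal_eq_zero hd hΩ hF hb, inner_zero_right]

end SimplicialMesh

/-! ### Piecewise constant functions with zero gradient -/

variable {d : ℕ} {Ω : Set (Euc d)} {K : SimplicialMesh Ω} {S T F : Finset (Euc d)}

/-- Translation of a test function, as the integral of its directional derivative. -/
lemma integral_cell_translate_sub {φ : Euc d → ℝ} (hφ : ContDiff ℝ 1 φ) (v : Euc d) :
    ∫ x, φ x ∂(cellMeas T) - ∫ x, φ (x - v) ∂(cellMeas T) =
      ∫ t in (0 : ℝ)..1, ∫ x, fderiv ℝ (fun y => φ (y - t • v)) x v ∂(cellMeas T) := by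
  have hfd : ∀ (t : ℝ) (x : Euc d), fderiv ℝ (fun y => φ (y - t • v)) x v =
    fderiv ℝ φ (x - t • v) v :=
    fun t x => by rw [fderiv_comp_sub]
  simp only [hfd]
  have hc : Continuous fun z : ℝ × Euc d => fderiv ℝ φ (z.2 - z.1 • v) v :=
    ((hφ.continuous_fderiv one_ne_zero).comp (by fun_prop)).clm_apply continuous_const
  have hI : Integrable (Function.uncurry fun (t : ℝ) x => fderiv ℝ φ (x - t • v) v)
      ((volume.restrict (uIoc 0 1)).prod (cellMeas T)) := by
    rw [cellMeas, Measure.prod_restrict]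
    exact (hc.continuousOn.integrableOn_compact (isCompact_uIcc.prod isCompact_hull)).mono_set
      (prod_mono uIoc_subset_uIcc subset_rfl)
  rw [intervalIntegral_integral_swap hI]
  rw [← integral_sub (integrable_cell hφ.continuous.continuousOn)
    (integrable_cell (f := fun x => φ (x - v))
      (hφ.continuous.comp (by fun_prop : Continuous fun x => x - v)).continuousOn)]
  refine integral_congr_ae (.of_forall fun x => ?_)
  have hder : ∀ t : ℝ, HasDerivAt (fun t : ℝ => φ (x - t • v)) (-(fderiv ℝ φ (x - t • v) v)) t := by
    intro t
    have h1 : HasDerivAt (fun t : ℝ => x - t • v) (-v) t := by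
      simpa using ((hasDerivAt_id t).smul_const v).const_sub x
    have h2 := ((hφ.differentiable one_ne_zero) (x - t • v)).hasFDerivAt.comp_hasDerivAt t h1
    rw [map_neg] at h2
    exact h2
  have h2 := intervalIntegral.integral_eq_sub_of_hasDerivAt (a := 0) (b := 1)
    (fun t _ => hder t) (by
      refine Continuous.intervalIntegrable ?_ _ _
      exact (hc.comp (by fun_prop : Continuous fun t : ℝ => (t, x))).neg)
  rw [intervalIntegral.integral_neg] at h2
  simp only [one_smul, zero_smul, sub_zero] at h2
  simp only
  linarith

namespace SimplicialMesh

lemma integral_cell_of_tsupport {φ : Euc d → ℝ} (hT : T ∈ K.cells) (hS : S ∈ K.cells)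
    (h : Function.support φ ⊆ interior (hull S)) :
    ∫ x, φ x ∂(cellMeas T) = if T = S then ∫ x, φ x else 0 := by
  split_ifs with hTS
  · subst hTS
    exact setIntegral_eq_integral_of_forall_compl_eq_zero fun x hx => by
      by_contra h0; exact hx (interior_subset (h h0))
  · refine setIntegral_eq_zero_of_forall_eq_zero fun x hx => ?_
    by_contra h0
    exact (disjoint_interior_hull hS hT (Ne.symm hTS)).le_bot ⟨h h0, hx⟩

/-- A piecewise constant function whose distributional gradient vanishes takes the same value
on two elements with a common point in `Ω`: a bump function is moved from one to the other. -/
lemma eq_of_mem_of_mem (hd : 0 < d) (hΩ : IsPolytopalDomain Ω) {c : Finset (Euc d) → ℝ}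
    (h : ∀ (ψ : Euc d → ℝ) (v : Euc d), ContDiff ℝ 1 ψ → HasCompactSupport ψ → tsupport ψ ⊆ Ω →
      ∑ T ∈ K.cells, c T * ∫ x, fderiv ℝ ψ x v ∂(cellMeas T) = 0)
    (hS : S ∈ K.cells) (hT : T ∈ K.cells) {x : Euc d} (hx : x ∈ Ω) (hxS : x ∈ hull S)
    (hxT : x ∈ hull T) : c S = c T := by
  obtain ⟨r, hr, hball⟩ := Metric.isOpen_iff.1 hΩ.isOpen x hx
  -- Points `a` of the interior of `S` and `b` of the interior of `T`, both close to `x`.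
  obtain ⟨a, haS, hax⟩ := Metric.mem_closure_iff.1
    ((isSimplex hS).hull_subset_closure_interior hd hxS) (r / 2) (by positivity)
  obtain ⟨b, hbT, hbx⟩ := Metric.mem_closure_iff.1
    ((isSimplex hT).hull_subset_closure_interior hd hxT) (r / 2) (by positivity)
  obtain ⟨e₁, he₁, hb₁⟩ := Metric.isOpen_iff.1 (isOpen_interior (s := hull S)) a haS
  obtain ⟨e₂, he₂, hb₂⟩ := Metric.isOpen_iff.1 (isOpen_interior (s := hull T)) b hbT
  set e := min (min e₁ e₂) (r / 2) / 2 with he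
  have hm : 0 < min (min e₁ e₂) (r / 2) := by positivity
  have he0 : 0 < e := by positivity
  have hee₁ : e < e₁ := by
    linarith [min_le_left (min e₁ e₂) (r / 2), min_le_left e₁ e₂]
  have hee₂ : e < e₂ := by
    linarith [min_le_left (min e₁ e₂) (r / 2), min_le_right e₁ e₂]
  have heer : e < r / 2 := by linarith [min_le_right (min e₁ e₂) (r / 2)]
  clear_value e
  let φ : ContDiffBump a := ⟨e / 2, e, by positivity, by linarith⟩
  have hφc : ContDiff ℝ 1 φ := φ.contDiff
  have hsupp : ∀ w, Function.support (fun y => φ (y - w)) ⊆ Metric.ball (a + w) e := by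
    intro w y hy
    have : y - w ∈ Function.support φ := hy
    rw [φ.support_eq, Metric.mem_ball, dist_eq_norm] at this
    rwa [Metric.mem_ball, dist_eq_norm, ← sub_sub, sub_right_comm]
  have hts : ∀ t ∈ Icc (0 : ℝ) 1, tsupport (fun y => φ (y - t • (b - a))) ⊆ Ω := by
    intro t ht
    refine ((closure_mono (hsupp _)).trans Metric.closure_ball_subset_closedBall).trans ?_
    refine subset_trans (fun y hy => ?_) hball
    have h1 : a + t • (b - a) ∈ Metric.ball x (r / 2) := by
      have : a + t • (b - a) = (1 - t) • a + t • b := by module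
      rw [this]
      exact convex_ball x _ (by rwa [Metric.mem_ball, dist_comm])
        (by rwa [Metric.mem_ball, dist_comm]) (by linarith [ht.2]) ht.1 (by ring)
    rw [Metric.mem_ball] at h1 ⊢
    linarith [dist_triangle y (a + t • (b - a)) x, Metric.mem_closedBall.1 hy]
  have hcs : ∀ w, HasCompactSupport fun y => φ (y - w) := fun w =>
    HasCompactSupport.of_support_subset_isCompact (isCompact_closedBall (a + w) e)
      ((hsupp w).trans Metric.ball_subset_closedBall)
  have hcd : ∀ w, ContDiff ℝ 1 fun y => φ (y - w) := fun w =>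
    hφc.comp (contDiff_id.sub contDiff_const)
  -- The difference of `φ` and of its translate by `b - a` is an integral of derivatives of test
  -- functions supported in `Ω`.
  have key : ∑ A ∈ K.cells, c A *
      (∫ y, φ y ∂(cellMeas A) - ∫ y, φ (y - (b - a)) ∂(cellMeas A)) = 0 := by
    simp only [integral_cell_translate_sub hφc]
    have hint : ∀ A ∈ K.cells, IntervalIntegrable (fun t : ℝ => c A *
        ∫ x, fderiv ℝ (fun y => φ (y - t • (b - a))) x (b - a) ∂(cellMeas A)) volume 0 1 := by
      intro A _
      refine Continuous.intervalIntegrable ?_ _ _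
      refine continuous_const.mul ?_
      simp only [fderiv_comp_sub]
      refine continuous_parametric_integral_of_continuous
        (f := fun (t : ℝ) x => fderiv ℝ φ (x - t • (b - a)) (b - a)) ?_ isCompact_hull
      exact ((hφc.continuous_fderiv one_ne_zero).comp (by fun_prop)).clm_apply continuous_const
    simp only [← intervalIntegral.integral_const_mul]
    rw [← intervalIntegral.integral_finsetSum hint]
    refine intervalIntegral.integral_zero_ae (.of_forall fun t ht => ?_)
    rw [uIoc_of_le zero_le_one] at ht
    exact h _ _ (hcd _) (hcs _) (hts t ⟨ht.1.le, ht.2⟩)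
  have h1 : Function.support φ ⊆ interior (hull S) := by
    have := hsupp 0
    simp only [sub_zero, add_zero] at this
    exact (this.trans (Metric.ball_subset_ball hee₁.le)).trans hb₁
  have h2 : Function.support (fun y => φ (y - (b - a))) ⊆ interior (hull T) := by
    have := hsupp (b - a)
    rw [add_sub_cancel] at this
    exact (this.trans (Metric.ball_subset_ball hee₂.le)).trans hb₂
  have h3 : ∑ A ∈ K.cells, c A *
      (∫ y, φ y ∂(cellMeas A) - ∫ y, φ (y - (b - a)) ∂(cellMeas A)) =
      c S * (∫ y, φ y) - c T * ∫ y, φ y := by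
    have e1 : ∀ A ∈ K.cells, c A * ∫ y, φ y ∂(cellMeas A) = if A = S then c A * ∫ y, φ y else 0 :=
      fun A hA => by rw [integral_cell_of_tsupport hA hS h1, mul_ite, mul_zero]
    have e2 : ∀ A ∈ K.cells, c A * ∫ y, φ (y - (b - a)) ∂(cellMeas A) =
        if A = T then c A * ∫ y, φ y else 0 := fun A hA => by
      rw [integral_cell_of_tsupport hA hT h2, mul_ite, mul_zero,
        integral_sub_right_eq_self (fun y => φ y)]
    simp only [mul_sub, Finset.sum_sub_distrib]
    rw [Finset.sum_congr rfl e1, Finset.sum_congr rfl e2, Finset.sum_ite_eq' K.cells S,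
      Finset.sum_ite_eq' K.cells T, if_pos hS, if_pos hT]
  rw [h3, sub_eq_zero] at key
  exact mul_right_cancel₀ (φ.integral_pos (μ := volume)).ne' key

/-- A piecewise constant function whose distributional gradient vanishes is constant, as `Ω` is
connected. -/
lemma eq_of_sum_integral_fderiv (hd : 0 < d) (hΩ : IsPolytopalDomain Ω) {c : Finset (Euc d) → ℝ}
    (h : ∀ (ψ : Euc d → ℝ) (v : Euc d), ContDiff ℝ 1 ψ → HasCompactSupport ψ → tsupport ψ ⊆ Ω →
      ∑ T ∈ K.cells, c T * ∫ x, fderiv ℝ ψ x v ∂(cellMeas T) = 0)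
    (hS : S ∈ K.cells) (hT : T ∈ K.cells) : c S = c T := by
  by_contra hne
  have hcl : ∀ p : Finset (Euc d) → Prop, IsClosed (⋃ A ∈ {A | A ∈ K.cells ∧ p A}, hull A) :=
    fun p => (K.cells.finite_toSet.subset fun A hA => hA.1).isClosed_biUnion fun A _ =>
      isCompact_hull.isClosed
  have hmeet : ∀ p : Finset (Euc d) → Prop, ∀ A ∈ K.cells, p A →
      (Ω ∩ ⋃ A ∈ {A | A ∈ K.cells ∧ p A}, hull A).Nonempty := by
    intro p A hA hp
    obtain ⟨κ, hκ, -, x, hx⟩ := (isSimplex hA).exists_closedBall hd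
    have hxI : x ∈ interior (hull A) := mem_interior.2 ⟨_, Metric.ball_subset_closedBall.trans hx,
      Metric.isOpen_ball, Metric.mem_ball_self (mul_pos hκ ((isSimplex hA).diam_pos hd))⟩
    exact ⟨x, interior_hull_subset hΩ hA hxI,
      mem_biUnion (s := {A | A ∈ K.cells ∧ p A}) ⟨hA, hp⟩ (interior_subset hxI)⟩
  obtain ⟨x, hxΩ, hx1, hx2⟩ := isPreconnected_closed_iff.1 hΩ.connected.isPreconnected _ _
    (hcl fun A => c A = c S) (hcl fun A => c A ≠ c S)
    (fun x hx => by
      have := subset_closure hx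
      rw [K.closure_eq] at this
      obtain ⟨A, hA, hxA⟩ := mem_iUnion₂.1 this
      by_cases hcA : c A = c S
      · exact Or.inl (mem_biUnion (show A ∈ {A | A ∈ K.cells ∧ _} from ⟨hA, hcA⟩) hxA)
      · exact Or.inr (mem_biUnion (show A ∈ {A | A ∈ K.cells ∧ _} from ⟨hA, hcA⟩) hxA))
    (hmeet _ S hS rfl) (hmeet _ T hT (Ne.symm hne))
  obtain ⟨A, hA, hxA⟩ := mem_iUnion₂.1 hx1
  obtain ⟨B, hB, hxB⟩ := mem_iUnion₂.1 hx2
  exact hB.2 ((eq_of_mem_of_mem hd hΩ h hB.1 hA.1 hxΩ hxB hxA).trans hA.2)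

end SimplicialMesh

/-! ### Inf-sup condition and discretely divergence-free velocities -/

variable {d : ℕ} {Ω : Set (Euc d)} {K : SimplicialMesh Ω} {S T F : Finset (Euc d)} {k : ℕ}

namespace SimplicialMesh

/-- The restriction of a discrete pressure to an element. -/
def locPre (hd : 0 < d) (hT : T ∈ K.cells) (q : preSpace K k) : locPreSub k T :=
  ⟨q.1, q.2.1 T hT, fun F hF => q.2.2.2.1 F (mem_faces_of_mem_facesOf hd hT hF)⟩

lemma coupling_eq (hd : 0 < d) {v : Vel d} (hv : v ∈ velSpace K k) {q : Pre d}
    (hq : q ∈ preSpace K k) : coupling K k v q =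
      ∑ T ∈ K.cells, (-∫ x, q.1 T x * divergence (v.1 T) x ∂(cellMeas T) +
        ∑ F ∈ facesOf T, ∫ x, q.2 F x * ⟪v.1 T x, normal T F⟫ ∂(faceMeas F)) :=
  Finset.sum_congr rfl fun T hT =>
    (isSimplex hT).integral_inner_pressureGrad hd (locPre hd hT ⟨q, hq⟩) (hv.1 T hT)

/-- The coupling is nondegenerate on the pressures of zero average. A pressure in the
kernel has zero discrete gradient (test with that gradient), hence is locally constant with the same
value on both sides of each face; a distributional gradient that vanishes makes it constant. -/
theorem eq_zero_of_coupling (hd : 0 < d) (hΩ : IsPolytopalDomain Ω) {q : Pre d}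
    (hq : q ∈ preSpaceZero K k) (h : ∀ v ∈ velSpace K k, coupling K k v q = 0) : q = 0 := by
  classical
  have hG : ∀ T ∈ K.cells, pressureGrad k T q ∈ rtn d ((k : ℤ) + 1) := fun T hT =>
    ((isSimplex hT).pressureGrad_spec hd (locPre hd hT ⟨q, hq.1⟩)).1
  -- The test velocity has the discrete gradients of `q` as element components, and zero face
  -- components, which do not enter the coupling.
  have h0 := h (fun S => if S ∈ K.cells then pressureGrad k S q else 0, 0)
    ⟨fun T hT => by simpa only [if_pos hT] using hG T hT, fun T hT => if_neg hT,
      fun _ _ => zero_mem _, fun _ _ => rfl, fun _ _ _ => rfl⟩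
  rw [coupling, Finset.sum_congr rfl (g := fun T => ∫ x, ‖pressureGrad k T q x‖ ^ 2 ∂(cellMeas T))
    fun T hT => by simp only [if_pos hT, real_inner_self_eq_norm_sq],
    Finset.sum_eq_zero_iff_of_nonneg fun T _ => integral_nonneg fun x => sq_nonneg _] at h0
  have hc : ∀ T ∈ K.cells, ∃ c : ℝ, (∀ x, q.1 T x = c) ∧
      ∀ F ∈ facesOf T, ∀ x ∈ hull F, q.2 F x = c := fun T hT =>
    (isSimplex hT).eq_const_of_pressureGrad hd (locPre hd hT ⟨q, hq.1⟩)
      ((isScalable_rtn _).eq_zero_of_integral hd (isSimplex hT) (hG T hT) (h0 T hT).le)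
  choose! c hc1 hc2 using hc
  have hconst : ∀ S ∈ K.cells, ∀ T ∈ K.cells, c S = c T := fun S hS T hT => by
    refine eq_of_sum_integral_fderiv hd hΩ (fun ψ v hψ hψc hψs => ?_) hS hT
    refine Eq.trans ?_ (sum_inner_normal_eq_zero (K := K) hd hΩ
      (fun F => (∫ x, q.2 F x * ψ x ∂(faceMeas F)) • v) fun F _ hb => ?_)
    · refine Finset.sum_congr rfl fun T hT => ?_
      rw [(isSimplex hT).integral_fderiv hd hψ, Finset.mul_sum]
      refine Finset.sum_congr rfl fun F hF => ?_
      rw [real_inner_smul_left, mul_left_comm, ← integral_const_mul, mul_comm]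
      congr 1
      refine setIntegral_congr_fun measurableSet_hull fun x hx => ?_
      simp only [hc2 T hT F hF x hx]
    · refine (congrArg (· • v) (setIntegral_eq_zero_of_forall_eq_zero fun x hx => ?_)).trans
        (zero_smul ℝ v)
      have hxΩ : x ∉ Ω :=
        fun h => (hΩ.isOpen.inter_frontier_eq ▸ (⟨h, hb hx⟩ : x ∈ Ω ∩ frontier Ω) :
        x ∈ (∅ : Set (Euc d)))
      rw [image_eq_zero_of_notMem_tsupport fun h => hxΩ (hψs h), mul_zero]
  have hmean := hq.2
  rw [integral_piecewise hΩ K (fun _ y => y) fun T hT =>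
    integrable_cell (continuous_of_mem_poly (hq.1.1 T hT)).continuousOn] at hmean
  obtain ⟨S, hS⟩ := cells_nonempty hΩ K
  have hpos : 0 < ∑ T ∈ K.cells, volume.real (hull T) :=
    Finset.sum_pos (fun T hT => (isSimplex hT).volume_pos hd) ⟨S, hS⟩
  have hcS : c S = 0 := by
    have : ∑ T ∈ K.cells, ∫ x, q.1 T x ∂(cellMeas T) =
        (∑ T ∈ K.cells, volume.real (hull T)) * c S := by
      rw [Finset.sum_mul]
      refine Finset.sum_congr rfl fun T hT => ?_
      simp only [hc1 T hT, hconst T hT S hS, cellMeas, integral_const, smul_eq_mul,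
        measureReal_restrict_apply_univ]
    rw [this] at hmean
    exact (mul_eq_zero.1 hmean).resolve_left hpos.ne'
  refine Prod.ext (funext fun T => ?_) (funext fun F => ?_)
  · by_cases hT : T ∈ K.cells
    · funext x
      rw [hc1 T hT, hconst T hT S hS, hcS]; rfl
    · exact hq.1.2.1 T hT
  · by_cases hF : F ∈ K.faces
    · obtain ⟨T, hT, hFT⟩ := exists_cell hF
      obtain ⟨p, -, hp⟩ := hq.1.2.2.1 F hF
      funext x
      by_cases hx : x ∈ hull F
      · rw [hc2 T hT F hFT x hx, hconst T hT S hS, hcS]; rfl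
      · rw [hp, indicator_of_notMem hx]; rfl
    · exact hq.1.2.2.2 F hF

/-- The normal components of a discretely divergence-free velocity are continuous across the
interfaces, and vanish on the boundary faces. -/
lemma sum_normal_component_eq_zero (hd : 0 < d) {w : Vel d} (hw : w ∈ velSpace K k)
    (h : ∀ q ∈ preSpaceZero K k, coupling K k w q = 0) {φ : Finset (Euc d) → Euc d → ℝ}
    (hφ : ∀ T ∈ K.cells, ∀ F ∈ facesOf T,
      Integrable (fun x => φ F x * ⟪w.1 T x, normal T F⟫) (faceMeas F)) :
    ∑ T ∈ K.cells, ∑ F ∈ facesOf T, ∫ x, φ F x * ⟪w.1 T x, normal T F⟫ ∂(faceMeas F) = 0 := by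
  classical
  set g : Finset (Euc d) → Euc d → ℝ := fun F => ∑ T ∈ K.cells with F ∈ facesOf T,
    (hull F).indicator fun x => ⟪w.1 T x, normal T F⟫ with hg
  have hmw : ∀ T ∈ K.cells, ∀ F ∈ facesOf T,
      MemLp (fun x => ⟪w.1 T x, normal T F⟫) 2 (faceMeas F) := fun T hT F hF => by
    have hcw := continuous_of_mem_vec (rtn_le_vec (hw.1 T hT))
    exact (isSimplex hT).memLp_face hd hF (Continuous.continuousOn (by fun_prop)) 2
  have hgF : ∀ F, g F ∈ facePoly (k : ℤ) F := fun F => sum_mem fun T hT => by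
    have hT := Finset.mem_filter.1 hT
    have := (isSimplex hT.1).normal_mem_facePoly hd hT.2 (hw.1 T hT.1)
    rwa [add_sub_cancel_right] at this
  have hgx : ∀ F, ∀ x ∈ hull F, g F x = ∑ T ∈ K.cells with F ∈ facesOf T,
      ⟪w.1 T x, normal T F⟫ := fun F x hx => by
    simp only [hg, Finset.sum_apply]
    exact Finset.sum_congr rfl fun T _ => indicator_of_mem hx _
  -- Integrals over a face involve only the sum `g F` of the outward normal components.
  have hsum : ∀ F (ψ : Euc d → ℝ), (∀ T ∈ K.cells, F ∈ facesOf T →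
      Integrable (fun x => ψ x * ⟪w.1 T x, normal T F⟫) (faceMeas F)) →
      ∑ T ∈ K.cells with F ∈ facesOf T, ∫ x, ψ x * ⟪w.1 T x, normal T F⟫ ∂(faceMeas F) =
        ∫ x, ψ x * g F x ∂(faceMeas F) := by
    intro F ψ hψ
    rw [← integral_finsetSum _ fun T hT => hψ T (Finset.mem_filter.1 hT).1
      (Finset.mem_filter.1 hT).2]
    refine setIntegral_congr_fun measurableSet_hull fun x hx => ?_
    simp only [hgx F x hx, Finset.mul_sum]
  have hg0 : ∀ F ∈ K.faces, g F = 0 := by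
    intro F hF
    obtain ⟨S, hS, hFS⟩ := exists_cell hF
    have hq : (0, Pi.single F (g F)) ∈ preSpace K k := by
      refine ⟨fun _ _ => zero_mem _, fun _ _ => rfl, fun F' _ => ?_, fun F' hF' => ?_⟩
      · rcases eq_or_ne F' F with rfl | hne
        · simpa using hgF F'
        · simp [Pi.single_eq_of_ne hne]
      · exact Pi.single_eq_of_ne (by rintro rfl; exact hF' hF) _
    have e := h _ ⟨hq, by simp [piecewise]⟩
    rw [coupling_eq hd hw hq] at e
    simp only [Pi.zero_apply, zero_mul, integral_zero, neg_zero, zero_add] at e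
    rw [sum_facesOf_comm hd, Finset.sum_eq_single F] at e
    · simp only [Pi.single_eq_same] at e
      rw [hsum F (g F) fun T hT hFT => integrable_mul_memLp
        ((isSimplex hT).memLp_facePoly hd hFT (hgF F))
        (hmw T hT F hFT)] at e
      refine (isSimplex hS).eq_zero_of_mem_facePoly hd hFS (hgF F) ?_
      simp only [sq]
      exact e.le
    · intro F' _ hne
      simp [Pi.single_eq_of_ne hne]
    · exact fun h => absurd hF h
  rw [sum_facesOf_comm hd]
  refine Finset.sum_eq_zero fun F hF => ?_
  rw [hsum F (φ F) fun T hT hFT => hφ T hT F hFT, hg0 F hF]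
  simp

/-- A discretely divergence-free velocity is divergence free in each element: its divergences, with
zero face components, are a test pressure, of zero average since the normal components match. -/
lemma divergence_eq_zero (hd : 0 < d) (hΩ : IsPolytopalDomain Ω) {w : Vel d}
    (hw : w ∈ velSpace K k) (h : ∀ q ∈ preSpaceZero K k, coupling K k w q = 0)
    (hT : T ∈ K.cells) : divergence (w.1 T) = 0 := by
  classical
  have hp : ∀ T ∈ K.cells, divergence (w.1 T) ∈ poly d (k : ℤ) := fun T hT => by
    have := divergence_mem_poly (rtn_le_vec (hw.1 T hT))
    rwa [add_sub_cancel_right] at this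
  have hq : (fun S => if S ∈ K.cells then divergence (w.1 S) else 0, 0) ∈ preSpace K k :=
    ⟨fun T hT => by simpa only [if_pos hT] using hp T hT, fun T hT => if_neg hT,
      fun _ _ => zero_mem _, fun _ _ => rfl⟩
  have e := h _ ⟨hq, by
    rw [integral_piecewise hΩ K (fun _ y => y) fun T hT =>
      integrable_cell (continuous_of_mem_poly (hq.1 T hT)).continuousOn]
    refine Eq.trans ?_ (sum_normal_component_eq_zero hd hw h (φ := fun _ _ => 1) fun T hT F hF => by
      have hcw := continuous_of_mem_vec (rtn_le_vec (hw.1 T hT))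
      exact (isSimplex hT).integrable_face hd hF (Continuous.continuousOn (by fun_prop)))
    refine Finset.sum_congr rfl fun T hT => ?_
    have := (isSimplex hT).integral_divergence_mul hd
      (contDiff_of_mem_vec (n := 1) (rtn_le_vec (hw.1 T hT))) (r := fun _ => 1) contDiff_const
    simpa [if_pos hT] using this⟩
  rw [coupling_eq hd hw hq] at e
  simp only [Pi.zero_apply, zero_mul, integral_zero, Finset.sum_const_zero, add_zero,
    Finset.sum_neg_distrib, neg_eq_zero] at e
  rw [Finset.sum_congr rfl (g := fun T => ∫ x, ‖divergence (w.1 T) x‖ ^ 2 ∂(cellMeas T))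
    fun T hT => by simp only [if_pos hT, Real.norm_eq_abs, sq_abs]; simp only [sq],
    Finset.sum_eq_zero_iff_of_nonneg fun T _ => integral_nonneg fun x => sq_nonneg _] at e
  exact (isScalable_poly _).eq_zero_of_integral hd (isSimplex hT) (hp T hT) (e T hT).le

lemma exists_poly_of_mem_velSpace {v : Vel d} (hv : v ∈ velSpace K k) (hF : F ∈ K.faces) :
    ∃ p ∈ vec (poly d k), ∀ x ∈ hull F, v.2 F x = p x := by
  choose p hp hvp using hv.2.2.1 F hF
  refine ⟨fun x => WithLp.toLp 2 fun i => p i x, hp, fun x hx => ?_⟩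
  ext i
  have := congrFun (hvp i) x
  rwa [indicator_of_mem hx] at this

/-- The convective form is non-dissipative for a discretely divergence-free advection field. -/
theorem conv_self_eq_zero (hd : 0 < d) (hΩ : IsPolytopalDomain Ω) {w v : Vel d}
    (hw : w ∈ velSpace K k) (hv : v ∈ velSpace K k)
    (h : ∀ q ∈ preSpaceZero K k, coupling K k w q = 0) : conv K w v v = 0 := by
  have hI : ∀ T ∈ K.cells, ∀ F ∈ facesOf T,
      Integrable (fun x => ‖v.2 F x‖ ^ 2 * ⟪w.1 T x, normal T F⟫) (faceMeas F) := by
    intro T hT F hF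
    obtain ⟨p, hp, hvp⟩ := exists_poly_of_mem_velSpace hv (mem_faces_of_mem_facesOf hd hT hF)
    have hcp := continuous_of_mem_vec hp
    have hcw := continuous_of_mem_vec (rtn_le_vec (hw.1 T hT))
    refine ((isSimplex hT).integrable_face hd hF (f := fun x => ‖p x‖ ^ 2 * ⟪w.1 T x, normal T F⟫)
      (Continuous.continuousOn (by fun_prop))).congr ?_
    exact (ae_restrict_iff' measurableSet_hull).2 (.of_forall fun x hx => by simp only [hvp x hx])
  refine Eq.trans ?_ ((congrArg (1 / 2 * ·) (sum_normal_component_eq_zero hd hw h hI)).trans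
    (mul_zero _))
  rw [conv, Finset.mul_sum]
  refine Finset.sum_congr rfl fun T hT => ?_
  have hsT := isSimplex hT
  have hvT := rtn_le_vec (hv.1 T hT)
  have hcv := continuous_of_mem_vec hvT
  have hcw := continuous_of_mem_vec (rtn_le_vec (hw.1 T hT))
  have hdv := differentiable_of_mem_vec hvT
  have hr : ContDiff ℝ 1 fun x => ‖v.1 T x‖ ^ 2 := (contDiff_of_mem_vec hvT).norm_sq ℝ
  have hcr := hr.continuous_fderiv one_ne_zero
  have e1 := hsT.integral_divergence_mul hd
    (contDiff_of_mem_vec (n := 1) (rtn_le_vec (hw.1 T hT))) hr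
  -- Since `div w_T = 0`, `∫_T (w · ∇)v · v = ½ ∑_F ∫_F (w · n) |v_T|²`.
  rw [divergence_eq_zero hd hΩ hw h hT] at e1
  simp only [Pi.zero_apply, zero_mul, integral_zero] at e1
  rw [← integral_finsetSum _ fun i _ => integrable_cell (Continuous.continuousOn (by fun_prop))]
    at e1
  have e2 : ∀ x, ∑ i, w.1 T x i * fderiv ℝ (fun x => ‖v.1 T x‖ ^ 2) x (basisVec i) =
      2 * ⟪fderiv ℝ (v.1 T) x (w.1 T x), v.1 T x⟫ := by
    intro x
    have : fderiv ℝ (fun x => ‖v.1 T x‖ ^ 2) x (w.1 T x) =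
        2 * ⟪fderiv ℝ (v.1 T) x (w.1 T x), v.1 T x⟫ := by
      have := ((hdv x).hasFDerivAt.norm_sq).fderiv
      rw [this]
      simp [real_inner_comm]
    rw [← this]
    conv_rhs => rw [← sum_smul_basisVec (w.1 T x)]
    simp
  simp only [e2] at e1
  rw [integral_const_mul] at e1
  have e3 : ∀ F ∈ facesOf T,
      ∫ x, ⟪w.1 T x, normal T F⟫ * ⟪v.2 F x - v.1 T x, v.2 F x + v.1 T x⟫ ∂(faceMeas F) =
        ∫ x, ‖v.2 F x‖ ^ 2 * ⟪w.1 T x, normal T F⟫ ∂(faceMeas F) -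
          ∫ x, ⟪w.1 T x, normal T F⟫ * ‖v.1 T x‖ ^ 2 ∂(faceMeas F) := by
    intro F hF
    rw [← integral_sub (hI T hT F hF)
      (hsT.integrable_face hd hF (Continuous.continuousOn (by fun_prop)))]
    refine integral_congr_ae (.of_forall fun x => ?_)
    simp only [inner_sub_left, inner_add_right, real_inner_self_eq_norm_sq,
      real_inner_comm (v.1 T x) (v.2 F x)]
    ring
  rw [Finset.sum_congr rfl e3, Finset.sum_sub_distrib]
  linarith

lemma prodZero_self_nonneg (v : Vel d) : 0 ≤ prodZero K v v := by
  simp only [prodZero, real_inner_self_eq_norm_sq]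
  exact Finset.sum_nonneg fun T _ => add_nonneg (integral_nonneg fun _ => sq_nonneg _)
    (mul_nonneg diam_nonneg (Finset.sum_nonneg fun F _ => integral_nonneg fun _ => sq_nonneg _))

lemma eq_zero_of_prodZero (hd : 0 < d) {v : Vel d} (hv : v ∈ velSpace K k)
    (h : prodZero K v v ≤ 0) : v = 0 := by
  have h0 := le_antisymm h (prodZero_self_nonneg v)
  have p1 : ∀ T : Finset (Euc d), 0 ≤ ∫ x, ‖v.1 T x‖ ^ 2 ∂(cellMeas T) :=
    fun T => integral_nonneg fun _ => sq_nonneg _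
  have p2 : ∀ T F : Finset (Euc d), 0 ≤ ∫ x, ‖v.2 F x - v.1 T x‖ ^ 2 ∂(faceMeas F) :=
    fun T F => integral_nonneg fun _ => sq_nonneg _
  have p3 : ∀ T : Finset (Euc d),
      0 ≤ diam T * ∑ F ∈ facesOf T, ∫ x, ‖v.2 F x - v.1 T x‖ ^ 2 ∂(faceMeas F) :=
    fun T => mul_nonneg diam_nonneg (Finset.sum_nonneg fun F _ => p2 T F)
  simp only [prodZero, real_inner_self_eq_norm_sq] at h0
  rw [Finset.sum_eq_zero_iff_of_nonneg fun T _ => add_nonneg (p1 T) (p3 T)] at h0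
  have h1 : ∀ T ∈ K.cells, v.1 T = 0 := fun T hT =>
    (isScalable_rtn _).eq_zero_of_integral hd (isSimplex hT) (hv.1 T hT)
      ((add_eq_zero_iff_of_nonneg (p1 T) (p3 T)).1 (h0 T hT)).1.le
  refine Prod.ext (funext fun T => ?_) (funext fun F => ?_)
  · by_cases hT : T ∈ K.cells
    exacts [h1 T hT, hv.2.1 T hT]
  · by_cases hF : F ∈ K.faces
    · obtain ⟨T, hT, hFT⟩ := exists_cell hF
      have h2 := (mul_eq_zero.1 ((add_eq_zero_iff_of_nonneg (p1 T) (p3 T)).1 (h0 T hT)).2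
        ).resolve_left ((isSimplex hT).diam_pos hd).ne'
      have h3 := (Finset.sum_eq_zero_iff_of_nonneg fun F _ => p2 T F).1 h2 F hFT
      simp only [h1 T hT, Pi.zero_apply, sub_zero] at h3
      have hm := (isSimplex hT).memLp_of_isFaceProj hd hFT (hv.2.2.1 F hF)
      rw [integral_norm_sq_eq_sum hm,
        Finset.sum_eq_zero_iff_of_nonneg fun i _ => integral_nonneg fun _ => sq_nonneg _] at h3
      funext x
      ext i
      exact congrFun ((isSimplex hT).eq_zero_of_mem_facePoly hd hFT (hv.2.2.1 F hF i)
        (h3 i (Finset.mem_univ i)).le) x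
    · exact hv.2.2.2.1 F hF

end SimplicialMesh

/-! ### Convergence in `L²` -/

section L2Limits

variable {X E ι : Type*} [MeasurableSpace X] {μ : Measure X} [NormedAddCommGroup E]
  {l : Filter ι}

lemma tendsto_eLpNorm_sub {f g : ι → X → E} {u : X → E} (hf : ∀ n, MemLp (f n) 2 μ)
    (hg : ∀ n, MemLp (g n) 2 μ) (hu : MemLp u 2 μ)
    (h1 : Tendsto (fun n => eLpNorm (fun x => f n x - u x) 2 μ) l (𝓝 0))
    (h2 : Tendsto (fun n => eLpNorm (fun x => g n x - u x) 2 μ) l (𝓝 0)) :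
    Tendsto (fun n => eLpNorm (fun x => f n x - g n x) 2 μ) l (𝓝 0) := by
  refine tendsto_of_tendsto_of_tendsto_of_le_of_le tendsto_const_nhds
    (by simpa using h1.add h2) (fun _ => zero_le) fun n => ?_
  have := eLpNorm_sub_le ((hf n).sub hu).1 ((hg n).sub hu).1 one_le_two
  rwa [sub_sub_sub_cancel_right] at this

lemma tendsto_toLp {f : ι → X → E} {u : X → E} (hf : ∀ n, MemLp (f n) 2 μ) (hu : MemLp u 2 μ)
    (h : Tendsto (fun n => eLpNorm (fun x => f n x - u x) 2 μ) l (𝓝 0)) :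
    Tendsto (fun n => (hf n).toLp (f n)) l (𝓝 (hu.toLp u)) :=
  (Lp.tendsto_Lp_iff_tendsto_eLpNorm'' f hf u hu).2 h

lemma tendsto_integral_norm_sq {f : ι → X → E} {u : X → E} (hf : ∀ n, MemLp (f n) 2 μ)
    (hu : MemLp u 2 μ) (h : Tendsto (fun n => eLpNorm (fun x => f n x - u x) 2 μ) l (𝓝 0)) :
    Tendsto (fun n => ∫ x, ‖f n x‖ ^ 2 ∂μ) l (𝓝 (∫ x, ‖u x‖ ^ 2 ∂μ)) := by
  simp only [← norm_toLp_sq hu, ← fun n => norm_toLp_sq (hf n)]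
  exact (tendsto_toLp hf hu h).norm.pow 2

lemma tendsto_integral_inner {H : Type*} [NormedAddCommGroup H] [InnerProductSpace ℝ H]
    {f : ι → X → H} {u g : X → H} (hf : ∀ n, MemLp (f n) 2 μ) (hu : MemLp u 2 μ)
    (hg : MemLp g 2 μ) (h : Tendsto (fun n => eLpNorm (fun x => f n x - u x) 2 μ) l (𝓝 0)) :
    Tendsto (fun n => ∫ x, ⟪f n x, g x⟫ ∂μ) l (𝓝 (∫ x, ⟪u x, g x⟫ ∂μ)) := by
  have e : ∀ {v : X → H} (hv : MemLp v 2 μ), ∫ x, ⟪v x, g x⟫ ∂μ = ⟪hv.toLp v, hg.toLp g⟫ := by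
    intro v hv
    rw [L2.inner_def]
    refine integral_congr_ae ?_
    filter_upwards [hv.coeFn_toLp, hg.coeFn_toLp] with x h1 h2
    rw [h1, h2]
  simp only [e hu, fun n => e (hf n)]
  exact (tendsto_toLp hf hu h).inner tendsto_const_nhds

lemma eLpNorm_two_eq {f : X → E} (hf : MemLp f 2 μ) :
    eLpNorm f 2 μ = ENNReal.ofReal √(∫ x, ‖f x‖ ^ 2 ∂μ) := by
  rw [← norm_toLp_sq hf, Real.sqrt_sq (norm_nonneg _), Lp.norm_toLp,
    ENNReal.ofReal_toReal hf.2.ne]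

lemma ae_eq_of_tendsto {f : ι → X → E} {u v : X → E} [l.NeBot] (hf : ∀ n, MemLp (f n) 2 μ)
    (hu : MemLp u 2 μ) (hv : MemLp v 2 μ)
    (h1 : Tendsto (fun n => eLpNorm (fun x => f n x - u x) 2 μ) l (𝓝 0))
    (h2 : Tendsto (fun n => eLpNorm (fun x => f n x - v x) 2 μ) l (𝓝 0)) : u =ᵐ[μ] v :=
  (MemLp.toLp_eq_toLp_iff hu hv).1
    (tendsto_nhds_unique (tendsto_toLp hf hu h1) (tendsto_toLp hf hv h2))

end L2Limits

/-! ### Traces of functions in `H¹` -/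

variable {d : ℕ} {Ω : Set (Euc d)} {K : SimplicialMesh Ω} {S T F : Finset (Euc d)} {k : ℕ}
  {u : Euc d → Euc d} {G : Euc d → Euc d →L[ℝ] Euc d} {φ : ℕ → Euc d → Euc d}

lemma IsSimplex.exists_eLpNorm_trace_le (hd : 0 < d) (hT : IsSimplex T) (hF : F ∈ facesOf T) :
    ∃ C : ℝ≥0∞, C ≠ ⊤ ∧ ∀ ψ : Euc d → Euc d, ContDiff ℝ 1 ψ → eLpNorm ψ 2 (faceMeas F) ≤
      C * (eLpNorm ψ 2 (cellMeas T) + eLpNorm (fderiv ℝ ψ) 2 (cellMeas T)) := by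
  obtain ⟨κ, hκ, hκT⟩ := hT.exists_closedBall hd
  have hh := hT.diam_pos hd
  set M := (d + 1 + diam T ^ 2) / (κ * diam T) with hM
  have hM0 : 0 < M := by positivity
  refine ⟨ENNReal.ofReal √M, ENNReal.ofReal_ne_top, fun ψ hψ => ?_⟩
  have hψd := hψ.continuous_fderiv one_ne_zero
  have h := hκT.trace_le hd hκ.le hF hψ
  rw [eLpNorm_two_eq (hT.memLp_face hd hF hψ.continuous.continuousOn 2),
    eLpNorm_two_eq (memLp_cell hψ.continuous.continuousOn 2),
    eLpNorm_two_eq (memLp_cell hψd.continuousOn 2),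
    ← ENNReal.ofReal_add (Real.sqrt_nonneg _) (Real.sqrt_nonneg _),
    ← ENNReal.ofReal_mul (Real.sqrt_nonneg _)]
  refine ENNReal.ofReal_le_ofReal ?_
  have h1 : 0 ≤ ∫ x, ‖ψ x‖ ^ 2 ∂(cellMeas T) := integral_norm_sq_nonneg
  have h2 : 0 ≤ ∫ x, ‖fderiv ℝ ψ x‖ ^ 2 ∂(cellMeas T) := integral_nonneg fun _ => sq_nonneg _
  set a := ∫ x, ‖ψ x‖ ^ 2 ∂(cellMeas T)
  set b := ∫ x, ‖fderiv ℝ ψ x‖ ^ 2 ∂(cellMeas T)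
  rw [Real.sqrt_le_left (by positivity), mul_pow, Real.sq_sqrt hM0.le]
  have h3 : ∫ x, ‖ψ x‖ ^ 2 ∂(faceMeas F) ≤ M * (a + b) := by
    rw [hM, div_mul_eq_mul_div, le_div_iff₀ (by positivity)]
    nlinarith [mul_nonneg (sq_nonneg (diam T)) h1, mul_nonneg (Nat.cast_nonneg (α := ℝ) d) h2]
  refine h3.trans (mul_le_mul_of_nonneg_left ?_ hM0.le)
  nlinarith [Real.sq_sqrt h1, Real.sq_sqrt h2, Real.sqrt_nonneg a, Real.sqrt_nonneg b]

lemma tendsto_eLpNorm_face {ι : Type*} {l : Filter ι} (hd : 0 < d) (hT : IsSimplex T)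
    (hF : F ∈ facesOf T) {f g : ι → Euc d → Euc d} (hf : ∀ n, ContDiff ℝ ∞ (f n))
    (hg : ∀ n, ContDiff ℝ ∞ (g n)) (hu : MemLp u 2 (cellMeas T)) (hG : MemLp G 2 (cellMeas T))
    (h1 : Tendsto (fun n => eLpNorm (fun x => f n x - u x) 2 (cellMeas T)) l (𝓝 0))
    (h2 : Tendsto (fun n => eLpNorm (fun x => fderiv ℝ (f n) x - G x) 2 (cellMeas T)) l (𝓝 0))
    (h3 : Tendsto (fun n => eLpNorm (fun x => g n x - u x) 2 (cellMeas T)) l (𝓝 0))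
    (h4 : Tendsto (fun n => eLpNorm (fun x => fderiv ℝ (g n) x - G x) 2 (cellMeas T)) l (𝓝 0)) :
    Tendsto (fun n => eLpNorm (fun x => f n x - g n x) 2 (faceMeas F)) l (𝓝 0) := by
  obtain ⟨C, hC, h⟩ := hT.exists_eLpNorm_trace_le hd hF
  have hd1 : ∀ {ψ : Euc d → Euc d}, ContDiff ℝ ∞ ψ → Differentiable ℝ ψ := fun hψ =>
    hψ.differentiable (by simp)
  have hm : ∀ {ψ : Euc d → Euc d}, ContDiff ℝ ∞ ψ → MemLp ψ 2 (cellMeas T) := fun hψ =>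
    memLp_cell hψ.continuous.continuousOn 2
  have hm' : ∀ {ψ : Euc d → Euc d}, ContDiff ℝ ∞ ψ → MemLp (fderiv ℝ ψ) 2 (cellMeas T) := fun hψ =>
    memLp_cell (hψ.continuous_fderiv (by simp)).continuousOn 2
  have e := (tendsto_eLpNorm_sub (fun n => hm (hf n)) (fun n => hm (hg n)) hu h1 h3).add
    (tendsto_eLpNorm_sub (fun n => hm' (hf n)) (fun n => hm' (hg n)) hG h2 h4)
  have e2 := ENNReal.Tendsto.const_mul (a := C) e (Or.inr hC)
  rw [add_zero, mul_zero] at e2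
  refine tendsto_of_tendsto_of_tendsto_of_le_of_le tendsto_const_nhds e2
    (fun _ => zero_le) fun n => ?_
  have hfg := h (fun x => f n x - g n x) (((hf n).sub (hg n)).of_le (by simp))
  have e3 : fderiv ℝ (fun x => f n x - g n x) = fun x => fderiv ℝ (f n) x - fderiv ℝ (g n) x :=
    funext fun x => fderiv_fun_sub (hd1 (hf n) x) (hd1 (hg n) x)
  rwa [e3] at hfg

namespace SimplicialMesh

lemma tendsto_cell (hΩ : IsPolytopalDomain Ω) (hT : T ∈ K.cells) (h : TendstoH1 Ω φ u G) :
    Tendsto (fun n => eLpNorm (fun x => φ n x - u x) 2 (cellMeas T)) atTop (𝓝 0) ∧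
    Tendsto (fun n => eLpNorm (fun x => fderiv ℝ (φ n) x - G x) 2 (cellMeas T)) atTop (𝓝 0) :=
  ⟨tendsto_of_tendsto_of_tendsto_of_le_of_le tendsto_const_nhds h.1 (fun _ => zero_le)
    fun _ => eLpNorm_mono_measure _ (cellMeas_le hΩ hT),
  tendsto_of_tendsto_of_tendsto_of_le_of_le tendsto_const_nhds h.2 (fun _ => zero_le)
    fun _ => eLpNorm_mono_measure _ (cellMeas_le hΩ hT)⟩

/-- Any approximation of `u` by smooth functions converges to the trace of `u`. -/
lemma tendsto_trace (hd : 0 < d) (hΩ : IsPolytopalDomain Ω) (hF : F ∈ K.faces)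
    (hu : MemLp u 2 (volume.restrict Ω)) (hG : MemLp G 2 (volume.restrict Ω))
    (hφ : ∀ n, ContDiff ℝ ∞ (φ n)) (h : TendstoH1 Ω φ u G) {γ : Euc d → Euc d}
    (hγ : IsTrace Ω F u G γ) :
    Tendsto (fun n => eLpNorm (fun x => φ n x - γ x) 2 (faceMeas F)) atTop (𝓝 0) := by
  obtain ⟨T, hT, hFT⟩ := exists_cell hF
  obtain ⟨hγm, ψ, hψ, hψu, hψγ⟩ := hγ
  have hsT := isSimplex hT
  have e := tendsto_eLpNorm_face hd hsT hFT hφ hψ (hu.mono_measure (cellMeas_le hΩ hT))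
    (hG.mono_measure (cellMeas_le hΩ hT)) (tendsto_cell hΩ hT h).1 (tendsto_cell hΩ hT h).2
    (tendsto_cell hΩ hT hψu).1 (tendsto_cell hΩ hT hψu).2
  have hm : ∀ {f : Euc d → Euc d}, ContDiff ℝ ∞ f → MemLp f 2 (faceMeas F) := fun hf =>
    hsT.memLp_face hd hFT hf.continuous.continuousOn 2
  have e2 := e.add hψγ
  rw [add_zero] at e2
  refine tendsto_of_tendsto_of_tendsto_of_le_of_le tendsto_const_nhds e2 (fun _ => zero_le)
    fun n => ?_
  have := eLpNorm_add_le ((hm (hφ n)).sub (hm (hψ n))).1 ((hm (hψ n)).sub hγm).1 one_le_two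
  rwa [sub_add_sub_cancel] at this

/-- Functions in `H¹` which are limits of smooth functions have traces. -/
lemma exists_isTrace (hd : 0 < d) (hΩ : IsPolytopalDomain Ω) (hF : F ∈ K.faces)
    (hu : MemLp u 2 (volume.restrict Ω)) (hG : MemLp G 2 (volume.restrict Ω))
    (hφ : ∀ n, ContDiff ℝ ∞ (φ n)) (h : TendstoH1 Ω φ u G) : ∃ γ, IsTrace Ω F u G γ := by
  obtain ⟨T, hT, hFT⟩ := exists_cell hF
  have hsT := isSimplex hT
  have hm : ∀ n, MemLp (φ n) 2 (faceMeas F) := fun n =>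
    hsT.memLp_face hd hFT (hφ n).continuous.continuousOn 2
  obtain ⟨h1, h2⟩ := tendsto_cell hΩ hT h
  have hfst : Tendsto (fun n : ℕ × ℕ => n.1) atTop atTop := by
    rw [← prod_atTop_atTop_eq]; exact tendsto_fst
  have hsnd : Tendsto (fun n : ℕ × ℕ => n.2) atTop atTop := by
    rw [← prod_atTop_atTop_eq]; exact tendsto_snd
  have e := tendsto_eLpNorm_face hd hsT hFT (fun n : ℕ × ℕ => hφ n.1) (fun n => hφ n.2)
    (hu.mono_measure (cellMeas_le hΩ hT)) (hG.mono_measure (cellMeas_le hΩ hT))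
    (h1.comp hfst) (h2.comp hfst) (h1.comp hsnd) (h2.comp hsnd)
  have hc : CauchySeq fun n => (hm n).toLp (φ n) := by
    rw [cauchySeq_iff_tendsto_dist_atTop_0]
    simp only [dist_edist, Lp.edist_toLp_toLp]
    exact (ENNReal.tendsto_toReal ENNReal.zero_ne_top).comp e
  obtain ⟨g, hg⟩ := cauchySeq_tendsto_of_complete hc
  refine ⟨g, Lp.memLp g, φ, hφ, h, ?_⟩
  refine (Lp.tendsto_Lp_iff_tendsto_eLpNorm'' φ hm g (Lp.memLp g)).1 ?_
  rwa [Lp.toLp_coeFn]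

lemma isTrace_ae_eq (hd : 0 < d) (hΩ : IsPolytopalDomain Ω) (hF : F ∈ K.faces)
    (hu : MemLp u 2 (volume.restrict Ω)) (hG : MemLp G 2 (volume.restrict Ω))
    (hφ : ∀ n, ContDiff ℝ ∞ (φ n)) (h : TendstoH1 Ω φ u G) {γ γ' : Euc d → Euc d}
    (hγ : IsTrace Ω F u G γ) (hγ' : IsTrace Ω F u G γ') : γ =ᵐ[faceMeas F] γ' := by
  obtain ⟨T, hT, hFT⟩ := exists_cell hF
  exact ae_eq_of_tendsto (fun n => (isSimplex hT).memLp_face hd hFT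
    (hφ n).continuous.continuousOn 2) hγ.1 hγ'.1 (tendsto_trace hd hΩ hF hu hG hφ h hγ)
    (tendsto_trace hd hΩ hF hu hG hφ h hγ')

lemma isTrace_boundary (hd : 0 < d) (hΩ : IsPolytopalDomain Ω) (hF : F ∈ K.faces)
    (hb : hull F ⊆ frontier Ω) (hu : MemLp u 2 (volume.restrict Ω))
    (hG : MemLp G 2 (volume.restrict Ω)) (h : VanishesOnBoundary Ω u G) {γ : Euc d → Euc d}
    (hγ : IsTrace Ω F u G γ) : γ =ᵐ[faceMeas F] 0 := by
  obtain ⟨φ, hφ, h⟩ := h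
  obtain ⟨T, hT, hFT⟩ := exists_cell hF
  refine ae_eq_of_tendsto (fun n => (isSimplex hT).memLp_face hd hFT
    (hφ n).1.continuous.continuousOn 2) hγ.1 MemLp.zero
    (tendsto_trace hd hΩ hF hu hG (fun n => (hφ n).1) h hγ) ?_
  refine tendsto_const_nhds.congr fun n => (Eq.trans (eLpNorm_congr_ae ?_) eLpNorm_zero).symm
  refine (ae_restrict_iff' measurableSet_hull).2 (.of_forall fun x hx => ?_)
  have hxΩ : x ∉ Ω := fun h => (hΩ.isOpen.inter_frontier_eq ▸ (⟨h, hb hx⟩ : x ∈ Ω ∩ frontier Ω) :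
    x ∈ (∅ : Set (Euc d)))
  simp [image_eq_zero_of_notMem_tsupport fun h => hxΩ ((hφ n).2.2 h)]

lemma trace_sq_le (hd : 0 < d) (hΩ : IsPolytopalDomain Ω) (hT : T ∈ K.cells) (hF : F ∈ facesOf T)
    {κ : ℝ} (hκ : 0 ≤ κ) (hκT : IsShapeRegular κ T)
    (hu : MemLp u 2 (volume.restrict Ω)) (hG : MemLp G 2 (volume.restrict Ω))
    (hφ : ∀ n, ContDiff ℝ ∞ (φ n)) (h : TendstoH1 Ω φ u G) {γ : Euc d → Euc d}
    (hγ : IsTrace Ω F u G γ) :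
    κ * diam T * ∫ x, ‖γ x‖ ^ 2 ∂(faceMeas F) ≤ (d + 1) * ∫ x, ‖u x‖ ^ 2 ∂(cellMeas T) +
      diam T ^ 2 * ∫ x, ‖G x‖ ^ 2 ∂(cellMeas T) := by
  have e1 := tendsto_integral_norm_sq (fun n => (isSimplex hT).memLp_face hd hF
    (hφ n).continuous.continuousOn 2) hγ.1 (tendsto_trace hd hΩ
    (mem_faces_of_mem_facesOf hd hT hF) hu hG hφ h hγ)
  have e2 := tendsto_integral_norm_sq (fun n => memLp_cell (hφ n).continuous.continuousOn 2)
    (hu.mono_measure (cellMeas_le hΩ hT)) (tendsto_cell hΩ hT h).1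
  have e3 := tendsto_integral_norm_sq
    (fun n => memLp_cell ((hφ n).continuous_fderiv (by simp)).continuousOn 2)
    (hG.mono_measure (cellMeas_le hΩ hT)) (tendsto_cell hΩ hT h).2
  exact le_of_tendsto_of_tendsto' (e1.const_mul _) ((e2.const_mul _).add (e3.const_mul _)) fun n =>
    hκT.trace_le hd hκ hF ((hφ n).of_le (by simp))

end SimplicialMesh

/-- The trace of matrices, as a continuous linear map. -/
noncomputable def traceL (d : ℕ) : (Euc d →L[ℝ] Euc d) →L[ℝ] ℝ :=
  ∑ j, (EuclideanSpace.proj j : Euc d →L[ℝ] ℝ).comp (ContinuousLinearMap.apply ℝ (Euc d)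
    (basisVec j))

lemma traceL_apply (A : Euc d →L[ℝ] Euc d) : traceL d A = trace A := by
  simp [traceL, trace]

/-- Integration by parts on an element for functions in `H¹`. -/
lemma SimplicialMesh.integral_trace_mul (hd : 0 < d) (hΩ : IsPolytopalDomain Ω) (hT : T ∈ K.cells)
    (hu : MemLp u 2 (volume.restrict Ω)) (hG : MemLp G 2 (volume.restrict Ω))
    (hφ : ∀ n, ContDiff ℝ ∞ (φ n)) (h : TendstoH1 Ω φ u G) {γ : Finset (Euc d) → Euc d → Euc d}
    (hγ : ∀ F ∈ K.faces, IsTrace Ω F u G (γ F)) {r : Euc d → ℝ} (hr : ContDiff ℝ 1 r) :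
    ∫ x, trace (G x) * r x ∂(cellMeas T) =
      -∑ i, ∫ x, u x i * fderiv ℝ r x (basisVec i) ∂(cellMeas T) +
        ∑ F ∈ facesOf T, ∫ x, ⟪γ F x, normal T F⟫ * r x ∂(faceMeas F) := by
  have hsT := isSimplex hT
  have hrc := hr.continuous
  have hrd := hr.continuous_fderiv one_ne_zero
  obtain ⟨h1, h2⟩ := tendsto_cell hΩ hT h
  have huT := hu.mono_measure (cellMeas_le hΩ hT)
  have hGT := hG.mono_measure (cellMeas_le hΩ hT)
  have hmr : MemLp r 2 (cellMeas T) := memLp_cell hrc.continuousOn 2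
  have e1 : Tendsto (fun n => ∫ x, divergence (φ n) x * r x ∂(cellMeas T)) atTop
      (𝓝 (∫ x, trace (G x) * r x ∂(cellMeas T))) := by
    have hm : ∀ n, MemLp (fun x => traceL d (fderiv ℝ (φ n) x)) 2 (cellMeas T) := fun n =>
      (traceL d).comp_memLp' (memLp_cell ((hφ n).continuous_fderiv (by simp)).continuousOn 2)
    have e := tendsto_integral_inner hm ((traceL d).comp_memLp' hGT) hmr (by
      have h3 := ENNReal.Tendsto.const_mul (a := (‖traceL d‖₊ : ℝ≥0∞)) h2
        (Or.inr ENNReal.coe_ne_top)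
      rw [mul_zero] at h3
      refine tendsto_of_tendsto_of_tendsto_of_le_of_le tendsto_const_nhds h3 (fun _ => zero_le)
        fun n => ?_
      refine eLpNorm_le_nnreal_smul_eLpNorm_of_ae_le_mul (.of_forall fun x => ?_) 2
      rw [Function.comp, ← map_sub]
      exact (traceL d).le_opNNNorm _)
    simpa only [inner_mul, Function.comp, traceL_apply, divergence] using e
  have e2 : Tendsto (fun n => -∑ i, ∫ x, φ n x i * fderiv ℝ r x (basisVec i) ∂(cellMeas T) +
      ∑ F ∈ facesOf T, ∫ x, ⟪φ n x, normal T F⟫ * r x ∂(faceMeas F)) atTop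
      (𝓝 (-∑ i, ∫ x, u x i * fderiv ℝ r x (basisVec i) ∂(cellMeas T) +
        ∑ F ∈ facesOf T, ∫ x, ⟪γ F x, normal T F⟫ * r x ∂(faceMeas F))) := by
    refine (tendsto_finsetSum _ fun i _ => ?_).neg.add (tendsto_finsetSum _ fun F hF => ?_)
    · have e := tendsto_integral_inner (fun n => memLp_cell (hφ n).continuous.continuousOn 2) huT
        (memLp_cell (f := fun x => fderiv ℝ r x (basisVec i) • basisVec i)
          (Continuous.continuousOn (by fun_prop)) 2) h1
      simpa only [inner_smul_right, inner_basisVec, mul_comm] using e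
    · have e := tendsto_integral_inner (fun n => hsT.memLp_face hd hF
        (hφ n).continuous.continuousOn 2) (hγ F (mem_faces_of_mem_facesOf hd hT hF)).1
        (hsT.memLp_face hd hF (f := fun x => r x • normal T F)
          (Continuous.continuousOn (by fun_prop)) 2)
        (tendsto_trace hd hΩ (mem_faces_of_mem_facesOf hd hT hF) hu hG hφ h
          (hγ F (mem_faces_of_mem_facesOf hd hT hF)))
      simpa only [inner_smul_right, mul_comm] using e
  refine tendsto_nhds_unique e1 (e2.congr fun n => ?_)
  exact (hsT.integral_divergence_mul hd ((hφ n).of_le (by simp)) hr).symm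


/-! ### The interpolate of the initial velocity -/

variable {d : ℕ} {Ω : Set (Euc d)} {K : SimplicialMesh Ω} {S T F : Finset (Euc d)} {k : ℕ}
  {u : Euc d → Euc d} {G : Euc d → Euc d →L[ℝ] Euc d}

lemma IsL2Proj.congr_ae {V : Submodule ℝ (Euc d → ℝ)} {μ : Measure (Euc d)} {g g' p : Euc d → ℝ}
    (hp : IsL2Proj V μ g p) (h : g =ᵐ[μ] g') : IsL2Proj V μ g' p :=
  ⟨hp.1, fun r hr => (hp.2 r hr).trans
    (integral_congr_ae (h.mono fun x hx => by simp only [hx]))⟩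

lemma IsFaceProj.congr_ae {l : ℤ} {g g' w : Euc d → Euc d} (hw : IsFaceProj l F g w)
    (h : g =ᵐ[faceMeas F] g') : IsFaceProj l F g' w :=
  fun i => (hw i).congr_ae (h.mono fun x hx => by simp only [hx])

namespace SimplicialMesh

lemma exists_isVelInterp (hd : 0 < d) (hΩ : IsPolytopalDomain Ω) (K : SimplicialMesh Ω) (k : ℕ)
    (hu : IsH1 Ω u G) (hV : VanishesOnBoundary Ω u G) :
    ∃ w ∈ velSpace K k, IsVelInterp K k u G w := by
  classical
  obtain ⟨φ, hφ, hlim⟩ := id hV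
  have hγ : ∀ F ∈ K.faces, ∃ γ, IsTrace Ω F u G γ := fun F hF =>
    exists_isTrace hd hΩ hF hu.memLp hu.memLp_grad (fun n => (hφ n).1) hlim
  choose! γ hγ using hγ
  have hw : ∀ T ∈ K.cells, ∃ w, IsRTNInterp ((k : ℤ) + 1) T u γ w := fun T hT =>
    (isSimplex hT).exists_isRTNInterp hd _ (hu.memLp.mono_measure (cellMeas_le hΩ hT))
      fun F hF => (hγ F (mem_faces_of_mem_facesOf hd hT hF)).1
  choose! w hw using hw
  have hp : ∀ F ∈ K.faces, ∃ p, IsFaceProj (k : ℤ) F (γ F) p := fun F hF => by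
    obtain ⟨T, hT, hFT⟩ := exists_cell hF
    exact (isSimplex hT).exists_isFaceProj hd hFT _ (hγ F hF).1
  choose! p hp using hp
  refine ⟨(fun T => if T ∈ K.cells then w T else 0, fun F => if F ∈ K.faces then p F else 0),
    ⟨fun T hT => ?_, fun T hT => if_neg hT, fun F hF i => ?_, fun F hF => if_neg hF,
      fun F hF hb => ?_⟩, γ, hγ, fun T hT => ?_, fun F hF => ?_⟩
  · simpa only [if_pos hT] using (hw T hT).1
  · simpa only [if_pos hF] using (hp F hF i).1
  · simp only [if_pos hF]
    obtain ⟨T, hT, hFT⟩ := exists_cell hF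
    refine (isSimplex hT).isFaceProj_unique hd hFT ((hp F hF).congr_ae
      (isTrace_boundary hd hΩ hF hb hu.memLp hu.memLp_grad hV (hγ F hF))) fun i => ?_
    exact ⟨zero_mem _, fun r _ => rfl⟩
  · simpa only [if_pos hT] using hw T hT
  · simpa only [if_pos hF] using hp F hF

lemma isVelInterp_unique (hd : 0 < d) (hΩ : IsPolytopalDomain Ω) (hu : IsH1 Ω u G)
    (hV : VanishesOnBoundary Ω u G) {w w' : Vel d} (hw : w ∈ velSpace K k)
    (hw' : w' ∈ velSpace K k) (h : IsVelInterp K k u G w) (h' : IsVelInterp K k u G w') :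
    w = w' := by
  obtain ⟨φ, hφ, hlim⟩ := hV
  obtain ⟨γ, hγ, h1, h2⟩ := h
  obtain ⟨γ', hγ', h1', h2'⟩ := h'
  have he : ∀ F ∈ K.faces, γ' F =ᵐ[faceMeas F] γ F := fun F hF =>
    isTrace_ae_eq hd hΩ hF hu.memLp hu.memLp_grad (fun n => (hφ n).1) hlim (hγ' F hF) (hγ F hF)
  refine Prod.ext (funext fun T => ?_) (funext fun F => ?_)
  · by_cases hT : T ∈ K.cells
    · refine (h1 T hT).unique hd (isSimplex hT)
        ⟨(h1' T hT).1, (h1' T hT).2.1, fun F hF => ((h1' T hT).2.2 F hF).congr_ae ?_⟩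
      exact (he F (mem_faces_of_mem_facesOf hd hT hF)).mono fun x hx => by simp only [hx]
    · rw [hw.2.1 T hT, hw'.2.1 T hT]
  · by_cases hF : F ∈ K.faces
    · obtain ⟨T, hT, hFT⟩ := exists_cell hF
      exact (isSimplex hT).isFaceProj_unique hd hFT (h2 F hF) ((h2' F hF).congr_ae (he F hF))
    · rw [hw.2.2.2.1 F hF, hw'.2.2.2.1 F hF]

/-- The interpolate of a divergence-free field is discretely divergence-free. -/
lemma coupling_velInterp (hd : 0 < d) (hΩ : IsPolytopalDomain Ω) (hu : IsH1 Ω u G)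
    (hV : VanishesOnBoundary Ω u G) (hdiv : ∀ᵐ x ∂(volume.restrict Ω), trace (G x) = 0)
    {w : Vel d} (hw : w ∈ velSpace K k) (h : IsVelInterp K k u G w) {q : Pre d}
    (hq : q ∈ preSpace K k) : coupling K k w q = 0 := by
  obtain ⟨φ, hφ, hlim⟩ := id hV
  obtain ⟨γ, hγ, h1, -⟩ := h
  have hflux : ∀ T ∈ K.cells, ∀ F ∈ facesOf T, ∀ r ∈ facePoly (k : ℤ) F,
      ∫ x, r x * ⟪w.1 T x, normal T F⟫ ∂(faceMeas F) =
        ∫ x, r x * ⟪γ F x, normal T F⟫ ∂(faceMeas F) := fun T hT F hF r hr => by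
    have := ((h1 T hT).2.2 F hF).2 r (by rwa [add_sub_cancel_right])
    rw [integral_indicator_mul] at this
    simpa only [mul_comm] using this
  have hcell : ∀ T ∈ K.cells, ∫ x, q.1 T x * divergence (w.1 T) x ∂(cellMeas T) = 0 := by
    intro T hT
    have hqT := hq.1 T hT
    have e1 := (isSimplex hT).integral_divergence_mul hd
      (contDiff_of_mem_vec (n := 1) (rtn_le_vec (hw.1 T hT))) (contDiff_of_mem_poly hqT)
    have e2 := integral_trace_mul hd hΩ hT hu.memLp hu.memLp_grad (fun n => (hφ n).1) hlim hγ
      (contDiff_of_mem_poly hqT)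
    have e3 : ∫ x, trace (G x) * q.1 T x ∂(cellMeas T) = 0 := by
      refine integral_eq_zero_of_ae ?_
      filter_upwards [Measure.absolutelyContinuous_of_le (cellMeas_le hΩ hT) hdiv] with x hx
      simp [hx]
    simp only [mul_comm (q.1 T _)]
    rw [e1, ← e3, e2]
    refine congrArg₂ (-· + ·) (Finset.sum_congr rfl fun i _ => ?_)
      (Finset.sum_congr rfl fun F hF => ?_)
    · refine (h1 T hT).2.1 i _ ?_
      have := fderiv_mem_poly hqT (basisVec i)
      rwa [show (k : ℤ) - 1 = k + 1 - 2 by ring] at this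
    · have := hflux T hT F hF _ (indicator_mem_facePoly hqT)
      rw [integral_indicator_mul, integral_indicator_mul] at this
      simpa only [mul_comm] using this
  rw [coupling_eq hd hw hq, Finset.sum_congr rfl fun T hT => by rw [hcell T hT, neg_zero, zero_add]]
  refine Eq.trans (Finset.sum_congr rfl fun T hT => Finset.sum_congr rfl fun F hF => ?_)
    (sum_inner_normal_eq_zero (K := K) hd hΩ (fun F => ∫ x, q.2 F x • γ F x ∂(faceMeas F))
      fun F hF hb => ?_)
  · have hFK := mem_faces_of_mem_facesOf hd hT hF
    have hint : Integrable (fun x => q.2 F x • γ F x) (faceMeas F) :=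
      memLp_one_iff_integrable.1 ((hγ F hFK).1.smul
        ((isSimplex hT).memLp_facePoly hd hF (hq.2.2.1 F hFK)))
    rw [hflux T hT F hF _ (hq.2.2.1 F hFK), real_inner_comm, ← integral_inner hint]
    simp only [inner_smul_right, real_inner_comm]
  · refine integral_eq_zero_of_ae ?_
    filter_upwards [isTrace_boundary hd hΩ hF hb hu.memLp hu.memLp_grad hV (hγ F hF)] with x hx
    simp [hx]

/-- Stability of the interpolation in the discrete `L²`-norm. -/
theorem exists_prodZero_velInterp_le (hd : 0 < d) (hΩ : IsPolytopalDomain Ω) (k : ℕ) {κ : ℝ}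
    (hκ : 0 < κ) : ∃ C : ℝ, 0 < C ∧ ∀ K : SimplicialMesh Ω, (∀ T ∈ K.cells, IsShapeRegular κ T) →
      ∀ (u : Euc d → Euc d) (G : Euc d → Euc d →L[ℝ] Euc d), IsH1 Ω u G →
        VanishesOnBoundary Ω u G → ∀ w ∈ velSpace K k, IsVelInterp K k u G w →
          prodZero K w w ≤ C * normH1Sq Ω u G := by
  obtain ⟨C₁, hC₁, h₁⟩ := exists_rtn_le hd ((k : ℤ) + 1) hκ
  obtain ⟨C₂, hC₂, h₂⟩ := (isScalable_rtn (d := d) ((k : ℤ) + 1)).exists_trace_le hd hκ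
  set R := Metric.diam Ω with hR
  have hR0 : 0 ≤ R := Metric.diam_nonneg
  set m : ℝ := κ⁻¹ * ((d + 1) + R ^ 2) with hm
  have hm0 : 0 < m := by positivity
  set A : ℝ := C₁ * (1 + (d + 1) * m) with hA
  have hA0 : 0 < A := by positivity
  refine ⟨A + (d + 1) * (2 * m + 2 * (C₂ * A)), by positivity,
    fun K hK u G hu hV w hw ⟨γ, hγ, h1, h2⟩ => ?_⟩
  obtain ⟨φ, hφ, hlim⟩ := hV
  have hIu : ∀ T ∈ K.cells, Integrable (fun x => ‖u x‖ ^ 2) (cellMeas T) := fun T hT =>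
    (integrable_norm_sq hu.memLp).mono_measure (cellMeas_le hΩ hT)
  have hfrob : Integrable (fun x => frob (G x) (G x)) (volume.restrict Ω) := by
    simp only [frob_self_eq]
    exact integrable_finsetSum _ fun j _ => integrable_norm_sq
      ((ContinuousLinearMap.apply ℝ (Euc d) (basisVec j)).comp_memLp' hu.memLp_grad)
  have hIG : ∀ T ∈ K.cells, Integrable (fun x => frob (G x) (G x)) (cellMeas T) := fun T hT =>
    hfrob.mono_measure (cellMeas_le hΩ hT)
  rw [normH1Sq, integral_eq_sum hΩ K hIu, integral_eq_sum hΩ K hIG, ← Finset.sum_add_distrib,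
    Finset.mul_sum, prodZero]
  refine Finset.sum_le_sum fun T hT => ?_
  have hsT := isSimplex hT
  have hcard : ((facesOf T).card : ℝ) = d + 1 := by rw [hsT.card_facesOf]; push_cast; ring
  have hh := hsT.diam_pos hd
  set N := ∫ x, ‖u x‖ ^ 2 ∂(cellMeas T) + ∫ x, frob (G x) (G x) ∂(cellMeas T) with hN
  have hu0 : 0 ≤ ∫ x, ‖u x‖ ^ 2 ∂(cellMeas T) := integral_norm_sq_nonneg
  have hG1 : 0 ≤ ∫ x, ‖G x‖ ^ 2 ∂(cellMeas T) := integral_nonneg fun _ => sq_nonneg _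
  have hG2 : ∫ x, ‖G x‖ ^ 2 ∂(cellMeas T) ≤ ∫ x, frob (G x) (G x) ∂(cellMeas T) :=
    integral_mono (((hu.memLp_grad.mono_measure (cellMeas_le hΩ hT))).integrable_norm_pow
      two_ne_zero) (hIG T hT) fun x => norm_sq_le_frob _
  have hN0 : 0 ≤ N := by linarith
  have hmT := hu.memLp.mono_measure (cellMeas_le hΩ hT)
  have hmF : ∀ F ∈ facesOf T, MemLp (γ F) 2 (faceMeas F) := fun F hF =>
    (hγ F (mem_faces_of_mem_facesOf hd hT hF)).1
  have htr : ∀ F ∈ facesOf T, diam T * ∫ x, ‖γ F x‖ ^ 2 ∂(faceMeas F) ≤ m * N := by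
    intro F hF
    have e := trace_sq_le hd hΩ hT hF hκ.le (hK T hT) hu.memLp hu.memLp_grad
      (fun n => (hφ n).1) hlim (hγ F (mem_faces_of_mem_facesOf hd hT hF))
    have hdR : diam T ^ 2 ≤ R ^ 2 := pow_le_pow_left₀ hh.le (diam_le hΩ hT) 2
    rw [hm, mul_assoc, ← div_eq_inv_mul, le_div_iff₀ hκ]
    have e1 := mul_le_mul hdR hG2 hG1 (sq_nonneg R)
    have e2 : (d + 1 : ℝ) * ∫ x, ‖u x‖ ^ 2 ∂(cellMeas T) ≤ (d + 1) * N :=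
      mul_le_mul_of_nonneg_left (by linarith) (by positivity)
    have e3 : R ^ 2 * ∫ x, frob (G x) (G x) ∂(cellMeas T) ≤ R ^ 2 * N :=
      mul_le_mul_of_nonneg_left (by linarith) (by positivity)
    nlinarith
  have hwT : ∫ x, ‖w.1 T x‖ ^ 2 ∂(cellMeas T) ≤ A * N := by
    have e := h₁ T (hK T hT) _ (hw.1 T hT) _ (add_nonneg hu0 (mul_nonneg hh.le
      (Finset.sum_nonneg fun F _ => integral_norm_sq_nonneg)))
      ((h1 T hT).dofBound hd hsT hmT hmF)
    refine e.trans ?_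
    rw [hA, mul_assoc]
    refine mul_le_mul_of_nonneg_left ?_ hC₁.le
    have e2 := Finset.sum_le_sum htr
    rw [← Finset.mul_sum, Finset.sum_const, nsmul_eq_mul, hcard] at e2
    linarith
  have hface : ∀ F ∈ facesOf T, diam T * ∫ x, ‖w.2 F x - w.1 T x‖ ^ 2 ∂(faceMeas F) ≤
      2 * (m * N) + 2 * (C₂ * (A * N)) := by
    intro F hF
    have hFK := mem_faces_of_mem_facesOf hd hT hF
    have e1 := integral_norm_sub_sq_le (hsT.memLp_of_isFaceProj hd hF fun i => (h2 F hFK i).1)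
      (hsT.memLp_face hd hF (continuous_of_mem_vec (rtn_le_vec (hw.1 T hT))).continuousOn 2)
    have e2 := hsT.integral_faceProj_le hd hF (hmF F hF) (h2 F hFK)
    have e3 := (h₂ T (hK T hT) F hF _ (hw.1 T hT)).trans (mul_le_mul_of_nonneg_left hwT hC₂.le)
    have e4 := mul_le_mul_of_nonneg_left e1 hh.le
    have e5 := (mul_le_mul_of_nonneg_left e2 hh.le).trans (htr F hF)
    linarith
  simp only [real_inner_self_eq_norm_sq]
  rw [Finset.mul_sum]
  have e := Finset.sum_le_sum hface
  rw [Finset.sum_const, nsmul_eq_mul, hcard] at e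
  calc _ ≤ A * N + (d + 1) * (2 * (m * N) + 2 * (C₂ * (A * N))) := add_le_add hwT e
    _ = _ := by ring

end SimplicialMesh

/-! ### The discrete problem in terms of multilinear forms -/

section Multilinear

variable {ι X H U V W : Type*} [AddCommGroup U] [Module ℝ U] [AddCommGroup V] [Module ℝ V]
  [AddCommGroup W] [Module ℝ W]

lemma exists_bilin_sum {s : Finset ι} {g : ι → U → V → ℝ}
    (h : ∀ i ∈ s, ∃ A : U →ₗ[ℝ] V →ₗ[ℝ] ℝ, ∀ u v, A u v = g i u v) :
    ∃ A : U →ₗ[ℝ] V →ₗ[ℝ] ℝ, ∀ u v, A u v = ∑ i ∈ s, g i u v := by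
  choose! A hA using h
  refine ⟨∑ i ∈ s, A i, fun u v => ?_⟩
  simp only [LinearMap.sum_apply]
  exact Finset.sum_congr rfl fun i hi => hA i hi u v

lemma exists_trilin_sum {s : Finset ι} {g : ι → W → U → V → ℝ}
    (h : ∀ i ∈ s, ∃ A : W →ₗ[ℝ] U →ₗ[ℝ] V →ₗ[ℝ] ℝ, ∀ w u v, A w u v = g i w u v) :
    ∃ A : W →ₗ[ℝ] U →ₗ[ℝ] V →ₗ[ℝ] ℝ, ∀ w u v, A w u v = ∑ i ∈ s, g i w u v := by
  choose! A hA using h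
  refine ⟨∑ i ∈ s, A i, fun w u v => ?_⟩
  simp only [LinearMap.sum_apply]
  exact Finset.sum_congr rfl fun i hi => hA i hi w u v

/-- The trilinear form `∫ ⟪A w u, B v⟫ dμ`. -/
noncomputable def pairing₃ [MeasurableSpace X] [NormedAddCommGroup H] [InnerProductSpace ℝ H]
    (μ : Measure X) (A : W →ₗ[ℝ] U →ₗ[ℝ] (X → H)) (B : V →ₗ[ℝ] (X → H))
    (hA : ∀ w u, MemLp (A w u) 2 μ) (hB : ∀ v, MemLp (B v) 2 μ) :
    W →ₗ[ℝ] U →ₗ[ℝ] V →ₗ[ℝ] ℝ where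
  toFun w := pairing μ (A w) B (hA w) hB
  map_add' w w' := LinearMap.ext₂ fun u v => by
    simp only [LinearMap.add_apply, pairing_apply]
    rw [← integral_add (integrable_inner (hA w u) (hB v)) (integrable_inner (hA w' u) (hB v))]
    simp [inner_add_left]
  map_smul' c w := LinearMap.ext₂ fun u v => by
    simp only [LinearMap.smul_apply, pairing_apply, smul_eq_mul, RingHom.id_apply]
    rw [← integral_const_mul]
    simp [real_inner_smul_left]

end Multilinear

variable {d : ℕ} {Ω : Set (Euc d)} {K : SimplicialMesh Ω} {S T F : Finset (Euc d)} {k : ℕ}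

namespace SimplicialMesh

/-- The component of a discrete velocity on an element, as a linear map. -/
def velCell (K : SimplicialMesh Ω) (k : ℕ) (T : Finset (Euc d)) :
    velSpace K k →ₗ[ℝ] (Euc d → Euc d) where
  toFun v := v.1.1 T
  map_add' _ _ := rfl
  map_smul' _ _ := rfl

/-- The component of a discrete velocity on a face, as a linear map. -/
def velFace (K : SimplicialMesh Ω) (k : ℕ) (F : Finset (Euc d)) :
    velSpace K k →ₗ[ℝ] (Euc d → Euc d) where
  toFun v := v.1.2 F
  map_add' _ _ := rfl
  map_smul' _ _ := rfl

/-- The restriction of a discrete velocity to an element, as a linear map. -/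
def velLoc (hd : 0 < d) (hT : T ∈ K.cells) (k : ℕ) : velSpace K k →ₗ[ℝ] locSub k T where
  toFun v := ⟨loc T v, v.2.1 T hT, fun F hF => v.2.2.2.1 F (mem_faces_of_mem_facesOf hd hT hF)⟩
  map_add' _ _ := rfl
  map_smul' _ _ := rfl

/-- The restriction of a discrete pressure to an element, as a linear map. -/
def preLoc (hd : 0 < d) (hT : T ∈ K.cells) (k : ℕ) : preSpace K k →ₗ[ℝ] locPreSub k T where
  toFun := locPre hd hT
  map_add' _ _ := rfl
  map_smul' _ _ := rfl

instance : FiniteDimensional ℝ (velSpace K k) := by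
  let L : velSpace K k →ₗ[ℝ] ((T : K.cells) → rtn d ((k : ℤ) + 1)) ×
      ((F : K.faces) → vec (facePoly (k : ℤ) F.1)) :=
    { toFun := fun v => (fun T => ⟨v.1.1 T, v.2.1 T.1 T.2⟩, fun F => ⟨v.1.2 F, v.2.2.2.1 F.1 F.2⟩)
      map_add' := fun _ _ => rfl
      map_smul' := fun _ _ => rfl }
  refine FiniteDimensional.of_injective L fun v w h => Subtype.ext (Prod.ext (funext fun T => ?_)
    (funext fun F => ?_))
  · by_cases hT : T ∈ K.cells
    · exact congrArg Subtype.val (congrFun (congrArg Prod.fst h) ⟨T, hT⟩)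
    · rw [v.2.2.1 T hT, w.2.2.1 T hT]
  · by_cases hF : F ∈ K.faces
    · exact congrArg Subtype.val (congrFun (congrArg Prod.snd h) ⟨F, hF⟩)
    · rw [v.2.2.2.2.1 F hF, w.2.2.2.2.1 F hF]

instance : FiniteDimensional ℝ (preSpace K k) := by
  let L : preSpace K k →ₗ[ℝ] ((T : K.cells) → poly d (k : ℤ)) ×
      ((F : K.faces) → facePoly (k : ℤ) F.1) :=
    { toFun := fun v => (fun T => ⟨v.1.1 T, v.2.1 T.1 T.2⟩, fun F => ⟨v.1.2 F, v.2.2.2.1 F.1 F.2⟩)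
      map_add' := fun _ _ => rfl
      map_smul' := fun _ _ => rfl }
  refine FiniteDimensional.of_injective L fun v w h => Subtype.ext (Prod.ext (funext fun T => ?_)
    (funext fun F => ?_))
  · by_cases hT : T ∈ K.cells
    · exact congrArg Subtype.val (congrFun (congrArg Prod.fst h) ⟨T, hT⟩)
    · rw [v.2.2.1 T hT, w.2.2.1 T hT]
  · by_cases hF : F ∈ K.faces
    · exact congrArg Subtype.val (congrFun (congrArg Prod.snd h) ⟨F, hF⟩)
    · rw [v.2.2.2.2 F hF, w.2.2.2.2 F hF]

lemma continuous_velCell (hT : T ∈ K.cells) (v : velSpace K k) : Continuous (velCell K k T v) :=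
  continuous_of_mem_vec (rtn_le_vec (v.2.1 T hT))

lemma memLp_velCell (hT : T ∈ K.cells) (v : velSpace K k) :
    MemLp (velCell K k T v) 2 (cellMeas T) :=
  memLp_cell (continuous_velCell hT v).continuousOn 2

lemma memLp_velFace (hd : 0 < d) (hT : T ∈ K.cells) (hF : F ∈ facesOf T) (v : velSpace K k) :
    MemLp (velFace K k F v) 2 (faceMeas F) :=
  (isSimplex hT).memLp_of_isFaceProj hd hF
    (v.2.2.2.1 F (mem_faces_of_mem_facesOf hd hT hF))

lemma memLp_velCell_face (hd : 0 < d) (hT : T ∈ K.cells) (hF : F ∈ facesOf T)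
    (v : velSpace K k) : MemLp (velCell K k T v) 2 (faceMeas F) :=
  (isSimplex hT).memLp_face hd hF (continuous_velCell hT v).continuousOn 2

lemma exists_jump_bilin (hd : 0 < d) (hT : T ∈ K.cells) (k : ℕ) :
    ∃ A : velSpace K k →ₗ[ℝ] velSpace K k →ₗ[ℝ] ℝ, ∀ w v, A w v = ∑ F ∈ facesOf T,
      ∫ x, ⟪w.1.2 F x - w.1.1 T x, v.1.2 F x - v.1.1 T x⟫ ∂(faceMeas F) :=
  exists_bilin_sum fun F hF => ⟨pairing (faceMeas F) (velFace K k F - velCell K k T)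
    (velFace K k F - velCell K k T)
    (fun v => (memLp_velFace hd hT hF v).sub (memLp_velCell_face hd hT hF v))
    (fun v => (memLp_velFace hd hT hF v).sub (memLp_velCell_face hd hT hF v)), fun _ _ => rfl⟩

lemma exists_prodZero_bilin (hd : 0 < d) (K : SimplicialMesh Ω) (k : ℕ) :
    ∃ M : velSpace K k →ₗ[ℝ] velSpace K k →ₗ[ℝ] ℝ, ∀ w v, M w v = prodZero K (w : Vel d) v :=
  exists_bilin_sum fun T hT => by
    obtain ⟨A, hA⟩ := exists_jump_bilin hd hT k
    refine ⟨pairing (cellMeas T) (velCell K k T) (velCell K k T) (memLp_velCell hT)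
      (memLp_velCell hT) + diam T • A, fun w v => ?_⟩
    rw [LinearMap.add_apply, LinearMap.add_apply, LinearMap.smul_apply, LinearMap.smul_apply, hA]
    rfl

lemma exists_convStab_bilin (hd : 0 < d) (K : SimplicialMesh Ω) (k : ℕ)
    (β : Finset (Euc d) → ℝ) :
    ∃ j : velSpace K k →ₗ[ℝ] velSpace K k →ₗ[ℝ] ℝ, ∀ w v, j w v = convStab K β (w : Vel d) v :=
  exists_bilin_sum fun T hT => by
    obtain ⟨A, hA⟩ := exists_jump_bilin hd hT k
    refine ⟨β T • A, fun w v => ?_⟩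
    rw [LinearMap.smul_apply, LinearMap.smul_apply, hA]
    rfl

lemma exists_visc_bilin (hd : 0 < d) {η : ℝ} {s : Finset (Euc d) → LocVel d → LocVel d → ℝ}
    (hs : IsStabilization K k η s) :
    ∃ a : velSpace K k →ₗ[ℝ] velSpace K k →ₗ[ℝ] ℝ, ∀ w v, a w v = visc K k s (w : Vel d) v :=
  exists_bilin_sum fun T hT => by
    obtain ⟨A, hA⟩ := exists_viscT_bilin hd (isSimplex hT) hs hT
    exact ⟨A.compl₁₂ (velLoc hd hT k) (velLoc hd hT k), fun w v => hA _ _⟩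

lemma exists_coupling_bilin (hd : 0 < d) (K : SimplicialMesh Ω) (k : ℕ) :
    ∃ b : velSpace K k →ₗ[ℝ] preSpace K k →ₗ[ℝ] ℝ, ∀ v q,
      b v q = coupling K k (v : Vel d) (q : Pre d) :=
  exists_bilin_sum fun T hT => by
    exact ⟨pairing (cellMeas T) (velCell K k T)
      ((rtn d ((k : ℤ) + 1)).subtype ∘ₗ gradPreLin hd (isSimplex hT) k ∘ₗ preLoc hd hT k)
      (memLp_velCell hT) fun q => memLp_of_mem_rtn
        (gradPreLin hd (isSimplex hT) k (preLoc hd hT k q)).2, fun _ _ => rfl⟩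

lemma exists_conv_trilin (hd : 0 < d) (K : SimplicialMesh Ω) (k : ℕ) :
    ∃ N : velSpace K k →ₗ[ℝ] velSpace K k →ₗ[ℝ] velSpace K k →ₗ[ℝ] ℝ, ∀ w v z,
      N w v z = conv K (w : Vel d) v z :=
  exists_trilin_sum fun T hT => by
    have hdv : ∀ v : velSpace K k, Differentiable ℝ (v.1.1 T) := fun v =>
      differentiable_of_mem_vec (rtn_le_vec (v.2.1 T hT))
    have hdc : ∀ v : velSpace K k, Continuous (fderiv ℝ (v.1.1 T)) := fun v =>
      (isScalable_rtn _).continuous_fderiv (v.2.1 T hT)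
    let A : velSpace K k →ₗ[ℝ] velSpace K k →ₗ[ℝ] (Euc d → Euc d) := LinearMap.mk₂ ℝ
      (fun w v x => fderiv ℝ (v.1.1 T) x (w.1.1 T x)) (fun w w' v => funext fun x => map_add _ _ _)
      (fun c w v => funext fun x =>
        (fderiv ℝ (v.1.1 T) x).map_smul c (w.1.1 T x))
      (fun w v v' => funext fun x => by
        change fderiv ℝ (v.1.1 T + v'.1.1 T) x _ = _
        rw [fderiv_add (hdv v x) (hdv v' x)]; rfl)
      (fun c w v => funext fun x => by
        change fderiv ℝ (c • v.1.1 T) x _ = _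
        rw [fderiv_const_smul (hdv v x)]; rfl)
    have hA : ∀ w v, MemLp (A w v) 2 (cellMeas T) := fun w v =>
      memLp_cell ((hdc v).clm_apply (continuous_velCell hT w)).continuousOn 2
    have hB : ∃ B : velSpace K k →ₗ[ℝ] velSpace K k →ₗ[ℝ] velSpace K k →ₗ[ℝ] ℝ, ∀ w v z,
        B w v z = ∑ F ∈ facesOf T, ∫ x, ⟪w.1.1 T x, normal T F⟫ *
          ⟪v.1.2 F x - v.1.1 T x, z.1.2 F x + z.1.1 T x⟫ ∂(faceMeas F) :=
      exists_trilin_sum fun F hF => by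
        let D : velSpace K k →ₗ[ℝ] velSpace K k →ₗ[ℝ] (Euc d → Euc d) := LinearMap.mk₂ ℝ
          (fun w v x => ⟪w.1.1 T x, normal T F⟫ • (v.1.2 F x - v.1.1 T x))
          (fun w w' v => funext fun x => by
            change ⟪w.1.1 T x + w'.1.1 T x, normal T F⟫ • _ = _
            rw [inner_add_left, add_smul]; rfl)
          (fun c w v => funext fun x => by
            change ⟪c • w.1.1 T x, normal T F⟫ • _ = _
            rw [real_inner_smul_left, mul_smul]; rfl)
          (fun w v v' => funext fun x => by
            change _ • (v.1.2 F x + v'.1.2 F x - (v.1.1 T x + v'.1.1 T x)) = _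
            rw [add_sub_add_comm, smul_add]; rfl)
          (fun c w v => funext fun x => by
            change _ • (c • v.1.2 F x - c • v.1.1 T x) = _
            rw [← smul_sub, smul_comm]; rfl)
        have hD : ∀ w v, MemLp (D w v) 2 (faceMeas F) := fun w v => by
          obtain ⟨p, hp, hvp⟩ := exists_poly_of_mem_velSpace v.2 (mem_faces_of_mem_facesOf hd hT hF)
          refine (memLp_congr_ae ?_).2 ((isSimplex hT).memLp_face hd hF
            (f := fun x => (⟪w.1.1 T x, normal T F⟫ : ℝ) • (p x - v.1.1 T x))
            (Continuous.continuousOn ?_) 2)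
          · exact (ae_restrict_iff' measurableSet_hull).2 (.of_forall fun x hx => by
              change ⟪w.1.1 T x, normal T F⟫ • (v.1.2 F x - v.1.1 T x) = _
              rw [hvp x hx])
          · exact ((continuous_velCell hT w).inner (𝕜 := ℝ) continuous_const).smul
              ((continuous_of_mem_vec hp).sub (continuous_velCell hT v))
        refine ⟨pairing₃ (faceMeas F) D (velFace K k F + velCell K k T) hD
          (fun v => (memLp_velFace hd hT hF v).add (memLp_velCell_face hd hT hF v)),
          fun w v z => integral_congr_ae (.of_forall fun x => ?_)⟩
        exact real_inner_smul_left _ _ _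
    obtain ⟨B, hB⟩ := hB
    refine ⟨pairing₃ (cellMeas T) A (velCell K k T) hA (memLp_velCell hT) + (1 / 2 : ℝ) • B,
      fun w v z => ?_⟩
    simp only [LinearMap.add_apply, LinearMap.smul_apply, hB]
    rfl

/-- The piecewise polynomial function `v_h`, as an element of `L²(Ω)`. -/
noncomputable def velL2 (K : SimplicialMesh Ω) (k : ℕ) :
    velSpace K k →ₗ[ℝ] Lp (Euc d) 2 (volume.restrict Ω) :=
  toLpLin _ { toFun := fun v => K.piecewise v.1.1
              map_add' := fun v w => funext fun x => piecewise_add v.1.1 w.1.1 x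
              map_smul' := fun c v => funext fun x => piecewise_smul c v.1.1 x }
    fun v => memLp_piecewise fun _ hT => memLp_velCell hT v

lemma inner_velL2 (f : Lp (Euc d) 2 (volume.restrict Ω)) (v : velSpace K k) :
    ⟪f, velL2 K k v⟫ = ∫ x in Ω, ⟪f x, K.piecewise v.1.1 x⟫ := by
  rw [L2.inner_def]
  refine integral_congr_ae ?_
  filter_upwards [(memLp_piecewise (K := K) fun _ hT => memLp_velCell hT v).coeFn_toLp] with x hx
  exact congrArg (inner ℝ (f x)) hx

lemma norm_velL2_sq_le (hΩ : IsPolytopalDomain Ω) (v : velSpace K k) :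
    ‖velL2 K k v‖ ^ 2 ≤ prodZero K (v : Vel d) v := by
  have e : ‖velL2 K k v‖ ^ 2 = ∫ x in Ω, ‖K.piecewise v.1.1 x‖ ^ 2 :=
    norm_toLp_sq (memLp_piecewise fun _ hT => memLp_velCell hT v)
  have hI : ∀ T ∈ K.cells, Integrable (fun x => ‖v.1.1 T x‖ ^ 2) (cellMeas T) := fun T hT =>
    integrable_norm_sq (memLp_velCell hT v)
  rw [e, integral_piecewise hΩ K (v := v.1.1) (fun _ y => ‖y‖ ^ 2) hI, prodZero]
  refine Finset.sum_le_sum fun T _ => ?_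
  simp only [real_inner_self_eq_norm_sq]
  exact le_add_of_nonneg_right (mul_nonneg diam_nonneg
    (Finset.sum_nonneg fun F _ => integral_nonneg fun _ => sq_nonneg _))

/-- The discrete pressures of zero average. -/
def preZero (hΩ : IsPolytopalDomain Ω) (K : SimplicialMesh Ω) (k : ℕ) :
    Submodule ℝ (preSpace K k) where
  carrier := {q | (q : Pre d) ∈ preSpaceZero K k}
  zero_mem' := ⟨zero_mem _, by simp [piecewise]⟩
  add_mem' := fun {p q} hp hq => ⟨(p + q).2, by
    have : IsFiniteMeasure (volume.restrict Ω) :=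
      ⟨by rw [Measure.restrict_apply_univ]; exact hΩ.bounded.measure_lt_top⟩
    have hI : ∀ q : preSpace K k, Integrable (K.piecewise q.1.1) (volume.restrict Ω) := fun q =>
      (memLp_piecewise fun T hT =>
        memLp_cell (continuous_of_mem_poly (q.2.1 T hT)).continuousOn 2).integrable one_le_two
    change ∫ x in Ω, K.piecewise (p.1.1 + q.1.1) x = 0
    simp only [piecewise_add]
    rw [integral_add (hI p) (hI q), hp.2, hq.2, add_zero]⟩
  smul_mem' := fun c q hq => ⟨(c • q).2, by
    change ∫ x in Ω, K.piecewise (c • q.1.1) x = 0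
    simp only [piecewise_smul]
    rw [integral_smul, hq.2, smul_zero]⟩

end SimplicialMesh

/-! ### The energy estimate and the theorem -/

/-- Integrated energy inequality, with the dissipation. The factor `e^{-s}` absorbs `E`; in front of
the dissipation it is bounded below by `e^{-t}`. -/
lemma energy_estimate {T : ℝ} {E E' D g : ℝ → ℝ}
    (hE : ∀ t ∈ Icc 0 T, HasDerivWithinAt E (E' t) (Icc 0 T) t) (hD : ContinuousOn D (Icc 0 T))
    (hg : ContinuousOn g (Icc 0 T)) (hD0 : ∀ t ∈ Icc 0 T, 0 ≤ D t) (hg0 : ∀ t ∈ Icc 0 T, 0 ≤ g t)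
    (he : ∀ t ∈ Icc 0 T, E' t ≤ g t + E t - 2 * D t) {t : ℝ} (ht : t ∈ Icc 0 T) :
    E t + 2 * ∫ s in (0 : ℝ)..t, D s ≤ Real.exp t * (E 0 + ∫ s in (0 : ℝ)..t, g s) := by
  have hsub : Icc 0 t ⊆ Icc 0 T := Icc_subset_Icc_right ht.2
  have hIg : IntegrableOn g (Icc 0 t) := (hg.mono hsub).integrableOn_compact isCompact_Icc
  have hID : IntegrableOn D (Icc 0 t) := (hD.mono hsub).integrableOn_compact isCompact_Icc
  have hexp : ∀ s, HasDerivAt (fun s => Real.exp (-s)) (-Real.exp (-s)) s := fun s => by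
    simpa using ((hasDerivAt_id s).neg).exp
  have key := intervalIntegral.sub_le_integral_of_hasDeriv_right_of_le
    (g := fun s => Real.exp (-s) * E s) (g' := fun s => -Real.exp (-s) * E s + Real.exp (-s) * E' s)
    (φ := fun s => g s - 2 * Real.exp (-t) * D s) ht.1
    ((Real.continuous_exp.comp continuous_neg).continuousOn.mul
      fun s hs => (hE s (hsub hs)).continuousWithinAt.mono hsub)
    (fun s hs => by
      have h1 := hE s (hsub (Ioo_subset_Icc_self hs))
      have h2 : HasDerivAt E (E' s) s :=
        h1.hasDerivAt (Icc_mem_nhds hs.1 (hs.2.trans_le ht.2))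
      exact ((hexp s).mul h2).hasDerivWithinAt)
    (hIg.sub (hID.const_mul _))
    (fun s hs => by
      have hs' := hsub (Ioo_subset_Icc_self hs)
      have h1 := he s hs'
      have h2 : Real.exp (-s) ≤ 1 := Real.exp_le_one_iff.2 (by linarith [hs.1])
      have h3 : Real.exp (-t) ≤ Real.exp (-s) := Real.exp_le_exp.2 (by linarith [hs.2])
      have h4 := mul_le_mul_of_nonneg_right h3 (hD0 s hs')
      have h5 := mul_le_mul_of_nonneg_right h2 (hg0 s hs')
      have h6 := mul_le_mul_of_nonneg_left h1 (Real.exp_pos (-s)).le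
      nlinarith)
  have hi : ∀ {h : ℝ → ℝ}, IntegrableOn h (Icc 0 t) → IntervalIntegrable h volume 0 t := fun h =>
    (intervalIntegrable_iff_integrableOn_Icc_of_le ht.1).2 h
  rw [intervalIntegral.integral_sub (hi hIg) ((hi hID).const_mul _),
    intervalIntegral.integral_const_mul] at key
  simp only [neg_zero, Real.exp_zero, one_mul] at key
  have h1 : Real.exp t * Real.exp (-t) = 1 := by rw [← Real.exp_add]; simp
  have h2 := mul_le_mul_of_nonneg_left key (Real.exp_pos t).le
  set I := ∫ s in (0 : ℝ)..t, D s
  set J := ∫ s in (0 : ℝ)..t, g s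
  have h3 : Real.exp t * (Real.exp (-t) * E t - E 0) = E t - Real.exp t * E 0 := by
    linear_combination E t * h1
  have h4 : Real.exp t * (J - 2 * Real.exp (-t) * I) = Real.exp t * J - 2 * I := by
    linear_combination (-2 * I) * h1
  rw [h3, h4] at h2
  linarith

/-- The consequence of the energy inequality for the norm in the energy estimate: `A` and `J` are
the viscous and convective dissipations, and `B` is controlled by `A`. -/
lemma sSup_add_integral_le {T C : ℝ} {E E' A J B g : ℝ → ℝ} (hT : 0 < T)
    (hE : ∀ t ∈ Icc 0 T, HasDerivWithinAt E (E' t) (Icc 0 T) t) (hA : ContinuousOn A (Icc 0 T))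
    (hJ : ContinuousOn J (Icc 0 T)) (hg : ContinuousOn g (Icc 0 T))
    (hA0 : ∀ t ∈ Icc 0 T, 0 ≤ A t) (hJ0 : ∀ t ∈ Icc 0 T, 0 ≤ J t) (hE0 : ∀ t ∈ Icc 0 T, 0 ≤ E t)
    (hg0 : ∀ t ∈ Icc 0 T, 0 ≤ g t) (he : ∀ t ∈ Icc 0 T, E' t ≤ g t + E t - 2 * (A t + J t))
    (hB0 : ∀ t, 0 ≤ B t) (hB : ∀ t, B t ≤ C * A t) :
    sSup (E '' Icc 0 T) + (∫ t in (0 : ℝ)..T, B t) + ∫ t in (0 : ℝ)..T, J t ≤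
      (1 + max C 1) * (Real.exp T * (E 0 + ∫ t in (0 : ℝ)..T, g t)) := by
  have hD0 : ∀ t ∈ Icc 0 T, 0 ≤ A t + J t := fun t ht => add_nonneg (hA0 t ht) (hJ0 t ht)
  have hest := fun t (ht : t ∈ Icc 0 T) => energy_estimate hE (hA.add hJ) hg hD0 hg0 he ht
  simp only [Pi.add_apply] at hest
  set R := Real.exp T * (E 0 + ∫ t in (0 : ℝ)..T, g t) with hR
  have hgi := ContinuousOn.intervalIntegrable_of_Icc (μ := volume) hT.le hg
  have hai := ContinuousOn.intervalIntegrable_of_Icc (μ := volume) hT.le hA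
  have hji := ContinuousOn.intervalIntegrable_of_Icc (μ := volume) hT.le hJ
  have hsup : sSup (E '' Icc 0 T) ≤ R := by
    refine csSup_le ((nonempty_Icc.2 hT.le).image _) ?_
    rintro _ ⟨t, ht, rfl⟩
    have hsub : ∀ r ∈ Icc 0 t, r ∈ Icc 0 T := fun r hr => ⟨hr.1, hr.2.trans ht.2⟩
    have h1 := hest t ht
    have h2 : 0 ≤ ∫ r in (0 : ℝ)..t, (A r + J r) :=
      intervalIntegral.integral_nonneg ht.1 fun r hr => hD0 r (hsub r hr)
    have h3 : ∫ r in (0 : ℝ)..t, g r ≤ ∫ r in (0 : ℝ)..T, g r :=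
      intervalIntegral.integral_mono_interval le_rfl ht.1 ht.2
        ((ae_restrict_iff' measurableSet_Ioc).2
          (.of_forall fun r hr => hg0 r (Ioc_subset_Icc_self hr))) hgi
    have h4 : 0 ≤ ∫ r in (0 : ℝ)..t, g r :=
      intervalIntegral.integral_nonneg ht.1 fun r hr => hg0 r (hsub r hr)
    calc E t ≤ Real.exp t * (E 0 + ∫ r in (0 : ℝ)..t, g r) := by linarith
      _ ≤ R := mul_le_mul (Real.exp_le_exp.2 ht.2) (by linarith)
          (add_nonneg (hE0 0 (left_mem_Icc.2 hT.le)) h4) (Real.exp_pos _).le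
  have hdis := hest T (right_mem_Icc.2 hT.le)
  rw [intervalIntegral.integral_add hai hji, ← hR] at hdis
  have h0A := intervalIntegral.integral_nonneg (μ := volume) hT.le hA0
  have h0J := intervalIntegral.integral_nonneg (μ := volume) hT.le hJ0
  have h0E := hE0 T (right_mem_Icc.2 hT.le)
  -- `B` need not be measurable: the integral of a nonnegative function is bounded by that of any
  -- integrable majorant.
  have hN : ∫ t in (0 : ℝ)..T, B t ≤ max C 1 * ∫ t in (0 : ℝ)..T, A t := by
    rw [← intervalIntegral.integral_const_mul, intervalIntegral.integral_of_le hT.le,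
      intervalIntegral.integral_of_le hT.le]
    refine integral_mono_of_nonneg (.of_forall hB0)
      ((intervalIntegrable_iff_integrableOn_Ioc_of_le hT.le).1 (hai.const_mul _))
      ((ae_restrict_iff' measurableSet_Ioc).2 (.of_forall fun t ht => (hB t).trans ?_))
    exact mul_le_mul_of_nonneg_right (le_max_left C 1) (hA0 t (Ioc_subset_Icc_self ht))
  have h1 : 1 ≤ max C 1 := le_max_right _ _
  nlinarith

/-- The discrete spaces carry no norm, which `HasDerivWithinAt.continuousWithinAt` requires. -/
lemma continuousWithinAt_of_hasDerivWithinAt {V : Type*} [AddCommGroup V] [Module ℝ V]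
    [FiniteDimensional ℝ V] [TopologicalSpace V] [IsTopologicalAddGroup V] [ContinuousSMul ℝ V]
    [T2Space V] {u : ℝ → V} {u' : V} {S : Set ℝ} {t : ℝ} (h : HasDerivWithinAt u u' S t) :
    ContinuousWithinAt u S t := by
  let e := (Module.finBasis ℝ V).equivFunL
  have h1 := (hasDerivWithinAt_clm_comp e.toContinuousLinearMap h).continuousWithinAt
  have h2 := e.symm.continuous.continuousAt.comp_continuousWithinAt h1
  exact h2.congr (fun s _ => (e.symm_apply_apply (u s)).symm) (e.symm_apply_apply (u t)).symm

lemma hasDerivWithinAt_bilin_self {V : Type*} [AddCommGroup V] [Module ℝ V] [FiniteDimensional ℝ V]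
    [TopologicalSpace V] [IsTopologicalAddGroup V] [ContinuousSMul ℝ V] [T2Space V]
    {M : V →ₗ[ℝ] V →ₗ[ℝ] ℝ} (hs : ∀ u v, M u v = M v u) (hM : ∀ u, u ≠ 0 → 0 < M u u)
    {u : ℝ → V} {u' : V} {S : Set ℝ} {t : ℝ} (h : HasDerivWithinAt u u' S t) :
    HasDerivWithinAt (fun t => M (u t) (u t)) (2 * M u' (u t)) S t := by
  obtain ⟨n, e, he⟩ := exists_orthonormal_coordinates M hs hM
  let L : V →L[ℝ] EuclideanSpace ℝ (Fin n) :=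
    ⟨e.symm.toLinearMap, LinearMap.continuous_of_finiteDimensional _⟩
  have hL : ∀ v w, M v w = ⟪L v, L w⟫ := fun v w => by
    rw [← he]
    simp [L]
  have h1 := (hasDerivWithinAt_clm_comp L h).norm_sq
  have h2 : (fun t => M (u t) (u t)) = fun t => ‖L (u t)‖ ^ 2 :=
    funext fun s => by rw [hL, real_inner_self_eq_norm_sq]
  rw [h2, hL, real_inner_comm]
  exact h1

variable {d : ℕ} {Ω : Set (Euc d)} {K : SimplicialMesh Ω} {k : ℕ}

lemma prodZero_comm (w v : Vel d) : prodZero K w v = prodZero K v w := by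
  simp only [prodZero, real_inner_comm]

lemma convStab_self_nonneg {β : Finset (Euc d) → ℝ} (hβ : ∀ T ∈ K.cells, 0 ≤ β T) (v : Vel d) :
    0 ≤ convStab K β v v :=
  Finset.sum_nonneg fun T hT => mul_nonneg (hβ T hT) (Finset.sum_nonneg fun _ _ =>
    integral_nonneg fun _ => real_inner_self_nonneg)

lemma normOneSq_le_visc (hd : 0 < d) {κ C : ℝ} {s : Finset (Euc d) → LocVel d → LocVel d → ℝ}
    (hK : ∀ T ∈ K.cells, IsShapeRegular κ T)
    (hC : ∀ T ∈ K.cells, IsShapeRegular κ T → ∀ v ∈ locSpace k T,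
        normOneSqT T v ≤ C * viscT k s T v v ∧ 0 ≤ viscT k s T v v) (v : velSpace K k) :
    normOneSq K (v : Vel d) ≤ C * visc K k s (v : Vel d) v ∧ 0 ≤ visc K k s (v : Vel d) v := by
  have h := fun T hT => hC T hT (hK T hT) _ (SimplicialMesh.velLoc hd hT k v).2
  refine ⟨?_, Finset.sum_nonneg fun T hT => (h T hT).2⟩
  rw [visc, Finset.mul_sum]
  exact Finset.sum_le_sum fun T hT => (h T hT).1

namespace SimplicialMesh

variable {η ν tF : ℝ} {s : Finset (Euc d) → LocVel d → LocVel d → ℝ}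
  {β : Finset (Euc d) → ℝ → ℝ} {f : ℝ → Lp (Euc d) 2 (volume.restrict Ω)} {u₀ : Euc d → Euc d}
  {G₀ : Euc d → Euc d →L[ℝ] Euc d} {u : ℝ → velSpace K k} {p : ℝ → preSpace K k}

lemma continuousOn_convStab {S : Set ℝ} (hβ : ∀ T ∈ K.cells, ContinuousOn (β T) S) (w v : Vel d) :
    ContinuousOn (fun t => convStab K (fun T => β T t) w v) S :=
  continuousOn_finsetSum _ fun T hT => (hβ T hT).mul continuousOn_const

lemma prodZero_self_pos (hd : 0 < d) {v : velSpace K k} (hv : v ≠ 0) :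
    0 < prodZero K (v : Vel d) v :=
  lt_of_not_ge fun h => hv (Subtype.ext (eq_zero_of_prodZero hd v.2 h))

/-- Well-posedness of the discrete problem. The interpolate of a divergence-free field is an
admissible initial datum, being discretely divergence free. -/
theorem exists_isSolution (hd : 0 < d) (hΩ : IsPolytopalDomain Ω) (hs : IsStabilization K k η s)
    (hvisc : ∀ v : velSpace K k, 0 ≤ visc K k s (v : Vel d) v) (hν : 0 < ν) (htF : 0 < tF)
    (hβc : ∀ T ∈ K.cells, ContinuousOn (β T) (Icc 0 tF))
    (hβ : ∀ T ∈ K.cells, ∀ t ∈ Icc 0 tF, 0 < β T t) (hf : ContinuousOn f (Icc 0 tF))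
    (hu₀ : IsH1 Ω u₀ G₀) (hV : VanishesOnBoundary Ω u₀ G₀)
    (hdiv : ∀ᵐ x ∂(volume.restrict Ω), trace (G₀ x) = 0) :
    ∃ (u : ℝ → velSpace K k) (p : ℝ → preSpace K k), IsSolution K k s ν tF β f u₀ G₀ u p ∧
      ∀ (v : ℝ → velSpace K k) (q : ℝ → preSpace K k), IsSolution K k s ν tF β f u₀ G₀ v q →
        EqOn v u (Icc 0 tF) ∧ EqOn q p (Icc 0 tF) := by
  obtain ⟨M, hM⟩ := exists_prodZero_bilin hd K k
  obtain ⟨a, ha⟩ := exists_visc_bilin hd hs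
  obtain ⟨N, hN⟩ := exists_conv_trilin hd K k
  obtain ⟨b, hb⟩ := exists_coupling_bilin hd K k
  choose j hj using fun t : ℝ => exists_convStab_bilin hd K k fun T => β T t
  let ℓ : ℝ → velSpace K k →ₗ[ℝ] ℝ := fun t => (innerₗ _ (f t)) ∘ₗ velL2 K k
  have hℓ : ∀ t v, ℓ t v = ∫ x in Ω, ⟪f t x, K.piecewise (v : Vel d).1 x⟫ := fun t v =>
    inner_velL2 (f t) v
  have hker : ∀ v : velSpace K k, v ∈ constraintKer b (preZero hΩ K k) ↔
      ∀ q ∈ preSpaceZero K k, coupling K k (v : Vel d) q = 0 := fun v =>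
    ⟨fun h q hq => (hb v ⟨q, hq.1⟩).symm.trans (h ⟨q, hq.1⟩ hq),
      fun h q hq => (hb v q).trans (h q hq)⟩
  have hMs : ∀ w v, M w v = M v w := fun w v => by rw [hM, hM, prodZero_comm]
  have hMp : ∀ v, v ≠ 0 → 0 < M v v := fun v hv => by rw [hM]; exact prodZero_self_pos hd hv
  have hjc : ∀ w v, ContinuousOn (fun t => j t w v) (Icc 0 tF) := fun w v => by
    simp only [hj]
    exact continuousOn_convStab hβc _ _
  have hb0 : ∀ q ∈ preZero hΩ K k, (∀ v, b v q = 0) → q = 0 := fun q hq h =>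
    Subtype.ext (eq_zero_of_coupling hd hΩ hq fun v hv => (hb ⟨v, hv⟩ q).symm.trans (h ⟨v, hv⟩))
  obtain ⟨w, hw, hwI⟩ := exists_isVelInterp hd hΩ K k hu₀ hV
  obtain ⟨u, u', p, h0, hu'c, hu, heq, huZ, hpc, hp⟩ := exists_saddle_solution (M := M)
    (a := ν • a) (N := N) (j := j) (ℓ := ℓ) (b := b) (P₀ := preZero hΩ K k) (u₀ := ⟨w, hw⟩) htF hMs
    hMp
    (fun v => by
      rw [LinearMap.smul_apply, LinearMap.smul_apply, ha]
      exact mul_nonneg hν.le (hvisc v))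
    (fun t ht v => by
      rw [hj]
      exact convStab_self_nonneg (fun T hT => (hβ T hT t ht).le) _)
    hjc (fun v => hf.inner continuousOn_const)
    (fun v hv => (hN v v v).trans (conv_self_eq_zero hd hΩ v.2 v.2 ((hker v).1 hv))) hb0
    ((hker _).2 fun q hq => coupling_velInterp hd hΩ hu₀ hV hdiv hw hwI hq.1)
  have hform : ∀ (t : ℝ) (v v' z : velSpace K k) (q : preSpace K k),
      (M v' z + (ν • a) v z + N v v z + j t v z + b z q = ℓ t z ↔
      prodZero K (v' : Vel d) z + ν * visc K k s (v : Vel d) z + conv K (v : Vel d) v z +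
        convStab K (fun T => β T t) (v : Vel d) z + coupling K k (z : Vel d) q =
        ∫ x in Ω, ⟪f t x, K.piecewise (z : Vel d).1 x⟫) := fun t v v' z q => by
    rw [LinearMap.smul_apply, LinearMap.smul_apply, hM, ha, hN, hj, hb, hℓ, smul_eq_mul]
  refine ⟨u, p, ⟨by rwa [h0], ⟨u', hu'c, hu, fun t ht v => (hform ..).1 (heq t ht v)⟩,
    fun t ht q hq => ?_, hpc, fun t _ => hp t⟩, fun v q h => ?_⟩
  · rw [(hker _).1 (huZ t ht) q hq, neg_zero]
  · obtain ⟨v', -, hv, hveq⟩ := h.momentum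
    refine eqOn_of_saddle_solution (a := ν • a) (N := N) (j := j) (ℓ := ℓ) htF hMs hMp hjc hb0 ?_
      hv hu (fun t ht z => (hform ..).2 (hveq t ht z)) heq
      (fun t ht => (hker _).2 fun r hr => neg_eq_zero.1 (h.mass t ht r hr)) huZ h.zero_average
      fun t _ => hp t
    rw [h0]
    exact Subtype.ext (isVelInterp_unique hd hΩ hu₀ hV (v 0).2 hw h.initial hwI)

/-- The energy estimate, obtained by taking the velocity itself as test function: the convective and
coupling terms vanish, since the discrete velocity is discretely divergence free. -/
theorem tripleNormSq_le_of_isSolution (hd : 0 < d) (hΩ : IsPolytopalDomain Ω)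
    (hs : IsStabilization K k η s) {C : ℝ} (hC : ∀ v : velSpace K k,
      normOneSq K (v : Vel d) ≤ C * visc K k s (v : Vel d) v ∧ 0 ≤ visc K k s (v : Vel d) v)
    (hν : 0 < ν) (htF : 0 < tF) (hβc : ∀ T ∈ K.cells, ContinuousOn (β T) (Icc 0 tF))
    (hβ : ∀ T ∈ K.cells, ∀ t ∈ Icc 0 tF, 0 < β T t) (hf : ContinuousOn f (Icc 0 tF))
    (h : IsSolution K k s ν tF β f u₀ G₀ u p) :
    tripleNormSq K ν tF β (fun t => (u t : Vel d)) ≤ (1 + max C 1) * (Real.exp tF *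
      (prodZero K (u 0 : Vel d) (u 0) + ∫ t in (0 : ℝ)..tF, ‖f t‖ ^ 2)) := by
  obtain ⟨M, hM⟩ := exists_prodZero_bilin hd K k
  obtain ⟨a, ha⟩ := exists_visc_bilin hd hs
  choose j hj using fun t : ℝ => exists_convStab_bilin hd K k fun T => β T t
  obtain ⟨u', -, hu, heq⟩ := h.momentum
  have huc : ContinuousOn u (Icc 0 tF) := fun t ht =>
    continuousWithinAt_of_hasDerivWithinAt (hu t ht)
  have hE : ∀ t ∈ Icc 0 tF, HasDerivWithinAt (fun t => prodZero K (u t : Vel d) (u t))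
      (2 * prodZero K (u' t : Vel d) (u t)) (Icc 0 tF) t := fun t ht => by
    simp only [← hM]
    refine hasDerivWithinAt_bilin_self (fun w v => by rw [hM, hM, prodZero_comm])
      (fun v hv => ?_) (hu t ht)
    rw [hM]
    exact prodZero_self_pos hd hv
  have hac : ContinuousOn (fun t => ν * visc K k s (u t : Vel d) (u t)) (Icc 0 tF) := by
    simp only [← ha]
    exact continuousOn_const.mul
      (continuousOn_bilin (B := fun _ => a) (fun _ _ => continuousOn_const) huc huc)
  have hjc : ContinuousOn (fun t => convStab K (fun T => β T t) (u t : Vel d) (u t))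
      (Icc 0 tF) := by
    simp only [← hj]
    refine continuousOn_bilin (fun w v => ?_) huc huc
    simp only [hj]
    exact continuousOn_convStab hβc _ _
  have ha0 : ∀ t, 0 ≤ ν * visc K k s (u t : Vel d) (u t) := fun t =>
    mul_nonneg hν.le (hC (u t)).2
  have hj0 : ∀ t ∈ Icc 0 tF, 0 ≤ convStab K (fun T => β T t) (u t : Vel d) (u t) := fun t ht =>
    convStab_self_nonneg (fun T hT => (hβ T hT t ht).le) _
  have hmass : ∀ t ∈ Icc 0 tF, ∀ q ∈ preSpaceZero K k, coupling K k (u t : Vel d) q = 0 :=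
    fun t ht q hq => neg_eq_zero.1 (h.mass t ht q hq)
  have hen : ∀ t ∈ Icc 0 tF, 2 * prodZero K (u' t : Vel d) (u t) ≤ ‖f t‖ ^ 2 +
      prodZero K (u t : Vel d) (u t) - 2 * (ν * visc K k s (u t : Vel d) (u t) +
        convStab K (fun T => β T t) (u t : Vel d) (u t)) := fun t ht => by
    have h1 := heq t ht (u t)
    rw [conv_self_eq_zero hd hΩ (u t).2 (u t).2 (hmass t ht),
      hmass t ht _ (h.zero_average t ht), ← inner_velL2] at h1
    have h2 := real_inner_le_norm (f t) (velL2 K k (u t))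
    have h3 := norm_velL2_sq_le hΩ (u t)
    -- `2 ⟪f, u⟫ ≤ ‖f‖² + ‖u‖²`: the last term is the one which `e^{-t}` absorbs.
    have h4 := two_mul_le_add_sq ‖f t‖ ‖velL2 K k (u t)‖
    linarith
  exact sSup_add_integral_le htF hE hac hjc (hf.norm.pow 2) (fun t _ => ha0 t) hj0
    (fun t _ => prodZero_self_nonneg _) (fun t _ => sq_nonneg _) hen
    (fun t => mul_nonneg hν.le (Finset.sum_nonneg fun T _ => normOneSqT_nonneg _)) fun t =>
      (mul_le_mul_of_nonneg_left (hC (u t)).1 hν.le).trans_eq (mul_left_comm _ _ _)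

end SimplicialMesh
end HybridNS

theorem theorem3 (d : ℕ) (hd : d = 2 ∨ d = 3) (k : ℕ) (Ω : Set (HybridNS.Euc d))
    (hΩ : HybridNS.IsPolytopalDomain Ω) (σ : ℝ) (η : ℝ) (hη : 0 < η) :
    ∃ C : ℝ, 0 < C ∧
      ∀ (K : HybridNS.SimplicialMesh Ω), K.IsRegular σ →
      ∀ (s : Finset (HybridNS.Euc d) → HybridNS.LocVel d → HybridNS.LocVel d → ℝ),
        HybridNS.IsStabilization K k η s →
      ∀ (ν tF : ℝ), 0 < ν → 0 < tF →
      ∀ (β : Finset (HybridNS.Euc d) → ℝ → ℝ),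
        (∀ T ∈ K.cells, ContinuousOn (β T) (Set.Icc 0 tF)) →
        (∀ T ∈ K.cells, ∀ t ∈ Set.Icc 0 tF, 0 < β T t) →
      ∀ (f : ℝ → MeasureTheory.Lp (HybridNS.Euc d) 2 (MeasureTheory.volume.restrict Ω)),
        ContinuousOn f (Set.Icc 0 tF) →
      ∀ (u₀ : HybridNS.Euc d → HybridNS.Euc d)
        (G₀ : HybridNS.Euc d → HybridNS.Euc d →L[ℝ] HybridNS.Euc d),
        HybridNS.IsH1 Ω u₀ G₀ → HybridNS.VanishesOnBoundary Ω u₀ G₀ →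
        (∀ᵐ x ∂(MeasureTheory.volume.restrict Ω), HybridNS.trace (G₀ x) = 0) →
      ∃ (u : ℝ → HybridNS.velSpace K k) (p : ℝ → HybridNS.preSpace K k),
        HybridNS.IsSolution K k s ν tF β f u₀ G₀ u p ∧
        (∀ (v : ℝ → HybridNS.velSpace K k) (q : ℝ → HybridNS.preSpace K k),
          HybridNS.IsSolution K k s ν tF β f u₀ G₀ v q →
            Set.EqOn v u (Set.Icc 0 tF) ∧ Set.EqOn q p (Set.Icc 0 tF)) ∧
        HybridNS.tripleNormSq K ν tF β (fun t => (u t : HybridNS.Vel d)) ≤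
          C * (Real.exp tF *
            ((∫ t in (0 : ℝ)..tF, ‖f t‖ ^ 2) + HybridNS.normH1Sq Ω u₀ G₀)) := by
  have hd0 : 0 < d := by rcases hd with rfl | rfl <;> norm_num
  have hκ : 0 < (2 * max σ 1)⁻¹ := by positivity
  obtain ⟨C₁, hC₁, h₁⟩ := HybridNS.exists_viscT_coercive hd0 k hκ hη
  obtain ⟨C₂, hC₂, h₂⟩ := HybridNS.SimplicialMesh.exists_prodZero_velInterp_le hd0 hΩ k hκ
  refine ⟨(1 + max C₁ 1) * (1 + C₂), by positivity, fun K hK s hs ν tF hν htF β hβc hβ f hf u₀ G₀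
    hu₀ hV hdiv => ?_⟩
  have hreg : ∀ T ∈ K.cells, HybridNS.IsShapeRegular (2 * max σ 1)⁻¹ T := fun T hT =>
    hK.isShapeRegular hT
  have hvisc := fun v : HybridNS.velSpace K k =>
    HybridNS.normOneSq_le_visc hd0 hreg (h₁ K s hs) v
  obtain ⟨u, p, hup, huniq⟩ := HybridNS.SimplicialMesh.exists_isSolution hd0 hΩ hs
    (fun v => (hvisc v).2) hν htF hβc hβ hf hu₀ hV hdiv
  refine ⟨u, p, hup, huniq, (HybridNS.SimplicialMesh.tripleNormSq_le_of_isSolution hd0 hΩ hs hvisc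
    hν htF hβc hβ hf hup).trans ?_⟩
  rw [mul_assoc]
  refine mul_le_mul_of_nonneg_left ?_ (by positivity)
  rw [mul_left_comm]
  refine mul_le_mul_of_nonneg_left ?_ (Real.exp_pos _).le
  have h3 := h₂ K hreg u₀ G₀ hu₀ hV _ (u 0).2 hup.initial
  have h4 : 0 ≤ ∫ t in (0 : ℝ)..tF, ‖f t‖ ^ 2 :=
    intervalIntegral.integral_nonneg htF.le fun t _ => sq_nonneg _
  have h5 := HybridNS.SimplicialMesh.prodZero_self_nonneg (K := K) (u 0 : HybridNS.Vel d)
  have h6 : 0 ≤ HybridNS.normH1Sq Ω u₀ G₀ := nonneg_of_mul_nonneg_right (h5.trans h3) hC₂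
  nlinarith
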